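/- For $\tau$ in the upper half-plane $\mathbb H$ let $\theta_{\alpha\beta}(z|\tau)=\sum_{k\in\mathbb Z}e^{\pi i(k+\alpha/2)^2\tau+2\pi i(k+\alpha/2)(z+\beta/2)}$, $\theta_1=-\theta_{11}$, $\theta_2=\theta_{10}$, $\theta_3=\theta_{00}$, $\theta_4=\theta_{01}$ and $\vartheta_k(\tau)=\theta_k(0|\tau)$. Let $\nu,\mu,N\in\mathbb Z$, $N\neq0$, and put $$x(\tau)=\frac{\vartheta_4^4(\tau)}{\vartheta_3^4(\tau)},\qquad y(\tau)=-\frac{\vartheta_4^2(\tau)}{\vartheta_3^2(\tau)}\,\frac{\theta_2^2\big(\frac{\nu\tau+\mu}{2N}\big|\tau\big)}{\theta_1^2\big(\frac{\nu\tau+\mu}{2N}\big|\tau\big)} .$$ Assume that $y$ is not constant (and not identically $\infty$). Picard's curve $F^{(\nu,\mu)}_{N}$ is the irreducible plane curve $F(x,y)=0$ with $F(x(\tau),y(\tau))=0$ for all $\tau$. For $f:\mathbb H\to\mathbb C$ let $\mathbf{Aut}\,f$ be the group of all $\gamma\in\Gamma(1)=\mathrm{PSL}_2(\mathbb Z)$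 with $f(\gamma\tau)=f(\tau)$ for all $\tau$, and put $G_y=\mathbf{Aut}\,y$, $G_x=\mathbf{Aut}\,x$. 1. $G_y=G_x\cap G_y$, and this is the group that uniformizes Picard's curve: the curve $F^{(\nu,\mu)}_N$ exists, and there is a homeomorphism from the compactified quotient $\overline{\mathbb H/G_y}$ (cusps added, horocycle topology) onto the compact Riemann surface of $F^{(\nu,\mu)}_N$ under which the coordinate functions of the curve become $x(\tau)$ and $y(\tau)$. 2. $G_y$ is a free group and a congruence subgroup contained in $\Gamma(2)$. A matrix $\begin{pmatrix}a&b\\c&d\end{pmatrix}\in\mathrm{SL}_2(\mathbb Z)$ represents an element of $G_y$ if and only if it lies in $\Gamma(2)$ and, for some $\varepsilon\in\{1,-1\}$, $\nu a+\mu c\equiv\varepsilon\nu$ and $\nu b+\mu d\equiv\varepsilon\mu\pmod{2N}$. 3. Let $M=2|N|/\gcd(\nu,\mu,2N)$ and let $\mathbf N=M/2$ if $M$ is even, $\mathbf N=M$ if $M$ is odd. Then $1\le\mathbf N\le|N|$, and $G_y$ is conjugate in $\Gamma(1)$ to the group $G^{(\mathbf N)}$ of all matrices (up to sign) $$\begin{pmatrix}2\mathbf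 Nn+1&2m\\2\mathbf Np&2\mathbf Nq+1\end{pmatrix},\qquad n,m,p,q\in\mathbb Z,\quad 2mp-2\mathbf Nqn=q+n .$$ If $2N\mid\nu$, then $G_y$ is equal to $G^{(\mathbf N)}$; if $2N\mid\mu$, then $G_y$ is equal to the group of the transposed matrices. 4. The topological genus of $\overline{\mathbb H/G_y}$ equals the genus of Picard's curve $F^{(0,1)}_{\mathbf N}$ with parameters $(0,1,\mathbf N)$ (which exists; for $\mathbf N=1$ it is the line $y=0$). 5. The rank and free generators of $G_y$ are computable: there are computable functions which assign to every triple $(\nu,\mu,N)$ as above the rank of $G_y$ and a list of matrices that is a free basis of $G_y$. -/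

import Mathlib

open scoped MatrixGroups Topology
open UpperHalfPlane

noncomputable section

namespace PicardUniformization

/-! ### Theta functions and Picard's uniformizing functions -/

/-- The theta series with characteristics `(α, β)`. -/
def thetaChar (α β : ℂ) (z τ : ℂ) : ℂ :=
  ∑' k : ℤ, Complex.exp
    (Real.pi * Complex.I * ((k : ℂ) + α / 2) ^ 2 * τ
      + 2 * Real.pi * Complex.I * ((k : ℂ) + α / 2) * (z + β / 2))

/-- Jacobi's `θ₁(z|τ)`. -/
def theta1 (z τ : ℂ) : ℂ := -thetaChar 1 1 z τ

/-- Jacobi's `θ₂(z|τ)`. -/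
def theta2 (z τ : ℂ) : ℂ := thetaChar 1 0 z τ

/-- Jacobi's `θ₃(z|τ)`. -/
def theta3 (z τ : ℂ) : ℂ := thetaChar 0 0 z τ

/-- Jacobi's `θ₄(z|τ)`. -/
def theta4 (z τ : ℂ) : ℂ := thetaChar 0 1 z τ

/-- The function `x(τ) = ϑ₄(τ)⁴ / ϑ₃(τ)⁴` on the upper half-plane. -/
def picardX (τ : ℍ) : ℂ := theta4 0 τ ^ 4 / theta3 0 τ ^ 4

/-- Picard's uniformizing function
`y(τ) = -(ϑ₄² / ϑ₃²) · θ₂²(z|τ) / θ₁²(z|τ)` at `z = (ν τ + μ) / (2 N)`. -/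
def picardY (ν μ N : ℤ) (τ : ℍ) : ℂ :=
  -(theta4 0 τ ^ 2 / theta3 0 τ ^ 2) *
    (theta2 (((ν : ℂ) * τ + μ) / (2 * N)) τ ^ 2 / theta1 (((ν : ℂ) * τ + μ) / (2 * N)) τ ^ 2)

/-! ### Automorphism groups -/

/-- The group of all `γ ∈ SL₂(ℤ)` with `f (γ τ) = f τ` for all `τ`, that is, the full preimage in
`SL₂(ℤ)` of the automorphism group of `f` in the modular group `PSL₂(ℤ)`. -/
def autGroup (f : ℍ → ℂ) : Subgroup SL(2, ℤ) where
  carrier := {γ | ∀ τ : ℍ, f (γ • τ) = f τ}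
  one_mem' := fun τ => by rw [one_smul]
  mul_mem' := by
    intro a b ha hb τ
    rw [mul_smul, ha, hb]
  inv_mem' := by
    intro a ha τ
    have h := ha (a⁻¹ • τ)
    rw [smul_inv_smul] at h
    exact h.symm

/-- The image of a subgroup of `SL₂(ℤ)` in the modular group `PSL₂(ℤ)`. -/
def inPSL (Γ : Subgroup SL(2, ℤ)) : Subgroup (Matrix.ProjectiveSpecialLinearGroup (Fin 2) ℤ) :=
  Γ.map (QuotientGroup.mk' (Subgroup.center SL(2, ℤ)))

/-- The group `G_x ∩ G_y` belonging to Picard's curve. -/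
def picardGroup (ν μ N : ℤ) : Subgroup SL(2, ℤ) :=
  autGroup picardX ⊓ autGroup (picardY ν μ N)

/-- The integer `𝐍` computed from `(ν, μ, N)`: if `M` is the order of `(ν τ + μ) / (2 N)` modulo
the lattice `ℤ + ℤ τ`, it is `M / 2` for even `M` and `M` for odd `M`. -/
def reducedLevel (ν μ N : ℤ) : ℕ :=
  if Even ((2 * N).natAbs / Nat.gcd (Int.gcd ν μ) (2 * N).natAbs) then
    (2 * N).natAbs / Nat.gcd (Int.gcd ν μ) (2 * N).natAbs / 2
  else (2 * N).natAbs / Nat.gcd (Int.gcd ν μ) (2 * N).natAbs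

/-- The matrices `(2Kn+1, 2m; 2Kp, 2Kq+1)` with `2mp - 2Kqn = q + n`. -/
def picardMatrices (K : ℤ) : Set (Matrix (Fin 2) (Fin 2) ℤ) :=
  {A | ∃ n m p q : ℤ, 2 * m * p - 2 * K * q * n = q + n ∧
    A = !![2 * K * n + 1, 2 * m; 2 * K * p, 2 * K * q + 1]}

/-- `γ` is represented, up to the sign that is invisible in `PSL₂(ℤ)`, by a matrix in `S`. -/
def RepresentedIn (S : Set (Matrix (Fin 2) (Fin 2) ℤ)) (γ : SL(2, ℤ)) : Prop :=
  (γ : Matrix (Fin 2) (Fin 2) ℤ) ∈ S ∨ -(γ : Matrix (Fin 2) (Fin 2) ℤ) ∈ S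

/-- The members of the list `L`, in order, are a free basis of the subgroup `G`. -/
def IsFreeBasis {H : Type*} [Group H] (L : List H) (G : Subgroup H) : Prop :=
  Function.Injective (FreeGroup.lift (fun i : Fin L.length => L.get i)) ∧
    (FreeGroup.lift (fun i : Fin L.length => L.get i)).range = G

/-- The entries `(a, b, c, d)` of a matrix in `SL₂(ℤ)`. -/
def entries (γ : SL(2, ℤ)) : ℤ × ℤ × ℤ × ℤ := (γ 0 0, γ 0 1, γ 1 0, γ 1 1)

/-! ### The compactified quotients of the upper half-plane -/

/-- The upper half-plane together with the cusps `ℚ ∪ {∞}`. -/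
inductive ExtendedUHP : Type
  | point (τ : ℍ) : ExtendedUHP
  | cusp (s : OnePoint ℚ) : ExtendedUHP

namespace ExtendedUHP

/-- Fractional linear transformations on the extended upper half-plane. -/
instance : MulAction SL(2, ℤ) ExtendedUHP where
  smul γ z := match z with
    | point τ => point (γ • τ)
    | cusp s => cusp (Matrix.SpecialLinearGroup.mapGL ℚ γ • s)
  one_smul z := by
    cases z with
    | point τ => exact congrArg point (one_smul _ τ)
    | cusp s =>
      refine congrArg cusp ?_
      rw [map_one, one_smul]
  mul_smul a b z := by
    cases z with
    | point τ => exact congrArg point (mul_smul a b τ)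
    | cusp s =>
      refine congrArg cusp ?_
      rw [map_mul, mul_smul]

/-- The neighbourhood `{Im τ > R} ∪ {∞}` of the cusp `∞`. -/
def horoball (R : ℝ) : Set ExtendedUHP :=
  point '' {τ : ℍ | R < τ.im} ∪ {cusp OnePoint.infty}

/-- The horocycle topology. -/
instance : TopologicalSpace ExtendedUHP :=
  TopologicalSpace.generateFrom
    ({S | ∃ U : Set ℍ, IsOpen U ∧ S = point '' U} ∪
      {S | ∃ (γ : SL(2, ℤ)) (R : ℝ), 0 < R ∧ S = (fun z => γ • z) '' horoball R})

end ExtendedUHP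

/-- The compactified quotient of the upper half-plane by `Γ`, with the quotient topology. -/
abbrev CompactifiedQuotient (Γ : Subgroup SL(2, ℤ)) : Type :=
  Quotient (MulAction.orbitRel Γ ExtendedUHP)

/-- The class of a point of the upper half-plane. -/
def CompactifiedQuotient.mk (Γ : Subgroup SL(2, ℤ)) (τ : ℍ) : CompactifiedQuotient Γ :=
  Quotient.mk (MulAction.orbitRel Γ ExtendedUHP) (ExtendedUHP.point τ)

/-! ### Plane algebraic curves and their compact Riemann surfaces -/

/-- An irreducible plane curve `F(x, y) = 0` over the complex numbers. -/
structure PlaneCurve where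
  /-- The polynomial `F`, in the variables `x = X 0` and `y = X 1`. -/
  poly : MvPolynomial (Fin 2) ℂ
  irreducible : Irreducible poly

namespace PlaneCurve

/-- The coordinate ring `ℂ[x, y] / (F)`. -/
abbrev CoordRing (C : PlaneCurve) : Type := MvPolynomial (Fin 2) ℂ ⧸ Ideal.span {C.poly}

instance (C : PlaneCurve) : IsDomain C.CoordRing := by
  have : (Ideal.span {C.poly}).IsPrime :=
    (Ideal.span_singleton_prime C.irreducible.ne_zero).2 C.irreducible.prime
  exact Ideal.Quotient.isDomain _

/-- The function field of the curve. -/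
abbrev FunctionField (C : PlaneCurve) : Type := FractionRing C.CoordRing

/-- The coordinate functions `x` (for `i = 0`) and `y` (for `i = 1`). -/
def coord (C : PlaneCurve) (i : Fin 2) : C.FunctionField :=
  algebraMap C.CoordRing C.FunctionField (Ideal.Quotient.mk _ (MvPolynomial.X i))

/-- The points of the compact Riemann surface of the curve: the places of the function field, that
is, its nontrivial valuation rings that contain the constants. -/
def RiemannSurface (C : PlaneCurve) : Type :=
  {V : ValuationSubring C.FunctionField //
    (∀ c : ℂ, algebraMap ℂ C.FunctionField c ∈ V) ∧ V ≠ ⊤}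

open Classical in
/-- The value in `ℂ ∪ {∞}` of the function `f` at a place. -/
def value (C : PlaneCurve) (f : C.FunctionField) (v : C.RiemannSurface) : OnePoint ℂ :=
  if h : ∃ c : ℂ, f - algebraMap ℂ C.FunctionField c ∈ v.1.nonunits then
    ((h.choose : ℂ) : OnePoint ℂ)
  else OnePoint.infty

/-- The complex topology: the coarsest one for which all functions in the function field are
continuous maps to the Riemann sphere. -/
instance (C : PlaneCurve) : TopologicalSpace C.RiemannSurface :=
  ⨅ f : C.FunctionField, TopologicalSpace.induced (C.value f) inferInstance

end PlaneCurve

/-- `C` is Picard's curve with parameters `(ν, μ, N)`: the irreducible relation between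
`x(τ)` and `y(τ)`. -/
def IsPicardCurve (ν μ N : ℤ) (C : PlaneCurve) : Prop :=
  ∀ τ : ℍ, MvPolynomial.eval ![picardX τ, picardY ν μ N τ] C.poly = 0

/-- `Γ` uniformizes the curve `C` by means of the functions `x` and `y`: the compactified quotient
by `Γ` is the Riemann surface of `C`, with `x(τ)` and `y(τ)` as the coordinate functions. -/
def Uniformizes (Γ : Subgroup SL(2, ℤ)) (x y : ℍ → ℂ) (C : PlaneCurve) : Prop :=
  ∃ Φ : CompactifiedQuotient Γ ≃ₜ C.RiemannSurface, ∀ τ : ℍ,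
    C.value (C.coord 0) (Φ (CompactifiedQuotient.mk Γ τ)) = ((x τ : ℂ) : OnePoint ℂ) ∧
    C.value (C.coord 1) (Φ (CompactifiedQuotient.mk Γ τ)) = ((y τ : ℂ) : OnePoint ℂ)

/-! ### The genus -/

/-- The topological genus of a compact connected orientable surface: half of the first Betti
number. -/
def topologicalGenus (X : Type) [TopologicalSpace X] : ℕ :=
  Module.finrank ℚ
    (((AlgebraicTopology.singularHomologyFunctor (ModuleCat.{0} ℚ) 1).obj
      (ModuleCat.of ℚ ℚ)).obj (TopCat.of X)) / 2

end PicardUniformization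

end

/-! ### Theta functions, the Legendre coordinate and its values at torsion points. -/

noncomputable section

namespace PicardUniformization

open scoped Real
open Complex (exp)

/-! With `z = (ντ + μ)/(2N)`, the function `y` is the value at a torsion point of the even elliptic
function `legendreX` of degree two, which has its pole at the lattice points and takes the values
`0`, `1`, `x` at the half periods `1/2`, `τ/2`, `(1+τ)/2`. So `y` is the abscissa of a torsion point
on the Legendre curve with modulus `x`. All theta products are bilinear in the pair `thetaA`,
`thetaB` of theta functions at `2τ`, and this yields the zeros of `theta1`, the addition of
2-torsion points and the duplication formula.

Under `Γ(2)` the function `x` is invariant and `y` with parameter row `v = (ν, μ)` becomes `y` with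
parameter row `vγ` (`gamma_two_smul`). Since `legendreX` is even of degree two, two such functions
agree at a point if and only if their rows agree up to sign modulo `2N` (`picardY_eq_iff`). That
`Aut y` lies in `Γ(2)` at all is seen at the cusps: at the cusps over `x = 1`, `0`, `∞` the limits
of `y` lie in the disjoint sets `{1} ∪ (-∞,0)`, `{0} ∪ (1,∞)`, `(0,1) ∪ {∞}` (`autGroup_pY_le`).

For the uniformization, every point of the extended upper half-plane defines the valuation ring of
the functions with a finite limit there (`placeRing`), hence a continuous map from the compact
quotient to the Hausdorff space of places. It is injective on the upper half-plane because `x`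
separates the `Γ(2)`-orbits (`exists_gamma_two_of_picardX_eq`: equal `x` means equal duplication
formulas, so the two lattices are homothetic) and because `y` then detects the row. At the cusps the
leading exponents and coefficients of `1 - y` measured against `1 - x` recover the row up to a
parabolic shear (`exists_shear_of_limits`). It is surjective because norms from level `2K` to level
`2` have coefficients that are polynomials in `x`, by Liouville's theorem; so every function
satisfies a monic equation over `ℂ(x)`, and a place can only be one of the finitely many translates
above its value of `x` (`placeOf_surjective`).

For the explicit form, an element of `Γ(2)` is `±1` plus twice an integral matrix, so the
congruences modulo `2𝐍` depend only on a row modulo `𝐍`. This row lifts to a primitive one, and the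
primitive rows form a single orbit of `SL₂(ℤ)` (`stabMod_explicit`). The equality of genera follows
from this conjugacy and the uniformization of the curve with parameters `(0, 1, 𝐍)`.

For freeness and computability, `Γ(2)` is, up to sign, the Sanov group, which is free by ping-pong.
Schreier's method with the first word of each coset in a fixed enumeration gives a free basis of the
stabilizer (`schreier_free_basis`), and coset equality is decided by integer matrix arithmetic, so
the basis is a primitive recursive function of `(ν, μ, N)`. -/

/-- `θ₃(2z|2τ)`. -/
def thetaA (z τ : ℂ) : ℂ := jacobiTheta₂ (2 * z) (2 * τ)

/-- `θ₂(2z|2τ)`. -/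
def thetaB (z τ : ℂ) : ℂ := exp (π * Complex.I * τ / 2 + 2 * π * Complex.I * z) * jacobiTheta₂ (2 * z + τ) (2 * τ)

theorem thetaChar_eq (α β z τ : ℂ) : thetaChar α β z τ =
    exp (π * Complex.I * α ^ 2 * τ / 4 + π * Complex.I * α * (z + β / 2)) *
      jacobiTheta₂ (z + α * τ / 2 + β / 2) τ := by
  rw [thetaChar, jacobiTheta₂, ← tsum_mul_left]
  refine tsum_congr fun k => ?_
  rw [jacobiTheta₂_term, ← Complex.exp_add]
  congr 1
  ring

/-- The bijection `(m, n) ↔ (k, l)` given by `m + n = 2k, m - n = 2l` or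
`m + n = 2k + 1, m - n = 2l + 1`. -/
def parityEquiv : (ℤ × ℤ) ⊕ (ℤ × ℤ) ≃ ℤ × ℤ where
  toFun := Sum.elim (fun p => (p.1 + p.2, p.1 - p.2)) (fun p => (p.1 + p.2 + 1, p.1 - p.2))
  invFun p := if (p.1 + p.2) % 2 = 0 then Sum.inl ((p.1 + p.2) / 2, (p.1 - p.2) / 2)
    else Sum.inr ((p.1 + p.2) / 2, (p.1 - p.2) / 2)
  left_inv := by
    rintro (⟨k, l⟩ | ⟨k, l⟩)
    · have h : (k + l + (k - l)) % 2 = 0 := by omega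
      simp only [Sum.elim_inl, h, if_true, Sum.inl.injEq, Prod.mk.injEq]
      omega
    · have h : ¬ (k + l + 1 + (k - l)) % 2 = 0 := by omega
      simp only [Sum.elim_inr, h, if_false, Sum.inr.injEq, Prod.mk.injEq]
      omega
  right_inv := by
    rintro ⟨m, n⟩
    by_cases h : (m + n) % 2 = 0
    · simp only [h, if_true, Sum.elim_inl, Prod.mk.injEq]
      omega
    · simp only [h, if_false, Sum.elim_inr, Prod.mk.injEq]
      omega

theorem summable_theta {τ : ℂ} (hτ : 0 < τ.im) (z : ℂ) :
    Summable fun n : ℤ => ‖jacobiTheta₂_term n z τ‖ :=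
  ((summable_jacobiTheta₂_term_iff z τ).2 hτ).norm

/-- Split the double sum by the parity of `m + n`. In the new indices `m² + n²` becomes `2k² + 2l²`,
or the same form shifted by one half in both variables, so each part is again a product of two theta
series, now at `2τ`. -/
theorem jacobiTheta₂_mul {τ : ℂ} (hτ : 0 < τ.im) (x y : ℂ) :
    jacobiTheta₂ (x + y) τ * jacobiTheta₂ (x - y) τ =
      thetaA x τ * thetaA y τ + thetaB x τ * thetaB y τ := by
  have h2 : 0 < (2 * τ).im := by simpa using hτ
  have key := summable_mul_of_summable_norm (summable_theta hτ (x + y)) (summable_theta hτ (x - y))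
  have e1 := (tsum_mul_tsum_of_summable_norm (summable_theta h2 (2 * x)) (summable_theta h2 (2 * y)))
  have e2 := (tsum_mul_tsum_of_summable_norm (summable_theta h2 (2 * x + τ))
    (summable_theta h2 (2 * y + τ)))
  have s : Summable ((fun p : ℤ × ℤ => jacobiTheta₂_term p.1 (x + y) τ *
      jacobiTheta₂_term p.2 (x - y) τ) ∘ parityEquiv) := parityEquiv.summable_iff.2 key
  have h : ∑' c, (fun p : ℤ × ℤ => jacobiTheta₂_term p.1 (x + y) τ *
      jacobiTheta₂_term p.2 (x - y) τ) (parityEquiv c) = _ :=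
    (HasSum.sum (s.comp_injective Sum.inl_injective).hasSum
      (s.comp_injective Sum.inr_injective).hasSum).tsum_eq
  rw [parityEquiv.tsum_eq (fun p : ℤ × ℤ => jacobiTheta₂_term p.1 (x + y) τ *
      jacobiTheta₂_term p.2 (x - y) τ)] at h
  rw [jacobiTheta₂, jacobiTheta₂,
    tsum_mul_tsum_of_summable_norm (summable_theta hτ (x + y)) (summable_theta hτ (x - y)), h]
  congr 1
  · rw [thetaA, thetaA, jacobiTheta₂, jacobiTheta₂, e1]
    refine tsum_congr fun p => ?_
    simp only [parityEquiv, Function.comp, Equiv.coe_fn_mk, Sum.elim_inl, jacobiTheta₂_term]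
    rw [← Complex.exp_add, ← Complex.exp_add]
    congr 1
    push_cast
    ring
  · rw [thetaB, thetaB, jacobiTheta₂, jacobiTheta₂, mul_mul_mul_comm, e2, ← Complex.exp_add,
      ← tsum_mul_left]
    refine tsum_congr fun p => ?_
    simp only [parityEquiv, Function.comp, Equiv.coe_fn_mk, Sum.elim_inr, jacobiTheta₂_term]
    rw [← Complex.exp_add, ← Complex.exp_add, ← Complex.exp_add]
    congr 1
    push_cast
    ring

/-- Translations by half periods act linearly on the pair (`thetaA`, `thetaB`): `1/2` changes the
sign of the second, `τ/2` swaps the two up to a common exponential. The product formulas for all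
four theta functions follow from the one for `θ₃` in this way. -/
theorem thetaA_add_half (z τ : ℂ) : thetaA (z + 1 / 2) τ = thetaA z τ := by
  rw [thetaA, thetaA, mul_add, mul_one_div_cancel two_ne_zero, jacobiTheta₂_add_left]

theorem thetaB_add_half (z τ : ℂ) : thetaB (z + 1 / 2) τ = -thetaB z τ := by
  rw [thetaB, thetaB, show 2 * (z + 1 / 2) + τ = 2 * z + τ + 1 by ring, jacobiTheta₂_add_left,
    show π * Complex.I * τ / 2 + 2 * π * Complex.I * (z + 1 / 2) =
      π * Complex.I * τ / 2 + 2 * π * Complex.I * z + π * Complex.I by ring, Complex.exp_add _ (π * Complex.I),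
    Complex.exp_pi_mul_I]
  ring

theorem thetaA_add_half_tau (z τ : ℂ) : thetaA (z + τ / 2) τ =
    exp (-(π * Complex.I * τ / 2 + 2 * π * Complex.I * z)) * thetaB z τ := by
  rw [thetaA, thetaB, ← mul_assoc, ← Complex.exp_add, neg_add_cancel, Complex.exp_zero, one_mul]
  congr 1
  ring

theorem thetaB_add_half_tau (z τ : ℂ) : thetaB (z + τ / 2) τ =
    exp (-(π * Complex.I * τ / 2 + 2 * π * Complex.I * z)) * thetaA z τ := by
  rw [thetaA, thetaB, show 2 * (z + τ / 2) + τ = 2 * z + 2 * τ by ring, jacobiTheta₂_add_left',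
    ← mul_assoc, ← Complex.exp_add]
  congr 2
  ring

theorem thetaA_neg (z τ : ℂ) : thetaA (-z) τ = thetaA z τ := by
  rw [thetaA, thetaA, mul_neg, jacobiTheta₂_neg_left]

theorem thetaB_neg (z τ : ℂ) : thetaB (-z) τ = thetaB z τ := by
  rw [thetaB, thetaB, ← jacobiTheta₂_neg_left, show -(2 * -z + τ) = 2 * z + τ - 2 * τ by ring]
  have := jacobiTheta₂_add_left' (2 * z + τ - 2 * τ) (2 * τ)
  rw [sub_add_cancel] at this
  rw [this, ← mul_assoc, ← Complex.exp_add]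
  congr 2
  ring

theorem thetaA_add_tau (z τ : ℂ) : thetaA (z + τ) τ =
    exp (-(2 * π * Complex.I * τ + 4 * π * Complex.I * z)) * thetaA z τ := by
  rw [show z + τ = z + τ / 2 + τ / 2 by ring, thetaA_add_half_tau, thetaB_add_half_tau, ← mul_assoc,
    ← Complex.exp_add]
  congr 2
  ring

theorem thetaB_add_tau (z τ : ℂ) : thetaB (z + τ) τ =
    exp (-(2 * π * Complex.I * τ + 4 * π * Complex.I * z)) * thetaB z τ := by
  rw [show z + τ = z + τ / 2 + τ / 2 by ring, thetaB_add_half_tau, thetaA_add_half_tau, ← mul_assoc,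
    ← Complex.exp_add]
  congr 2
  ring

theorem theta3_eq (z τ : ℂ) : theta3 z τ = jacobiTheta₂ z τ := by
  rw [theta3, thetaChar_eq]
  simp

theorem theta4_eq (z τ : ℂ) : theta4 z τ = jacobiTheta₂ (z + 1 / 2) τ := by
  rw [theta4, thetaChar_eq]
  simp

theorem theta2_eq (z τ : ℂ) : theta2 z τ =
    exp (π * Complex.I * τ / 4 + π * Complex.I * z) * jacobiTheta₂ (z + τ / 2) τ := by
  rw [theta2, thetaChar_eq]
  simp

theorem theta1_eq (z τ : ℂ) : theta1 z τ = -(exp (π * Complex.I * τ / 4 + π * Complex.I * (z + 1 / 2)) *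
    jacobiTheta₂ (z + τ / 2 + 1 / 2) τ) := by
  rw [theta1, thetaChar_eq]
  simp

theorem theta3_mul {τ : ℂ} (hτ : 0 < τ.im) (x y : ℂ) :
    theta3 (x + y) τ * theta3 (x - y) τ =
    thetaA x τ * thetaA y τ + thetaB x τ * thetaB y τ := by
  rw [theta3_eq, theta3_eq, jacobiTheta₂_mul hτ]

theorem theta4_mul {τ : ℂ} (hτ : 0 < τ.im) (x y : ℂ) :
    theta4 (x + y) τ * theta4 (x - y) τ =
    thetaA x τ * thetaA y τ - thetaB x τ * thetaB y τ := by
  rw [theta4_eq, theta4_eq, show x + y + 1 / 2 = x + 1 / 2 + y by ring,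
    show x - y + 1 / 2 = x + 1 / 2 - y by ring, jacobiTheta₂_mul hτ, thetaA_add_half,
    thetaB_add_half]
  ring

theorem theta2_mul {τ : ℂ} (hτ : 0 < τ.im) (x y : ℂ) :
    theta2 (x + y) τ * theta2 (x - y) τ =
    thetaB x τ * thetaA y τ + thetaA x τ * thetaB y τ := by
  rw [theta2_eq, theta2_eq, mul_mul_mul_comm, show x + y + τ / 2 = x + τ / 2 + y by ring,
    show x - y + τ / 2 = x + τ / 2 - y by ring, jacobiTheta₂_mul hτ, thetaA_add_half_tau,
    thetaB_add_half_tau, ← Complex.exp_add]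
  have h := Complex.exp_ne_zero (π * Complex.I * τ / 2 + 2 * π * Complex.I * x)
  rw [Complex.exp_neg, show π * Complex.I * τ / 4 + π * Complex.I * (x + y) +
    (π * Complex.I * τ / 4 + π * Complex.I * (x - y)) =
      π * Complex.I * τ / 2 + 2 * π * Complex.I * x by ring]
  field_simp

theorem theta1_mul {τ : ℂ} (hτ : 0 < τ.im) (x y : ℂ) :
    theta1 (x + y) τ * theta1 (x - y) τ =
    thetaA x τ * thetaB y τ - thetaB x τ * thetaA y τ := by
  rw [theta1_eq, theta1_eq, neg_mul_neg, mul_mul_mul_comm,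
    show x + y + τ / 2 + 1 / 2 = x + 1 / 2 + τ / 2 + y by ring,
    show x - y + τ / 2 + 1 / 2 = x + 1 / 2 + τ / 2 - y by ring, jacobiTheta₂_mul hτ,
    thetaA_add_half_tau, thetaB_add_half_tau, thetaA_add_half, thetaB_add_half, ← Complex.exp_add]
  have h := Complex.exp_ne_zero (π * Complex.I * τ / 2 + 2 * π * Complex.I * (x + 1 / 2))
  rw [Complex.exp_neg, show π * Complex.I * τ / 4 + π * Complex.I * (x + y + 1 / 2) +
    (π * Complex.I * τ / 4 + π * Complex.I * (x - y + 1 / 2)) =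
      π * Complex.I * τ / 2 + 2 * π * Complex.I * (x + 1 / 2) by ring]
  field_simp
  ring

theorem theta3_sq {τ : ℂ} (hτ : 0 < τ.im) (x : ℂ) :
    theta3 x τ ^ 2 = thetaA 0 τ * thetaA x τ + thetaB 0 τ * thetaB x τ := by
  have := theta3_mul hτ x 0
  rw [add_zero, sub_zero] at this
  linear_combination this

theorem theta4_sq {τ : ℂ} (hτ : 0 < τ.im) (x : ℂ) :
    theta4 x τ ^ 2 = thetaA 0 τ * thetaA x τ - thetaB 0 τ * thetaB x τ := by
  have := theta4_mul hτ x 0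
  rw [add_zero, sub_zero] at this
  linear_combination this

theorem theta2_sq {τ : ℂ} (hτ : 0 < τ.im) (x : ℂ) :
    theta2 x τ ^ 2 = thetaB 0 τ * thetaA x τ + thetaA 0 τ * thetaB x τ := by
  have := theta2_mul hτ x 0
  rw [add_zero, sub_zero] at this
  linear_combination this

theorem theta1_sq {τ : ℂ} (hτ : 0 < τ.im) (x : ℂ) :
    theta1 x τ ^ 2 = thetaB 0 τ * thetaA x τ - thetaA 0 τ * thetaB x τ := by
  have := theta1_mul hτ x 0
  rw [add_zero, sub_zero] at this
  linear_combination this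

theorem differentiable_jacobiTheta₂ {τ : ℂ} (hτ : 0 < τ.im) :
    Differentiable ℂ fun z => jacobiTheta₂ z τ :=
  fun z => differentiableAt_jacobiTheta₂_fst z hτ

theorem differentiable_thetaA {τ : ℂ} (hτ : 0 < τ.im) : Differentiable ℂ fun z => thetaA z τ := by
  have h2 : 0 < (2 * τ).im := by simpa using hτ
  exact (differentiable_jacobiTheta₂ h2).comp (differentiable_id.const_mul 2)

theorem differentiable_thetaB {τ : ℂ} (hτ : 0 < τ.im) : Differentiable ℂ fun z => thetaB z τ := by
  have h2 : 0 < (2 * τ).im := by simpa using hτ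
  have := (differentiable_jacobiTheta₂ h2).comp
    ((differentiable_id (𝕜 := ℂ) (E := ℂ)).const_mul 2 |>.add_const τ)
  exact Differentiable.mul (by fun_prop) this

theorem differentiable_theta1 {τ : ℂ} (hτ : 0 < τ.im) : Differentiable ℂ fun z => theta1 z τ := by
  have := (differentiable_jacobiTheta₂ hτ).comp
    ((differentiable_id (𝕜 := ℂ) (E := ℂ)).add_const (τ / 2) |>.add_const (1 / 2))
  simp_rw [theta1_eq]
  exact (Differentiable.mul (by fun_prop) this).neg

theorem differentiable_theta2 {τ : ℂ} (hτ : 0 < τ.im) : Differentiable ℂ fun z => theta2 z τ := by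
  have := (differentiable_jacobiTheta₂ hτ).comp
    ((differentiable_id (𝕜 := ℂ) (E := ℂ)).add_const (τ / 2))
  simp_rw [theta2_eq]
  exact Differentiable.mul (by fun_prop) this

/-- The constant Fourier coefficient of the theta series is `1`. -/
theorem integral_jacobiTheta₂ {τ : ℂ} (hτ : 0 < τ.im) :
    ∫ x in (0 : ℝ)..1, jacobiTheta₂ x τ = 1 := by
  let f : ℤ → C(ℝ, ℂ) := fun n => ⟨fun x => jacobiTheta₂_term n x τ, by
    unfold jacobiTheta₂_term; fun_prop⟩
  have hs : Summable fun n : ℤ => ‖(f n).restrict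
      (⟨Set.uIcc 0 1, isCompact_uIcc⟩ : TopologicalSpace.Compacts ℝ)‖ := by
    refine Summable.of_nonneg_of_le (fun _ => norm_nonneg _) (fun n => ?_) (summable_theta hτ 0)
    refine (ContinuousMap.norm_le _ (norm_nonneg _)).2 fun x => ?_
    simp [f, norm_jacobiTheta₂_term]
  have h := intervalIntegral.hasSum_intervalIntegral_of_summable_norm (a := 0) (b := 1) hs
  have h0 : ∀ n : ℤ, n ≠ 0 → ∫ x in (0 : ℝ)..1, f n x = 0 := by
    intro n hn
    have e : ∀ x : ℝ, f n x = exp (2 * π * Complex.I * n * x) * exp (π * Complex.I * n ^ 2 * τ) :=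
      fun x => by simp only [f, ContinuousMap.coe_mk, jacobiTheta₂_term, Complex.exp_add]
    simp_rw [e]
    rw [intervalIntegral.integral_mul_const, integral_exp_mul_complex]
    · have : exp (2 * π * Complex.I * n * (1 : ℝ)) = 1 :=
        Complex.exp_eq_one_iff.2 ⟨n, by push_cast; ring⟩
      rw [this]
      simp
    · simp [hn, Real.pi_ne_zero]
  have h1 := hasSum_single (f := fun n => ∫ x in (0 : ℝ)..1, f n x) 0 (fun n hn => h0 n hn)
  have h2 := h.unique h1
  have h3 : ∫ x in (0 : ℝ)..1, f 0 x = 1 := by simp [f, jacobiTheta₂_term]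
  rw [← h3, ← h2]
  rfl

theorem exists_jacobiTheta₂_ne_zero {τ : ℂ} (hτ : 0 < τ.im) : ∃ z, jacobiTheta₂ z τ ≠ 0 := by
  by_contra! h
  have := integral_jacobiTheta₂ hτ
  simp [h] at this

theorem exists_theta1_ne_zero {τ : ℂ} (hτ : 0 < τ.im) : ∃ z, theta1 z τ ≠ 0 := by
  obtain ⟨z, hz⟩ := exists_jacobiTheta₂_ne_zero hτ
  refine ⟨z - τ / 2 - 1 / 2, ?_⟩
  rw [theta1_eq, show z - τ / 2 - 1 / 2 + τ / 2 + 1 / 2 = z by ring]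
  exact neg_ne_zero.2 (mul_ne_zero (Complex.exp_ne_zero _) hz)

/-! ### The zeros of `theta1`. -/

theorem eq_zero_or_eq_zero_of_entire_mul {f g : ℂ → ℂ} (hf : Differentiable ℂ f)
    (hg : Differentiable ℂ g) (h : ∀ z, f z * g z = 0) : (∀ z, f z = 0) ∨ ∀ z, g z = 0 := by
  by_contra! H
  obtain ⟨⟨a, ha⟩, ⟨b, hb⟩⟩ := H
  have hf' : AnalyticOnNhd ℂ f Set.univ := fun z _ => hf.analyticAt z
  have : ∀ᶠ z in 𝓝 b, f z = 0 := by
    filter_upwards [(hg b).continuousAt.eventually_ne hb] with z hz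
    exact (mul_eq_zero.1 (h z)).resolve_right hz
  exact ha (hf'.eqOn_zero_of_preconnected_of_eventuallyEq_zero isPreconnected_univ
    (Set.mem_univ b) this (Set.mem_univ a))

theorem thetaA_add_one (z τ : ℂ) : thetaA (z + 1) τ = thetaA z τ := by
  rw [show z + 1 = z + 1 / 2 + 1 / 2 by ring, thetaA_add_half, thetaA_add_half]

theorem thetaB_add_one (z τ : ℂ) : thetaB (z + 1) τ = thetaB z τ := by
  rw [show z + 1 = z + 1 / 2 + 1 / 2 by ring, thetaB_add_half, thetaB_add_half, neg_neg]

/-- An entire doubly periodic function is constant. -/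
theorem exists_const_of_doubly_periodic {τ : ℂ} (hτ : 0 < τ.im) {f : ℂ → ℂ}
    (hf : Differentiable ℂ f) (h1 : ∀ z, f (z + 1) = f z) (h2 : ∀ z, f (z + τ) = f z) (z : ℂ) :
    f z = f 0 := by
  have p1 : Function.Periodic f 1 := h1
  have p2 : Function.Periodic f τ := h2
  have hK : IsCompact ((fun p : ℝ × ℝ => (p.1 : ℂ) + p.2 * τ) '' (Set.Icc 0 1 ×ˢ Set.Icc 0 1)) :=
    (isCompact_Icc.prod isCompact_Icc).image (by fun_prop)
  refine hf.apply_eq_apply_of_bounded ?_ z 0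
  refine ((hK.image hf.continuous).isBounded).subset ?_
  rintro _ ⟨w, rfl⟩
  set t := w.im / τ.im with ht
  set s := w.re - t * τ.re with hs
  have hw : w = s + t * τ := by
    apply Complex.ext
    · simp [hs]
    · simp [ht, hτ.ne']
  refine ⟨(Int.fract s : ℝ) + (Int.fract t : ℝ) * τ, ⟨(Int.fract s, Int.fract t),
    ⟨⟨Int.fract_nonneg _, (Int.fract_lt_one _).le⟩, ⟨Int.fract_nonneg _, (Int.fract_lt_one _).le⟩⟩,
    rfl⟩, ?_⟩
  have e : w = (Int.fract s : ℝ) + (Int.fract t : ℝ) * τ + ⌊s⌋ * 1 + ⌊t⌋ * τ := by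
    rw [hw]
    nth_rewrite 1 [← Int.floor_add_fract s, ← Int.floor_add_fract t]
    push_cast
    ring
  rw [e, p2.int_mul ⌊t⌋, p1.int_mul ⌊s⌋]

theorem theta1_sq_add_one {τ : ℂ} (hτ : 0 < τ.im) (z : ℂ) :
    theta1 (z + 1) τ ^ 2 = theta1 z τ ^ 2 := by
  rw [theta1_sq hτ, theta1_sq hτ, thetaA_add_one, thetaB_add_one]

theorem theta1_sq_add_tau {τ : ℂ} (hτ : 0 < τ.im) (z : ℂ) : theta1 (z + τ) τ ^ 2 =
    exp (-(2 * π * Complex.I * τ + 4 * π * Complex.I * z)) * theta1 z τ ^ 2 := by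
  rw [theta1_sq hτ, theta1_sq hτ, thetaA_add_tau, thetaB_add_tau]
  ring

theorem theta1_add_one_eq_zero {τ : ℂ} (hτ : 0 < τ.im) (z : ℂ) :
    theta1 (z + 1) τ = 0 ↔ theta1 z τ = 0 := by
  rw [← sq_eq_zero_iff, theta1_sq_add_one hτ, sq_eq_zero_iff]

theorem theta1_add_tau_eq_zero {τ : ℂ} (hτ : 0 < τ.im) (z : ℂ) :
    theta1 (z + τ) τ = 0 ↔ theta1 z τ = 0 := by
  rw [← sq_eq_zero_iff, theta1_sq_add_tau hτ, mul_eq_zero, or_iff_right (Complex.exp_ne_zero _),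
    sq_eq_zero_iff]

theorem theta1_add_lattice_eq_zero {τ : ℂ} (hτ : 0 < τ.im) (z : ℂ) (m n : ℤ) :
    theta1 (z + m + n * τ) τ = 0 ↔ theta1 z τ = 0 := by
  have p1 : Function.Periodic (fun z => theta1 z τ = 0) 1 :=
    fun z => propext (theta1_add_one_eq_zero hτ z)
  have p2 : Function.Periodic (fun z => theta1 z τ = 0) τ :=
    fun z => propext (theta1_add_tau_eq_zero hτ z)
  have e1 := p1.int_mul m z
  have e2 := p2.int_mul n (z + m)
  simp only [mul_one] at e1
  exact iff_of_eq (e2.trans e1)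

theorem theta1_zero {τ : ℂ} (hτ : 0 < τ.im) : theta1 0 τ = 0 := by
  rw [← sq_eq_zero_iff, theta1_sq hτ]
  ring

/-- `θ₂(2z|2τ)` and `θ₃(2z|2τ)` have no common zero. -/
theorem thetaA_ne_zero_or_thetaB_ne_zero {τ : ℂ} (hτ : 0 < τ.im) (z : ℂ) :
    thetaA z τ ≠ 0 ∨ thetaB z τ ≠ 0 := by
  by_contra! h
  obtain ⟨u, hu⟩ := exists_theta1_ne_zero hτ
  have d := differentiable_theta1 hτ
  -- At a common zero, `theta1_mul` makes the product of the two translates vanish for every `y`, so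
  -- that `theta1` would vanish identically.
  have := eq_zero_or_eq_zero_of_entire_mul (f := fun y => theta1 (z + y) τ)
    (g := fun y => theta1 (z - y) τ) (d.comp (differentiable_id.const_add z))
    (d.comp (differentiable_id.const_sub z)) fun y => by
      rw [theta1_mul hτ, h.1, h.2]; ring
  rcases this with H | H
  · exact hu (by simpa using H (u - z))
  · exact hu (by simpa using H (z - u))

/-- A zero at a half period `w` turns `theta1_mul` into one of the relations `AB = 0`, `A² - B² =
0`, `A² + B² = 0`. Each splits into linear factors, and a linear relation between `A` and `B` kills
`theta1`. -/
theorem theta1_ne_zero_of_half_period {τ : ℂ} (hτ : 0 < τ.im) :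
    theta1 (1 / 2) τ ≠ 0 ∧ theta1 (τ / 2) τ ≠ 0 ∧ theta1 (1 / 2 + τ / 2) τ ≠ 0 := by
  obtain ⟨u, hu⟩ := exists_theta1_ne_zero hτ
  have hA := differentiable_thetaA hτ
  have hB := differentiable_thetaB hτ
  have key : ∀ w, theta1 w τ = 0 → ∀ x, thetaA (x + w) τ * thetaB x τ = thetaB (x + w) τ * thetaA x τ := by
    intro w hw x
    have := theta1_mul hτ (x + w) x
    rw [add_sub_cancel_left, hw, mul_zero] at this
    linear_combination -this
  have hu2 := mt sq_eq_zero_iff.1 hu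
  rw [theta1_sq hτ] at hu2
  have lin : ∀ c : ℂ, (∀ z, thetaA z τ - c * thetaB z τ = 0) → False := by
    intro c h
    apply hu2
    linear_combination thetaB 0 τ * h u - thetaB u τ * h 0
  refine ⟨fun h => ?_, fun h => ?_, fun h => ?_⟩
  · have := eq_zero_or_eq_zero_of_entire_mul hA hB fun z => by
      have := key _ h z
      rw [thetaA_add_half, thetaB_add_half] at this
      linear_combination this / 2
    rcases this with H | H
    · exact lin 0 fun z => by rw [H z]; ring
    · apply hu2
      rw [H, H]
      ring
  · have := eq_zero_or_eq_zero_of_entire_mul (hA.sub (hB.const_mul 1)) (hA.sub (hB.const_mul (-1)))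
      fun z => by
        have := key _ h z
        rw [thetaA_add_half_tau, thetaB_add_half_tau] at this
        have e := Complex.exp_ne_zero (-(π * Complex.I * τ / 2 + 2 * π * Complex.I * z))
        apply mul_left_cancel₀ e
        simp only [Pi.sub_apply]
        linear_combination -this
    rcases this with H | H
    · exact lin _ H
    · exact lin _ H
  · have := eq_zero_or_eq_zero_of_entire_mul (hA.sub (hB.const_mul Complex.I))
      (hA.sub (hB.const_mul (-Complex.I))) fun z => by
        have := key _ h z
        rw [← add_assoc, thetaA_add_half_tau, thetaB_add_half_tau, thetaA_add_half, thetaB_add_half] at this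
        have e := Complex.exp_ne_zero (-(π * Complex.I * τ / 2 + 2 * π * Complex.I * (z + 1 / 2)))
        apply mul_left_cancel₀ e
        simp only [Pi.sub_apply]
        linear_combination -this - exp (-(π * Complex.I * τ / 2 + 2 * π * Complex.I * (z + 1 / 2))) *
          thetaB z τ ^ 2 * Complex.I_sq
    rcases this with H | H
    · exact lin _ H
    · exact lin _ H

/-- An entire nonvanishing function which is `1`-periodic and `τ`-quasi-periodic with constant
multiplier `μ` has multiplier `exp (2πi n τ)`. -/
theorem exists_multiplier {τ : ℂ} (hτ : 0 < τ.im) {h : ℂ → ℂ} (hd : Differentiable ℂ h)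
    (h0 : ∀ z, h z ≠ 0) (h1 : ∀ z, h (z + 1) = h z) (μ : ℂ) (h2 : ∀ z, h (z + τ) = μ * h z) :
    ∃ n : ℤ, μ = exp (2 * π * Complex.I * n * τ) := by
  have d1 : ∀ z, deriv h (z + 1) = deriv h z := fun z => by
    rw [← deriv_comp_add_const]
    simp_rw [h1]
  have d2 : ∀ z, deriv h (z + τ) = μ * deriv h z := fun z => by
    rw [← deriv_comp_add_const]
    simp_rw [h2]
    rw [deriv_const_mul _ (hd z)]
  have hμ : μ ≠ 0 := by
    rintro rfl
    exact h0 (0 + τ) (by rw [h2, zero_mul])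
  have hdd : Differentiable ℂ (deriv h) := by
    have : ContDiff ℂ 2 h := hd.contDiff
    exact ((contDiff_succ_iff_deriv (n := 1)).1 this).2.2.differentiable (by norm_num)
  -- The logarithmic derivative is entire and doubly periodic, hence a constant `l`; so `h` is an
  -- exponential, and the period `1` forces `exp l = 1`.
  have c := exists_const_of_doubly_periodic hτ (f := fun z => deriv h z / h z) (hdd.div hd h0)
    (fun z => by simp only [h1, d1]) (fun z => by
      simp only [h2, d2]
      rw [mul_div_mul_left _ _ hμ])
  set l := deriv h 0 / h 0
  have e : ∀ z, h z = h 0 * exp (l * z) := by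
    intro z
    have := is_const_of_deriv_eq_zero (f := fun z => h z * exp (-(l * z)))
      (hd.mul (by fun_prop)) (fun z => by
        have hz : HasDerivAt (fun z => exp (-(l * z))) (exp (-(l * z)) * (-(l * 1))) z :=
          (((hasDerivAt_id z).const_mul l).neg).cexp
        have := ((hd z).hasDerivAt.mul hz).deriv
        refine this.trans ?_
        have h3 : deriv h z = l * h z := by
          have := c z
          field_simp [h0 z] at this
          exact (div_eq_iff (h0 z)).1 (c z)
        rw [h3]
        ring) z 0
    simp only [mul_zero, neg_zero, Complex.exp_zero, mul_one] at this
    rw [← this, mul_assoc, ← Complex.exp_add]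
    simp
  have hl : exp l = 1 := by
    have := h1 0
    rw [e (0 + 1), zero_add, mul_one] at this
    exact mul_left_cancel₀ (h0 0) (by rw [this, mul_one])
  obtain ⟨n, hn⟩ := Complex.exp_eq_one_iff.1 hl
  refine ⟨n, ?_⟩
  have := h2 0
  rw [e (0 + τ), zero_add, mul_comm μ] at this
  rw [← mul_left_cancel₀ (h0 0) this, hn]
  congr 1
  ring

/-- The zeros of `θ₁(·|τ)` are the points of the lattice `ℤ + ℤ τ`. -/
theorem theta1_eq_zero_iff {τ : ℂ} (hτ : 0 < τ.im) (w : ℂ) :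
    theta1 w τ = 0 ↔ ∃ m n : ℤ, w = m + n * τ := by
  constructor
  swap
  · rintro ⟨m, n, rfl⟩
    rw [← zero_add (m : ℂ), theta1_add_lattice_eq_zero hτ, theta1_zero hτ]
  intro hw
  have hA := differentiable_thetaA hτ
  have hB := differentiable_thetaB hτ
  have hA' : Differentiable ℂ fun z => thetaA (z + w) τ := hA.comp (differentiable_id.add_const w)
  have hB' : Differentiable ℂ fun z => thetaB (z + w) τ := hB.comp (differentiable_id.add_const w)
  have key : ∀ x, thetaA (x + w) τ * thetaB x τ = thetaB (x + w) τ * thetaA x τ := by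
    intro x
    have := theta1_mul hτ (x + w) x
    rw [add_sub_cancel_left, hw, mul_zero] at this
    linear_combination -this
  classical
  -- By `key` the quotients of `thetaA` and of `thetaB` under translation by `w` coincide; as the
  -- two have no common zero, the quotients glue to an entire function without zeros.
  let h : ℂ → ℂ := fun z => if thetaA z τ ≠ 0 then thetaA (z + w) τ / thetaA z τ
    else thetaB (z + w) τ / thetaB z τ
  have eA : ∀ z, thetaA z τ ≠ 0 → h z = thetaA (z + w) τ / thetaA z τ := fun z hz => if_pos hz
  have eB : ∀ z, thetaB z τ ≠ 0 → h z = thetaB (z + w) τ / thetaB z τ := by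
    intro z hz
    by_cases ha : thetaA z τ ≠ 0
    · rw [eA z ha, div_eq_div_iff ha hz, key]
    · exact if_neg ha
  have hhA : ∀ z, thetaA (z + w) τ = h z * thetaA z τ := by
    intro z
    rcases thetaA_ne_zero_or_thetaB_ne_zero hτ z with ha | hb
    · rw [eA z ha, div_mul_cancel₀ _ ha]
    · rw [eB z hb, div_mul_eq_mul_div, eq_div_iff hb, key]
  have hhB : ∀ z, thetaB (z + w) τ = h z * thetaB z τ := by
    intro z
    rcases thetaA_ne_zero_or_thetaB_ne_zero hτ z with ha | hb
    · rw [eA z ha, div_mul_eq_mul_div, eq_div_iff ha, key]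
    · rw [eB z hb, div_mul_cancel₀ _ hb]
  have hd : Differentiable ℂ h := by
    intro z
    rcases thetaA_ne_zero_or_thetaB_ne_zero hτ z with ha | hb
    · refine (((hA' z).div (hA z) ha)).congr_of_eventuallyEq ?_
      filter_upwards [(hA z).continuousAt.eventually_ne ha] with y hy using eA y hy
    · refine (((hB' z).div (hB z) hb)).congr_of_eventuallyEq ?_
      filter_upwards [(hB z).continuousAt.eventually_ne hb] with y hy using eB y hy
  have h0 : ∀ z, h z ≠ 0 := by
    intro z hz
    have e1 := hhA z
    have e2 := hhB z
    rw [hz, zero_mul] at e1 e2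
    rcases thetaA_ne_zero_or_thetaB_ne_zero hτ (z + w) with ha | hb
    · exact ha e1
    · exact hb e2
  have cancel : ∀ z c, c * thetaA z τ = h z * thetaA z τ → c * thetaB z τ = h z * thetaB z τ →
      h z = c := by
    intro z c h1 h2
    rcases thetaA_ne_zero_or_thetaB_ne_zero hτ z with ha | hb
    · exact (mul_right_cancel₀ ha h1).symm
    · exact (mul_right_cancel₀ hb h2).symm
  have h1 : ∀ z, h (z + 1) = h z := by
    intro z
    apply cancel
    · rw [← hhA, thetaA_add_one, ← hhA, add_right_comm, thetaA_add_one]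
    · rw [← hhB, thetaB_add_one, ← hhB, add_right_comm, thetaB_add_one]
  have h2 : ∀ z, h (z + τ) = exp (-(4 * π * Complex.I * w)) * h z := by
    intro z
    have e : exp (-(2 * π * Complex.I * τ + 4 * π * Complex.I * (z + w))) =
      exp (-(4 * π * Complex.I * w)) * exp (-(2 * π * Complex.I * τ + 4 * π * Complex.I * z)) := by
      rw [← Complex.exp_add]
      congr 1
      ring
    apply cancel
    · rw [← hhA, add_right_comm, thetaA_add_tau, thetaA_add_tau, hhA, e]
      ring
    · rw [← hhB, add_right_comm, thetaB_add_tau, thetaB_add_tau, hhB, e]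
      ring
  -- Comparing the multiplier `exp (-4πiw)` with `exp (2πinτ)` puts `2w` in the lattice; the three
  -- nonzero half periods are then excluded by parity.
  obtain ⟨n, hn⟩ := exists_multiplier hτ hd h0 h1 _ h2
  obtain ⟨m, hm⟩ := Complex.exp_eq_exp_iff_exists_int.1 hn
  have h2w : w * 2 = -m + -n * τ := by
    have : (2 * π * Complex.I) * (w * 2) = (2 * π * Complex.I) * (-m + -n * τ) := by
      linear_combination -hm
    exact mul_left_cancel₀ Complex.two_pi_I_ne_zero this
  obtain ⟨k1, k2, k3⟩ := theta1_ne_zero_of_half_period hτ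
  rcases Int.even_or_odd' (-m) with ⟨a, ha | ha⟩ <;> rcases Int.even_or_odd' (-n) with ⟨b, hb | hb⟩
  · refine ⟨a, b, ?_⟩
    have ha' : (-m : ℂ) = 2 * a := by exact_mod_cast ha
    have hb' : (-n : ℂ) = 2 * b := by exact_mod_cast hb
    linear_combination h2w / 2 + ha' / 2 + hb' * τ / 2
  · exfalso
    have ha' : (-m : ℂ) = 2 * a := by exact_mod_cast ha
    have hb' : (-n : ℂ) = 2 * b + 1 := by exact_mod_cast hb
    apply k2
    rw [← theta1_add_lattice_eq_zero hτ _ a b, ← hw]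
    congr 1
    linear_combination - h2w / 2 - ha' / 2 - hb' * τ / 2
  · exfalso
    have ha' : (-m : ℂ) = 2 * a + 1 := by exact_mod_cast ha
    have hb' : (-n : ℂ) = 2 * b := by exact_mod_cast hb
    apply k1
    rw [← theta1_add_lattice_eq_zero hτ _ a b, ← hw]
    congr 1
    linear_combination - h2w / 2 - ha' / 2 - hb' * τ / 2
  · exfalso
    have ha' : (-m : ℂ) = 2 * a + 1 := by exact_mod_cast ha
    have hb' : (-n : ℂ) = 2 * b + 1 := by exact_mod_cast hb
    apply k3
    rw [← theta1_add_lattice_eq_zero hτ _ a b, ← hw]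
    congr 1
    linear_combination - h2w / 2 - ha' / 2 - hb' * τ / 2

theorem theta2_zero_sq {τ : ℂ} (hτ : 0 < τ.im) :
    theta2 0 τ ^ 2 = 2 * (thetaA 0 τ * thetaB 0 τ) := by
  rw [theta2_sq hτ]; ring

theorem theta3_zero_sq {τ : ℂ} (hτ : 0 < τ.im) :
    theta3 0 τ ^ 2 = thetaA 0 τ ^ 2 + thetaB 0 τ ^ 2 := by
  rw [theta3_sq hτ]; ring

theorem theta4_zero_sq {τ : ℂ} (hτ : 0 < τ.im) :
    theta4 0 τ ^ 2 = thetaA 0 τ ^ 2 - thetaB 0 τ ^ 2 := by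
  rw [theta4_sq hτ]; ring

theorem theta2_zero_ne_zero {τ : ℂ} (hτ : 0 < τ.im) : theta2 0 τ ≠ 0 := by
  intro h
  apply (theta1_ne_zero_of_half_period hτ).1
  rw [← sq_eq_zero_iff, theta1_sq hτ, ← zero_add (1 / 2 : ℂ), thetaA_add_half, thetaB_add_half]
  linear_combination theta2 0 τ * h - theta2_zero_sq hτ

theorem theta4_zero_ne_zero {τ : ℂ} (hτ : 0 < τ.im) : theta4 0 τ ≠ 0 := by
  intro h
  apply (theta1_ne_zero_of_half_period hτ).2.1
  rw [← sq_eq_zero_iff, theta1_sq hτ, ← zero_add (τ / 2 : ℂ), thetaA_add_half_tau,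
    thetaB_add_half_tau]
  have := theta4_zero_sq hτ
  rw [h] at this
  linear_combination exp (-(π * Complex.I * τ / 2 + 2 * π * Complex.I * 0)) * this

theorem theta3_zero_ne_zero {τ : ℂ} (hτ : 0 < τ.im) : theta3 0 τ ≠ 0 := by
  intro h
  apply (theta1_ne_zero_of_half_period hτ).2.2
  rw [← sq_eq_zero_iff, theta1_sq hτ, ← zero_add (1 / 2 : ℂ), thetaA_add_half_tau,
    thetaB_add_half_tau, thetaA_add_half, thetaB_add_half]
  have := theta3_zero_sq hτ
  rw [h] at this
  linear_combination exp (-(π * Complex.I * τ / 2 + 2 * π * Complex.I * (0 + 1 / 2))) * this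

/-! ### The even elliptic function of degree two. -/

/-- Picard's function of `z` and `τ`. -/
def legendreX (z τ : ℂ) : ℂ :=
  -(theta4 0 τ ^ 2 / theta3 0 τ ^ 2) * (theta2 z τ ^ 2 / theta1 z τ ^ 2)

theorem picardY_eq_legendreX (ν μ N : ℤ) (τ : ℍ) :
    picardY ν μ N τ = legendreX (((ν : ℂ) * τ + μ) / (2 * N)) τ := rfl

theorem picardX_eq (τ : ℍ) : picardX τ =
    (thetaA 0 τ ^ 2 - thetaB 0 τ ^ 2) ^ 2 / (thetaA 0 τ ^ 2 + thetaB 0 τ ^ 2) ^ 2 := by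
  rw [picardX, ← theta4_zero_sq τ.im_pos, ← theta3_zero_sq τ.im_pos]
  ring

theorem legendreX_eq {τ : ℂ} (hτ : 0 < τ.im) (z : ℂ) : legendreX z τ =
    -((thetaA 0 τ ^ 2 - thetaB 0 τ ^ 2) * (thetaB 0 τ * thetaA z τ + thetaA 0 τ * thetaB z τ)) /
      ((thetaA 0 τ ^ 2 + thetaB 0 τ ^ 2) * (thetaB 0 τ * thetaA z τ - thetaA 0 τ * thetaB z τ)) := by
  rw [legendreX, theta4_zero_sq hτ, theta3_zero_sq hτ, theta2_sq hτ, theta1_sq hτ, ← neg_div,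
    div_mul_div_comm, neg_mul]

theorem legendreX_add_one {τ : ℂ} (hτ : 0 < τ.im) (z : ℂ) :
    legendreX (z + 1) τ = legendreX z τ := by
  rw [legendreX_eq hτ, legendreX_eq hτ, thetaA_add_one, thetaB_add_one]

theorem legendreX_add_tau {τ : ℂ} (hτ : 0 < τ.im) (z : ℂ) :
    legendreX (z + τ) τ = legendreX z τ := by
  rw [legendreX_eq hτ, legendreX_eq hτ, thetaA_add_tau, thetaB_add_tau]
  have := Complex.exp_ne_zero (-(2 * π * Complex.I * τ + 4 * π * Complex.I * z))
  refine Eq.trans ?_ (mul_div_mul_left _ _ this)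
  congr 1 <;> ring

theorem legendreX_neg {τ : ℂ} (hτ : 0 < τ.im) (z : ℂ) :
    legendreX (-z) τ = legendreX z τ := by
  rw [legendreX_eq hτ, legendreX_eq hτ, thetaA_neg, thetaB_neg]

theorem legendreX_add_lattice {τ : ℂ} (hτ : 0 < τ.im) (z : ℂ) (m n : ℤ) :
    legendreX (z + m + n * τ) τ = legendreX z τ := by
  have p1 : Function.Periodic (fun z => legendreX z τ) 1 := fun z => legendreX_add_one hτ z
  have p2 : Function.Periodic (fun z => legendreX z τ) τ := fun z => legendreX_add_tau hτ z
  have e1 := p1.int_mul m z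
  have e2 := p2.int_mul n (z + m)
  simp only [mul_one] at e1
  exact e2.trans e1

/-- `legendreX` takes every value at most twice in a period parallelogram. -/
theorem theta1_add_or_sub_eq_zero {τ : ℂ} (hτ : 0 < τ.im) {z w : ℂ} (hz : theta1 z τ ≠ 0)
    (hw : theta1 w τ ≠ 0) (h : legendreX z τ = legendreX w τ) :
    theta1 (z + w) τ = 0 ∨ theta1 (z - w) τ = 0 := by
  rw [← mul_eq_zero, theta1_mul hτ]
  have h2 := theta2_zero_ne_zero hτ
  have h3 := theta3_zero_ne_zero hτ
  have h4 := theta4_zero_ne_zero hτ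
  rw [legendreX, legendreX] at h
  have h' := mul_left_cancel₀ (neg_ne_zero.2 (div_ne_zero (pow_ne_zero 2 h4) (pow_ne_zero 2 h3))) h
  rw [div_eq_div_iff (pow_ne_zero 2 hz) (pow_ne_zero 2 hw), theta1_sq hτ, theta1_sq hτ,
    theta2_sq hτ, theta2_sq hτ] at h'
  have e := theta2_zero_sq hτ
  -- After cross-multiplication, the equality of the two values is `2A(0)B(0)` times the bilinear
  -- form of `theta1_mul`.
  have : theta2 0 τ ^ 2 * (thetaA z τ * thetaB w τ - thetaB z τ * thetaA w τ) = 0 := by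
    rw [e]
    linear_combination -h'
  exact (mul_eq_zero.1 this).resolve_left (pow_ne_zero 2 h2)

theorem legendreX_one_sub {τ : ℂ} (hτ : 0 < τ.im) {z : ℂ} (hz : theta1 z τ ≠ 0) :
    1 - legendreX z τ = theta2 0 τ ^ 2 * theta4 z τ ^ 2 / (theta3 0 τ ^ 2 * theta1 z τ ^ 2) := by
  have h3 := theta3_zero_ne_zero hτ
  have e : 1 - legendreX z τ = (theta3 0 τ ^ 2 * theta1 z τ ^ 2 + theta4 0 τ ^ 2 * theta2 z τ ^ 2) /
      (theta3 0 τ ^ 2 * theta1 z τ ^ 2) := by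
    rw [legendreX]
    field_simp
    ring
  rw [e]
  congr 1
  rw [theta3_zero_sq hτ, theta4_zero_sq hτ, theta1_sq hτ, theta2_zero_sq hτ, theta2_sq hτ,
    theta4_sq hτ]
  ring

/-- Translation by `τ/2` exchanges `θ₁²` and `θ₄²` up to a common factor, so the product does not
depend on `z`. On the Legendre curve this is the addition of the 2-torsion point with abscissa `1`.
-/
theorem legendreX_add_half_tau {τ : ℂ} (hτ : 0 < τ.im) {z : ℂ} (hz : theta1 z τ ≠ 0)
    (hz' : theta1 (z + τ / 2) τ ≠ 0) :
    (1 - legendreX z τ) * (1 - legendreX (z + τ / 2) τ) = theta2 0 τ ^ 4 / theta3 0 τ ^ 4 := by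
  have h3 := theta3_zero_ne_zero hτ
  have h2 : theta1 (z + τ / 2) τ ^ 2 =
      -exp (-(π * Complex.I * τ / 2 + 2 * π * Complex.I * z)) * theta4 z τ ^ 2 := by
    rw [theta1_sq hτ, theta4_sq hτ, thetaA_add_half_tau, thetaB_add_half_tau]
    ring
  have h4 : theta4 (z + τ / 2) τ ^ 2 =
      -exp (-(π * Complex.I * τ / 2 + 2 * π * Complex.I * z)) * theta1 z τ ^ 2 := by
    rw [theta1_sq hτ, theta4_sq hτ, thetaA_add_half_tau, thetaB_add_half_tau]
    ring
  have h5 : theta4 z τ ≠ 0 := by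
    intro h
    rw [h] at h2
    exact hz' (by simpa using h2)
  rw [legendreX_one_sub hτ hz, legendreX_one_sub hτ hz', h2, h4]
  have e := Complex.exp_ne_zero (-(π * Complex.I * τ / 2 + 2 * π * Complex.I * z))
  field_simp

theorem legendreX_half {τ : ℂ} (hτ : 0 < τ.im) : legendreX (1 / 2) τ = 0 := by
  rw [legendreX, theta2_sq hτ, ← zero_add (1 / 2 : ℂ), thetaA_add_half, thetaB_add_half]
  ring

theorem legendreX_half_tau {τ : ℂ} (hτ : 0 < τ.im) : legendreX (τ / 2) τ = 1 := by
  have h := legendreX_one_sub hτ (theta1_ne_zero_of_half_period hτ).2.1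
  have : theta4 (τ / 2) τ ^ 2 = 0 := by
    rw [theta4_sq hτ, ← zero_add (τ / 2 : ℂ), thetaA_add_half_tau, thetaB_add_half_tau]
    ring
  rw [this, mul_zero, zero_div] at h
  linear_combination -h

/-- The point `0` is a pole, and division by zero returns `0` there. Hence parameters in the lattice
count among the constant cases. -/
theorem legendreX_zero {τ : ℂ} (hτ : 0 < τ.im) : legendreX 0 τ = 0 := by
  rw [legendreX, theta1_zero hτ]
  simp

theorem picardX_ne_zero (τ : ℍ) : picardX τ ≠ 0 :=
  div_ne_zero (pow_ne_zero 4 (theta4_zero_ne_zero τ.im_pos))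
    (pow_ne_zero 4 (theta3_zero_ne_zero τ.im_pos))

/-- Jacobi's identity `ϑ₃⁴ = ϑ₂⁴ + ϑ₄⁴`. -/
theorem one_sub_picardX (τ : ℍ) : 1 - picardX τ = theta2 0 τ ^ 4 / theta3 0 τ ^ 4 := by
  have h3 := theta3_zero_ne_zero τ.im_pos
  rw [picardX, eq_div_iff (pow_ne_zero 4 h3)]
  field_simp
  linear_combination (theta3 0 τ ^ 2 + thetaA 0 τ ^ 2 + thetaB 0 τ ^ 2) * theta3_zero_sq τ.im_pos -
    (theta4 0 τ ^ 2 + thetaA 0 τ ^ 2 - thetaB 0 τ ^ 2) * theta4_zero_sq τ.im_pos -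
    (theta2 0 τ ^ 2 + 2 * (thetaA 0 τ * thetaB 0 τ)) * theta2_zero_sq τ.im_pos

theorem one_sub_picardX_ne_zero (τ : ℍ) : 1 - picardX τ ≠ 0 := by
  rw [one_sub_picardX]
  exact div_ne_zero (pow_ne_zero 4 (theta2_zero_ne_zero τ.im_pos))
    (pow_ne_zero 4 (theta3_zero_ne_zero τ.im_pos))

/-! ### The translation `τ ↦ τ + 1` -/

/-- The integers `n²` and `n` have the same parity. -/
theorem jacobiTheta₂_tau_add_one (z τ : ℂ) :
    jacobiTheta₂ z (τ + 1) = jacobiTheta₂ (z + 1 / 2) τ := by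
  refine tsum_congr fun n => ?_
  rw [jacobiTheta₂_term, jacobiTheta₂_term, Complex.exp_eq_exp_iff_exists_int]
  obtain ⟨k, hk⟩ := Int.even_mul_pred_self n
  refine ⟨k, ?_⟩
  have : (n : ℂ) * (n - 1) = k + k := by exact_mod_cast hk
  linear_combination π * Complex.I * this

theorem theta3_tau_add_one (z τ : ℂ) : theta3 z (τ + 1) = theta4 z τ := by
  rw [theta3_eq, theta4_eq, jacobiTheta₂_tau_add_one]

theorem theta4_tau_add_one (z τ : ℂ) : theta4 z (τ + 1) = theta3 z τ := by
  rw [theta3_eq, theta4_eq, jacobiTheta₂_tau_add_one, add_assoc, add_halves,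
    jacobiTheta₂_add_left]

theorem theta2_tau_add_one (z τ : ℂ) : theta2 z (τ + 1) = exp (π * Complex.I / 4) * theta2 z τ := by
  rw [theta2_eq, theta2_eq, jacobiTheta₂_tau_add_one, ← mul_assoc, ← Complex.exp_add,
    show z + (τ + 1) / 2 + 1 / 2 = z + τ / 2 + 1 by ring, jacobiTheta₂_add_left]
  congr 2
  ring

theorem theta1_tau_add_one (z τ : ℂ) : theta1 z (τ + 1) = exp (π * Complex.I / 4) * theta1 z τ := by
  rw [theta1_eq, theta1_eq, jacobiTheta₂_tau_add_one, mul_neg, ← mul_assoc, ← Complex.exp_add,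
    show z + (τ + 1) / 2 + 1 / 2 + 1 / 2 = z + τ / 2 + 1 / 2 + 1 by ring, jacobiTheta₂_add_left]
  congr 3
  ring

/-! ### The inversion `τ ↦ -1 / τ` -/

/-- The automorphy factor of the theta functions under `τ ↦ -1 / τ`. -/
def thetaFactor (z τ : ℂ) : ℂ :=
  1 / (-Complex.I * τ) ^ (1 / 2 : ℂ) * exp (-π * Complex.I * z ^ 2 / τ)

theorem theta3_inversion (z τ : ℂ) :
    theta3 z τ = thetaFactor z τ * theta3 (z / τ) (-1 / τ) := by
  rw [theta3_eq, theta3_eq, jacobiTheta₂_functional_equation, thetaFactor]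

theorem theta4_inversion {z τ : ℂ} (hτ : 0 < τ.im) :
    theta4 z τ = thetaFactor z τ * theta2 (z / τ) (-1 / τ) := by
  have h0 : τ ≠ 0 := by rintro rfl; simp at hτ
  rw [theta4_eq, theta2_eq, show z + 1 / 2 = z - 1 / 2 + 1 by ring, jacobiTheta₂_add_left,
    jacobiTheta₂_functional_equation, thetaFactor,
    show (z - 1 / 2) / τ = z / τ + -1 / τ / 2 by ring]
  have e : exp (-π * Complex.I * (z - 1 / 2) ^ 2 / τ) = exp (-π * Complex.I * z ^ 2 / τ) *
      exp (π * Complex.I * (-1 / τ) / 4 + π * Complex.I * (z / τ)) := by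
    rw [← Complex.exp_add]
    congr 1
    field_simp
    ring
  rw [e]
  ring

theorem theta2_inversion {z τ : ℂ} (hτ : 0 < τ.im) :
    theta2 z τ = thetaFactor z τ * theta4 (z / τ) (-1 / τ) := by
  have h0 : τ ≠ 0 := by rintro rfl; simp at hτ
  rw [theta4_eq, theta2_eq, jacobiTheta₂_functional_equation, thetaFactor,
    show (z + τ / 2) / τ = z / τ + 1 / 2 by field_simp, ← mul_assoc, mul_left_comm,
    ← Complex.exp_add]
  congr 3
  field_simp
  ring

theorem theta1_inversion {z τ : ℂ} (hτ : 0 < τ.im) :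
    theta1 z τ = Complex.I * thetaFactor z τ * theta1 (z / τ) (-1 / τ) := by
  have h0 : τ ≠ 0 := by rintro rfl; simp at hτ
  have e : exp (π * Complex.I * τ / 4 + π * Complex.I * (z + 1 / 2)) *
      exp (-π * Complex.I * (z + τ / 2 - 1 / 2) ^ 2 / τ) = exp (π / 2 * Complex.I) * (
        exp (-π * Complex.I * z ^ 2 / τ) *
        exp (π * Complex.I * (-1 / τ) / 4 + π * Complex.I * (z / τ + 1 / 2))) := by
    rw [← Complex.exp_add, ← Complex.exp_add, ← Complex.exp_add]
    congr 1
    field_simp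
    ring
  rw [Complex.exp_pi_div_two_mul_I] at e
  rw [theta1_eq, theta1_eq, show z + τ / 2 + 1 / 2 = z + τ / 2 - 1 / 2 + 1 by ring,
    jacobiTheta₂_add_left, jacobiTheta₂_functional_equation, thetaFactor, mul_neg,
    show (z + τ / 2 - 1 / 2) / τ = z / τ + -1 / τ / 2 + 1 / 2 by field_simp; ring]
  linear_combination (-(1 / (-Complex.I * τ) ^ (1 / 2 : ℂ) *
    jacobiTheta₂ (z / τ + -1 / τ / 2 + 1 / 2) (-1 / τ))) * e

theorem thetaFactor_ne_zero {τ : ℂ} (hτ : 0 < τ.im) (z : ℂ) : thetaFactor z τ ≠ 0 := by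
  have h0 : τ ≠ 0 := by rintro rfl; simp at hτ
  refine mul_ne_zero (one_div_ne_zero ?_) (Complex.exp_ne_zero _)
  rw [Complex.cpow_def_of_ne_zero (mul_ne_zero (neg_ne_zero.2 Complex.I_ne_zero) h0)]
  exact Complex.exp_ne_zero _

/-- The inversion exchanges `θ₂` and `θ₄` and changes the sign of `θ₁²` relative to the common
factor, which is the passage from the theta quotient of `X` to that of `1 - X`. -/
theorem legendreX_inversion {z τ : ℂ} (hτ : 0 < τ.im) (hz : theta1 z τ ≠ 0) :
    legendreX (z / τ) (-1 / τ) = 1 - legendreX z τ := by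
  have c := thetaFactor_ne_zero hτ z
  have c0 := thetaFactor_ne_zero hτ 0
  have h4 := theta4_inversion (z := z) hτ
  have h1 := theta1_inversion (z := z) hτ
  have h20 := theta2_inversion (z := 0) hτ
  have h30 := theta3_inversion 0 τ
  have h3 := theta3_zero_ne_zero hτ
  rw [zero_div] at h20 h30
  rw [legendreX_one_sub hτ hz, legendreX]
  have hz' : theta1 (z / τ) (-1 / τ) ≠ 0 := by rintro h; rw [h, mul_zero] at h1; exact hz h1
  have h3' : theta3 0 (-1 / τ) ≠ 0 := by rintro h; rw [h, mul_zero] at h30; exact h3 h30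
  rw [h4, h1, h20, h30]
  simp only [mul_pow, Complex.I_sq]
  field_simp

theorem coe_T_smul (τ : ℍ) : ((ModularGroup.T • τ : ℍ) : ℂ) = τ + 1 := by
  rw [UpperHalfPlane.modular_T_smul, UpperHalfPlane.coe_vadd]
  push_cast
  ring

theorem coe_S_smul (τ : ℍ) : ((ModularGroup.S • τ : ℍ) : ℂ) = -1 / τ := by
  rw [UpperHalfPlane.modular_S_smul, UpperHalfPlane.coe_mk, ← neg_inv, neg_div, one_div]

theorem picardX_T_smul (τ : ℍ) : picardX (ModularGroup.T • τ) = (picardX τ)⁻¹ := by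
  rw [picardX, picardX, coe_T_smul, theta4_tau_add_one, theta3_tau_add_one, inv_div]

theorem picardX_S_smul (τ : ℍ) : picardX (ModularGroup.S • τ) = 1 - picardX τ := by
  have c := thetaFactor_ne_zero τ.im_pos 0
  have h20 := theta2_inversion (z := 0) τ.im_pos
  have h30 := theta3_inversion 0 τ
  have h3 := theta3_zero_ne_zero τ.im_pos
  rw [zero_div] at h20 h30
  have h3' : theta3 0 (-1 / τ) ≠ 0 := by rintro h; rw [h, mul_zero] at h30; exact h3 h30
  rw [one_sub_picardX, picardX, coe_S_smul, h20, h30]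
  field_simp

/-! ### Values at torsion points as functions of `τ`. -/

theorem theta1_torsion_eq_zero_iff {ν μ N : ℤ} (hN : N ≠ 0) (τ : ℍ) :
    theta1 (((ν : ℂ) * τ + μ) / (2 * N)) τ = 0 ↔ 2 * N ∣ ν ∧ 2 * N ∣ μ := by
  have hN' : (2 * N : ℂ) ≠ 0 := by exact_mod_cast mul_ne_zero two_ne_zero hN
  rw [theta1_eq_zero_iff τ.im_pos]
  constructor
  · rintro ⟨m, n, h⟩
    rw [div_eq_iff hN'] at h
    have him := congrArg Complex.im h
    have hre := congrArg Complex.re h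
    have hN2 : (2 * N : ℂ) = ((2 * N : ℤ) : ℝ) := by push_cast; ring
    rw [hN2, Complex.im_mul_ofReal] at him
    rw [hN2, Complex.re_mul_ofReal] at hre
    simp at him hre
    have h1 : ν = 2 * N * n := by
      have : ((ν : ℝ) - 2 * N * n) * τ.im = 0 := by linear_combination him
      have := (mul_eq_zero.1 this).resolve_right τ.im_ne_zero
      have : (ν : ℝ) = 2 * N * n := by linear_combination this
      exact_mod_cast this
    subst h1
    refine ⟨⟨n, rfl⟩, ⟨m, ?_⟩⟩
    have : (μ : ℝ) = 2 * N * m := by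
      push_cast at hre
      linear_combination hre
    exact_mod_cast this
  · rintro ⟨⟨n, rfl⟩, ⟨m, rfl⟩⟩
    refine ⟨m, n, ?_⟩
    rw [div_eq_iff hN']
    push_cast
    ring

/-- `T` exchanges `ϑ₃` and `ϑ₄`, so the prefactor `ϑ₄²/ϑ₃²` is inverted; this accounts for the
division by `x`. -/
theorem picardY_T_smul (ν μ N : ℤ) (τ : ℍ) :
    picardY ν μ N (ModularGroup.T • τ) = picardY ν (ν + μ) N τ / picardX τ := by
  have h3 := theta3_zero_ne_zero τ.im_pos
  have h4 := theta4_zero_ne_zero τ.im_pos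
  have e := Complex.exp_ne_zero (π * Complex.I / 4)
  rw [picardY, picardY, picardX, coe_T_smul, theta4_tau_add_one, theta3_tau_add_one,
    theta2_tau_add_one, theta1_tau_add_one, mul_pow, mul_pow, mul_div_mul_left _ _ (pow_ne_zero 2 e),
    show (ν : ℂ) * (τ + 1) + μ = ν * τ + (ν + μ : ℤ) by push_cast; ring]
  field_simp

/-- At lattice points both functions have the conventional value `0`, which is not preserved by `X ↦
1 - X`; hence the hypothesis. -/
theorem picardY_S_smul {ν μ N : ℤ} (hN : N ≠ 0) (h : ¬ (2 * N ∣ ν ∧ 2 * N ∣ μ)) (τ : ℍ) :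
    picardY ν μ N (ModularGroup.S • τ) = 1 - picardY μ (-ν) N τ := by
  have h' : ¬ (2 * N ∣ μ ∧ 2 * N ∣ -ν) := by rwa [dvd_neg, and_comm]
  rw [← theta1_torsion_eq_zero_iff hN τ] at h'
  rw [picardY_eq_legendreX, picardY_eq_legendreX, ← legendreX_inversion τ.im_pos h', coe_S_smul]
  congr 1
  have := τ.ne_zero
  push_cast
  field_simp
  ring

theorem picardY_neg (ν μ N : ℤ) (τ : ℍ) : picardY (-ν) (-μ) N τ = picardY ν μ N τ := by
  rw [picardY_eq_legendreX, picardY_eq_legendreX, ← legendreX_neg τ.im_pos]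
  congr 1
  push_cast
  ring

theorem picardY_add_period {N : ℤ} (hN : N ≠ 0) (ν μ k l : ℤ) (τ : ℍ) :
    picardY (ν + 2 * N * k) (μ + 2 * N * l) N τ = picardY ν μ N τ := by
  have hN' : (N : ℂ) ≠ 0 := by exact_mod_cast hN
  rw [picardY_eq_legendreX, picardY_eq_legendreX,
    ← legendreX_add_lattice τ.im_pos (((ν : ℂ) * τ + μ) / (2 * N)) l k]
  congr 1
  push_cast
  field_simp
  ring

theorem picardY_congr {N ν μ ν' μ' : ℤ} (hN : N ≠ 0) (h : 2 * N ∣ ν' - ν) (h' : 2 * N ∣ μ' - μ)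
    (τ : ℍ) : picardY ν' μ' N τ = picardY ν μ N τ := by
  obtain ⟨k, hk⟩ := h
  obtain ⟨l, hl⟩ := h'
  rw [← picardY_add_period hN ν μ k l τ, ← hk, ← hl]
  ring_nf

theorem picardY_eq_iff {N ν μ ν' μ' : ℤ} (hN : N ≠ 0) (h : ¬ (2 * N ∣ ν ∧ 2 * N ∣ μ))
    (h' : ¬ (2 * N ∣ ν' ∧ 2 * N ∣ μ')) (τ : ℍ) : picardY ν' μ' N τ = picardY ν μ N τ ↔
      ∃ ε : ℤ, (ε = 1 ∨ ε = -1) ∧ 2 * N ∣ ν' - ε * ν ∧ 2 * N ∣ μ' - ε * μ := by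
  constructor
  · intro e
    rw [← theta1_torsion_eq_zero_iff hN τ] at h h'
    rcases theta1_add_or_sub_eq_zero τ.im_pos h' h e with H | H
    · refine ⟨-1, Or.inr rfl, ?_⟩
      rw [← add_div, show (ν' : ℂ) * τ + μ' + (ν * τ + μ) = (ν' - -1 * ν : ℤ) * τ + (μ' - -1 * μ : ℤ) by
        push_cast; ring, theta1_torsion_eq_zero_iff hN] at H
      exact H
    · refine ⟨1, Or.inl rfl, ?_⟩
      rw [← sub_div, show (ν' : ℂ) * τ + μ' - (ν * τ + μ) = (ν' - 1 * ν : ℤ) * τ + (μ' - 1 * μ : ℤ) by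
        push_cast; ring, theta1_torsion_eq_zero_iff hN] at H
      exact H
  · rintro ⟨ε, rfl | rfl, h1, h2⟩
    · exact picardY_congr hN (by simpa using h1) (by simpa using h2) τ
    · rw [← picardY_neg ν μ]
      exact picardY_congr hN (by simpa using h1) (by simpa using h2) τ

theorem picardY_mul_shift {N ν μ : ℤ} (hN : N ≠ 0) (h : ¬ (2 * N ∣ ν ∧ 2 * N ∣ μ))
    (h' : ¬ (2 * N ∣ ν + N ∧ 2 * N ∣ μ)) (τ : ℍ) :
    (1 - picardY ν μ N τ) * (1 - picardY (ν + N) μ N τ) = 1 - picardX τ := by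
  have hN' : (N : ℂ) ≠ 0 := by exact_mod_cast hN
  have e : (((ν + N : ℤ) : ℂ) * τ + μ) / (2 * N) = ((ν : ℂ) * τ + μ) / (2 * N) + τ / 2 := by
    push_cast
    field_simp
    ring
  rw [← theta1_torsion_eq_zero_iff hN τ] at h h'
  rw [e] at h'
  rw [picardY_eq_legendreX, picardY_eq_legendreX, one_sub_picardX, e,
    legendreX_add_half_tau τ.im_pos h h']

/-- The parameters for which `picardY` is constant: `z` is `0`, `1/2` or `τ/2` modulo the lattice. -/
def IsDegenerate (ν μ N : ℤ) : Prop :=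
  (2 * N ∣ ν ∧ N ∣ μ) ∨ (2 * N ∣ μ ∧ N ∣ ν)

theorem picardY_of_isDegenerate {ν μ N : ℤ} (hN : N ≠ 0) (h : IsDegenerate ν μ N) :
    ∃ c : ℂ, ∀ τ : ℍ, picardY ν μ N τ = c := by
  have hN' : (N : ℂ) ≠ 0 := by exact_mod_cast hN
  rcases h with ⟨⟨k, rfl⟩, ⟨l, rfl⟩⟩ | ⟨⟨k, rfl⟩, ⟨l, rfl⟩⟩
  · rcases Int.even_or_odd' l with ⟨m, rfl | rfl⟩
    · refine ⟨0, fun τ => ?_⟩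
      rw [← legendreX_zero τ.im_pos, ← legendreX_add_lattice τ.im_pos _ m k, picardY_eq_legendreX]
      congr 1
      push_cast
      field_simp
      ring
    · refine ⟨0, fun τ => ?_⟩
      rw [← legendreX_half τ.im_pos, ← legendreX_add_lattice τ.im_pos _ m k, picardY_eq_legendreX]
      congr 1
      push_cast
      field_simp
      ring
  · rcases Int.even_or_odd' l with ⟨m, rfl | rfl⟩
    · refine ⟨0, fun τ => ?_⟩
      rw [← legendreX_zero τ.im_pos, ← legendreX_add_lattice τ.im_pos _ k m, picardY_eq_legendreX]
      congr 1
      push_cast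
      field_simp
      ring
    · refine ⟨1, fun τ => ?_⟩
      rw [← legendreX_half_tau τ.im_pos, ← legendreX_add_lattice τ.im_pos _ k m, picardY_eq_legendreX]
      congr 1
      push_cast
      field_simp
      ring

end PicardUniformization

end

/-! ### The function `x` separates the orbits of `Γ(2)`. -/

noncomputable section

namespace PicardUniformization

open scoped Real
open Complex (exp)
open Filter Asymptotics

/-- An analytic germ that is multiplied by approximately `4` under `z ↦ 2 z` vanishes to second
order at `0`. -/
theorem exists_sq_mul_of_doubling {d : ℂ → ℂ} (hd : AnalyticAt ℂ d 0)
    (h0 : ¬ ∀ᶠ z in 𝓝 0, d z = 0) (h : (fun z => d (2 * z) - 4 * d z) =o[𝓝 0] d) :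
    ∃ g : ℂ → ℂ, AnalyticAt ℂ g 0 ∧ g 0 ≠ 0 ∧ ∀ᶠ z in 𝓝 0, d z = z ^ 2 * g z := by
  obtain ⟨n, g, hg, hg0, hdg⟩ := hd.exists_eventuallyEq_pow_smul_nonzero_iff.2 h0
  simp only [sub_zero, smul_eq_mul] at hdg
  have t2 : Tendsto (fun z : ℂ => 2 * z) (𝓝 0) (𝓝 0) := by
    simpa using (continuous_const_mul (2 : ℂ)).tendsto 0
  -- For `d = zⁿ g` with `g 0 ≠ 0` the hypothesis reads `2ⁿ g(2z) - 4 g(z) = o(g)`; the limit at `0`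
  -- gives `2ⁿ = 4`.
  have h1 : (fun z => z ^ n * (2 ^ n * g (2 * z) - 4 * g z)) =o[𝓝[≠] 0] fun z => z ^ n * g z := by
    refine ((h.congr' ?_ hdg).mono nhdsWithin_le_nhds)
    filter_upwards [hdg, t2.eventually hdg] with z e1 e2
    rw [e1, e2, mul_pow]
    ring
  have h2 : (fun z => 2 ^ n * g (2 * z) - 4 * g z) =o[𝓝[≠] 0] g := by
    rw [isLittleO_iff] at h1 ⊢
    intro c hc
    filter_upwards [h1 hc, self_mem_nhdsWithin] with z hz hz0
    rw [norm_mul, norm_mul, mul_left_comm] at hz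
    exact le_of_mul_le_mul_left hz (norm_pos_iff.2 (pow_ne_zero n hz0))
  have h3 : (fun z => 2 ^ n * g (2 * z) - 4 * g z) =o[𝓝[≠] 0] fun _ => (1 : ℂ) :=
    h2.trans_isBigO ((hg.continuousAt.tendsto.mono_left nhdsWithin_le_nhds).isBigO_one ℂ)
  have h4 := (isLittleO_one_iff ℂ).1 h3
  have h5 : Tendsto (fun z => 2 ^ n * g (2 * z) - 4 * g z) (𝓝[≠] 0)
      (𝓝 (2 ^ n * g 0 - 4 * g 0)) := by
    refine Tendsto.mono_left ?_ nhdsWithin_le_nhds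
    have hc : Tendsto (fun z => g (2 * z)) (𝓝 0) (𝓝 (g 0)) := hg.continuousAt.tendsto.comp t2
    exact (hc.const_mul _).sub (hg.continuousAt.tendsto.const_mul _)
  have h6 := tendsto_nhds_unique h4 h5
  have h7 : (2 : ℂ) ^ n = 4 := by
    have : (2 ^ n - 4) * g 0 = 0 := by linear_combination -h6
    linear_combination (mul_eq_zero.1 this).resolve_right hg0
  have h8 : n = 2 := by
    have : 2 ^ n = 2 ^ 2 := by exact_mod_cast h7.trans (by norm_num : (4 : ℂ) = ((2 ^ 2 : ℕ) : ℂ))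
    exact Nat.pow_right_injective le_rfl this
  subst h8
  exact ⟨g, hg, hg0, hdg⟩

/-- Two analytic germs with the same doubling formula agree up to a scaling of the variable. -/
theorem exists_scaling_of_doubling {D f g : ℂ → ℂ} (hD : HasStrictDerivAt D 4 0) (hD0 : D 0 = 0)
    (hf : AnalyticAt ℂ f 0) (hg : AnalyticAt ℂ g 0) (hf0 : f 0 = 0) (hg0 : g 0 = 0)
    (hfn : ¬ ∀ᶠ z in 𝓝 0, f z = 0) (hgn : ¬ ∀ᶠ z in 𝓝 0, g z = 0)
    (hfD : ∀ᶠ z in 𝓝 0, f (2 * z) = D (f z)) (hgD : ∀ᶠ z in 𝓝 0, g (2 * z) = D (g z)) :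
    ∃ k : ℂ, k ≠ 0 ∧ ∀ᶠ z in 𝓝 0, f (k * z) = g z := by
  have tf : Tendsto f (𝓝 0) (𝓝 0) := by simpa [hf0] using hf.continuousAt.tendsto
  have tg : Tendsto g (𝓝 0) (𝓝 0) := by simpa [hg0] using hg.continuousAt.tendsto
  have main : ∀ {u : ℂ → ℂ}, Tendsto u (𝓝 0) (𝓝 0) → (∀ᶠ z in 𝓝 0, u (2 * z) = D (u z)) →
      (fun z => u (2 * z) - 4 * u z) =o[𝓝 0] u := by
    intro u tu huD
    have := hD.isLittleO.comp_tendsto (tu.prodMk_nhds (tendsto_const_nhds (x := (0 : ℂ))))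
    refine this.congr' ?_ ?_
    · filter_upwards [huD] with z hz
      rw [hz]
      simp [hD0, mul_comm (4 : ℂ)]
    · filter_upwards with z
      simp
  obtain ⟨F, hF, hF0, hfF⟩ := exists_sq_mul_of_doubling hf hfn (main tf hfD)
  obtain ⟨G, hG, hG0, hgG⟩ := exists_sq_mul_of_doubling hg hgn (main tg hgD)
  -- With this `k` the coefficients of `z²` in `f (k z)` and `g z` agree.
  obtain ⟨k, hk⟩ := IsAlgClosed.exists_pow_nat_eq (G 0 / F 0) two_pos
  have hk0 : k ≠ 0 := by
    rintro rfl
    exact div_ne_zero hG0 hF0 (by rw [← hk]; ring)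
  refine ⟨k, hk0, ?_⟩
  have tk : Tendsto (fun z : ℂ => k * z) (𝓝 0) (𝓝 0) := by
    simpa using (continuous_const_mul k).tendsto 0
  by_contra hne
  have ha : AnalyticAt ℂ (fun z => f (k * z)) 0 := by
    refine AnalyticAt.fun_comp (g := f) (f := fun z => k * z) ?_ (by fun_prop)
    simpa using hf
  -- Strict differentiability of `D` shows that a nonzero difference is again multiplied by
  -- approximately `4` under doubling, hence has order exactly two; but its coefficient of `z²` has
  -- been made zero.
  obtain ⟨H, hH, hH0, hdH⟩ := exists_sq_mul_of_doubling (d := fun z => f (k * z) - g z)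
    (ha.sub hg) (fun h => hne (by filter_upwards [h] with z hz using sub_eq_zero.1 hz)) (by
      have := hD.isLittleO.comp_tendsto ((tf.comp tk).prodMk_nhds tg)
      refine this.congr' ?_ ?_
      · filter_upwards [tk.eventually hfD, hgD] with z h1 h2
        simp only [Function.comp]
        rw [← h1, ← h2, mul_left_comm k 2 z]
        simp [mul_comm]
      · exact Eventually.of_forall fun z => rfl)
  have e : (fun z => H z) =ᶠ[𝓝[≠] 0] fun z => k ^ 2 * F (k * z) - G z := by
    filter_upwards [hdH.filter_mono nhdsWithin_le_nhds,
      (tk.eventually hfF).filter_mono nhdsWithin_le_nhds,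
      hgG.filter_mono nhdsWithin_le_nhds, self_mem_nhdsWithin] with z h1 h2 h3 h4
    rw [h2, h3] at h1
    apply mul_left_cancel₀ (pow_ne_zero 2 h4)
    rw [← h1]
    ring
  have t1 : Tendsto H (𝓝[≠] 0) (𝓝 (H 0)) := hH.continuousAt.tendsto.mono_left nhdsWithin_le_nhds
  have t2 : Tendsto (fun z => k ^ 2 * F (k * z) - G z) (𝓝[≠] 0) (𝓝 (k ^ 2 * F 0 - G 0)) := by
    refine Tendsto.mono_left ?_ nhdsWithin_le_nhds
    have hc : Tendsto (fun z => F (k * z)) (𝓝 0) (𝓝 (F 0)) := hF.continuousAt.tendsto.comp tk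
    exact (hc.const_mul _).sub hG.continuousAt.tendsto
  have := tendsto_nhds_unique (t1.congr' e) t2
  apply hH0
  rw [this, hk]
  field_simp
  ring

/-- The doubling map on the reciprocal of the `X`-coordinate of the Legendre curve. -/
def legendreDoubling (c u : ℂ) : ℂ := 4 * u * (1 - u) * (1 - c * u) / (1 - c * u ^ 2) ^ 2

theorem hasStrictDerivAt_legendreDoubling (c : ℂ) :
    HasStrictDerivAt (legendreDoubling c) 4 0 := by
  have hi := hasStrictDerivAt_id (0 : ℂ)
  have h1 := ((hi.const_mul 4).mul (hi.const_sub 1)).mul ((hi.const_mul c).const_sub 1)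
  have h2 := (((hi.pow 2).const_mul c).const_sub 1).pow 2
  have := h1.fun_div h2 (by simp)
  exact HasStrictDerivAt.congr_deriv (f := legendreDoubling c) this (by simp)

/-- The reciprocal of `legendreX`, with its value `0` at the lattice points. -/
def legendreU (z τ : ℂ) : ℂ :=
  -(theta3 0 τ ^ 2 / theta4 0 τ ^ 2) * (theta1 z τ ^ 2 / theta2 z τ ^ 2)

theorem theta3_double {τ : ℂ} (hτ : 0 < τ.im) (z : ℂ) :
    theta3 (2 * z) τ * theta3 0 τ = thetaA z τ ^ 2 + thetaB z τ ^ 2 := by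
  have := theta3_mul hτ z z
  rw [sub_self, ← two_mul] at this
  rw [this]
  ring

theorem theta4_double {τ : ℂ} (hτ : 0 < τ.im) (z : ℂ) :
    theta4 (2 * z) τ * theta4 0 τ = thetaA z τ ^ 2 - thetaB z τ ^ 2 := by
  have := theta4_mul hτ z z
  rw [sub_self, ← two_mul] at this
  rw [this]
  ring

/-- The duplication formula on the Legendre curve, in the coordinate `1/X`. The case `y = x` of the
addition formulas expresses the values at `2z` by those at `z` (`e3`, `e4`); the rest is polynomial
algebra. -/
theorem legendreU_double {τ : ℍ} {z : ℂ} (hA : thetaA z τ ≠ 0) (hB : thetaB z τ ≠ 0)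
    (h2 : theta2 z τ ≠ 0) :
    legendreU (2 * z) τ = legendreDoubling (picardX τ) (legendreU z τ) := by
  have hτ := τ.im_pos
  have k3 := pow_ne_zero 2 (theta3_zero_ne_zero hτ)
  have k4 := pow_ne_zero 2 (theta4_zero_ne_zero hτ)
  have k2 := pow_ne_zero 2 (theta2_zero_ne_zero hτ)
  rw [theta2_zero_sq hτ] at k2
  have k2' := pow_ne_zero 2 h2
  have d3 := theta3_double hτ z
  have d4 := theta4_double hτ z
  have e3 : (thetaA 0 τ * thetaA (2 * z) τ + thetaB 0 τ * thetaB (2 * z) τ) *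
      (thetaA 0 τ ^ 2 + thetaB 0 τ ^ 2) = (thetaA z τ ^ 2 + thetaB z τ ^ 2) ^ 2 := by
    rw [← d3, ← theta3_zero_sq hτ, ← theta3_sq hτ]
    ring
  have e4 : (thetaA 0 τ * thetaA (2 * z) τ - thetaB 0 τ * thetaB (2 * z) τ) *
      (thetaA 0 τ ^ 2 - thetaB 0 τ ^ 2) = (thetaA z τ ^ 2 - thetaB z τ ^ 2) ^ 2 := by
    rw [← d4, ← theta4_zero_sq hτ, ← theta4_sq hτ]
    ring
  rw [legendreU, legendreU, picardX_eq, legendreDoubling]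
  rw [theta3_zero_sq hτ] at k3 ⊢
  rw [theta4_zero_sq hτ] at k4 ⊢
  rw [theta2_sq hτ] at k2' ⊢
  rw [theta2_sq hτ, theta1_sq hτ, theta1_sq hτ]
  have ha0 : thetaA 0 τ ≠ 0 := fun h => k2 (by rw [h]; ring)
  have hb0 : thetaB 0 τ ≠ 0 := fun h => k2 (by rw [h]; ring)
  generalize thetaA 0 τ = a at *
  generalize thetaB 0 τ = b at *
  generalize thetaA z τ = A at *
  generalize thetaB z τ = B at *
  generalize thetaA (2 * z) τ = A2 at *
  generalize thetaB (2 * z) τ = B2 at *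
  have n1 : (a ^ 2 - b ^ 2) * (a ^ 2 + b ^ 2) * (b * A2 - a * B2) * (a * b) =
      2 * (b * A - a * B) * (b * A + a * B) * (a * A - b * B) * (a * A + b * B) := by
    linear_combination (-(a ^ 2 - b ^ 2) ^ 2 / 2) * e3 + ((a ^ 2 + b ^ 2) ^ 2 / 2) * e4
  have n2 : (b * A2 + a * B2) * (a * b) = 2 * A ^ 2 * B ^ 2 := by
    have : (a ^ 2 - b ^ 2) * (a ^ 2 + b ^ 2) * ((b * A2 + a * B2) * (a * b)) =
        (a ^ 2 - b ^ 2) * (a ^ 2 + b ^ 2) * (2 * A ^ 2 * B ^ 2) := by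
      linear_combination ((a ^ 2 - b ^ 2) * (a ^ 2 + b ^ 2) / 2) * e3 -
        ((a ^ 2 - b ^ 2) * (a ^ 2 + b ^ 2) / 2) * e4
    exact mul_left_cancel₀ (mul_ne_zero k4 k3) this
  have n3 : b * A2 + a * B2 ≠ 0 := by
    intro h
    rw [h, zero_mul] at n2
    exact mul_ne_zero (mul_ne_zero two_ne_zero (pow_ne_zero 2 hA)) (pow_ne_zero 2 hB) n2.symm
  have hab : a * b ≠ 0 := mul_ne_zero ha0 hb0
  have l1 : (b * A2 - a * B2) / (b * A2 + a * B2) =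
      (b * A - a * B) * (b * A + a * B) * (a * A - b * B) * (a * A + b * B) /
        ((a ^ 2 - b ^ 2) * (a ^ 2 + b ^ 2) * (A ^ 2 * B ^ 2)) := by
    rw [div_eq_div_iff n3 (by positivity)]
    apply mul_right_cancel₀ hab
    linear_combination (A ^ 2 * B ^ 2) * n1 - ((b * A - a * B) * (b * A + a * B) * (a * A - b * B) * (a * A + b * B)) * n2
  have r1 : 1 - -((a ^ 2 + b ^ 2) / (a ^ 2 - b ^ 2)) * ((b * A - a * B) / (b * A + a * B)) =
      2 * (a * b) * (a * A - b * B) / ((a ^ 2 - b ^ 2) * (b * A + a * B)) := by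
    field_simp
    ring
  have r2 : 1 - (a ^ 2 - b ^ 2) ^ 2 / (a ^ 2 + b ^ 2) ^ 2 *
      (-((a ^ 2 + b ^ 2) / (a ^ 2 - b ^ 2)) * ((b * A - a * B) / (b * A + a * B))) =
      2 * (a * b) * (a * A + b * B) / ((a ^ 2 + b ^ 2) * (b * A + a * B)) := by
    field_simp
    ring
  have r3 : 1 - (a ^ 2 - b ^ 2) ^ 2 / (a ^ 2 + b ^ 2) ^ 2 *
      (-((a ^ 2 + b ^ 2) / (a ^ 2 - b ^ 2)) * ((b * A - a * B) / (b * A + a * B))) ^ 2 =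
      4 * (a * b) * (A * B) / (b * A + a * B) ^ 2 := by
    field_simp
    ring
  rw [l1, r1, r2, r3]
  field_simp
  ring

theorem legendreU_analyticAt {τ : ℂ} (hτ : 0 < τ.im) : AnalyticAt ℂ (fun z => legendreU z τ) 0 := by
  have h1 := (differentiable_theta1 hτ).analyticAt 0
  have h2 := (differentiable_theta2 hτ).analyticAt 0
  exact analyticAt_const.mul ((h1.pow 2).div (h2.pow 2) (pow_ne_zero 2 (theta2_zero_ne_zero hτ)))

theorem legendreU_eventually_double (τ : ℍ) : ∀ᶠ z in 𝓝 0,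
    legendreU (2 * z) τ = legendreDoubling (picardX τ) (legendreU z τ) := by
  have hτ := τ.im_pos
  have k2 := pow_ne_zero 2 (theta2_zero_ne_zero hτ)
  rw [theta2_zero_sq hτ] at k2
  have ha0 : thetaA 0 τ ≠ 0 := fun h => k2 (by rw [h]; ring)
  have hb0 : thetaB 0 τ ≠ 0 := fun h => k2 (by rw [h]; ring)
  filter_upwards [(differentiable_thetaA hτ).continuous.continuousAt.eventually_ne ha0,
    (differentiable_thetaB hτ).continuous.continuousAt.eventually_ne hb0,
    (differentiable_theta2 hτ).continuous.continuousAt.eventually_ne (theta2_zero_ne_zero hτ)]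
    with z h1 h2 h3 using legendreU_double h1 h2 h3

theorem legendreU_not_eventually_zero {τ : ℂ} (hτ : 0 < τ.im) :
    ¬ ∀ᶠ z in 𝓝 0, legendreU z τ = 0 := by
  intro h
  obtain ⟨u, hu⟩ := exists_theta1_ne_zero hτ
  apply hu
  have ha : AnalyticOnNhd ℂ (fun z => theta1 z τ) Set.univ :=
    fun z _ => (differentiable_theta1 hτ).analyticAt z
  refine ha.eqOn_zero_of_preconnected_of_eventuallyEq_zero isPreconnected_univ
    (Set.mem_univ 0) ?_ (Set.mem_univ u)
  filter_upwards [h, (differentiable_theta2 hτ).continuous.continuousAt.eventually_ne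
    (theta2_zero_ne_zero hτ)] with z h1 h2
  have h3 := theta3_zero_ne_zero hτ
  have h4 := theta4_zero_ne_zero hτ
  rw [legendreU] at h1
  by_contra h5
  exact mul_ne_zero (neg_ne_zero.2 (div_ne_zero (pow_ne_zero 2 h3) (pow_ne_zero 2 h4)))
    (div_ne_zero (pow_ne_zero 2 h5) (pow_ne_zero 2 h2)) h1

theorem theta1_ne_zero_or_theta2_ne_zero {τ : ℂ} (hτ : 0 < τ.im) (z : ℂ) :
    theta1 z τ ≠ 0 ∨ theta2 z τ ≠ 0 := by
  by_contra! h
  have h1 := theta1_sq hτ z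
  have h2 := theta2_sq hτ z
  rw [h.1] at h1
  rw [h.2] at h2
  have k2 := pow_ne_zero 2 (theta2_zero_ne_zero hτ)
  rw [theta2_zero_sq hτ] at k2
  have ha0 : thetaA 0 τ ≠ 0 := fun h => k2 (by rw [h]; ring)
  have hb0 : thetaB 0 τ ≠ 0 := fun h => k2 (by rw [h]; ring)
  rcases thetaA_ne_zero_or_thetaB_ne_zero hτ z with H | H
  · exact mul_ne_zero hb0 H (by linear_combination -h1 / 2 - h2 / 2)
  · exact mul_ne_zero ha0 H (by linear_combination h1 / 2 - h2 / 2)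

/-- The duplication formula depends on `τ` only through `x`, so the germs of `1/X` at `0` for `τ`
and `τ'` differ by a scaling. Cleared of denominators this is an identity between entire functions,
hence holds everywhere. -/
theorem exists_scaling_of_picardX_eq {τ τ' : ℍ} (h : picardX τ = picardX τ') :
    ∃ k : ℂ, k ≠ 0 ∧ ∀ z, (theta1 (k * z) τ' = 0 ↔ theta1 z τ = 0) ∧
      legendreX (k * z) τ' = legendreX z τ := by
  obtain ⟨k, hk, hU⟩ := exists_scaling_of_doubling (f := fun z => legendreU z τ')
    (g := fun z => legendreU z τ)
    (hasStrictDerivAt_legendreDoubling (picardX τ)) (by simp [legendreDoubling])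
    (legendreU_analyticAt τ'.im_pos) (legendreU_analyticAt τ.im_pos)
    (by simp [legendreU, theta1_zero τ'.im_pos]) (by simp [legendreU, theta1_zero τ.im_pos])
    (legendreU_not_eventually_zero τ'.im_pos) (legendreU_not_eventually_zero τ.im_pos)
    (by rw [h]; exact legendreU_eventually_double τ') (legendreU_eventually_double τ)
  refine ⟨k, hk, ?_⟩
  have p3 := theta3_zero_ne_zero τ.im_pos
  have p4 := theta4_zero_ne_zero τ.im_pos
  have q3 := theta3_zero_ne_zero τ'.im_pos
  have q4 := theta4_zero_ne_zero τ'.im_pos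
  have d1 := differentiable_theta1 τ.im_pos
  have d2 := differentiable_theta2 τ.im_pos
  have d1' : Differentiable ℂ fun z => theta1 (k * z) τ' :=
    (differentiable_theta1 τ'.im_pos).comp (differentiable_id.const_mul k)
  have d2' : Differentiable ℂ fun z => theta2 (k * z) τ' :=
    (differentiable_theta2 τ'.im_pos).comp (differentiable_id.const_mul k)
  let l : ℂ → ℂ := fun z => (theta3 0 τ' ^ 2 * theta4 0 τ ^ 2) *
    (theta1 (k * z) τ' ^ 2 * theta2 z τ ^ 2)
  let r : ℂ → ℂ := fun z => (theta3 0 τ ^ 2 * theta4 0 τ' ^ 2) *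
    (theta1 z τ ^ 2 * theta2 (k * z) τ' ^ 2)
  have hl : Differentiable ℂ l := ((d1'.pow 2).mul (d2.pow 2)).const_mul _
  have hr : Differentiable ℂ r := ((d1.pow 2).mul (d2'.pow 2)).const_mul _
  have hlr : l = r := by
    refine AnalyticOnNhd.eq_of_eventuallyEq (z₀ := 0) (fun z _ => hl.analyticAt z)
      (fun z _ => hr.analyticAt z) ?_
    have tk : Tendsto (fun z : ℂ => k * z) (𝓝 0) (𝓝 0) := by
      simpa using (continuous_const_mul k).tendsto 0
    filter_upwards [hU, d2.continuous.continuousAt.eventually_ne (theta2_zero_ne_zero τ.im_pos),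
      tk.eventually ((differentiable_theta2 τ'.im_pos).continuous.continuousAt.eventually_ne
        (theta2_zero_ne_zero τ'.im_pos))] with z h1 h2 h3
    simp only [legendreU] at h1
    simp only [l, r]
    field_simp at h1
    linear_combination -h1
  intro z
  have e := congrFun hlr z
  simp only [l, r] at e
  have hz : theta1 (k * z) τ' = 0 ↔ theta1 z τ = 0 := by
    constructor
    · intro h0
      have h2 := (theta1_ne_zero_or_theta2_ne_zero τ'.im_pos (k * z)).resolve_left (by simp [h0])
      rw [h0] at e
      by_contra h1
      have : (theta3 0 τ ^ 2 * theta4 0 τ' ^ 2) * (theta1 z τ ^ 2 * theta2 (k * z) τ' ^ 2) ≠ 0 := by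
        simp [p3, q4, h1, h2]
      exact this (by rw [← e]; ring)
    · intro h0
      have h2 := (theta1_ne_zero_or_theta2_ne_zero τ.im_pos z).resolve_left (by simp [h0])
      rw [h0] at e
      by_contra h1
      have : (theta3 0 τ' ^ 2 * theta4 0 τ ^ 2) * (theta1 (k * z) τ' ^ 2 * theta2 z τ ^ 2) ≠ 0 := by
        simp [q3, p4, h1, h2]
      exact this (by rw [e]; ring)
  refine ⟨hz, ?_⟩
  rw [legendreX, legendreX]
  by_cases h0 : theta1 z τ = 0
  · rw [h0, hz.2 h0]
    simp
  · have h0' := mt hz.1 h0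
    field_simp
    linear_combination e

theorem lattice_coeff_eq {τ : ℍ} {a b c d : ℤ} (h : (a : ℂ) + b * τ = c + d * τ) :
    a = c ∧ b = d := by
  have him := congrArg Complex.im h
  have hre := congrArg Complex.re h
  simp at him hre
  have hb : b = d := by
    rcases him with h | h
    · exact h
    · exact absurd h τ.im_ne_zero
  subst hb
  exact ⟨by simpa using hre, rfl⟩

/-- `picardX` separates the orbits of `Γ(2)`. -/
theorem exists_gamma_two_of_picardX_eq {τ τ' : ℍ} (h : picardX τ = picardX τ') :
    ∃ γ ∈ CongruenceSubgroup.Gamma 2, γ • τ' = τ := by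
  obtain ⟨k, hk, H⟩ := exists_scaling_of_picardX_eq h
  have hτ := τ.im_pos
  have hτ' := τ'.im_pos
  -- The zeros of `theta1` are the lattice, so multiplication by `k` carries `ℤ + ℤτ` into `ℤ +
  -- ℤτ'`, and by `1/k` back. This yields integral matrices inverse to each other.
  have z1 := (H 1).1.2 ((theta1_eq_zero_iff hτ 1).2 ⟨1, 0, by simp⟩)
  have zt := (H τ).1.2 ((theta1_eq_zero_iff hτ τ).2 ⟨0, 1, by simp⟩)
  obtain ⟨d, c, hdc⟩ := (theta1_eq_zero_iff hτ' _).1 z1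
  obtain ⟨b, a, hba⟩ := (theta1_eq_zero_iff hτ' _).1 zt
  rw [mul_one] at hdc
  have w1 := (H (1 / k)).1.1 (by
    rw [mul_one_div_cancel hk]
    exact (theta1_eq_zero_iff hτ' 1).2 ⟨1, 0, by simp⟩)
  have wt := (H (τ' / k)).1.1 (by
    rw [mul_div_cancel₀ _ hk]
    exact (theta1_eq_zero_iff hτ' τ').2 ⟨0, 1, by simp⟩)
  obtain ⟨p, q, hpq⟩ := (theta1_eq_zero_iff hτ _).1 w1
  obtain ⟨r, s, hrs⟩ := (theta1_eq_zero_iff hτ _).1 wt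
  rw [div_eq_iff hk] at hpq hrs
  have E1 : ((1 : ℤ) : ℂ) + (0 : ℤ) * τ' = (p * d + q * b : ℤ) + (p * c + q * a : ℤ) * τ' := by
    push_cast
    linear_combination hpq + p * hdc + q * hba
  have E2 : ((0 : ℤ) : ℂ) + (1 : ℤ) * τ' = (r * d + s * b : ℤ) + (r * c + s * a : ℤ) * τ' := by
    push_cast
    linear_combination hrs + r * hdc + s * hba
  obtain ⟨f1, f2⟩ := lattice_coeff_eq E1
  obtain ⟨f3, f4⟩ := lattice_coeff_eq E2
  have hdet : (p * s - q * r) * (a * d - b * c) = 1 := by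
    linear_combination -(r * c + s * a) * f1 + (r * d + s * b) * f2 - f4
  have hden : (c : ℂ) * τ' + d ≠ 0 := by
    intro h0
    apply hk
    linear_combination hdc + h0
  have hτeq : (τ : ℂ) = (a * τ' + b) / (c * τ' + d) := by
    rw [eq_div_iff hden]
    linear_combination hba - τ * hdc
  -- Both points lie in the upper half-plane, so the determinant is positive.
  have hpos : 0 < a * d - b * c := by
    have him : (τ : ℂ).im * Complex.normSq (c * τ' + d) = (a * d - b * c : ℤ) * τ'.im := by
      rw [hτeq, Complex.div_im]
      have : Complex.normSq (c * τ' + d) ≠ 0 := by simpa using hden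
      generalize Complex.normSq (c * τ' + d) = m at this ⊢
      field_simp
      simp
      ring
    have h1 : 0 < (τ : ℂ).im * Complex.normSq (c * τ' + d) :=
      mul_pos hτ (Complex.normSq_pos.2 hden)
    rw [him] at h1
    exact_mod_cast (pos_iff_pos_of_mul_pos h1).2 τ'.im_pos
  have hone : a * d - b * c = 1 := by
    rcases Int.eq_one_or_neg_one_of_mul_eq_one' hdet with ⟨_, h⟩ | ⟨_, h⟩ <;> omega
  let γ : SL(2, ℤ) := ⟨!![a, b; c, d], by rw [Matrix.det_fin_two_of, hone]⟩
  -- Scaling preserves the values `0` and `1` of `X`, which distinguish the half periods `1/2` and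
  -- `τ/2`; so these classes are fixed, which is the congruence modulo `2`.
  have parity : ∀ (m n m' n' : ℤ), legendreX (((m : ℂ) + n * τ') / 2) τ' = legendreX (((m' : ℂ) + n' * τ') / 2) τ' →
      theta1 (((m : ℂ) + n * τ') / 2) τ' ≠ 0 → theta1 (((m' : ℂ) + n' * τ') / 2) τ' ≠ 0 →
      2 ∣ m - m' ∧ 2 ∣ n - n' := by
    intro m n m' n' h1 h2 h3
    rcases theta1_add_or_sub_eq_zero hτ' h2 h3 h1 with h4 | h4
    · obtain ⟨i, j, hij⟩ := (theta1_eq_zero_iff hτ' _).1 h4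
      obtain ⟨g1, g2⟩ := lattice_coeff_eq (τ := τ') (a := m + m') (b := n + n') (c := 2 * i)
        (d := 2 * j) (by push_cast; linear_combination 2 * hij)
      omega
    · obtain ⟨i, j, hij⟩ := (theta1_eq_zero_iff hτ' _).1 h4
      obtain ⟨g1, g2⟩ := lattice_coeff_eq (τ := τ') (a := m - m') (b := n - n') (c := 2 * i)
        (d := 2 * j) (by push_cast; linear_combination 2 * hij)
      omega
  have n1 := theta1_ne_zero_of_half_period hτ
  have n1' := theta1_ne_zero_of_half_period hτ'
  have par1 := parity d c 1 0 (by
      rw [show ((d : ℂ) + c * τ') / 2 = k * (1 / 2) by rw [hdc]; ring, (H (1 / 2)).2,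
        legendreX_half hτ]
      rw [show (((1 : ℤ) : ℂ) + (0 : ℤ) * τ') / 2 = 1 / 2 by simp, legendreX_half hτ'])
    (by
      rw [show ((d : ℂ) + c * τ') / 2 = k * (1 / 2) by rw [hdc]; ring]
      exact mt (H _).1.1 n1.1)
    (by
      rw [show (((1 : ℤ) : ℂ) + (0 : ℤ) * τ') / 2 = 1 / 2 by simp]
      exact n1'.1)
  have par2 := parity b a 0 1 (by
      rw [show ((b : ℂ) + a * τ') / 2 = k * (τ / 2) by linear_combination -hba / 2, (H (τ / 2)).2,
        legendreX_half_tau hτ]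
      rw [show (((0 : ℤ) : ℂ) + (1 : ℤ) * τ') / 2 = τ' / 2 by simp, legendreX_half_tau hτ'])
    (by
      rw [show ((b : ℂ) + a * τ') / 2 = k * (τ / 2) by linear_combination -hba / 2]
      exact mt (H _).1.1 n1.2.1)
    (by
      rw [show (((0 : ℤ) : ℂ) + (1 : ℤ) * τ') / 2 = τ' / 2 by simp]
      exact n1'.2.1)
  refine ⟨γ, ?_, ?_⟩
  · rw [CongruenceSubgroup.Gamma_mem]
    simp only [γ, Matrix.of_apply, Matrix.cons_val', Matrix.cons_val_zero,
      Matrix.cons_val_one, Matrix.cons_val_fin_one]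
    refine ⟨?_, ?_, ?_, ?_⟩
    · exact_mod_cast (ZMod.intCast_eq_intCast_iff_dvd_sub a 1 2).2 (by omega)
    · exact (ZMod.intCast_zmod_eq_zero_iff_dvd _ 2).2 (by simpa using par2.1)
    · exact (ZMod.intCast_zmod_eq_zero_iff_dvd _ 2).2 (by simpa using par1.2)
    · exact_mod_cast (ZMod.intCast_eq_intCast_iff_dvd_sub d 1 2).2 (by omega)
  · apply UpperHalfPlane.ext
    rw [UpperHalfPlane.coe_specialLinearGroup_apply, hτeq]
    simp [γ]

end PicardUniformization

end

/-! ### The action of `Γ(2)` on `x`, on `y` and on the rows of parameters. -/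

noncomputable section

namespace PicardUniformization

open scoped Real
open Complex (exp)

/-! ### Row vectors and generators of `Γ(2)` -/

/-- The right action of a matrix on row vectors. -/
def rowMul (v : ℤ × ℤ) (γ : SL(2, ℤ)) : ℤ × ℤ :=
  (v.1 * γ 0 0 + v.2 * γ 1 0, v.1 * γ 0 1 + v.2 * γ 1 1)

theorem rowMul_one (v : ℤ × ℤ) : rowMul v 1 = v := by
  simp [rowMul]

theorem rowMul_mul (v : ℤ × ℤ) (γ δ : SL(2, ℤ)) :
    rowMul v (γ * δ) = rowMul (rowMul v γ) δ := by
  simp only [rowMul, Matrix.SpecialLinearGroup.coe_mul, Matrix.mul_apply, Fin.sum_univ_two,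
    Prod.mk.injEq]
  constructor <;> ring

theorem rowMul_neg (v : ℤ × ℤ) (γ : SL(2, ℤ)) : rowMul v (-γ) = -rowMul v γ := by
  simp only [rowMul, Matrix.SpecialLinearGroup.coe_neg, Matrix.neg_apply, Prod.neg_mk,
    Prod.mk.injEq]
  constructor <;> ring

theorem rowMul_S (v : ℤ × ℤ) : rowMul v ModularGroup.S = (v.2, -v.1) := by
  simp [rowMul, ModularGroup.S]

theorem rowMul_T (v : ℤ × ℤ) : rowMul v ModularGroup.T = (v.1, v.1 + v.2) := by
  simp [rowMul, ModularGroup.T]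

theorem rowMul_add (v w : ℤ × ℤ) (γ : SL(2, ℤ)) : rowMul (v + w) γ = rowMul v γ + rowMul w γ := by
  simp only [rowMul, Prod.fst_add, Prod.snd_add, Prod.mk_add_mk, Prod.mk.injEq]
  constructor <;> ring

theorem rowMul_neg_left (v : ℤ × ℤ) (γ : SL(2, ℤ)) : rowMul (-v) γ = -rowMul v γ := by
  simp only [rowMul, Prod.fst_neg, Prod.snd_neg, Prod.neg_mk, Prod.mk.injEq]
  constructor <;> ring

/-- The row vector `v` is divisible by `m`. -/
def RowDvd (m : ℤ) (v : ℤ × ℤ) : Prop := m ∣ v.1 ∧ m ∣ v.2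

theorem RowDvd.mul {m : ℤ} {v : ℤ × ℤ} (h : RowDvd m v) (γ : SL(2, ℤ)) : RowDvd m (rowMul v γ) :=
  ⟨dvd_add (h.1.mul_right _) (h.2.mul_right _), dvd_add (h.1.mul_right _) (h.2.mul_right _)⟩

theorem rowDvd_mul_iff {m : ℤ} {v : ℤ × ℤ} (γ : SL(2, ℤ)) :
    RowDvd m (rowMul v γ) ↔ RowDvd m v := by
  refine ⟨fun h => ?_, fun h => h.mul γ⟩
  have := h.mul γ⁻¹
  rwa [← rowMul_mul, mul_inv_cancel, rowMul_one] at this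

/-- The generator `(1, 2; 0, 1)` of `Γ(2)`. -/
def genA : SL(2, ℤ) := ⟨!![1, 2; 0, 1], by simp [Matrix.det_fin_two_of]⟩

/-- The generator `(1, 0; 2, 1)` of `Γ(2)`. -/
def genB : SL(2, ℤ) := ⟨!![1, 0; 2, 1], by simp [Matrix.det_fin_two_of]⟩

theorem SL_mul_apply (γ δ : SL(2, ℤ)) (i j : Fin 2) :
    (γ * δ) i j = γ i 0 * δ 0 j + γ i 1 * δ 1 j := by
  rw [Matrix.SpecialLinearGroup.coe_mul, Matrix.mul_apply, Fin.sum_univ_two]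

theorem SL_inv_apply (γ : SL(2, ℤ)) : γ⁻¹ 0 0 = γ 1 1 ∧ γ⁻¹ 0 1 = -γ 0 1 ∧ γ⁻¹ 1 0 = -γ 1 0 ∧
    γ⁻¹ 1 1 = γ 0 0 := by
  rw [Matrix.SpecialLinearGroup.coe_inv, Matrix.adjugate_fin_two]
  simp

theorem SL_ext {γ δ : SL(2, ℤ)} (h1 : γ 0 0 = δ 0 0) (h2 : γ 0 1 = δ 0 1) (h3 : γ 1 0 = δ 1 0)
    (h4 : γ 1 1 = δ 1 1) : γ = δ := by
  ext i j
  fin_cases i <;> fin_cases j <;> assumption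

theorem genA_apply : genA 0 0 = 1 ∧ genA 0 1 = 2 ∧ genA 1 0 = 0 ∧ genA 1 1 = 1 := by simp [genA]
theorem genB_apply : genB 0 0 = 1 ∧ genB 0 1 = 0 ∧ genB 1 0 = 2 ∧ genB 1 1 = 1 := by simp [genB]
theorem S_apply : ModularGroup.S 0 0 = 0 ∧ ModularGroup.S 0 1 = -1 ∧ ModularGroup.S 1 0 = 1 ∧
    ModularGroup.S 1 1 = 0 := by simp [ModularGroup.S]
theorem T_apply : ModularGroup.T 0 0 = 1 ∧ ModularGroup.T 0 1 = 1 ∧ ModularGroup.T 1 0 = 0 ∧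
    ModularGroup.T 1 1 = 1 := by simp [ModularGroup.T]

theorem genA_eq : genA = ModularGroup.T * ModularGroup.T := by
  apply SL_ext <;> simp [SL_mul_apply, genA_apply, T_apply]

theorem genB_eq : genB = ModularGroup.S * genA⁻¹ * ModularGroup.S⁻¹ := by
  apply SL_ext <;> simp [SL_mul_apply, SL_inv_apply, genA_apply, genB_apply, S_apply]

theorem mem_gamma_two_iff (γ : SL(2, ℤ)) : γ ∈ CongruenceSubgroup.Gamma 2 ↔
    2 ∣ γ 0 0 - 1 ∧ 2 ∣ γ 0 1 ∧ 2 ∣ γ 1 0 ∧ 2 ∣ γ 1 1 - 1 := by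
  have h1 : ∀ a : ℤ, ((a : ZMod 2) = 1 ↔ 2 ∣ a - 1) := fun a => by
    have := ZMod.intCast_eq_intCast_iff_dvd_sub 1 a 2
    rw [eq_comm]
    simpa using this
  have h0 : ∀ a : ℤ, ((a : ZMod 2) = 0 ↔ 2 ∣ a) := fun a => by
    simpa using ZMod.intCast_zmod_eq_zero_iff_dvd a 2
  rw [CongruenceSubgroup.Gamma_mem, h1, h0, h0, h1]

theorem genA_mem : genA ∈ CongruenceSubgroup.Gamma 2 := by
  rw [mem_gamma_two_iff]
  simp [genA]

theorem genB_mem : genB ∈ CongruenceSubgroup.Gamma 2 := by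
  rw [mem_gamma_two_iff]
  simp [genB]

theorem neg_one_mem_gamma_two : (-1 : SL(2, ℤ)) ∈ CongruenceSubgroup.Gamma 2 := by
  rw [mem_gamma_two_iff]
  simp

theorem det_eq_one (γ : SL(2, ℤ)) : γ 0 0 * γ 1 1 - γ 0 1 * γ 1 0 = 1 := by
  rw [← Matrix.det_fin_two]
  exact γ.2

/-- The Sanov subgroup generated by `(1, 2; 0, 1)` and `(1, 0; 2, 1)`. -/
def sanov : Subgroup SL(2, ℤ) := Subgroup.closure {genA, genB}

theorem genA_mem_sanov : genA ∈ sanov := Subgroup.subset_closure (by simp)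
theorem genB_mem_sanov : genB ∈ sanov := Subgroup.subset_closure (by simp)

theorem sanov_le : sanov ≤ CongruenceSubgroup.Gamma 2 := by
  rw [sanov, Subgroup.closure_le]
  rintro γ (rfl | rfl)
  · exact genA_mem
  · exact genB_mem

theorem mem_sanov_or_neg_of_lower_left_zero {γ : SL(2, ℤ)} (hγ : γ ∈ CongruenceSubgroup.Gamma 2)
    (h : γ 1 0 = 0) : γ ∈ sanov ∨ -γ ∈ sanov := by
  have key : ∀ δ : SL(2, ℤ), δ 0 0 = 1 → δ 1 0 = 0 → 2 ∣ δ 0 1 → δ ∈ sanov := by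
    intro δ h1 h2 ⟨k, h3⟩
    have h4 := det_eq_one δ
    rw [h1, h2, one_mul, mul_zero, sub_zero] at h4
    have : δ = genA ^ k := by
      have hT : genA ^ k = ModularGroup.T ^ (2 * k) := by
        rw [genA_eq, ← pow_two, zpow_mul]
        rfl
      rw [hT]
      ext i j
      rw [ModularGroup.coe_T_zpow]
      fin_cases i <;> fin_cases j <;> simp [h1, h2, h3, h4]
    rw [this]
    exact zpow_mem genA_mem_sanov k
  have hdet := det_eq_one γ
  rw [h, mul_zero, sub_zero] at hdet
  rw [mem_gamma_two_iff] at hγ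
  rcases Int.eq_one_or_neg_one_of_mul_eq_one' hdet with ⟨h1, -⟩ | ⟨h1, -⟩
  · exact Or.inl (key γ h1 h hγ.2.1)
  · exact Or.inr (key (-γ) (by simp [h1]) (by simp [h]) (by simpa using hγ.2.1))

/-- `Γ(2)` is generated by the Sanov subgroup and `-1`. -/
theorem mem_sanov_or_neg {γ : SL(2, ℤ)} (hγ : γ ∈ CongruenceSubgroup.Gamma 2) :
    γ ∈ sanov ∨ -γ ∈ sanov := by
  induction hn : (γ 0 0).natAbs + (γ 1 0).natAbs using Nat.strong_induction_on generalizing γ with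
  | _ n ih =>
    by_cases h0 : γ 1 0 = 0
    · exact mem_sanov_or_neg_of_lower_left_zero hγ h0
    have step : ∀ δ ∈ sanov, ((δ * γ) 0 0).natAbs + ((δ * γ) 1 0).natAbs < n →
        γ ∈ sanov ∨ -γ ∈ sanov := by
      intro δ hδ hlt
      rcases ih _ hlt (mul_mem (sanov_le hδ) hγ) rfl with h | h
      · exact Or.inl ((Subgroup.mul_mem_cancel_left _ hδ).1 h)
      · rw [← mul_neg] at h
        exact Or.inr ((Subgroup.mul_mem_cancel_left _ hδ).1 h)
    have eA : ((genA * γ) 0 0 = γ 0 0 + 2 * γ 1 0) ∧ (genA * γ) 1 0 = γ 1 0 := by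
      simp [SL_mul_apply, genA_apply]
    have eA' : ((genA⁻¹ * γ) 0 0 = γ 0 0 - 2 * γ 1 0) ∧ (genA⁻¹ * γ) 1 0 = γ 1 0 := by
      simp [SL_mul_apply, SL_inv_apply, genA_apply, sub_eq_add_neg]
    have eB : ((genB * γ) 0 0 = γ 0 0) ∧ (genB * γ) 1 0 = γ 1 0 + 2 * γ 0 0 := by
      simp [SL_mul_apply, genB_apply, add_comm]
    have eB' : ((genB⁻¹ * γ) 0 0 = γ 0 0) ∧ (genB⁻¹ * γ) 1 0 = γ 1 0 - 2 * γ 0 0 := by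
      simp [SL_mul_apply, SL_inv_apply, genB_apply, sub_eq_add_neg, add_comm]
    have hp := (mem_gamma_two_iff γ).1 hγ
    have sA := step _ genA_mem_sanov
    have sA' := step _ (inv_mem genA_mem_sanov)
    have sB := step _ genB_mem_sanov
    have sB' := step _ (inv_mem genB_mem_sanov)
    rw [eA.1, eA.2] at sA
    rw [eA'.1, eA'.2] at sA'
    rw [eB.1, eB.2] at sB
    rw [eB'.1, eB'.2] at sB'
    obtain ⟨hp1, -, hp3, -⟩ := hp
    generalize γ 0 0 = a at *
    generalize γ 1 0 = c at *
    -- The entry `a` is odd and `c` is even and nonzero, so `|a| ≠ |c|` and neither vanishes; adding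
    -- or subtracting twice the entry of smaller modulus makes the other one smaller.
    by_cases hac : a.natAbs < c.natAbs
    · by_cases hs : (0 ≤ a ∧ 0 ≤ c) ∨ (a ≤ 0 ∧ c ≤ 0)
      · exact sB' (by omega)
      · exact sB (by omega)
    · by_cases hs : (0 ≤ a ∧ 0 ≤ c) ∨ (a ≤ 0 ∧ c ≤ 0)
      · exact sA' (by omega)
      · exact sA (by omega)

/-! ### Transformation of `picardX` and `picardY` -/

/-- `picardY` with the parameters `ν, μ` given as a row vector. -/
def pY (N : ℤ) (v : ℤ × ℤ) (τ : ℍ) : ℂ := picardY v.1 v.2 N τ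

theorem pY_T_smul (N : ℤ) (v : ℤ × ℤ) (τ : ℍ) :
    pY N v (ModularGroup.T • τ) = pY N (rowMul v ModularGroup.T) τ / picardX τ := by
  rw [rowMul_T]
  exact picardY_T_smul _ _ _ τ

theorem pY_S_smul {N : ℤ} (hN : N ≠ 0) {v : ℤ × ℤ} (h : ¬ RowDvd (2 * N) v) (τ : ℍ) :
    pY N v (ModularGroup.S • τ) = 1 - pY N (rowMul v ModularGroup.S) τ := by
  rw [rowMul_S]
  exact picardY_S_smul hN h τ

theorem pY_neg (N : ℤ) (v : ℤ × ℤ) (τ : ℍ) : pY N (-v) τ = pY N v τ :=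
  picardY_neg _ _ _ τ

theorem pY_congr {N : ℤ} (hN : N ≠ 0) {v w : ℤ × ℤ} (h : RowDvd (2 * N) (w - v)) (τ : ℍ) :
    pY N w τ = pY N v τ :=
  picardY_congr hN h.1 h.2 τ

theorem pY_eq_iff {N : ℤ} (hN : N ≠ 0) {v w : ℤ × ℤ} (hv : ¬ RowDvd (2 * N) v)
    (hw : ¬ RowDvd (2 * N) w) (τ : ℍ) :
    pY N w τ = pY N v τ ↔ RowDvd (2 * N) (w - v) ∨ RowDvd (2 * N) (w + v) := by
  refine (picardY_eq_iff hN hv hw τ).trans ⟨?_, ?_⟩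
  · rintro ⟨ε, rfl | rfl, h⟩
    · left
      simpa [RowDvd] using h
    · right
      simpa [RowDvd] using h
  · rintro (h | h)
    · exact ⟨1, Or.inl rfl, by simpa [RowDvd] using h⟩
    · exact ⟨-1, Or.inr rfl, by simpa [RowDvd] using h⟩

theorem S_mul_S : ModularGroup.S * ModularGroup.S = -1 := by
  apply SL_ext <;> simp [SL_mul_apply, S_apply]

theorem SL_inv_smul_eq (τ : ℍ) : ModularGroup.S⁻¹ • τ = ModularGroup.S • τ := by
  rw [inv_smul_eq_iff, smul_smul, S_mul_S, ModularGroup.SL_neg_smul, one_smul]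

/-- The substitutions that obey these laws form a subgroup, so it suffices to treat the two Sanov
generators, which are words in `S` and `T`. The sign is harmless because `-1` acts trivially and `X`
is even. -/
theorem gamma_two_smul {γ : SL(2, ℤ)} (hγ : γ ∈ CongruenceSubgroup.Gamma 2) :
    (∀ τ, picardX (γ • τ) = picardX τ) ∧ ∀ {N : ℤ}, N ≠ 0 → ∀ v : ℤ × ℤ, ¬ RowDvd (2 * N) v →
      ∀ τ, pY N v (γ • τ) = pY N (rowMul v γ) τ := by
  let H : Subgroup SL(2, ℤ) :=
    { carrier := {γ | (∀ τ, picardX (γ • τ) = picardX τ) ∧ ∀ {N : ℤ}, N ≠ 0 → ∀ v : ℤ × ℤ,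
        ¬ RowDvd (2 * N) v → ∀ τ, pY N v (γ • τ) = pY N (rowMul v γ) τ}
      one_mem' := by simp [rowMul_one]
      mul_mem' := by
        intro a b ha hb
        refine ⟨fun τ => by rw [mul_smul, ha.1, hb.1], fun hN v hv τ => ?_⟩
        rw [mul_smul, ha.2 hN v hv, hb.2 hN _ (mt (rowDvd_mul_iff a).1 hv), rowMul_mul]
      inv_mem' := by
        intro a ha
        refine ⟨fun τ => by rw [← ha.1, smul_inv_smul], fun hN v hv τ => ?_⟩
        have := ha.2 hN (rowMul v a⁻¹) (mt (rowDvd_mul_iff a⁻¹).1 hv) (a⁻¹ • τ)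
        rw [smul_inv_smul, ← rowMul_mul, inv_mul_cancel, rowMul_one] at this
        exact this.symm }
  have hA : genA ∈ H := by
    refine ⟨fun τ => ?_, fun hN v hv τ => ?_⟩
    · rw [genA_eq, mul_smul, picardX_T_smul, picardX_T_smul, inv_inv]
    · rw [genA_eq, mul_smul, pY_T_smul, pY_T_smul, picardX_T_smul, rowMul_mul]
      have := picardX_ne_zero τ
      field_simp
  have hB : genB ∈ H := by
    have hA' : genA⁻¹ ∈ H := H.inv_mem hA
    refine ⟨fun τ => ?_, fun hN v hv τ => ?_⟩
    · rw [genB_eq, mul_smul, mul_smul, picardX_S_smul, hA'.1, SL_inv_smul_eq, picardX_S_smul]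
      ring
    · rw [genB_eq, mul_smul, mul_smul, pY_S_smul hN hv, SL_inv_smul_eq,
        hA'.2 hN _ (mt (rowDvd_mul_iff _).1 hv), ← rowMul_mul,
        pY_S_smul hN (mt (rowDvd_mul_iff _).1 hv), ← rowMul_mul, ← pY_neg, ← rowMul_neg]
      have : ModularGroup.S⁻¹ = -ModularGroup.S := by
        rw [inv_eq_iff_mul_eq_one, mul_neg, S_mul_S, neg_neg]
      rw [this, mul_neg]
      ring
  have hs : sanov ≤ H := by
    rw [sanov, Subgroup.closure_le]
    rintro γ (rfl | rfl)
    · exact hA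
    · exact hB
  rcases mem_sanov_or_neg hγ with h | h
  · exact hs h
  · have h1 := hs h
    refine ⟨fun τ => ?_, fun hN v hv τ => ?_⟩
    · rw [← h1.1 τ, ModularGroup.SL_neg_smul]
    · rw [← ModularGroup.SL_neg_smul, h1.2 hN v hv, rowMul_neg, pY_neg]

/-- Every modular substitution is, modulo `Γ(2)` on the left, one of the six products `σ T^j`. -/
theorem exists_gamma_two_mul (γ : SL(2, ℤ)) :
    ∃ δ ∈ CongruenceSubgroup.Gamma 2, ∃ σ : SL(2, ℤ),
      (σ = 1 ∨ σ = ModularGroup.S ∨ σ = ModularGroup.T * ModularGroup.S) ∧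
        (γ = δ * σ ∨ γ = δ * σ * ModularGroup.T) := by
  have key : ∀ ρ : SL(2, ℤ), (2 ∣ γ 0 0 - ρ 0 0 ∧ 2 ∣ γ 0 1 - ρ 0 1 ∧ 2 ∣ γ 1 0 - ρ 1 0 ∧
      2 ∣ γ 1 1 - ρ 1 1) → γ * ρ⁻¹ ∈ CongruenceSubgroup.Gamma 2 := by
    intro ρ ⟨⟨a, ha⟩, ⟨b, hb⟩, ⟨c, hc⟩, ⟨d, hd⟩⟩
    have hdet := det_eq_one ρ
    rw [mem_gamma_two_iff]
    simp only [SL_mul_apply, SL_inv_apply]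
    refine ⟨⟨a * ρ 1 1 - b * ρ 1 0, ?_⟩, ⟨b * ρ 0 0 - a * ρ 0 1, ?_⟩, ⟨c * ρ 1 1 - d * ρ 1 0, ?_⟩,
      ⟨d * ρ 0 0 - c * ρ 0 1, ?_⟩⟩
    · linear_combination ρ 1 1 * ha - ρ 1 0 * hb + hdet
    · linear_combination ρ 0 0 * hb - ρ 0 1 * ha
    · linear_combination ρ 1 1 * hc - ρ 1 0 * hd
    · linear_combination ρ 0 0 * hd - ρ 0 1 * hc + hdet
  have hdet := det_eq_one γ
  have hodd : (γ 0 0 * γ 1 1 - γ 0 1 * γ 1 0) % 2 = 1 := by rw [hdet]; rfl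
  have fin : ∀ σ : SL(2, ℤ), (σ = 1 ∨ σ = ModularGroup.S ∨ σ = ModularGroup.T * ModularGroup.S) →
      (γ * σ⁻¹ ∈ CongruenceSubgroup.Gamma 2 ∨
        γ * (σ * ModularGroup.T)⁻¹ ∈ CongruenceSubgroup.Gamma 2) →
      ∃ δ ∈ CongruenceSubgroup.Gamma 2, ∃ σ : SL(2, ℤ),
      (σ = 1 ∨ σ = ModularGroup.S ∨ σ = ModularGroup.T * ModularGroup.S) ∧
        (γ = δ * σ ∨ γ = δ * σ * ModularGroup.T) := by
    rintro σ hσ (h | h)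
    · exact ⟨_, h, σ, hσ, Or.inl (by group)⟩
    · exact ⟨_, h, σ, hσ, Or.inr (by group)⟩
  have k1 := key 1
  have k2 := key (1 * ModularGroup.T)
  have k3 := key ModularGroup.S
  have k4 := key (ModularGroup.S * ModularGroup.T)
  have k5 := key (ModularGroup.T * ModularGroup.S)
  have k6 := key (ModularGroup.T * ModularGroup.S * ModularGroup.T)
  simp only [SL_mul_apply, S_apply, T_apply, Matrix.SpecialLinearGroup.coe_one,
    Matrix.one_apply_eq, ne_eq, zero_ne_one, one_ne_zero, not_false_eq_true,
    Matrix.one_apply_ne] at k1 k2 k3 k4 k5 k6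
  have f1 := fin 1 (Or.inl rfl)
  have f2 := fin _ (Or.inr (Or.inl rfl))
  have f3 := fin _ (Or.inr (Or.inr rfl))
  -- Six of the sixteen parity patterns have odd determinant, one for each coset of `Γ(2)`.
  rcases Int.emod_two_eq_zero_or_one (γ 0 0) with ha | ha <;>
  rcases Int.emod_two_eq_zero_or_one (γ 0 1) with hb | hb <;>
  rcases Int.emod_two_eq_zero_or_one (γ 1 0) with hc | hc <;>
  rcases Int.emod_two_eq_zero_or_one (γ 1 1) with hd | hd <;>
  simp [Int.sub_emod, Int.mul_emod, ha, hb, hc, hd] at hodd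
  · exact f2 (Or.inl (k3 (by omega)))
  · exact f2 (Or.inr (k4 (by omega)))
  · exact f1 (Or.inl (k1 (by omega)))
  · exact f3 (Or.inr (k6 (by omega)))
  · exact f1 (Or.inr (k2 (by omega)))
  · exact f3 (Or.inl (k5 (by omega)))

end PicardUniformization

end

/-! ### Asymptotics at the cusp `∞`. -/

noncomputable section

namespace PicardUniformization

open scoped Real
open Complex (exp)
open Filter

theorem tendsto_im_atImInfty : Tendsto (fun τ : ℍ => τ.im) atImInfty atTop :=
  tendsto_comap

/-- Dominated convergence: for `|r| ≤ 1/2` and `Im τ ≥ 1` one has `(n² + 2nr) Im τ ≥ n² - |n|`, a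
bound that does not depend on `τ`. -/
theorem tendsto_jacobiTheta₂_aux {r s : ℝ} (hr : |r| ≤ 1 / 2) {g : ℤ → ℂ}
    (hg : ∀ n : ℤ, Tendsto (fun τ : ℍ => jacobiTheta₂_term n (r * τ + s) τ) atImInfty (𝓝 (g n))) :
    Tendsto (fun τ : ℍ => jacobiTheta₂ (r * τ + s) τ) atImInfty (𝓝 (∑' n, g n)) := by
  have hs := summable_pow_mul_jacobiTheta₂_term_bound (1 / 2) (T := 1) one_pos 0
  refine tendsto_tsum_of_dominated_convergence hs hg ?_
  filter_upwards [tendsto_im_atImInfty.eventually_ge_atTop 1] with τ hτ n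
  rw [norm_jacobiTheta₂_term, pow_zero, one_mul]
  apply Real.exp_le_exp.2
  have him : ((r : ℂ) * τ + s).im = r * τ.im := by simp
  rw [him]
  have h1 : |(n : ℝ) * r| ≤ |(n : ℝ)| * (1 / 2) := by
    rw [abs_mul]; exact mul_le_mul_of_nonneg_left hr (abs_nonneg _)
  have h2 := neg_le_of_abs_le h1
  have h3 : 0 ≤ (n : ℝ) ^ 2 - |(n : ℝ)| := by
    have : |n| ≤ n ^ 2 := by
      rw [← sq_abs]; nlinarith [abs_nonneg n, sq_nonneg (|n| - 1), Int.le_self_sq |n|]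
    have h := (Int.cast_le (R := ℝ)).2 this
    push_cast at h; linarith
  have h4 : (n : ℝ) ^ 2 - |(n : ℝ)| ≤ ((n : ℝ) ^ 2 - |(n : ℝ)|) * τ.im :=
    le_mul_of_one_le_right h3 hτ
  have h5 : ((n : ℝ) ^ 2 - |(n : ℝ)|) * τ.im ≤ ((n : ℝ) ^ 2 + 2 * (n * r)) * τ.im :=
    mul_le_mul_of_nonneg_right (by linarith) τ.im_pos.le
  have h6 : (n : ℝ) ^ 2 - |(n : ℝ)| ≤ ((n : ℝ) ^ 2 + 2 * (n * r)) * τ.im := h4.trans h5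
  have := mul_le_mul_of_nonneg_left h6 Real.pi_pos.le
  rw [UpperHalfPlane.coe_im]
  have hc : (|n| : ℤ) = (|(n : ℝ)| : ℝ) := Int.cast_abs
  rw [hc]
  linarith

theorem tendsto_jacobiTheta₂_term_zero {r s : ℝ} {n : ℤ} (h : 0 < (n : ℝ) ^ 2 + 2 * n * r) :
    Tendsto (fun τ : ℍ => jacobiTheta₂_term n (r * τ + s) τ) atImInfty (𝓝 0) := by
  rw [tendsto_zero_iff_norm_tendsto_zero]
  have h1 : Tendsto (fun τ : ℍ => Real.exp (-(π * ((n : ℝ) ^ 2 + 2 * n * r) * τ.im))) atImInfty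
      (𝓝 0) :=
    Real.tendsto_exp_neg_atTop_nhds_zero.comp
      (tendsto_im_atImInfty.const_mul_atTop (mul_pos Real.pi_pos h))
  refine h1.congr fun τ => ?_
  rw [norm_jacobiTheta₂_term]
  have him : ((r : ℂ) * τ + s).im = r * τ.im := by simp
  rw [him, UpperHalfPlane.coe_im]
  congr 1; ring

theorem tendsto_jacobiTheta₂_one {r s : ℝ} (hr : |r| < 1 / 2) :
    Tendsto (fun τ : ℍ => jacobiTheta₂ (r * τ + s) τ) atImInfty (𝓝 1) := by
  have h := tendsto_jacobiTheta₂_aux (r := r) (s := s) hr.le (g := fun n => if n = 0 then 1 else 0) ?_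
  · rwa [tsum_ite_eq] at h
  intro n
  rcases eq_or_ne n 0 with rfl | hn
  · simp [jacobiTheta₂_term]
  rw [if_neg hn]
  apply tendsto_jacobiTheta₂_term_zero
  have h1 : |(n : ℝ) * r| < |(n : ℝ)| * (1 / 2) := by
    rw [abs_mul]; exact mul_lt_mul_of_pos_left hr (abs_pos.2 (by exact_mod_cast hn))
  have h2 := neg_lt_of_abs_lt h1
  have h3 : |(n : ℝ)| ≤ (n : ℝ) ^ 2 := by
    rw [← sq_abs]
    have : (1 : ℝ) ≤ |(n : ℝ)| := by exact_mod_cast Int.one_le_abs hn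
    nlinarith
  linarith

/-- On the boundary `r = 1/2` the terms `n = 0` and `n = -1` have the same modulus and both survive.
-/
theorem tendsto_jacobiTheta₂_half (s : ℝ) :
    Tendsto (fun τ : ℍ => jacobiTheta₂ (τ / 2 + s) τ) atImInfty
      (𝓝 (1 + exp (-(2 * π * Complex.I * s)))) := by
  have h := tendsto_jacobiTheta₂_aux (r := 1 / 2) (s := s) (by norm_num [abs_of_pos])
    (g := fun n => if n = 0 then 1 else if n = -1 then exp (-(2 * π * Complex.I * s)) else 0) ?_
  · have hs : ∑' n : ℤ, (if n = 0 then (1 : ℂ) else if n = -1 then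
        exp (-(2 * π * Complex.I * s)) else 0) = 1 + exp (-(2 * π * Complex.I * s)) := by
      rw [tsum_eq_sum (s := {0, -1})]
      · rw [Finset.sum_pair (by norm_num)]; simp
      · intro n hn
        simp only [Finset.mem_insert, Finset.mem_singleton, not_or] at hn
        rw [if_neg hn.1, if_neg hn.2]
    rw [hs] at h
    refine h.congr fun τ => ?_
    congr 1; push_cast; ring
  intro n
  rcases eq_or_ne n 0 with rfl | hn
  · simp [jacobiTheta₂_term]
  rcases eq_or_ne n (-1) with rfl | hn'
  · refine tendsto_const_nhds.congr fun τ => ?_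
    simp only [jacobiTheta₂_term]
    rw [if_neg (by norm_num)]
    simp only [if_true]
    congr 1; push_cast; ring
  rw [if_neg hn, if_neg hn']
  apply tendsto_jacobiTheta₂_term_zero
  have : 0 < n ^ 2 + n := by
    rcases lt_or_gt_of_ne hn with h | h
    · have : n ≤ -2 := by omega
      nlinarith
    · nlinarith
  have h2 := (Int.cast_lt (R := ℝ)).2 this
  push_cast at h2
  linarith

theorem picardX_one_sub_eq (τ : ℍ) :
    (1 - picardX τ) = exp (π * Complex.I * τ) *
      (jacobiTheta₂ (τ / 2 + (0 : ℝ)) τ / jacobiTheta₂ ((0 : ℝ) * τ + (0 : ℝ)) τ) ^ 4 := by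
  rw [one_sub_picardX, theta2_eq, theta3_eq, div_pow, mul_pow, ← Complex.exp_nat_mul]
  rw [mul_div_assoc]
  push_cast
  congr 1
  · congr 1; ring
  · congr 3 <;> simp

/-- The constant is `2⁴`: the two leading terms of `θ₂` coincide. Thus `1 - x` is a multiple of `exp
(πiτ)` to first order and can serve as the unit in which other functions are measured. -/
theorem tendsto_one_sub_picardX :
    Tendsto (fun τ : ℍ => (1 - picardX τ) * exp (-(π * Complex.I * τ))) atImInfty (𝓝 16) := by
  have h1 := tendsto_jacobiTheta₂_half 0
  have h2 := tendsto_jacobiTheta₂_one (r := 0) (s := 0) (by norm_num)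
  have h := (h1.div h2 one_ne_zero).pow 4
  have e : ((1 + exp (-(2 * π * Complex.I * (0 : ℝ)))) / 1) ^ 4 = 16 := by
    simp; norm_num
  rw [e] at h
  refine h.congr fun τ => ?_
  rw [picardX_one_sub_eq, mul_right_comm, ← Complex.exp_add, add_neg_cancel, Complex.exp_zero,
    one_mul]
  simp

/-- The exponential is chosen so that only theta series with arguments `rτ + s` remain, whose limits
are known for `|r| ≤ 1/2`. -/
theorem one_sub_legendreX_eq {τ : ℂ} (hτ : 0 < τ.im) {r s : ℝ}
    (hz : theta1 (r * τ + s) τ ≠ 0) :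
    (1 - legendreX (r * τ + s) τ) * exp (2 * π * Complex.I * r * τ) =
      -exp (-(2 * π * Complex.I * s)) *
      (jacobiTheta₂ (τ / 2 + (0 : ℝ)) τ * jacobiTheta₂ (r * τ + (s + 1 / 2 : ℝ)) τ /
      (jacobiTheta₂ ((0 : ℝ) * τ + (0 : ℝ)) τ *
        jacobiTheta₂ ((r + 1 / 2 : ℝ) * τ + (s + 1 / 2 : ℝ)) τ)) ^ 2 := by
  have h0 := theta3_zero_ne_zero hτ
  rw [legendreX_one_sub hτ hz]
  rw [theta1_eq, theta3_eq, theta2_eq, theta4_eq] at *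
  have e1 : (τ / 2 + (0 : ℝ) : ℂ) = 0 + τ / 2 := by simp
  have e2 : (r * τ + (s + 1 / 2 : ℝ) : ℂ) = r * τ + s + 1 / 2 := by push_cast; ring
  have e3 : ((0 : ℝ) * τ + (0 : ℝ) : ℂ) = 0 := by simp
  have e4 : ((r + 1 / 2 : ℝ) * τ + (s + 1 / 2 : ℝ) : ℂ) = r * τ + s + τ / 2 + 1 / 2 := by
    push_cast; ring
  rw [e1, e2, e3, e4]
  generalize jacobiTheta₂ (r * τ + s + 1 / 2) τ = a at *
  generalize jacobiTheta₂ 0 τ = b at *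
  generalize jacobiTheta₂ (0 + τ / 2) τ = c at *
  generalize jacobiTheta₂ (r * τ + s + τ / 2 + 1 / 2) τ = d at *
  have hd : d ≠ 0 := by rintro rfl; simp at hz
  have e5 : exp (π * Complex.I * τ / 4 + π * Complex.I * (r * τ + s + 1 / 2)) ^ 2 =
      -(exp (π * Complex.I * τ / 4 + π * Complex.I * 0) ^ 2 * exp (2 * π * Complex.I * r * τ) *
        exp (2 * π * Complex.I * s)) := by
    rw [← Complex.exp_nat_mul, ← Complex.exp_nat_mul, ← Complex.exp_add, ← Complex.exp_add]
    rw [show ((2 : ℕ) : ℂ) * (π * Complex.I * τ / 4 + π * Complex.I * (r * τ + s + 1 / 2)) =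
      ((2 : ℕ) : ℂ) * (π * Complex.I * τ / 4 + π * Complex.I * 0) + 2 * π * Complex.I * r * τ +
        2 * π * Complex.I * s + π * Complex.I by push_cast; ring]
    rw [Complex.exp_add _ (π * Complex.I), Complex.exp_pi_mul_I]; ring
  rw [neg_sq, mul_pow, mul_pow _ d, e5, Complex.exp_neg]
  have n1 := Complex.exp_ne_zero (π * Complex.I * τ / 4 + π * Complex.I * 0)
  have n2 := Complex.exp_ne_zero (2 * π * Complex.I * r * τ)
  have n3 := Complex.exp_ne_zero (2 * π * Complex.I * s)
  field_simp

theorem tendsto_legendreX_of_neg {r s : ℝ} (hr : -1 / 2 < r) (hr' : r < 0)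
    (hz : ∀ τ : ℍ, theta1 (r * τ + s) τ ≠ 0) :
    Tendsto (fun τ : ℍ => (1 - legendreX (r * τ + s) τ) * exp (2 * π * Complex.I * r * τ))
      atImInfty (𝓝 (-4 * exp (-(2 * π * Complex.I * s)))) := by
  have h1 := tendsto_jacobiTheta₂_half 0
  have h2 := tendsto_jacobiTheta₂_one (r := 0) (s := 0) (by norm_num)
  have h3 := tendsto_jacobiTheta₂_one (r := r) (s := s + 1 / 2)
    (abs_lt.2 ⟨by linarith, by linarith⟩)
  have h4 := tendsto_jacobiTheta₂_one (r := r + 1 / 2) (s := s + 1 / 2)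
    (abs_lt.2 ⟨by linarith, by linarith⟩)
  have h := (((h1.mul h3).div (h2.mul h4) (by norm_num)).pow 2).const_mul
    (-exp (-(2 * π * Complex.I * s)))
  have e : -exp (-(2 * π * Complex.I * s)) *
      ((1 + exp (-(2 * π * Complex.I * (0 : ℝ)))) * 1 / (1 * 1)) ^ 2 =
      -4 * exp (-(2 * π * Complex.I * s)) := by
    simp; ring
  rw [e] at h
  exact h.congr fun τ => (one_sub_legendreX_eq τ.im_pos (hz τ)).symm

theorem tendsto_legendreX_of_zero {s : ℝ} (hs : Complex.sin (π * s) ≠ 0)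
    (hz : ∀ τ : ℍ, theta1 ((0 : ℝ) * τ + s) τ ≠ 0) :
    Tendsto (fun τ : ℍ => 1 - legendreX ((0 : ℝ) * τ + s) τ)
      atImInfty (𝓝 (1 / Complex.sin (π * s) ^ 2)) := by
  have h1 := tendsto_jacobiTheta₂_half 0
  have h2 := tendsto_jacobiTheta₂_one (r := 0) (s := 0) (by norm_num)
  have h3 := tendsto_jacobiTheta₂_one (r := 0) (s := s + 1 / 2) (by norm_num)
  have h4 := tendsto_jacobiTheta₂_half (s + 1 / 2)
  have e1 : exp (-(2 * π * Complex.I * (s + 1 / 2 : ℝ))) = -exp (-(2 * π * Complex.I * s)) := by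
    rw [show -(2 * π * Complex.I * ((s + 1 / 2 : ℝ) : ℂ)) =
      -(2 * π * Complex.I * s) - π * Complex.I by push_cast; ring, Complex.exp_sub,
      Complex.exp_pi_mul_I]
    rw [div_neg, div_one]
  have e2 : 1 + exp (-(2 * π * Complex.I * (s + 1 / 2 : ℝ))) =
      2 * Complex.I * exp (-(π * Complex.I * s)) * Complex.sin (π * s) := by
    rw [e1, Complex.sin, show -(π * s : ℂ) * Complex.I = -(π * Complex.I * s) by ring,
      show (π * s : ℂ) * Complex.I = π * Complex.I * s by ring,
      show -(2 * π * Complex.I * s) = -(π * Complex.I * s) + -(π * Complex.I * s) by ring,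
      Complex.exp_add]
    have hh : exp (-(π * Complex.I * s)) * exp (π * Complex.I * s) = 1 := by
      rw [← Complex.exp_add]; simp
    linear_combination (-1 : ℂ) * hh + (exp (-(π * Complex.I * s)) ^ 2 -
      exp (-(π * Complex.I * s)) * exp (π * Complex.I * s)) * (-Complex.I_sq)
  have hd : 1 * (1 + exp (-(2 * π * Complex.I * (s + 1 / 2 : ℝ)))) ≠ 0 := by
    rw [e2, one_mul]
    exact mul_ne_zero (mul_ne_zero (mul_ne_zero two_ne_zero Complex.I_ne_zero)
      (Complex.exp_ne_zero _)) hs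
  have h := (((h1.mul h3).div (h2.mul h4) hd).pow 2).const_mul
    (-exp (-(2 * π * Complex.I * s)))
  have e : -exp (-(2 * π * Complex.I * s)) *
      ((1 + exp (-(2 * π * Complex.I * (0 : ℝ)))) * 1 /
        (1 * (1 + exp (-(2 * π * Complex.I * (s + 1 / 2 : ℝ)))))) ^ 2 =
      1 / Complex.sin (π * s) ^ 2 := by
    rw [e2, show -(2 * π * Complex.I * s) = -(π * Complex.I * s) + -(π * Complex.I * s) by ring,
      Complex.exp_add]
    have n1 := Complex.exp_ne_zero (-(π * Complex.I * s))
    have n2 := Complex.I_ne_zero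
    simp only [Complex.ofReal_zero, mul_zero, neg_zero, Complex.exp_zero]
    field_simp
    rw [Complex.I_sq]; norm_num
  rw [e] at h
  refine h.congr fun τ => ?_
  have := one_sub_legendreX_eq τ.im_pos (hz τ)
  simp only [Complex.ofReal_zero, mul_zero, zero_mul, Complex.exp_zero, mul_one, zero_add] at this ⊢
  rw [this]
  have e4 : (((1 : ℝ) / 2 : ℝ) : ℂ) * (τ : ℂ) = τ / 2 := by push_cast; ring
  rw [e4]
  rfl

/-- The coefficient of the leading term of `1 - y` at the cusp `∞`. -/
def leadCoeff (N : ℤ) (w : ℤ × ℤ) : ℂ :=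
  if w.1 = 0 then 1 / Complex.sin (π * (w.2 / (2 * N) : ℝ)) ^ 2
  else if w.1 = -N then 16 * Complex.sin (π * (w.2 / (2 * N) : ℝ)) ^ 2
  else -4 * exp (-(2 * π * Complex.I * (w.2 / (2 * N) : ℝ)))

/-- Representatives of the non-degenerate torsion points modulo sign and the lattice. -/
def IsNormalized (N : ℤ) (w : ℤ × ℤ) : Prop :=
  0 < N ∧ -N ≤ w.1 ∧ w.1 ≤ 0 ∧ ((w.1 = 0 ∨ w.1 = -N) → ¬ 2 * N ∣ w.2)

theorem sin_torsion_ne_zero {N m : ℤ} (hN : N ≠ 0) (h : ¬ 2 * N ∣ m) :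
    Complex.sin (π * (m / (2 * N) : ℝ)) ≠ 0 := by
  rw [Complex.sin_ne_zero_iff]
  intro k hk
  apply h
  refine ⟨k, ?_⟩
  have hN' : (N : ℂ) ≠ 0 := by exact_mod_cast hN
  have hp : (π : ℂ) ≠ 0 := by exact_mod_cast Real.pi_ne_zero
  push_cast at hk
  rw [mul_comm (k : ℂ)] at hk
  have := mul_left_cancel₀ hp hk
  field_simp at this
  have h2 : ((m : ℤ) : ℂ) = ((2 * N * k : ℤ) : ℂ) := by push_cast; exact this
  exact Int.cast_injective h2

theorem leadCoeff_ne_zero {N : ℤ} {w : ℤ × ℤ} (h : IsNormalized N w) : leadCoeff N w ≠ 0 := by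
  obtain ⟨hN, h1, h2, h3⟩ := h
  unfold leadCoeff
  split_ifs with a b
  · exact one_div_ne_zero (pow_ne_zero _ (sin_torsion_ne_zero hN.ne' (h3 (Or.inl a))))
  · exact mul_ne_zero (by norm_num) (pow_ne_zero _ (sin_torsion_ne_zero hN.ne' (h3 (Or.inr b))))
  · exact mul_ne_zero (by norm_num) (Complex.exp_ne_zero _)

theorem IsNormalized.not_rowDvd {N : ℤ} {w : ℤ × ℤ} (h : IsNormalized N w) :
    ¬ RowDvd (2 * N) w := by
  obtain ⟨hN, h1, h2, h3⟩ := h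
  rintro ⟨⟨k, hk⟩, h5⟩
  have : k = 0 := by
    have hk1 : k ≤ 0 := by by_contra hh; push Not at hh; nlinarith
    have hk2 : -1 < k := by by_contra hh; push Not at hh; nlinarith
    omega
  exact h3 (Or.inl (by rw [hk, this, mul_zero])) h5

theorem torsion_coe_eq (N a b : ℤ) (τ : ℂ) :
    ((a : ℂ) * τ + b) / (2 * N) = ((a / (2 * N) : ℝ) : ℂ) * τ + ((b / (2 * N) : ℝ) : ℂ) := by
  push_cast; ring

theorem tendsto_pY {N : ℤ} {w : ℤ × ℤ} (h : IsNormalized N w) :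
    Tendsto (fun τ : ℍ => (1 - pY N w τ) * exp (π * Complex.I * (w.1 / N) * τ)) atImInfty
      (𝓝 (leadCoeff N w)) := by
  have hw := h.not_rowDvd
  obtain ⟨hN, h1, h2, h3⟩ := h
  have hNR : (0 : ℝ) < N := by exact_mod_cast hN
  have hNC : (N : ℂ) ≠ 0 := by exact_mod_cast hN.ne'
  have hz : ∀ τ : ℍ, theta1 (((w.1 / (2 * N) : ℝ) : ℂ) * τ + ((w.2 / (2 * N) : ℝ) : ℂ)) τ ≠ 0 := by
    intro τ hh
    rw [← torsion_coe_eq] at hh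
    exact hw ((theta1_torsion_eq_zero_iff hN.ne' τ).1 hh)
  unfold leadCoeff
  split_ifs with a b
  · have hs := sin_torsion_ne_zero hN.ne' (h3 (Or.inl a))
    rw [a] at hz
    simp only [Int.cast_zero, zero_div] at hz
    refine (tendsto_legendreX_of_zero hs hz).congr fun τ => ?_
    unfold pY
    rw [picardY_eq_legendreX, torsion_coe_eq, a]
    simp
  -- On the edge `w.1 = -N` the limit is obtained from the edge `w.1 = 0` by the product formula
  -- `picardY_mul_shift`; the factor `16` comes from `1 - x`.
  · have hw0 : IsNormalized N (0, w.2) := ⟨hN, by simp [hN.le], le_rfl, fun _ => h3 (Or.inr b)⟩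
    have hs := sin_torsion_ne_zero hN.ne' (h3 (Or.inr b))
    have hz0 : ∀ τ : ℍ, theta1 ((0 : ℝ) * τ + ((w.2 / (2 * N) : ℝ) : ℂ)) τ ≠ 0 := by
      intro τ hh
      have := torsion_coe_eq N 0 w.2 τ
      simp only [Int.cast_zero, zero_div] at this
      rw [← this] at hh
      exact hw0.not_rowDvd ((theta1_torsion_eq_zero_iff (ν := 0) hN.ne' τ).1
        (by rw [Int.cast_zero]; exact hh))
    have hl := tendsto_one_sub_picardX.div (tendsto_legendreX_of_zero hs hz0)
      (one_div_ne_zero (pow_ne_zero _ hs))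
    rw [div_div_eq_mul_div, div_one] at hl
    refine hl.congr fun τ => ?_
    have h7 := picardY_mul_shift (μ := w.2) (ν := -N) hN.ne'
      (fun hh => h3 (Or.inr b) hh.2) (fun hh => h3 (Or.inr b) hh.2) τ
    rw [neg_add_cancel] at h7
    have h8 : picardY 0 w.2 N τ = legendreX ((0 : ℝ) * τ + ((w.2 / (2 * N) : ℝ) : ℂ)) τ := by
      rw [picardY_eq_legendreX, torsion_coe_eq]; simp
    have h9 : 1 - picardY 0 w.2 N τ ≠ 0 := fun h0 => by
      rw [h0, mul_zero] at h7; exact one_sub_picardX_ne_zero τ h7.symm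
    simp only [Pi.div_apply]
    rw [← h8, ← h7, pY, b]
    push_cast
    rw [neg_div, div_self hNC, mul_neg, mul_one, neg_mul]
    field_simp
  · have hlt : w.1 < 0 := lt_of_le_of_ne h2 a
    have hgt : -N < w.1 := lt_of_le_of_ne h1 (Ne.symm b)
    have hr : -1 / 2 < ((w.1 : ℝ) / (2 * N)) := by
      rw [div_lt_div_iff₀ (by norm_num) (by positivity)]
      have : (-N : ℝ) < w.1 := by exact_mod_cast hgt
      linarith
    have hr' : ((w.1 : ℝ) / (2 * N)) < 0 :=
      div_neg_of_neg_of_pos (by exact_mod_cast hlt) (by positivity)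
    refine (tendsto_legendreX_of_neg hr hr' hz).congr fun τ => ?_
    unfold pY
    rw [picardY_eq_legendreX, torsion_coe_eq]
    congr 2
    push_cast
    field_simp

/-- Reduce the first entry modulo `2N` to `[-N, N)` and make it nonpositive by a change of sign. The
hypotheses exclude `z = 0`, where `X` has its pole, and `z = τ/2`, where `1 - X` vanishes for all
`τ`. -/
theorem exists_isNormalized {N : ℤ} (hN : 0 < N) {w : ℤ × ℤ} (h : ¬ RowDvd (2 * N) w)
    (h' : ¬ RowDvd (2 * N) (w + (N, 0))) :
    ∃ u, IsNormalized N u ∧ (RowDvd (2 * N) (w - u) ∨ RowDvd (2 * N) (w + u)) := by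
  have h2N : 0 < 2 * N := by omega
  have key : ∀ w : ℤ × ℤ, ¬ RowDvd (2 * N) w → ¬ RowDvd (2 * N) (w + (N, 0)) →
      -N ≤ w.1 → w.1 ≤ 0 → IsNormalized N w := by
    intro w h h' h1 h2
    refine ⟨hN, h1, h2, ?_⟩
    rintro (a | a) hd
    · exact h ⟨by rw [a]; exact dvd_zero _, hd⟩
    · exact h' ⟨by simp [a], by simpa using hd⟩
  obtain ⟨m, k, hm, hm1, hm2⟩ : ∃ m k : ℤ, w.1 = m + 2 * N * k ∧ -N ≤ m ∧ m < N := by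
    refine ⟨(w.1 + N) % (2 * N) - N, (w.1 + N) / (2 * N), ?_, ?_, ?_⟩
    · have := Int.emod_add_mul_ediv (w.1 + N) (2 * N); linarith
    · have := Int.emod_nonneg (w.1 + N) h2N.ne'; linarith
    · have := Int.emod_lt_of_pos (w.1 + N) h2N; linarith
  rcases le_or_gt m 0 with h0 | h0
  · have hd : RowDvd (2 * N) (w - (m, w.2)) := ⟨⟨k, by simp [hm]⟩, by simp⟩
    refine ⟨(m, w.2), key _ ?_ ?_ hm1 h0, Or.inl hd⟩
    · intro hh; apply h
      exact ⟨by rw [hm]; exact dvd_add hh.1 (dvd_mul_right _ _), hh.2⟩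
    · intro hh; apply h'
      refine ⟨?_, hh.2⟩
      have : (w + (N, 0)).1 = m + N + 2 * N * k := by simp [hm]; ring
      rw [this]; exact dvd_add hh.1 (dvd_mul_right _ _)
  · have hd : RowDvd (2 * N) (w + (-m, -w.2)) := ⟨⟨k, by simp [hm]⟩, by simp⟩
    refine ⟨(-m, -w.2), key _ ?_ ?_ (by simp; omega) (by simp; omega), Or.inr hd⟩
    · intro hh; apply h
      refine ⟨?_, (dvd_neg).1 hh.2⟩
      rw [hm]; exact dvd_add ((dvd_neg).1 hh.1) (dvd_mul_right _ _)
    · intro hh; apply h'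
      have h1 : 2 * N ∣ -m + N := hh.1
      have h2 : 2 * N ∣ -w.2 := by simpa using hh.2
      refine ⟨?_, by simpa using h2⟩
      have : (w + (N, 0)).1 = -(-m + N) + 2 * N * (k + 1) := by simp [hm]; ring
      rw [this]; exact dvd_add ((dvd_neg).2 h1) (dvd_mul_right _ _)

/-! ### Limits at the three classes of cusps and the inclusion of automorphism groups in `Γ(2)`. -/

/-- `g` tends to `p` at the cusp `∞`, as a function with values in the Riemann sphere. -/
def CuspLim (g : ℍ → ℂ) (p : OnePoint ℂ) : Prop :=
  Tendsto (fun τ => (g τ : OnePoint ℂ)) atImInfty (𝓝 p)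

instance : NeBot atImInfty := by
  rw [atImInfty]
  refine comap_neBot fun t ht => ?_
  obtain ⟨a, ha⟩ := mem_atTop_sets.1 ht
  exact ⟨⟨⟨0, max a 1⟩, by simp⟩, ha _ (le_max_left _ _)⟩

theorem CuspLim.unique {g : ℍ → ℂ} {p q : OnePoint ℂ} (h : CuspLim g p) (h' : CuspLim g q) :
    p = q := tendsto_nhds_unique h h'

theorem cuspLim_coe {g : ℍ → ℂ} {c : ℂ} (h : Tendsto g atImInfty (𝓝 c)) : CuspLim g (c : OnePoint ℂ) :=
  (OnePoint.continuous_coe.tendsto c).comp h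

theorem tendsto_coe_infty_of_inv {α : Type*} {l : Filter α} {g : α → ℂ}
    (h : Tendsto (fun t => (g t)⁻¹) l (𝓝 0)) (hg : ∀ᶠ t in l, g t ≠ 0) :
    Tendsto (fun t => (g t : OnePoint ℂ)) l (𝓝 OnePoint.infty) := by
  have h1 : Tendsto (fun t => (g t)⁻¹) l (𝓝[≠] 0) :=
    tendsto_nhdsWithin_iff.2 ⟨h, hg.mono fun t ht => inv_ne_zero ht⟩
  have h2 := tendsto_inv₀_nhdsNE_zero.comp h1
  have h3 : Tendsto g l (Bornology.cobounded ℂ) := h2.congr fun t => by simp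
  rw [Metric.cobounded_eq_cocompact, ← coclosedCompact_eq_cocompact] at h3
  exact OnePoint.tendsto_coe_infty.comp h3

theorem tendsto_T_atImInfty : Tendsto (fun τ : ℍ => ModularGroup.T • τ) atImInfty atImInfty := by
  rw [atImInfty, tendsto_comap_iff]
  refine (tendsto_im_atImInfty).congr fun τ => ?_
  simp only [Function.comp]
  rw [← UpperHalfPlane.coe_im, ← UpperHalfPlane.coe_im, coe_T_smul]; simp

theorem CuspLim.comp_T {g : ℍ → ℂ} {p : OnePoint ℂ} (h : CuspLim g p) :
    CuspLim (fun τ => g (ModularGroup.T • τ)) p :=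
  Tendsto.comp (f := fun τ : ℍ => ModularGroup.T • τ) (g := fun τ => (g τ : OnePoint ℂ)) h
    tendsto_T_atImInfty

/-- A function whose limits at the cusps over `∞`, `0` and `1` lie in disjoint sets can only be
invariant under elements of `Γ(2)`. -/
theorem autGroup_le_of_cuspLim {f : ℍ → ℂ} (A B C : Set (OnePoint ℂ)) (hAB : Disjoint A B)
    (hAC : Disjoint A C) (hBC : Disjoint B C)
    (hA : ∀ δ ∈ CongruenceSubgroup.Gamma 2, ∃ p ∈ A, CuspLim (fun τ => f (δ • τ)) p)
    (hB : ∀ δ ∈ CongruenceSubgroup.Gamma 2, ∃ p ∈ B,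
      CuspLim (fun τ => f (δ • ModularGroup.S • τ)) p)
    (hC : ∀ δ ∈ CongruenceSubgroup.Gamma 2, ∃ p ∈ C,
      CuspLim (fun τ => f (δ • ModularGroup.T • ModularGroup.S • τ)) p) :
    autGroup f ≤ CongruenceSubgroup.Gamma 2 := by
  have key : ∀ γ : SL(2, ℤ), ∃ δ ∈ CongruenceSubgroup.Gamma 2,
      ((γ = δ ∨ γ = δ * ModularGroup.T) ∧ ∃ p ∈ A, CuspLim (fun τ => f (γ • τ)) p) ∨
      ((γ = δ * ModularGroup.S ∨ γ = δ * ModularGroup.S * ModularGroup.T) ∧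
        ∃ p ∈ B, CuspLim (fun τ => f (γ • τ)) p) ∨
      (∃ p ∈ C, CuspLim (fun τ => f (γ • τ)) p) := by
    intro γ
    obtain ⟨δ, hδ, σ, hσ, h⟩ := exists_gamma_two_mul γ
    refine ⟨δ, hδ, ?_⟩
    rcases hσ with rfl | rfl | rfl
    · obtain ⟨p, hp, hl⟩ := hA δ hδ
      refine Or.inl ⟨by simpa using h, p, hp, ?_⟩
      rcases h with rfl | rfl
      · simpa using hl
      · simpa [mul_smul] using hl.comp_T
    · obtain ⟨p, hp, hl⟩ := hB δ hδ
      refine Or.inr (Or.inl ⟨h, p, hp, ?_⟩)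
      rcases h with rfl | rfl
      · simpa [mul_smul] using hl
      · simpa [mul_smul] using hl.comp_T
    · obtain ⟨p, hp, hl⟩ := hC δ hδ
      refine Or.inr (Or.inr ⟨p, hp, ?_⟩)
      rcases h with rfl | rfl
      · simpa [mul_smul] using hl
      · simpa [mul_smul] using hl.comp_T
  -- Invariance transports the limits of `f` at `∞` and `0` to the cusps `γ∞` and `γ0`. Disjointness
  -- puts `γ` in `Γ(2) ∪ Γ(2)T` and `γS` in `Γ(2)S ∪ Γ(2)ST`; for `γ ∈ Γ(2)T` the upper left entries
  -- of `γS` would have different parities.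
  intro γ hγ
  have h1 : ∃ p ∈ A, CuspLim (fun τ => f (γ • τ)) p := by
    obtain ⟨p, hp, hl⟩ := hA 1 (one_mem _)
    refine ⟨p, hp, ?_⟩
    simp_rw [one_smul] at hl
    exact hl.congr fun τ => congrArg _ (hγ τ).symm
  have h2 : ∃ p ∈ B, CuspLim (fun τ => f ((γ * ModularGroup.S) • τ)) p := by
    obtain ⟨p, hp, hl⟩ := hB 1 (one_mem _)
    refine ⟨p, hp, ?_⟩
    simp_rw [one_smul] at hl
    exact hl.congr fun τ => congrArg _
      ((hγ _).symm.trans (by rw [← mul_smul]))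
  obtain ⟨p, hp, hl⟩ := h1
  obtain ⟨q, hq, hl'⟩ := h2
  obtain ⟨δ, hδ, ⟨k1, -⟩ | ⟨-, r, hr, hm⟩ | ⟨r, hr, hm⟩⟩ := key γ
  rotate_left
  · exact absurd (hl.unique hm) fun e => Set.disjoint_left.1 hAB hp (e ▸ hr)
  · exact absurd (hl.unique hm) fun e => Set.disjoint_left.1 hAC hp (e ▸ hr)
  obtain ⟨δ', hδ', ⟨-, r, hr, hm⟩ | ⟨k2, -⟩ | ⟨r, hr, hm⟩⟩ := key (γ * ModularGroup.S)
  · exact absurd (hl'.unique hm) fun e => Set.disjoint_right.1 hAB hq (e ▸ hr)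
  swap
  · exact absurd (hl'.unique hm) fun e => Set.disjoint_left.1 hBC hq (e ▸ hr)
  rcases k1 with rfl | rfl
  · exact hδ
  exfalso
  obtain ⟨a1, a2, a3, a4⟩ := (mem_gamma_two_iff δ).1 hδ
  obtain ⟨b1, b2, b3, b4⟩ := (mem_gamma_two_iff δ').1 hδ'
  obtain ⟨s1, s2, s3, s4⟩ := S_apply
  obtain ⟨t1, t2, t3, t4⟩ := T_apply
  rcases k2 with k2 | k2
  all_goals
    have h := congrArg (fun M : SL(2, ℤ) => M 0 0) k2
    simp only [SL_mul_apply, s1, s2, s3, s4, t1, t2, t3, t4] at h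
    omega

theorem one_sub_picardX_tendsto : Tendsto (fun τ => 1 - picardX τ) atImInfty (𝓝 0) := by
  have h1 : Tendsto (fun τ : ℍ => exp (π * Complex.I * τ)) atImInfty (𝓝 0) := by
    rw [tendsto_zero_iff_norm_tendsto_zero]
    refine (Real.tendsto_exp_neg_atTop_nhds_zero.comp
      (tendsto_im_atImInfty.const_mul_atTop Real.pi_pos)).congr fun τ => ?_
    rw [Complex.norm_exp]
    simp
  have := tendsto_one_sub_picardX.mul h1
  rw [mul_zero] at this
  refine this.congr fun τ => ?_
  rw [mul_assoc, ← Complex.exp_add]; simp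

theorem picardX_tendsto : Tendsto picardX atImInfty (𝓝 1) := by
  have := one_sub_picardX_tendsto.const_sub 1
  simpa using this

theorem picardX_TS_smul (τ : ℍ) :
    picardX (ModularGroup.T • ModularGroup.S • τ) = (1 - picardX τ)⁻¹ := by
  rw [picardX_T_smul, picardX_S_smul]

theorem cuspLim_picardX_infty : CuspLim picardX ((1 : ℂ) : OnePoint ℂ) :=
  cuspLim_coe picardX_tendsto

theorem cuspLim_picardX_S :
    CuspLim (fun τ => picardX (ModularGroup.S • τ)) ((0 : ℂ) : OnePoint ℂ) := by
  simp_rw [picardX_S_smul]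
  exact cuspLim_coe one_sub_picardX_tendsto

theorem cuspLim_picardX_TS :
    CuspLim (fun τ => picardX (ModularGroup.T • ModularGroup.S • τ)) OnePoint.infty := by
  simp_rw [picardX_TS_smul]
  refine tendsto_coe_infty_of_inv ?_ (Eventually.of_forall fun τ =>
    inv_ne_zero (one_sub_picardX_ne_zero τ))
  simpa using one_sub_picardX_tendsto

theorem autGroup_picardX : autGroup picardX = CongruenceSubgroup.Gamma 2 := by
  apply le_antisymm
  · refine autGroup_le_of_cuspLim {((1 : ℂ) : OnePoint ℂ)} {((0 : ℂ) : OnePoint ℂ)}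
      {OnePoint.infty} (by simp) (by simp) (by simp) ?_ ?_ ?_
    all_goals intro δ hδ; refine ⟨_, rfl, ?_⟩; simp_rw [(gamma_two_smul hδ).1]
    · exact cuspLim_picardX_infty
    · exact cuspLim_picardX_S
    · exact cuspLim_picardX_TS
  · intro γ hγ
    exact (gamma_two_smul hγ).1

/-- If the normalized row has nonzero first entry, `1 - y` decays exponentially and the limit is
`1`. Otherwise the limit is `1 - 1/sin² = -cot²`, which is negative because the third hypothesis
excludes `z = 1/2`. -/
theorem exists_tendsto_pY {N : ℤ} (hN : 0 < N) {w : ℤ × ℤ} (h : ¬ RowDvd (2 * N) w)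
    (h' : ¬ RowDvd (2 * N) (w + (N, 0))) (h'' : ¬ RowDvd (2 * N) (w + (0, N))) :
    ∃ L : ℝ, (L = 1 ∨ L < 0) ∧ Tendsto (pY N w) atImInfty (𝓝 (L : ℂ)) := by
  obtain ⟨u, hu, hwu⟩ := exists_isNormalized hN h h'
  have hy : pY N w = pY N u := by
    funext τ
    exact (pY_eq_iff hN.ne' hu.not_rowDvd h τ).2 hwu
  have hl := tendsto_pY hu
  obtain ⟨-, h1, h2, h3⟩ := id hu
  rw [hy]
  by_cases h0 : u.1 = 0
  · simp only [leadCoeff, h0, Int.cast_zero, zero_div, mul_zero, zero_mul,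
      Complex.exp_zero, mul_one] at hl
    have hs := sin_torsion_ne_zero hN.ne' (h3 (Or.inl h0))
    rw [← Complex.ofReal_mul, ← Complex.ofReal_sin] at hs hl
    have hs' : Real.sin (π * (u.2 / (2 * N))) ≠ 0 := by exact_mod_cast hs
    have hc : Real.cos (π * (u.2 / (2 * N))) ≠ 0 := by
      intro hc
      rw [Real.cos_eq_zero_iff] at hc
      obtain ⟨k, hk⟩ := hc
      have hNR : (N : ℝ) ≠ 0 := by exact_mod_cast hN.ne'
      have h5 : (u.2 : ℝ) = (2 * k + 1) * N := by
        have hp := Real.pi_ne_zero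
        field_simp at hk
        linarith
      have h6 : u.2 = (2 * k + 1) * N := by exact_mod_cast h5
      apply h''
      rcases hwu with ⟨⟨a, ha⟩, ⟨b, hb⟩⟩ | ⟨⟨a, ha⟩, ⟨b, hb⟩⟩
      · simp only [Prod.fst_sub, Prod.snd_sub, h0, h6] at ha hb
        exact ⟨⟨a, by simp; linarith⟩, ⟨b + k + 1, by simp; linarith⟩⟩
      · simp only [Prod.fst_add, Prod.snd_add, h0, h6] at ha hb
        exact ⟨⟨a, by simp; linarith⟩, ⟨b - k, by simp; linarith⟩⟩
    refine ⟨1 - 1 / Real.sin (π * (u.2 / (2 * N))) ^ 2, Or.inr ?_, ?_⟩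
    · have hp : 0 < Real.sin (π * (u.2 / (2 * N))) ^ 2 := by positivity
      have hp' : 0 < Real.cos (π * (u.2 / (2 * N))) ^ 2 := by positivity
      have := Real.sin_sq_add_cos_sq (π * (u.2 / (2 * N)))
      rw [sub_neg, lt_div_iff₀ hp]; linarith
    · have := hl.const_sub 1
      push_cast at this ⊢
      refine this.congr fun τ => by ring
  · refine ⟨1, Or.inl rfl, ?_⟩
    have h5 : Tendsto (fun τ : ℍ => exp (-(π * Complex.I * (u.1 / N) * τ))) atImInfty (𝓝 0) := by
      rw [tendsto_zero_iff_norm_tendsto_zero]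
      have hNR : (0 : ℝ) < N := by exact_mod_cast hN
      have hpos : 0 < π * (-u.1 / N : ℝ) := by
        refine mul_pos Real.pi_pos (div_pos ?_ hNR)
        have : u.1 < 0 := lt_of_le_of_ne h2 h0
        have : (u.1 : ℝ) < 0 := by exact_mod_cast this
        linarith
      refine (Real.tendsto_exp_neg_atTop_nhds_zero.comp
        (tendsto_im_atImInfty.const_mul_atTop hpos)).congr fun τ => ?_
      rw [Complex.norm_exp]
      simp only [Function.comp]
      congr 1
      have : -(π * Complex.I * (u.1 / N) * τ : ℂ) =
        ((-(π * (u.1 / N)) : ℝ) : ℂ) * (Complex.I * τ) := by push_cast; ring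
      rw [this, Complex.re_ofReal_mul]
      simp
      ring
    have := (hl.mul h5).const_sub 1
    rw [mul_zero, sub_zero] at this
    rw [Complex.ofReal_one]
    refine this.congr fun τ => ?_
    rw [mul_assoc, ← Complex.exp_add, add_neg_cancel, Complex.exp_zero]; ring

theorem pY_neg_level (N : ℤ) (v : ℤ × ℤ) (τ : ℍ) : pY (-N) v τ = pY N v τ := by
  rw [← pY_neg N v]
  unfold pY
  rw [picardY_eq_legendreX, picardY_eq_legendreX]
  congr 1
  simp only [Prod.fst_neg, Prod.snd_neg]
  push_cast
  rw [mul_neg, div_neg, ← neg_div]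
  congr 1; ring

theorem rowDvd_neg_modulus {m : ℤ} {v : ℤ × ℤ} : RowDvd (-m) v ↔ RowDvd m v := by
  unfold RowDvd; rw [neg_dvd, neg_dvd]

/-- The torsion points for which `y` is not constant. -/
def IsNonDeg (N : ℤ) (v : ℤ × ℤ) : Prop :=
  ¬ RowDvd (2 * N) v ∧ ¬ RowDvd (2 * N) (v + (N, 0)) ∧ ¬ RowDvd (2 * N) (v + (0, N))

theorem not_isDegenerate_iff {ν μ N : ℤ} : ¬ IsDegenerate ν μ N ↔ IsNonDeg N (ν, μ) := by
  rw [← not_iff_not, not_not]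
  unfold IsDegenerate IsNonDeg RowDvd
  simp only [Prod.mk_add_mk, add_zero]
  constructor
  · rintro (⟨h1, k, hk⟩ | ⟨h1, k, hk⟩) ⟨h2, h3, h4⟩
    · rcases Int.even_or_odd' k with ⟨j, rfl | rfl⟩
      · exact h2 ⟨h1, j, by rw [hk]; ring⟩
      · exact h4 ⟨h1, j + 1, by rw [hk]; ring⟩
    · rcases Int.even_or_odd' k with ⟨j, rfl | rfl⟩
      · exact h2 ⟨⟨j, by rw [hk]; ring⟩, h1⟩
      · exact h3 ⟨⟨j + 1, by rw [hk]; ring⟩, h1⟩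
  · intro h
    by_contra hc
    push Not at hc
    refine h ⟨fun hh => hc.1 hh.1 ((Dvd.intro_left _ rfl).trans hh.2), fun hh => ?_, fun hh => ?_⟩
    · exact hc.2 hh.2 (by
        have : N ∣ ν + N := (Dvd.intro_left 2 rfl).trans hh.1
        simpa using this)
    · exact hc.1 hh.1 (by
        have : N ∣ μ + N := (Dvd.intro_left 2 rfl).trans hh.2
        simpa using this)

theorem RowDvd.add {m : ℤ} {v w : ℤ × ℤ} (h : RowDvd m v) (h' : RowDvd m w) : RowDvd m (v + w) :=
  ⟨dvd_add h.1 h'.1, dvd_add h.2 h'.2⟩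

theorem RowDvd.neg {m : ℤ} {v : ℤ × ℤ} (h : RowDvd m v) : RowDvd m (-v) :=
  ⟨(dvd_neg).2 h.1, (dvd_neg).2 h.2⟩

theorem rowMul_fst (v : ℤ × ℤ) (γ : SL(2, ℤ)) : (rowMul v γ).1 = v.1 * γ 0 0 + v.2 * γ 1 0 := rfl

theorem rowMul_snd (v : ℤ × ℤ) (γ : SL(2, ℤ)) : (rowMul v γ).2 = v.1 * γ 0 1 + v.2 * γ 1 1 := rfl

theorem IsNonDeg.rowMul {N : ℤ} {v : ℤ × ℤ} (h : IsNonDeg N v) {γ : SL(2, ℤ)}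
    (hγ : γ ∈ CongruenceSubgroup.Gamma 2) : IsNonDeg N (rowMul v γ) := by
  obtain ⟨⟨a, ha⟩, ⟨b, hb⟩, ⟨c, hc⟩, ⟨d, hd⟩⟩ := (mem_gamma_two_iff γ).1 hγ
  obtain ⟨h1, h2, h3⟩ := h
  refine ⟨fun hh => h1 ((rowDvd_mul_iff γ).1 hh), fun hh => h2 ((rowDvd_mul_iff γ).1 ?_),
    fun hh => h3 ((rowDvd_mul_iff γ).1 ?_)⟩
  · rw [rowMul_add]
    have : RowDvd (2 * N) (PicardUniformization.rowMul (N, 0) γ - (N, 0)) := by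
      refine ⟨⟨a, ?_⟩, ⟨b, ?_⟩⟩
      · simp only [Prod.fst_sub, rowMul_fst]; linear_combination N * ha
      · simp only [Prod.snd_sub, rowMul_snd]; linear_combination N * hb
    have h := hh.add this
    rwa [add_assoc, add_sub_cancel] at h
  · rw [rowMul_add]
    have : RowDvd (2 * N) (PicardUniformization.rowMul (0, N) γ - (0, N)) := by
      refine ⟨⟨c, ?_⟩, ⟨d, ?_⟩⟩
      · simp only [Prod.fst_sub, rowMul_fst]; linear_combination N * hc
      · simp only [Prod.snd_sub, rowMul_snd]; linear_combination N * hd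
    have h := hh.add this
    rwa [add_assoc, add_sub_cancel] at h

theorem IsNonDeg.rowMul_S {N : ℤ} {v : ℤ × ℤ} (h : IsNonDeg N v) :
    IsNonDeg N (PicardUniformization.rowMul v ModularGroup.S) := by
  rw [PicardUniformization.rowMul_S]
  obtain ⟨h1, h2, h3⟩ := h
  unfold RowDvd at *
  refine ⟨fun hh => h1 ⟨(dvd_neg).1 hh.2, hh.1⟩, fun hh => h3 ?_, fun hh => h2 ?_⟩
  · simp only [Prod.mk_add_mk, Prod.fst_add, Prod.snd_add, add_zero] at hh ⊢
    exact ⟨(dvd_neg).1 hh.2, hh.1⟩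
  · simp only [Prod.mk_add_mk, Prod.fst_add, Prod.snd_add, add_zero] at hh ⊢
    refine ⟨?_, hh.1⟩
    have := dvd_add ((dvd_neg).2 hh.2) (dvd_refl (2 * N))
    ring_nf at this ⊢
    exact this

/-- The shift by `(N, 0)`, a translation of `z` by `τ/2`, prepares the use of the product formula in
`pY_TS_smul_eq_inv`. -/
theorem IsNonDeg.rowMul_TS {N : ℤ} {v : ℤ × ℤ} (h : IsNonDeg N v) :
    IsNonDeg N (PicardUniformization.rowMul v (ModularGroup.T * ModularGroup.S) + (N, 0)) := by
  rw [rowMul_mul, PicardUniformization.rowMul_S, rowMul_T]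
  obtain ⟨h1, h2, h3⟩ := h
  unfold RowDvd at *
  refine ⟨fun hh => h3 ?_, fun hh => h1 ?_, fun hh => h2 ?_⟩
  all_goals
    obtain ⟨v1, v2⟩ := v
    simp only [Prod.mk_add_mk, add_zero] at hh ⊢
    obtain ⟨⟨a, ha⟩, ⟨b, hb⟩⟩ := hh
  · exact ⟨⟨-b, by linarith⟩, ⟨a + b, by linarith⟩⟩
  · exact ⟨⟨-b, by linarith⟩, ⟨a + b - 1, by linarith⟩⟩
  · exact ⟨⟨-b + 1, by linarith⟩, ⟨a + b - 1, by linarith⟩⟩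

theorem pY_TS_smul {N : ℤ} (hN : N ≠ 0) {v : ℤ × ℤ} (h : ¬ RowDvd (2 * N) v) (τ : ℍ) :
    pY N v (ModularGroup.T • ModularGroup.S • τ) =
      (1 - pY N (rowMul v (ModularGroup.T * ModularGroup.S)) τ) / (1 - picardX τ) := by
  rw [pY_T_smul, pY_S_smul hN (fun hh => h ((rowDvd_mul_iff _).1 hh)), picardX_S_smul, rowMul_mul]

theorem pY_mul_shift {N : ℤ} (hN : N ≠ 0) {v : ℤ × ℤ} (h : ¬ RowDvd (2 * N) v)
    (h' : ¬ RowDvd (2 * N) (v + (N, 0))) (τ : ℍ) :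
    (1 - pY N v τ) * (1 - pY N (v + (N, 0)) τ) = 1 - picardX τ := by
  have := picardY_mul_shift (ν := v.1) (μ := v.2) hN h (fun hh => h' ⟨hh.1, by simpa using hh.2⟩) τ
  simpa [pY] using this

/-- In `(1 - y)/(1 - x)` both terms may tend to `0`; the product formula replaces the quotient by
the inverse of a single factor `1 - y`, whose limit is known. -/
theorem pY_TS_smul_eq_inv {N : ℤ} (hN : N ≠ 0) {v : ℤ × ℤ} (h : ¬ RowDvd (2 * N) v)
    (h' : ¬ RowDvd (2 * N) (rowMul v (ModularGroup.T * ModularGroup.S) + (N, 0))) (τ : ℍ) :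
    1 - pY N (rowMul v (ModularGroup.T * ModularGroup.S) + (N, 0)) τ ≠ 0 ∧
    pY N v (ModularGroup.T • ModularGroup.S • τ) =
      (1 - pY N (rowMul v (ModularGroup.T * ModularGroup.S) + (N, 0)) τ)⁻¹ := by
  have h1 := pY_mul_shift hN (fun hh => h ((rowDvd_mul_iff _).1 hh)) h' τ
  have h2 := one_sub_picardX_ne_zero τ
  rw [← h1] at h2
  have h3 := right_ne_zero_of_mul h2
  have h4 := left_ne_zero_of_mul h2
  refine ⟨h3, ?_⟩
  rw [pY_TS_smul hN h, ← h1]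
  field_simp

/-- At a cusp over `x = 1`, `0` or `∞` the limit is `L`, `1 - L` or `(1 - L)⁻¹` respectively, where
`L = 1` or `L < 0`. These possibilities give the three disjoint sets. -/
theorem autGroup_pY_le {N : ℤ} (hN : N ≠ 0) {v : ℤ × ℤ} (hv : IsNonDeg N v) :
    autGroup (pY N v) ≤ CongruenceSubgroup.Gamma 2 := by
  wlog hN0 : 0 < N generalizing N
  · have h1 : pY N v = pY (-N) v := by funext τ; rw [pY_neg_level]
    rw [h1]
    refine this (neg_ne_zero.2 hN) ?_ (by omega)
    obtain ⟨a, b, c⟩ := hv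
    have e : 2 * -N = -(2 * N) := by ring
    refine ⟨?_, fun h => b ?_, fun h => c ?_⟩
    · rwa [e, rowDvd_neg_modulus]
    · rw [e, rowDvd_neg_modulus] at h
      have : RowDvd (2 * N) (2 * N, 0) := ⟨dvd_refl _, dvd_zero _⟩
      convert h.add this using 1
      ext <;> (simp; try ring)
    · rw [e, rowDvd_neg_modulus] at h
      have : RowDvd (2 * N) (0, 2 * N) := ⟨dvd_zero _, dvd_refl _⟩
      convert h.add this using 1
      ext <;> (simp; try ring)
  refine autGroup_le_of_cuspLim
    ((fun r : ℝ => ((r : ℂ) : OnePoint ℂ)) '' {r | r = 1 ∨ r < 0})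
    ((fun r : ℝ => ((r : ℂ) : OnePoint ℂ)) '' {r | r = 0 ∨ 1 < r})
    ((fun r : ℝ => ((r : ℂ) : OnePoint ℂ)) '' {r | 0 < r ∧ r < 1} ∪ {OnePoint.infty}) ?_ ?_ ?_ ?_ ?_ ?_
  · rw [Set.disjoint_left]
    rintro _ ⟨r, hr, rfl⟩ ⟨s, hs, h⟩
    have : s = r := by simpa using h
    subst this
    rcases hr with h1 | h1 <;> rcases hs with h2 | h2 <;> linarith
  · rw [Set.disjoint_left]
    rintro _ ⟨r, hr, rfl⟩ (⟨s, hs, h⟩ | h)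
    · have : s = r := by simpa using h
      subst this
      rcases hr with h1 | h1 <;> linarith [hs.1, hs.2]
    · exact OnePoint.coe_ne_infty _ h
  · rw [Set.disjoint_left]
    rintro _ ⟨r, hr, rfl⟩ (⟨s, hs, h⟩ | h)
    · have : s = r := by simpa using h
      subst this
      rcases hr with h1 | h1 <;> linarith [hs.1, hs.2]
    · exact OnePoint.coe_ne_infty _ h
  · intro δ hδ
    obtain ⟨L, hL, hl⟩ := exists_tendsto_pY hN0 (hv.rowMul hδ).1 (hv.rowMul hδ).2.1
      (hv.rowMul hδ).2.2
    refine ⟨_, ⟨L, hL, rfl⟩, ?_⟩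
    simp_rw [(gamma_two_smul hδ).2 hN v hv.1]
    exact cuspLim_coe hl
  · intro δ hδ
    have hw := (hv.rowMul hδ).rowMul_S
    obtain ⟨L, hL, hl⟩ := exists_tendsto_pY hN0 hw.1 hw.2.1 hw.2.2
    refine ⟨_, ⟨1 - L, hL.elim (fun h => Or.inl (by linarith)) (fun h => Or.inr (by linarith)),
      rfl⟩, ?_⟩
    simp_rw [(gamma_two_smul hδ).2 hN v hv.1, pY_S_smul hN (hv.rowMul hδ).1]
    refine cuspLim_coe ?_
    push_cast
    exact hl.const_sub 1
  · intro δ hδ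
    have hw := (hv.rowMul hδ).rowMul_TS
    obtain ⟨L, hL, hl⟩ := exists_tendsto_pY hN0 hw.1 hw.2.1 hw.2.2
    have h6 := pY_TS_smul_eq_inv hN (hv.rowMul hδ).1 hw.1
    simp_rw [(gamma_two_smul hδ).2 hN v hv.1, fun τ => (h6 τ).2]
    have hl' := hl.const_sub 1
    rcases hL with rfl | hL
    · refine ⟨OnePoint.infty, Or.inr rfl, ?_⟩
      refine tendsto_coe_infty_of_inv ?_ (Eventually.of_forall fun τ => inv_ne_zero (h6 τ).1)
      simpa using hl'
    · refine ⟨_, Or.inl ⟨(1 - L)⁻¹, ⟨inv_pos.2 (by linarith), inv_lt_one_of_one_lt₀ (by linarith)⟩,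
        rfl⟩, ?_⟩
      refine cuspLim_coe ?_
      push_cast
      refine hl'.inv₀ ?_
      have : (1 - L : ℝ) ≠ 0 := by linarith
      exact_mod_cast this

theorem mem_autGroup_pY_iff {N : ℤ} (hN : N ≠ 0) {v : ℤ × ℤ} (hv : IsNonDeg N v) (γ : SL(2, ℤ)) :
    γ ∈ autGroup (pY N v) ↔ γ ∈ CongruenceSubgroup.Gamma 2 ∧
      (RowDvd (2 * N) (rowMul v γ - v) ∨ RowDvd (2 * N) (rowMul v γ + v)) := by
  constructor
  · intro h
    have h2 := autGroup_pY_le hN hv h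
    -- Equality at a single point, here `I`, already gives the congruence.
    refine ⟨h2, (pY_eq_iff hN hv.1 (hv.rowMul h2).1 UpperHalfPlane.I).1 ?_⟩
    rw [← (gamma_two_smul h2).2 hN v hv.1]
    exact h _
  · rintro ⟨h2, h⟩ τ
    rw [(gamma_two_smul h2).2 hN v hv.1]
    exact (pY_eq_iff hN hv.1 (hv.rowMul h2).1 τ).2 h

theorem exp_int_mul_eq_iff {N a b : ℤ} (hN : N ≠ 0) :
    exp (-(2 * π * Complex.I * (a / (2 * N) : ℝ))) = exp (-(2 * π * Complex.I * (b / (2 * N) : ℝ))) ↔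
      2 * N ∣ a - b := by
  have hNC : (N : ℂ) ≠ 0 := by exact_mod_cast hN
  have hp : (2 * π * Complex.I : ℂ) ≠ 0 := Complex.two_pi_I_ne_zero
  rw [Complex.exp_eq_exp_iff_exists_int]
  constructor
  · rintro ⟨n, hn⟩
    refine ⟨-n, ?_⟩
    push_cast at hn
    have h1 : (2 * π * Complex.I : ℂ) * (a / (2 * N)) = 2 * π * Complex.I * (b / (2 * N) - n) := by
      linear_combination -hn
    have h2 := mul_left_cancel₀ hp h1
    field_simp at h2
    have h3 : ((a - b : ℤ) : ℂ) = ((2 * N * -n : ℤ) : ℂ) := by push_cast; linear_combination h2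
    exact Int.cast_injective h3
  · rintro ⟨n, hn⟩
    refine ⟨-n, ?_⟩
    have h3 : (a : ℂ) = b + 2 * N * n := by
      have : a = b + 2 * N * n := by linarith
      exact_mod_cast this
    push_cast
    rw [h3]
    field_simp
    ring

theorem sin_sq_eq_iff {N a b : ℤ} (hN : N ≠ 0)
    (h : Complex.sin (π * (a / (2 * N) : ℝ)) ^ 2 = Complex.sin (π * (b / (2 * N) : ℝ)) ^ 2) :
    2 * N ∣ a - b ∨ 2 * N ∣ a + b := by
  have hNC : (N : ℂ) ≠ 0 := by exact_mod_cast hN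
  have hp : (π : ℂ) ≠ 0 := by exact_mod_cast Real.pi_ne_zero
  have h1 : Complex.cos (2 * (π * (a / (2 * N) : ℝ))) = Complex.cos (2 * (π * (b / (2 * N) : ℝ))) := by
    rw [Complex.cos_two_mul, Complex.cos_two_mul, Complex.cos_sq', Complex.cos_sq', h]
  rw [Complex.cos_eq_cos_iff] at h1
  obtain ⟨k, hk | hk⟩ := h1
  · left
    refine ⟨-k, ?_⟩
    push_cast at hk
    have h2 : (π : ℂ) * (b / N) = π * (2 * k + a / N) := by field_simp at hk ⊢; linear_combination hk
    have h3 := mul_left_cancel₀ hp h2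
    field_simp at h3
    have h4 : ((a - b : ℤ) : ℂ) = ((2 * N * -k : ℤ) : ℂ) := by push_cast; linear_combination -h3
    exact Int.cast_injective h4
  · right
    refine ⟨k, ?_⟩
    push_cast at hk
    have h2 : (π : ℂ) * (b / N) = π * (2 * k - a / N) := by field_simp at hk ⊢; linear_combination hk
    have h3 := mul_left_cancel₀ hp h2
    field_simp at h3
    have h4 : ((a + b : ℤ) : ℂ) = ((2 * N * k : ℤ) : ℂ) := by push_cast; linear_combination h3
    exact Int.cast_injective h4

/-- By `tendsto_pY` and `tendsto_one_sub_picardX`, `hem` says exactly that the exponentials in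
numerator and denominator cancel. -/
theorem tendsto_pY_pow {N : ℤ} {w : ℤ × ℤ} (h : IsNormalized N w) {e m : ℕ}
    (hem : (e : ℤ) * w.1 = -(m * N)) :
    Tendsto (fun τ => (1 - pY N w τ) ^ e / (1 - picardX τ) ^ m) atImInfty
      (𝓝 (leadCoeff N w ^ e / 16 ^ m)) := by
  have hNC : (N : ℂ) ≠ 0 := by exact_mod_cast h.1.ne'
  have h1 := ((tendsto_pY h).pow e).div (tendsto_one_sub_picardX.pow m)
    (pow_ne_zero _ (by norm_num))
  refine h1.congr fun τ => ?_
  simp only [Pi.div_apply]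
  rw [mul_pow, mul_pow, ← Complex.exp_nat_mul, ← Complex.exp_nat_mul]
  have h2 : (e : ℂ) * (π * Complex.I * (w.1 / N) * τ) = m * -(π * Complex.I * τ) := by
    have h3 : (e : ℂ) * w.1 = -(m * N) := by exact_mod_cast hem
    have h4 : (e : ℂ) * (w.1 / N) = -m := by
      rw [mul_div_assoc', h3, neg_div, mul_div_cancel_right₀ _ hNC]
    linear_combination (π * Complex.I * τ) * h4
  rw [h2]
  exact mul_div_mul_right _ _ (Complex.exp_ne_zero _)

/-! ### Recovering a torsion point from the limits at a cusp. -/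

/-- If all rational expressions in `x`, `y` have the same limits at two cusps, then the two torsion
points differ by a translation that fixes the cusp. -/
theorem exists_shear_of_limits {N : ℤ} (hN : 0 < N) {w w' : ℤ × ℤ} (h1 : ¬ RowDvd (2 * N) w)
    (h2 : ¬ RowDvd (2 * N) (w + (N, 0))) (h1' : ¬ RowDvd (2 * N) w')
    (h2' : ¬ RowDvd (2 * N) (w' + (N, 0)))
    (H : ∀ (e m : ℕ) (c : ℂ),
      Tendsto (fun τ => (1 - pY N w τ) ^ e / (1 - picardX τ) ^ m) atImInfty (𝓝 c) →
      Tendsto (fun τ => (1 - pY N w' τ) ^ e / (1 - picardX τ) ^ m) atImInfty (𝓝 c)) :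
    ∃ k : ℤ, RowDvd (2 * N) (w' - (w.1, w.2 + 2 * k * w.1)) ∨
      RowDvd (2 * N) (w' + (w.1, w.2 + 2 * k * w.1)) := by
  obtain ⟨u, hu, hwu⟩ := exists_isNormalized hN h1 h2
  obtain ⟨u', hu', hwu'⟩ := exists_isNormalized hN h1' h2'
  have hy : pY N w = pY N u := funext fun τ => (pY_eq_iff hN.ne' hu.not_rowDvd h1 τ).2 hwu
  have hy' : pY N w' = pY N u' := funext fun τ => (pY_eq_iff hN.ne' hu'.not_rowDvd h1' τ).2 hwu'
  rw [hy, hy'] at H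
  -- Normalization changes a row by a sign and a multiple of `2N`, and the shear by `2k` respects
  -- both.
  suffices hs : ∃ k : ℤ, RowDvd (2 * N) (u' - (u.1, u.2 + 2 * k * u.1)) ∨
      RowDvd (2 * N) (u' + (u.1, u.2 + 2 * k * u.1)) by
    obtain ⟨k, hk⟩ := hs
    refine ⟨k, ?_⟩
    have hshear : ∀ a b : ℤ × ℤ, RowDvd (2 * N) (a - b) →
        RowDvd (2 * N) ((a.1, a.2 + 2 * k * a.1) - (b.1, b.2 + 2 * k * b.1)) := by
      rintro a b ⟨⟨i, hi⟩, ⟨j, hj⟩⟩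
      refine ⟨⟨i, hi⟩, ⟨j + 2 * k * i, ?_⟩⟩
      simp only [Prod.fst_sub, Prod.snd_sub] at *
      linear_combination hj + 2 * k * hi
    have tw : RowDvd (2 * N) ((w.1, w.2 + 2 * k * w.1) - (u.1, u.2 + 2 * k * u.1)) ∨
        RowDvd (2 * N) ((w.1, w.2 + 2 * k * w.1) + (u.1, u.2 + 2 * k * u.1)) := by
      refine hwu.imp (hshear w u) fun h => ?_
      have := hshear w (-u) (by rwa [sub_neg_eq_add])
      convert this using 1
      ext <;> (simp; try ring)
    generalize (w.1, w.2 + 2 * k * w.1) = p at tw ⊢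
    generalize (u.1, u.2 + 2 * k * u.1) = q at tw hk
    rcases hwu' with a | a <;> rcases hk with b | b <;> rcases tw with c | c
    · left; have := (a.add b).add c.neg; convert this using 1; abel
    · right; have := (a.add b).add c; convert this using 1; abel
    · right; have := (a.add b).add c; convert this using 1; abel
    · left; have := (a.add b).add c.neg; convert this using 1; abel
    · right; have := (a.add b.neg).add c; convert this using 1; abel
    · left; have := (a.add b.neg).add c.neg; convert this using 1; abel
    · left; have := (a.add b.neg).add c.neg; convert this using 1; abel
    · right; have := (a.add b.neg).add c; convert this using 1; abel
  -- The power `(1 - y)^N` is comparable with `(1 - x)^|u.1|`; since `1 - x` tends to `0`, only one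
  -- exponent gives a finite nonzero limit.
  have hfst : u'.1 = u.1 := by
    have hzn : (u.1.natAbs : ℤ) = -u.1 := by have := hu.2.2.1; omega
    have hzn' : (u'.1.natAbs : ℤ) = -u'.1 := by have := hu'.2.2.1; omega
    have hNn : (N.natAbs : ℤ) = N := by omega
    have t1 := H _ _ _ (tendsto_pY_pow hu (e := N.natAbs) (m := u.1.natAbs)
      (by rw [hzn, hNn]; ring))
    have t3 := tendsto_pY_pow hu' (e := N.natAbs) (m := u'.1.natAbs) (by rw [hzn', hNn]; ring)
    have key : ∀ (a b : ℕ) (A B : ℂ), A ≠ 0 →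
        Tendsto (fun τ => (1 - pY N u' τ) ^ N.natAbs / (1 - picardX τ) ^ a) atImInfty (𝓝 A) →
        Tendsto (fun τ => (1 - pY N u' τ) ^ N.natAbs / (1 - picardX τ) ^ b) atImInfty (𝓝 B) →
        b ≤ a := by
      intro a b A B hA ta tb
      by_contra hlt
      obtain ⟨d, rfl⟩ : ∃ d : ℕ, b = a + (d + 1) := ⟨b - a - 1, by omega⟩
      have t4 := tb.mul (one_sub_picardX_tendsto.pow (d + 1))
      have t5 := tendsto_nhds_unique ta (t4.congr fun τ => ?_)
      · rw [zero_pow (by omega), mul_zero] at t5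
        exact hA t5
      · have := one_sub_picardX_ne_zero τ
        rw [pow_add (1 - picardX τ) a]
        field_simp
    have hne : ∀ z : ℤ × ℤ, IsNormalized N z → ∀ a b : ℕ, leadCoeff N z ^ a / 16 ^ b ≠ 0 :=
      fun z hz a b => div_ne_zero (pow_ne_zero _ (leadCoeff_ne_zero hz))
        (pow_ne_zero _ (by norm_num))
    have := key _ _ _ _ (hne u hu _ _) t1 t3
    have := key _ _ _ _ (hne u' hu' _ _) t3 t1
    omega
  have hcoef : ∀ e m : ℕ, (e : ℤ) * u.1 = -(m * N) →
      leadCoeff N u ^ e = leadCoeff N u' ^ e := by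
    intro e m hem
    have t1 := H _ _ _ (tendsto_pY_pow hu hem)
    have t2 := tendsto_pY_pow hu' (e := e) (m := m) (by rw [hfst]; exact hem)
    have := tendsto_nhds_unique t1 t2
    exact (div_left_inj' (pow_ne_zero m (by norm_num : (16 : ℂ) ≠ 0))).1 this
  obtain ⟨-, a1, a2, a3⟩ := id hu
  -- On the edges `u.1 = 0` and `u.1 = -N` no shear is needed, and the sign of `u.2` can be chosen
  -- freely because `u.1` and `-u.1` agree modulo `2N`.
  have fin : (2 * N ∣ u.2 - u'.2 ∨ 2 * N ∣ u.2 + u'.2) → (u.1 = 0 ∨ u.1 = -N) →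
      ∃ k : ℤ, RowDvd (2 * N) (u' - (u.1, u.2 + 2 * k * u.1)) ∨
      RowDvd (2 * N) (u' + (u.1, u.2 + 2 * k * u.1)) := by
    rintro h h0
    refine ⟨0, ?_⟩
    rw [mul_zero, zero_mul, add_zero]
    rcases h with h | h
    · left
      exact ⟨by simp [hfst], by simpa using (dvd_neg).2 h⟩
    · right
      refine ⟨?_, by simpa [add_comm] using h⟩
      rw [Prod.fst_add, hfst]
      rcases h0 with h0 | h0 <;> rw [h0]
      · exact dvd_zero _
      · exact ⟨-1, by ring⟩
  by_cases c0 : u.1 = 0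
  · have h := hcoef 1 0 (by simp [c0])
    rw [pow_one, pow_one, leadCoeff, leadCoeff, if_pos c0, if_pos (hfst.trans c0)] at h
    rw [one_div, one_div, inv_inj] at h
    exact fin (sin_sq_eq_iff hN.ne' h) (Or.inl c0)
  by_cases c1 : u.1 = -N
  · have h := hcoef 1 1 (by simp [c1])
    rw [pow_one, pow_one, leadCoeff, leadCoeff, hfst, if_neg c0, if_neg c0, if_pos c1,
      if_pos c1] at h
    exact fin (sin_sq_eq_iff hN.ne' (mul_left_cancel₀ (by norm_num) h)) (Or.inr c1)
  -- Here `g = gcd(N, u.1)`, and `e = N/g`, `m = |u.1|/g` are the least exponents that balance. The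
  -- leading coefficients then give `u.2 ≡ u'.2` modulo `2g`, and Bézout writes a multiple of `2g`
  -- as a multiple of `2u.1`, a shear, plus a multiple of `2N`.
  obtain ⟨g, e, m, hg, hem, hNe, hum⟩ : ∃ (g : ℤ) (e m : ℕ), 0 < g ∧ IsCoprime (e : ℤ) (m : ℤ) ∧
      N = e * g ∧ u.1 = -(m * g) := by
    have hgpos : 0 < Nat.gcd N.natAbs u.1.natAbs := Nat.gcd_pos_of_pos_left _ (by omega)
    obtain ⟨e, m, hc, he, hm⟩ := Nat.exists_coprime N.natAbs u.1.natAbs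
    refine ⟨Nat.gcd N.natAbs u.1.natAbs, e, m, by exact_mod_cast hgpos,
      Nat.isCoprime_iff_coprime.2 hc, ?_, ?_⟩
    · have : (N.natAbs : ℤ) = e * (Nat.gcd N.natAbs u.1.natAbs : ℕ) := by exact_mod_cast he
      omega
    · have : (u.1.natAbs : ℤ) = m * (Nat.gcd N.natAbs u.1.natAbs : ℕ) := by exact_mod_cast hm
      omega
  have h := hcoef e m (by rw [hum, hNe]; ring)
  rw [leadCoeff, leadCoeff, hfst, if_neg c0, if_neg c0, if_neg c1, if_neg c1, mul_pow, mul_pow] at h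
  have h := mul_left_cancel₀ (pow_ne_zero e (by norm_num : (-4 : ℂ) ≠ 0)) h
  rw [← Complex.exp_nat_mul, ← Complex.exp_nat_mul] at h
  have e1 : ∀ a : ℤ, (e : ℂ) * -(2 * π * Complex.I * (a / (2 * N) : ℝ)) =
      -(2 * π * Complex.I * (((e * a : ℤ) : ℝ) / (2 * N) : ℝ)) := by
    intro a; push_cast; ring
  rw [e1, e1, exp_int_mul_eq_iff hN.ne'] at h
  obtain ⟨j, hj⟩ := h
  have he0 : (e : ℤ) ≠ 0 := by
    intro h0; rw [h0, zero_mul] at hNe; omega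
  have hj' : u.2 - u'.2 = 2 * g * j := by
    apply mul_left_cancel₀ he0
    rw [hNe] at hj
    linear_combination hj
  obtain ⟨a, b, hab⟩ := hem
  refine ⟨j * b, Or.inl ⟨by simp [hfst], ?_⟩⟩
  refine ⟨-(j * a), ?_⟩
  simp only [Prod.snd_sub]
  rw [hum, hNe]
  linear_combination -hj' + 2 * g * j * hab

end PicardUniformization

end

/-! ### Liouville's theorem, the algebra of regular functions of level `2K` and local charts. -/

noncomputable section

namespace PicardUniformization

open scoped Real Manifold
open Complex (exp)
open Filter

/-- Holomorphic functions on the upper half-plane. -/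
abbrev Holo (f : ℍ → ℂ) : Prop := MDifferentiable 𝓘(ℂ) 𝓘(ℂ) f

theorem Holo.comp_smul {f : ℍ → ℂ} (hf : Holo f) (γ : SL(2, ℤ)) : Holo (fun τ => f (γ • τ)) :=
  MDifferentiable.comp (f := fun τ : ℍ => γ • τ) hf
    (mdifferentiable_smul (g := (γ : GL (Fin 2) ℝ)) (by simp))

theorem slash_weight_zero (f : ℍ → ℂ) (γ : SL(2, ℤ)) :
    SlashAction.map (0 : ℤ) γ f = fun τ => f (γ • τ) := by
  funext τ
  rw [ModularForm.SL_slash_apply]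
  simp

theorem isBoundedAtImInfty_comp_T {f : ℍ → ℂ} (h : IsBoundedAtImInfty f) :
    IsBoundedAtImInfty (fun τ => f (ModularGroup.T • τ)) :=
  Asymptotics.IsBigO.comp_tendsto h tendsto_T_atImInfty

/-- Liouville's theorem for `Γ(2)`. -/
theorem eq_const_of_gamma_two {f : ℍ → ℂ} (hf : Holo f)
    (hinv : ∀ γ ∈ CongruenceSubgroup.Gamma 2, ∀ τ, f (γ • τ) = f τ)
    (h1 : IsBoundedAtImInfty f) (h2 : IsBoundedAtImInfty fun τ => f (ModularGroup.S • τ))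
    (h3 : IsBoundedAtImInfty fun τ => f (ModularGroup.T • ModularGroup.S • τ)) :
    ∃ c, ∀ τ, f τ = c := by
  let 𝒢 : Subgroup (GL (Fin 2) ℝ) := (CongruenceSubgroup.Gamma 2 : Subgroup SL(2, ℤ))
  -- The function is a modular form of weight zero; boundedness at all cusps reduces to the three
  -- representatives by `exists_gamma_two_mul`.
  let F : ModularForm 𝒢 0 :=
    { toFun := f
      slash_action_eq' := by
        rintro _ ⟨γ, hγ, rfl⟩
        exact (slash_weight_zero f γ).trans (funext (hinv γ hγ))
      holo' := hf
      bdd_at_cusps' := by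
        intro c hc
        have hc' : IsCusp c (MonoidHom.range (Matrix.SpecialLinearGroup.mapGL (R := ℤ) (n := Fin 2) ℝ)) :=
          (Subgroup.IsArithmetic.isCusp_iff_isCusp_SL2Z 𝒢).1 hc
        obtain ⟨γ, hγ⟩ := isCusp_SL2Z_iff'.1 hc'
        refine (OnePoint.isBoundedAt_iff_exists_SL2Z hc').2 ⟨γ, hγ.symm, ?_⟩
        rw [slash_weight_zero]
        obtain ⟨δ, hδ, σ, hσ, h⟩ := exists_gamma_two_mul γ
        have key : IsBoundedAtImInfty fun τ => f ((δ * σ) • τ) := by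
          simp_rw [mul_smul, hinv δ hδ]
          rcases hσ with rfl | rfl | rfl
          · simpa using h1
          · exact h2
          · simpa [mul_smul] using h3
        rcases h with rfl | rfl
        · exact key
        · have := isBoundedAtImInfty_comp_T key
          simpa [mul_smul] using this }
  obtain ⟨c, hc⟩ := ModularForm.eq_const_of_weight_zero F
  exact ⟨c, fun τ => congrFun hc τ⟩

theorem differentiableAt_jacobiTheta₂_comp {z w : ℂ → ℂ} {t : ℂ} (hz : DifferentiableAt ℂ z t)
    (hw : DifferentiableAt ℂ w t) (ht : 0 < (w t).im) :
    DifferentiableAt ℂ (fun t => jacobiTheta₂ (z t) (w t)) t :=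
  DifferentiableAt.comp (f := fun t => (z t, w t)) (g := fun p : ℂ × ℂ => jacobiTheta₂ p.1 p.2) t
    (hasFDerivAt_jacobiTheta₂ (z t) ht).differentiableAt (hz.prodMk hw)

theorem holo_of_differentiableAt {f : ℍ → ℂ} (F : ℂ → ℂ) (h : ∀ τ : ℍ, f τ = F τ)
    (hF : ∀ t : ℂ, 0 < t.im → DifferentiableAt ℂ F t) : Holo f := by
  refine UpperHalfPlane.mdifferentiable_iff.2 ?_
  refine DifferentiableOn.congr (f := F) (fun t ht => (hF t ht).differentiableWithinAt) ?_
  intro t ht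
  rw [Function.comp, h, ofComplex_apply_of_im_pos ht]

theorem holo_picardX : Holo picardX := by
  refine holo_of_differentiableAt (fun t => theta4 0 t ^ 4 / theta3 0 t ^ 4) (fun _ => rfl) ?_
  intro t ht
  refine DifferentiableAt.div ?_ ?_ (pow_ne_zero _ (theta3_zero_ne_zero ht))
  · simp_rw [theta4_eq]
    exact (differentiableAt_jacobiTheta₂_comp (by fun_prop) differentiableAt_id ht).pow 4
  · simp_rw [theta3_eq]
    exact (differentiableAt_jacobiTheta₂_comp (by fun_prop) differentiableAt_id ht).pow 4

theorem holo_pY {N : ℤ} (hN : N ≠ 0) {v : ℤ × ℤ} (hv : ¬ RowDvd (2 * N) v) : Holo (pY N v) := by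
  refine holo_of_differentiableAt (fun t => -(theta4 0 t ^ 2 / theta3 0 t ^ 2) *
    (theta2 (((v.1 : ℂ) * t + v.2) / (2 * N)) t ^ 2 /
      theta1 (((v.1 : ℂ) * t + v.2) / (2 * N)) t ^ 2)) (fun _ => rfl) ?_
  intro t ht
  have h0 : theta1 (((v.1 : ℂ) * t + v.2) / (2 * N)) t ≠ 0 := fun hh =>
    hv ((theta1_torsion_eq_zero_iff hN (⟨t, ht⟩ : ℍ)).1 hh)
  refine DifferentiableAt.mul (DifferentiableAt.neg (DifferentiableAt.div ?_ ?_
    (pow_ne_zero _ (theta3_zero_ne_zero ht)))) (DifferentiableAt.div ?_ ?_ (pow_ne_zero _ h0))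
  · simp_rw [theta4_eq]
    exact (differentiableAt_jacobiTheta₂_comp (by fun_prop) differentiableAt_id ht).pow 2
  · simp_rw [theta3_eq]
    exact (differentiableAt_jacobiTheta₂_comp (by fun_prop) differentiableAt_id ht).pow 2
  · simp_rw [theta2_eq]
    refine DifferentiableAt.pow (DifferentiableAt.mul ?_ ?_) 2
    · fun_prop
    · exact differentiableAt_jacobiTheta₂_comp (by fun_prop) differentiableAt_id ht
  · simp_rw [theta1_eq]
    refine DifferentiableAt.pow (DifferentiableAt.neg (DifferentiableAt.mul ?_ ?_)) 2
    · fun_prop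
    · exact differentiableAt_jacobiTheta₂_comp (by fun_prop) differentiableAt_id ht

theorem isBoundedAtImInfty_of_tendsto {f : ℍ → ℂ} {c : ℂ} (h : Tendsto f atImInfty (𝓝 c)) :
    IsBoundedAtImInfty f :=
  h.isBigO_one ℝ

theorem isBoundedAtImInfty_mul {f g : ℍ → ℂ} (hf : IsBoundedAtImInfty f)
    (hg : IsBoundedAtImInfty g) : IsBoundedAtImInfty (fun τ => f τ * g τ) :=
  (Asymptotics.IsBigO.mul hf hg).congr_right fun _ => by simp

theorem isBoundedAtImInfty_add {f g : ℍ → ℂ} (hf : IsBoundedAtImInfty f)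
    (hg : IsBoundedAtImInfty g) : IsBoundedAtImInfty (fun τ => f τ + g τ) :=
  Asymptotics.IsBigO.add hf hg

theorem isBoundedAtImInfty_const (c : ℂ) : IsBoundedAtImInfty (fun _ => c) :=
  isBoundedAtImInfty_of_tendsto tendsto_const_nhds

theorem isBoundedAtImInfty_one_sub_pow (j : ℕ) :
    IsBoundedAtImInfty (fun τ => (1 - picardX τ) ^ j) :=
  isBoundedAtImInfty_of_tendsto (one_sub_picardX_tendsto.pow j)

/-- Modular functions of level `2K`, holomorphic on the upper half-plane, bounded at the cusps over
`x = 1` and `x = 0` and with at most poles at the cusps over `x = ∞`. -/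
def regularAlgebra (K : ℕ) : Subalgebra ℂ (ℍ → ℂ) where
  carrier := {f | Holo f ∧ (∀ γ ∈ CongruenceSubgroup.Gamma (2 * K), ∀ τ, f (γ • τ) = f τ) ∧
    ∀ δ ∈ CongruenceSubgroup.Gamma 2, IsBoundedAtImInfty (fun τ => f (δ • τ)) ∧
      IsBoundedAtImInfty (fun τ => f (δ • ModularGroup.S • τ)) ∧
      ∃ j : ℕ, IsBoundedAtImInfty (fun τ => (1 - picardX τ) ^ j *
        f (δ • ModularGroup.T • ModularGroup.S • τ))}
  mul_mem' := by
    rintro f g ⟨f1, f2, f3⟩ ⟨g1, g2, g3⟩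
    refine ⟨f1.mul g1, fun γ hγ τ => ?_, fun δ hδ => ?_⟩
    · simp only [Pi.mul_apply, f2 γ hγ, g2 γ hγ]
    obtain ⟨a1, a2, i, a3⟩ := f3 δ hδ
    obtain ⟨b1, b2, j, b3⟩ := g3 δ hδ
    refine ⟨isBoundedAtImInfty_mul a1 b1, isBoundedAtImInfty_mul a2 b2, i + j, ?_⟩
    refine (isBoundedAtImInfty_mul a3 b3).congr_left fun τ => ?_
    simp only [Pi.mul_apply]; ring
  add_mem' := by
    rintro f g ⟨f1, f2, f3⟩ ⟨g1, g2, g3⟩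
    refine ⟨f1.add g1, fun γ hγ τ => ?_, fun δ hδ => ?_⟩
    · simp only [Pi.add_apply, f2 γ hγ, g2 γ hγ]
    obtain ⟨a1, a2, i, a3⟩ := f3 δ hδ
    obtain ⟨b1, b2, j, b3⟩ := g3 δ hδ
    refine ⟨isBoundedAtImInfty_add a1 b1, isBoundedAtImInfty_add a2 b2, i + j, ?_⟩
    refine (isBoundedAtImInfty_add
      (isBoundedAtImInfty_mul (isBoundedAtImInfty_one_sub_pow j) a3)
      (isBoundedAtImInfty_mul (isBoundedAtImInfty_one_sub_pow i) b3)).congr_left fun τ => ?_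
    simp only [Pi.add_apply]; ring
  algebraMap_mem' := by
    intro c
    refine ⟨mdifferentiable_const, fun γ hγ τ => rfl, fun δ hδ => ⟨isBoundedAtImInfty_const c,
      isBoundedAtImInfty_const c, 0, ?_⟩⟩
    simp only [pow_zero, one_mul]
    exact isBoundedAtImInfty_const c

theorem gamma_le_gamma_two (K : ℕ) :
    CongruenceSubgroup.Gamma (2 * K) ≤ CongruenceSubgroup.Gamma 2 := by
  intro γ hγ
  rw [CongruenceSubgroup.Gamma_mem] at hγ
  rw [mem_gamma_two_iff]
  have h : ∀ a b : ℤ, (a : ZMod (2 * K)) = b → (2 : ℤ) ∣ a - b := by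
    intro a b h
    have := (ZMod.intCast_eq_intCast_iff_dvd_sub b a (2 * K)).1 h.symm
    exact (Dvd.intro _ (by push_cast; rfl)).trans this
  refine ⟨h _ 1 (by simpa using hγ.1), ?_, ?_, h _ 1 (by simpa using hγ.2.2.2)⟩
  · simpa using h (γ 0 1) 0 (by simpa using hγ.2.1)
  · simpa using h (γ 1 0) 0 (by simpa using hγ.2.2.1)

theorem regularAlgebra_comp {K : ℕ} {f : ℍ → ℂ} (hf : f ∈ regularAlgebra K) {δ : SL(2, ℤ)}
    (hδ : δ ∈ CongruenceSubgroup.Gamma 2) : (fun τ => f (δ • τ)) ∈ regularAlgebra K := by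
  obtain ⟨h1, h2, h3⟩ := hf
  refine ⟨h1.comp_smul δ, fun γ hγ τ => ?_, fun δ' hδ' => ?_⟩
  · have := (CongruenceSubgroup.Gamma_normal (2 * K)).conj_mem γ hγ δ
    have h := h2 _ this (δ • τ)
    simpa [mul_smul] using h
  · have h := h3 _ (mul_mem hδ hδ')
    simp_rw [mul_smul] at h
    exact h

theorem picardX_mem_regularAlgebra (K : ℕ) : picardX ∈ regularAlgebra K := by
  refine ⟨holo_picardX, fun γ hγ τ => (gamma_two_smul (gamma_le_gamma_two K hγ)).1 τ,
    fun δ hδ => ?_⟩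
  simp_rw [(gamma_two_smul hδ).1, picardX_TS_smul, picardX_S_smul]
  refine ⟨isBoundedAtImInfty_of_tendsto picardX_tendsto,
    isBoundedAtImInfty_of_tendsto one_sub_picardX_tendsto, 1, ?_⟩
  refine (isBoundedAtImInfty_const 1).congr_left fun τ => ?_
  rw [pow_one, mul_inv_cancel₀ (one_sub_picardX_ne_zero τ)]

theorem pY_bounded {N : ℤ} (hN : 0 < N) {w : ℤ × ℤ} (h : ¬ RowDvd (2 * N) w)
    (h' : ¬ RowDvd (2 * N) (w + (N, 0))) : IsBoundedAtImInfty (pY N w) := by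
  by_cases h'' : RowDvd (2 * N) (w + (0, N))
  · have hd : IsDegenerate w.1 w.2 N := by
      refine Or.inl ⟨by simpa using h''.1, ?_⟩
      have : N ∣ w.2 + N := (Dvd.intro_left 2 rfl).trans h''.2
      simpa using this
    obtain ⟨c, hc⟩ := picardY_of_isDegenerate hN.ne' hd
    exact (isBoundedAtImInfty_const c).congr_left fun τ => (hc τ).symm
  · obtain ⟨L, -, hl⟩ := exists_tendsto_pY hN h h' h''
    exact isBoundedAtImInfty_of_tendsto hl

theorem rowDvd_of_mem_gamma {K : ℕ} {γ : SL(2, ℤ)}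
    (hγ : γ ∈ CongruenceSubgroup.Gamma (2 * K)) (v : ℤ × ℤ) :
    RowDvd (2 * (K : ℤ)) (rowMul v γ - v) := by
  rw [CongruenceSubgroup.Gamma_mem] at hγ
  have h : ∀ a b : ℤ, (a : ZMod (2 * K)) = b → (2 * K : ℤ) ∣ a - b := by
    intro a b h
    have := (ZMod.intCast_eq_intCast_iff_dvd_sub b a (2 * K)).1 h.symm
    exact_mod_cast this
  obtain ⟨a, ha⟩ := h (γ 0 0) 1 (by simpa using hγ.1)
  obtain ⟨b, hb⟩ := h (γ 0 1) 0 (by simpa using hγ.2.1)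
  obtain ⟨c, hc⟩ := h (γ 1 0) 0 (by simpa using hγ.2.2.1)
  obtain ⟨d, hd⟩ := h (γ 1 1) 1 (by simpa using hγ.2.2.2)
  refine ⟨⟨v.1 * a + v.2 * c, ?_⟩, ⟨v.1 * b + v.2 * d, ?_⟩⟩
  · simp only [Prod.fst_sub, rowMul_fst]; linear_combination v.1 * ha + v.2 * hc
  · simp only [Prod.snd_sub, rowMul_snd]; linear_combination v.1 * hb + v.2 * hd

theorem pY_mem_regularAlgebra {K : ℕ} (hK : 0 < K) {v : ℤ × ℤ} (hv : IsNonDeg K v) :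
    pY K v ∈ regularAlgebra K := by
  have hN : (0 : ℤ) < K := by exact_mod_cast hK
  refine ⟨holo_pY hN.ne' hv.1, fun γ hγ τ => ?_, fun δ hδ => ?_⟩
  · rw [(gamma_two_smul (gamma_le_gamma_two K hγ)).2 hN.ne' v hv.1]
    exact pY_congr hN.ne' (rowDvd_of_mem_gamma hγ v) τ
  have hw := hv.rowMul hδ
  simp_rw [(gamma_two_smul hδ).2 hN.ne' v hv.1, pY_S_smul hN.ne' hw.1, pY_TS_smul hN.ne' hw.1]
  refine ⟨pY_bounded hN hw.1 hw.2.1, ?_, 1, ?_⟩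
  · have := hw.rowMul_S
    refine (isBoundedAtImInfty_add (isBoundedAtImInfty_const 1) (isBoundedAtImInfty_mul
      (isBoundedAtImInfty_const (-1)) (pY_bounded hN this.1 this.2.1))).congr_left fun τ => ?_
    ring
  · refine (isBoundedAtImInfty_add (isBoundedAtImInfty_const 1) (isBoundedAtImInfty_mul
      (isBoundedAtImInfty_const (-1)) (pY_bounded hN (fun hh => hw.1 ((rowDvd_mul_iff _).1 hh))
        hw.rowMul_TS.1))).congr_left fun τ => ?_
    have := one_sub_picardX_ne_zero τ
    field_simp
    ring

theorem isBigO_inv_one_sub_picardX :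
    (fun τ : ℍ => (1 - picardX τ)⁻¹) =O[atImInfty] fun τ => Real.exp (π * τ.im) := by
  have h := tendsto_one_sub_picardX.inv₀ (by norm_num)
  have h2 := (h.isBigO_one ℝ).mul
    (Asymptotics.isBigO_refl (fun τ : ℍ => exp (-(π * Complex.I * τ))) atImInfty).norm_right
  refine (h2.congr_left fun τ => ?_).trans ?_
  · have h3 := one_sub_picardX_ne_zero τ
    have h4 := Complex.exp_ne_zero (-(π * Complex.I * τ))
    rw [mul_inv, mul_assoc, inv_mul_cancel₀ h4, mul_one]
  · refine Asymptotics.IsBigO.of_norm_le fun τ => ?_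
    rw [one_mul, norm_norm, Complex.norm_exp]
    simp

theorem periodic_of_smul {f : ℍ → ℂ} (h : ℕ) (hf : ∀ τ : ℍ, f ((h : ℝ) +ᵥ τ) = f τ) :
    Function.Periodic (f ∘ ofComplex) ((h : ℝ) : ℂ) := by
  intro w
  by_cases hw : 0 < w.im
  · have : 0 < (w + ((h : ℝ) : ℂ)).im := by simpa using hw
    simp only [Function.comp]
    rw [ofComplex_apply_of_im_pos hw, ofComplex_apply_of_im_pos this, ← hf ⟨w, hw⟩]
    congr 1
    ext
    simp [add_comm]
  · have : ¬ 0 < (w + ((h : ℝ) : ℂ)).im := by simpa using hw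
    simp only [Function.comp]
    rw [ofComplex_apply_of_im_nonpos (not_lt.1 hw), ofComplex_apply_of_im_nonpos (not_lt.1 this)]

theorem coe_T_pow_smul (n : ℕ) (τ : ℍ) : ((ModularGroup.T ^ n • τ : ℍ) : ℂ) = τ + n := by
  induction n with
  | zero => simp
  | succ n ih => rw [pow_succ', mul_smul, coe_T_smul, ih]; push_cast; ring

theorem T_pow_smul_eq (n : ℕ) (τ : ℍ) : ((n : ℝ) +ᵥ τ) = ModularGroup.T ^ n • τ := by
  ext
  rw [coe_T_pow_smul]
  simp [add_comm]

/-- A `Γ(2)`-invariant element of the regular algebra is a polynomial in `x`. -/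
theorem exists_polynomial_of_invariant {K : ℕ} {f : ℍ → ℂ} (hf : f ∈ regularAlgebra K)
    (hinv : ∀ γ ∈ CongruenceSubgroup.Gamma 2, ∀ τ, f (γ • τ) = f τ) :
    ∃ P : Polynomial ℂ, ∀ τ, f τ = P.eval (picardX τ) := by
  obtain ⟨j, hj⟩ := (hf.2.2 1 (one_mem _)).2.2
  simp_rw [one_smul] at hj
  induction j generalizing f with
  | zero =>
    obtain ⟨h1, h2, -⟩ := hf.2.2 1 (one_mem _)
    simp only [one_smul, pow_zero, one_mul] at h1 h2 hj
    obtain ⟨c, hc⟩ := eq_const_of_gamma_two hf.1 hinv h1 h2 hj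
    exact ⟨Polynomial.C c, fun τ => by rw [hc, Polynomial.eval_C]⟩
  | succ j ih =>
    -- Induction on the pole order at the cusp over `x = ∞`: the value at infinity `c` of `g` is the
    -- leading coefficient, and subtracting `c x^(j+1)` lowers the order by one.
    set g : ℍ → ℂ := fun τ => (1 - picardX τ) ^ (j + 1) *
      f (ModularGroup.T • ModularGroup.S • τ) with hg
    have hgper : Function.Periodic (g ∘ ofComplex) (((2 : ℕ) : ℝ) : ℂ) := by
      refine periodic_of_smul 2 fun τ => ?_
      rw [T_pow_smul_eq]
      simp only [hg]
      have hA : ModularGroup.T ^ 2 ∈ CongruenceSubgroup.Gamma 2 := by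
        rw [pow_two, ← genA_eq]; exact genA_mem
      rw [(gamma_two_smul hA).1]
      congr 1
      have := (CongruenceSubgroup.Gamma_normal 2).conj_mem _ hA (ModularGroup.T * ModularGroup.S)
      rw [← hinv _ this (ModularGroup.T • ModularGroup.S • τ)]
      congr 1
      simp only [← mul_smul]
      congr 1
      group
    have hghol : Holo g := by
      refine MDifferentiable.mul (MDifferentiable.pow ?_ _) ?_
      · exact MDifferentiable.sub mdifferentiable_const holo_picardX
      · have := hf.1.comp_smul (ModularGroup.T * ModularGroup.S)
        simpa [mul_smul] using this
    have hdecay := exp_decay_sub_atImInfty (f := g) (h := ((2 : ℕ) : ℝ)) (by norm_num) hgper hghol hj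
    set c := valueAtInfty g
    have hx : (fun τ => picardX τ ^ (j + 1)) ∈ regularAlgebra K :=
      pow_mem (picardX_mem_regularAlgebra K) (j + 1)
    have hf1 : (fun τ => f τ - c * picardX τ ^ (j + 1)) ∈ regularAlgebra K :=
      sub_mem hf (mul_mem (Subalgebra.algebraMap_mem _ c) hx)
    -- The period `2` of `g` makes `g - c` decay like `exp (-π Im τ)`, which compensates exactly one
    -- factor `(1 - x)⁻¹`.
    obtain ⟨P, hP⟩ := ih hf1 (fun γ hγ τ => by rw [hinv γ hγ, (gamma_two_smul hγ).1]) (by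
      have h1 := hdecay.mul isBigO_inv_one_sub_picardX
      refine (h1.congr (g₂ := fun _ => (1 : ℝ)) (fun τ => ?_) fun τ => ?_)
      · simp only [hg]
        rw [picardX_TS_smul, inv_pow, pow_succ (1 - picardX τ) j]
        have := one_sub_picardX_ne_zero τ
        field_simp
      · rw [← Real.exp_add]
        convert Real.exp_zero using 2
        push_cast
        ring)
    refine ⟨P + Polynomial.C c * Polynomial.X ^ (j + 1), fun τ => ?_⟩
    simp only [Polynomial.eval_add, Polynomial.eval_mul, Polynomial.eval_C, Polynomial.eval_pow,
      Polynomial.eval_X]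
    rw [← hP]; ring

theorem one_sub_picardX_not_const (c : ℂ) : ¬ ∀ τ, picardX τ = c := by
  intro h
  have h1 := tendsto_nhds_unique picardX_tendsto (tendsto_const_nhds.congr fun τ => (h τ).symm)
  have h2 := one_sub_picardX_ne_zero UpperHalfPlane.I
  rw [h, ← h1, sub_self] at h2
  exact h2 rfl

/-- If `c` were omitted, `(x - c)⁻¹` would be holomorphic, invariant under `Γ(2)` and bounded at all
cusps, hence constant. The values `0`, `1` and `∞` belong to the cusps. -/
theorem exists_picardX_eq {c : ℂ} (h0 : c ≠ 0) (h1 : c ≠ 1) : ∃ τ, picardX τ = c := by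
  by_contra hne
  push Not at hne
  have hne' : ∀ τ, picardX τ - c ≠ 0 := fun τ => sub_ne_zero.2 (hne τ)
  have hol : Holo fun τ => (picardX τ - c)⁻¹ := by
    refine UpperHalfPlane.mdifferentiable_iff.2 ?_
    have h := (UpperHalfPlane.mdifferentiable_iff.1 holo_picardX).sub_const c
    exact h.inv fun t _ => hne' _
  suffices h : ∃ d, ∀ τ, (picardX τ - c)⁻¹ = d by
    obtain ⟨d, hd⟩ := h
    refine one_sub_picardX_not_const (c + d⁻¹) fun τ => ?_
    rw [← hd τ, inv_inv]; ring
  refine eq_const_of_gamma_two hol (fun γ hγ τ => by rw [(gamma_two_smul hγ).1]) ?_ ?_ ?_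
  · exact isBoundedAtImInfty_of_tendsto ((picardX_tendsto.sub_const c).inv₀
      (sub_ne_zero.2 (Ne.symm h1)))
  · simp_rw [picardX_S_smul]
    exact isBoundedAtImInfty_of_tendsto ((one_sub_picardX_tendsto.sub_const c).inv₀
      (by simpa using h0))
  · simp_rw [picardX_TS_smul]
    have h := one_sub_picardX_tendsto.div ((one_sub_picardX_tendsto.const_mul c).const_sub 1)
      (by simp)
    refine isBoundedAtImInfty_of_tendsto (h.congr fun τ => ?_)
    have h3 := one_sub_picardX_ne_zero τ
    simp only [Pi.div_apply]
    have h4 : (1 - picardX τ)⁻¹ - c = (1 - c * (1 - picardX τ)) / (1 - picardX τ) := by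
      field_simp
    rw [h4, inv_div]

/-! ### Meromorphic charts at interior points and at cusps. -/

/-- The functions of the regular algebra are meromorphic along the filter `l`. -/
structure HasChart (K : ℕ) (l : Filter ℍ) : Prop where
  neBot : l.NeBot
  exists_chart : ∃ (z₀ : ℂ) (p : ℍ → ℂ), Tendsto p l (𝓝[≠] z₀) ∧ ∀ f ∈ regularAlgebra K,
    ∃ m : ℂ → ℂ, MeromorphicAt m z₀ ∧ (∀ᶠ τ in l, f τ = m (p τ)) ∧
      (f ≠ 0 → meromorphicOrderAt m z₀ ≠ ⊤)

theorem HasChart.eventually_ne_zero {K : ℕ} {l : Filter ℍ} (h : HasChart K l) {f : ℍ → ℂ}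
    (hf : f ∈ regularAlgebra K) (h0 : f ≠ 0) : ∀ᶠ τ in l, f τ ≠ 0 := by
  obtain ⟨z, p, hp, hm⟩ := h.exists_chart
  obtain ⟨m, hm, hfm, htop⟩ := hm f hf
  have h1 := (meromorphicOrderAt_ne_top_iff_eventually_ne_zero hm).1 (htop h0)
  filter_upwards [hfm, hp.eventually h1] with τ h2 h3
  rwa [h2]

theorem HasChart.tendsto_or {K : ℕ} {l : Filter ℍ} (h : HasChart K l) {f g : ℍ → ℂ}
    (hf : f ∈ regularAlgebra K) (hg : g ∈ regularAlgebra K) :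
    (∃ c, Tendsto (fun τ => f τ / g τ) l (𝓝 c)) ∨ Tendsto (fun τ => g τ / f τ) l (𝓝 0) := by
  obtain ⟨z, p, hp, hm⟩ := h.exists_chart
  obtain ⟨m, hm1, hfm, -⟩ := hm f hf
  obtain ⟨n, hn1, hgn, -⟩ := hm g hg
  have hq := hm1.div hn1
  rcases le_or_gt 0 (meromorphicOrderAt (m / n) z) with h0 | h0
  · left
    obtain ⟨c, hc⟩ := tendsto_nhds_of_meromorphicOrderAt_nonneg hq h0
    refine ⟨c, (hc.comp hp).congr' ?_⟩
    filter_upwards [hfm, hgn] with τ h2 h3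
    simp [h2, h3]
  · right
    have h1 : Tendsto (m / n)⁻¹ (𝓝[≠] z) (𝓝 0) :=
      tendsto_inv₀_cobounded.comp (tendsto_cobounded_of_meromorphicOrderAt_neg h0)
    refine (h1.comp hp).congr' ?_
    filter_upwards [hfm, hgn] with τ h2 h3
    simp [h2, h3]

/-- Orders are integers: if `f/g` vanishes in the chart, a high power of it outweighs any pole of
`a/b`. This makes the valuation rings of charts maximal. -/
theorem HasChart.archimedean {K : ℕ} {l : Filter ℍ} (h : HasChart K l) {f g a b : ℍ → ℂ}
    (hf : f ∈ regularAlgebra K) (hg : g ∈ regularAlgebra K) (ha : a ∈ regularAlgebra K)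
    (hb : b ∈ regularAlgebra K) :
    (∃ c, Tendsto (fun τ => g τ / f τ) l (𝓝 c)) ∨
      ∃ (n : ℕ) (c : ℂ), Tendsto (fun τ => a τ / b τ * (f τ / g τ) ^ n) l (𝓝 c) := by
  obtain ⟨z, p, hp, hm⟩ := h.exists_chart
  obtain ⟨m, hm1, hfm, -⟩ := hm f hf
  obtain ⟨n, hn1, hgn, -⟩ := hm g hg
  obtain ⟨α, hα1, haα, -⟩ := hm a ha
  obtain ⟨β, hβ1, hbβ, hβ2⟩ := hm b hb
  have hq := hm1.div hn1
  rcases le_or_gt (meromorphicOrderAt (m / n) z) 0 with h0 | h0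
  · left
    have h1 : 0 ≤ meromorphicOrderAt (n / m) z := by
      rw [← inv_div, meromorphicOrderAt_inv]
      cases hh : meromorphicOrderAt (m / n) z with
      | top => exact le_top
      | coe k =>
        rw [hh] at h0
        have : k ≤ 0 := by exact_mod_cast h0
        have h2 : (0 : ℤ) ≤ -k := by omega
        exact_mod_cast h2
    obtain ⟨c, hc⟩ := tendsto_nhds_of_meromorphicOrderAt_nonneg (hn1.div hm1) h1
    refine ⟨c, (hc.comp hp).congr' ?_⟩
    filter_upwards [hfm, hgn] with τ h2 h3
    simp [h2, h3]
  · right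
    have hr := hα1.div hβ1
    have key : ∃ k : ℕ, 0 ≤ meromorphicOrderAt (α / β * (m / n) ^ k) z := by
      cases ht : meromorphicOrderAt (m / n) z with
      | top =>
        refine ⟨1, ?_⟩
        rw [pow_one, meromorphicOrderAt_mul hr hq, ht]
        simp
      | coe t =>
        rw [ht] at h0
        have ht0 : 0 < t := by exact_mod_cast h0
        cases hu : meromorphicOrderAt (α / β) z with
        | top =>
          refine ⟨0, ?_⟩
          rw [pow_zero, mul_one, hu]
          exact le_top
        | coe u =>
          obtain ⟨n, hn⟩ : ∃ n : ℕ, 0 ≤ u + n * t := by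
            have : (u.natAbs : ℤ) ≤ u.natAbs * t := le_mul_of_one_le_right (by positivity) ht0
            exact ⟨u.natAbs, by omega⟩
          refine ⟨n, ?_⟩
          rw [meromorphicOrderAt_mul hr (hq.pow _), meromorphicOrderAt_pow hq, ht, hu]
          exact_mod_cast hn
    obtain ⟨k, hk⟩ := key
    obtain ⟨c, hc⟩ := tendsto_nhds_of_meromorphicOrderAt_nonneg (hr.mul (hq.pow k)) hk
    refine ⟨k, c, (hc.comp hp).congr' ?_⟩
    filter_upwards [hfm, hgn, haα, hbβ] with τ h2 h3 h4 h5
    simp [h2, h3, h4, h5]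

theorem hasChart_nhdsNE (K : ℕ) (τ₀ : ℍ) : HasChart K (𝓝[≠] τ₀) := by
  have : Nontrivial ℍ := ⟨UpperHalfPlane.I, (1 : ℝ) +ᵥ UpperHalfPlane.I, fun h => by
    have := congrArg UpperHalfPlane.re h
    simp at this⟩
  refine ⟨inferInstance, (τ₀ : ℂ), fun τ => (τ : ℂ), ?_, fun f hf => ?_⟩
  · refine tendsto_nhdsWithin_iff.2 ⟨?_, ?_⟩
    · exact (continuous_coe.tendsto τ₀).mono_left nhdsWithin_le_nhds
    · filter_upwards [self_mem_nhdsWithin] with τ hτ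
      exact fun h => hτ (UpperHalfPlane.ext h)
  · have hd := UpperHalfPlane.mdifferentiable_iff.1 hf.1
    refine ⟨f ∘ ofComplex, ?_, ?_, ?_⟩
    · exact (hd.analyticAt (isOpen_upperHalfPlaneSet.mem_nhds τ₀.im_pos)).meromorphicAt
    · exact Eventually.of_forall fun τ => by simp
    · intro h0 htop
      refine h0 (UpperHalfPlane.eq_zero_of_frequently hf.1 (τ := τ₀) ?_)
      rw [meromorphicOrderAt_eq_top_iff] at htop
      refine Eventually.frequently ?_
      have ht : Tendsto (fun τ : ℍ => (τ : ℂ)) (𝓝[≠] τ₀) (𝓝[≠] (τ₀ : ℂ)) := by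
        refine tendsto_nhdsWithin_iff.2 ⟨?_, ?_⟩
        · exact (continuous_coe.tendsto τ₀).mono_left nhdsWithin_le_nhds
        · filter_upwards [self_mem_nhdsWithin] with τ hτ
          exact fun h => hτ (UpperHalfPlane.ext h)
      filter_upwards [ht.eventually htop] with τ hτ
      simpa using hτ

theorem eq_zero_of_eventually_atImInfty {f : ℍ → ℂ} (hf : Holo f)
    (h : ∀ᶠ τ in atImInfty, f τ = 0) : f = 0 := by
  rw [atImInfty, eventually_comap] at h
  obtain ⟨R, hR⟩ := (eventually_gt_atTop 0).and h |>.exists_forall_of_atTop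
  have hpos : 0 < max R 1 + 1 := by positivity
  let τ₀ : ℍ := ⟨⟨0, max R 1 + 1⟩, hpos⟩
  refine UpperHalfPlane.eq_zero_of_frequently hf (τ := τ₀) (Eventually.frequently ?_)
  have ho : {τ : ℍ | R < τ.im} ∈ 𝓝 τ₀ := by
    refine (isOpen_lt continuous_const continuous_im).mem_nhds ?_
    show R < max R 1 + 1
    linarith [le_max_left R 1]
  filter_upwards [nhdsWithin_le_nhds ho] with τ hτ
  exact (hR τ.im hτ.le).2 τ rfl

theorem exists_bounded_exp_mul {K : ℕ} {f : ℍ → ℂ} (hf : f ∈ regularAlgebra K) (γ : SL(2, ℤ)) :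
    ∃ j : ℕ, IsBoundedAtImInfty fun τ => exp (π * Complex.I * τ) ^ j * f (γ • τ) := by
  have hb : IsBoundedAtImInfty fun τ : ℍ => exp (π * Complex.I * τ) := by
    refine Asymptotics.IsBigO.of_bound 1 (Eventually.of_forall fun τ => ?_)
    rw [Complex.norm_exp]
    simp [Real.pi_pos.le, τ.im_pos.le, mul_nonneg]
  have hx : IsBoundedAtImInfty fun τ => exp (π * Complex.I * τ) * (1 - picardX τ)⁻¹ := by
    refine isBoundedAtImInfty_of_tendsto ((tendsto_one_sub_picardX.inv₀ (by norm_num)).congr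
      fun τ => ?_)
    rw [mul_inv, Complex.exp_neg, inv_inv, mul_comm]
  have hpow : ∀ {g : ℍ → ℂ} (_ : IsBoundedAtImInfty g) (j : ℕ),
      IsBoundedAtImInfty fun τ => g τ ^ j := by
    intro g hg j
    have := Asymptotics.IsBigO.pow hg j
    exact this.congr_right fun _ => by simp
  obtain ⟨δ, hδ, σ, hσ, h⟩ := exists_gamma_two_mul γ
  obtain ⟨h1, h2, j, h3⟩ := hf.2.2 δ hδ
  have key : ∃ j : ℕ, IsBoundedAtImInfty fun τ => exp (π * Complex.I * τ) ^ j * f ((δ * σ) • τ) := by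
    simp_rw [mul_smul]
    rcases hσ with rfl | rfl | rfl
    · exact ⟨0, by simpa using h1⟩
    · exact ⟨0, by simpa using h2⟩
    · refine ⟨j, (isBoundedAtImInfty_mul (hpow hx j) h3).congr_left fun τ => ?_⟩
      have := one_sub_picardX_ne_zero τ
      rw [mul_pow, inv_pow, mul_smul]
      field_simp
  obtain ⟨j, hj⟩ := key
  rcases h with rfl | rfl
  · exact ⟨j, hj⟩
  · refine ⟨j, (isBoundedAtImInfty_mul (isBoundedAtImInfty_const ((-1) ^ j))
      (isBoundedAtImInfty_comp_T hj)).congr_left fun τ => ?_⟩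
    rw [coe_T_smul, mul_add, mul_one, Complex.exp_add, Complex.exp_pi_mul_I, ← mul_assoc, ← mul_pow,
      mul_smul _ ModularGroup.T]
    congr 2; ring

/-- The local parameter is `q = exp (πiτ/K)`, as `T^(2K)` lies in the normal subgroup `Γ(2K)` of
level `2K`. Since `q^K = exp (πiτ)`, a power of `q` removes the pole and the remaining function
extends holomorphically to `q = 0`. -/
theorem hasChart_cusp {K : ℕ} (hK : 0 < K) (γ : SL(2, ℤ)) :
    HasChart K (map (fun τ => γ • τ) atImInfty) := by
  have hK' : (0 : ℝ) < ((2 * K : ℕ) : ℝ) := by exact_mod_cast (by omega : 0 < 2 * K)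
  have hKC : (K : ℂ) ≠ 0 := by exact_mod_cast hK.ne'
  have hq : Tendsto (fun τ : ℍ => Function.Periodic.qParam ((2 * K : ℕ) : ℝ) τ) atImInfty
      (𝓝[≠] 0) :=
    (Function.Periodic.qParam_tendsto hK').comp tendsto_coe_atImInfty
  have hqK : ∀ τ : ℍ, Function.Periodic.qParam ((2 * K : ℕ) : ℝ) τ ^ K =
      exp (π * Complex.I * τ) := by
    intro τ
    rw [Function.Periodic.qParam, ← Complex.exp_nat_mul]
    congr 1
    push_cast
    field_simp
  refine ⟨inferInstance, 0, fun τ => Function.Periodic.qParam ((2 * K : ℕ) : ℝ) (γ⁻¹ • τ : ℍ), ?_,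
    fun f hf => ?_⟩
  · rw [tendsto_map'_iff]
    refine hq.congr fun τ => ?_
    simp
  · obtain ⟨j, hj⟩ := exists_bounded_exp_mul hf γ
    set G : ℍ → ℂ := fun τ => exp (π * Complex.I * τ) ^ j * f (γ • τ) with hG
    have hper : Function.Periodic (G ∘ ofComplex) (((2 * K : ℕ) : ℝ) : ℂ) := by
      refine periodic_of_smul (2 * K) fun τ => ?_
      rw [T_pow_smul_eq]
      simp only [hG]
      congr 1
      · rw [coe_T_pow_smul]
        congr 1
        rw [Complex.exp_eq_exp_iff_exists_int]
        exact ⟨K, by push_cast; ring⟩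
      · have hT : ModularGroup.T ^ (2 * K) ∈ CongruenceSubgroup.Gamma (2 * K) := by
          rw [CongruenceSubgroup.Gamma_mem, ← zpow_natCast, ModularGroup.coe_T_zpow]
          have := ZMod.natCast_self (2 * K)
          push_cast at this
          simp [this]
        have := (CongruenceSubgroup.Gamma_normal (2 * K)).conj_mem _ hT γ
        rw [← hf.2.1 _ this (γ • τ)]
        congr 1
        simp only [← mul_smul]
        congr 1
        group
    have hhol : Holo G := by
      refine MDifferentiable.mul (MDifferentiable.pow ?_ _) (hf.1.comp_smul γ)
      exact holo_of_differentiableAt (fun t => exp (π * Complex.I * t)) (fun _ => rfl)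
        fun t _ => by fun_prop
    have han := analyticAt_cuspFunction_zero hK' hper hhol hj
    have heq : ∀ τ : ℍ, f (γ • τ) = cuspFunction ((2 * K : ℕ) : ℝ) G
        (Function.Periodic.qParam ((2 * K : ℕ) : ℝ) τ) /
        (Function.Periodic.qParam ((2 * K : ℕ) : ℝ) τ) ^ (K * j) := by
      intro τ
      rw [eq_cuspFunction τ hK'.ne' hper, pow_mul, hqK]
      simp only [hG]
      have := Complex.exp_ne_zero (π * Complex.I * τ)
      field_simp
    refine ⟨fun q => cuspFunction ((2 * K : ℕ) : ℝ) G q / q ^ (K * j), ?_, ?_, ?_⟩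
    · exact han.meromorphicAt.div ((MeromorphicAt.id 0).pow _)
    · rw [eventually_map]
      refine Eventually.of_forall fun τ => ?_
      rw [heq]; simp
    · intro h0 htop
      rw [meromorphicOrderAt_eq_top_iff] at htop
      apply h0
      have h1 := eq_zero_of_eventually_atImInfty (hf.1.comp_smul γ) (by
        filter_upwards [hq.eventually htop] with τ hτ
        rw [heq]; exact hτ)
      funext τ
      have h2 := congrFun h1 (γ⁻¹ • τ)
      simpa using h2

theorem regularAlgebra_mul_eq_zero {K : ℕ} {f g : ℍ → ℂ} (hf : f ∈ regularAlgebra K)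
    (hg : g ∈ regularAlgebra K) (h : f * g = 0) : f = 0 ∨ g = 0 := by
  by_contra hc
  push Not at hc
  have hch := hasChart_nhdsNE K UpperHalfPlane.I
  have := hch.neBot
  obtain ⟨τ, h1, h2⟩ := ((hch.eventually_ne_zero hf hc.1).and
    (hch.eventually_ne_zero hg hc.2)).exists
  exact mul_ne_zero h1 h2 (congrFun h τ)

end PicardUniformization

end

/-! ### The topology of the extended upper half-plane and compactness of the quotients. -/

noncomputable section

namespace PicardUniformization

open Filter

theorem continuous_SL_smul (γ : SL(2, ℤ)) : Continuous fun τ : ℍ => γ • τ :=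
  continuous_const_smul (γ : GL (Fin 2) ℝ)

namespace ExtendedUHP

theorem point_injective : Function.Injective point := fun _ _ h => by injection h

theorem smul_point (γ : SL(2, ℤ)) (τ : ℍ) : γ • point τ = point (γ • τ) := rfl

theorem smul_cusp (γ : SL(2, ℤ)) (s : OnePoint ℚ) :
    γ • cusp s = cusp (Matrix.SpecialLinearGroup.mapGL ℚ γ • s) := rfl

theorem exists_smul_infty (s : OnePoint ℚ) : ∃ γ : SL(2, ℤ), cusp s = γ • cusp OnePoint.infty := by
  obtain ⟨γ, hγ⟩ := OnePoint.exists_mem_SL2 ℤ s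
  exact ⟨γ, by rw [smul_cusp, hγ]⟩

theorem isOpen_image_point {U : Set ℍ} (hU : IsOpen U) : IsOpen (point '' U) :=
  TopologicalSpace.isOpen_generateFrom_of_mem (Or.inl ⟨U, hU, rfl⟩)

theorem isOpen_smul_horoball (γ : SL(2, ℤ)) {R : ℝ} (hR : 0 < R) :
    IsOpen ((fun z => γ • z) '' horoball R) :=
  TopologicalSpace.isOpen_generateFrom_of_mem (Or.inr ⟨γ, R, hR, rfl⟩)

theorem point_mem_horoball {τ : ℍ} {R : ℝ} : point τ ∈ horoball R ↔ R < τ.im := by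
  constructor
  · rintro (⟨τ', h, h'⟩ | h)
    · rwa [← point_injective h']
    · cases h
  · exact fun h => Or.inl ⟨τ, h, rfl⟩

theorem cusp_mem_horoball {s : OnePoint ℚ} {R : ℝ} :
    cusp s ∈ horoball R ↔ s = OnePoint.infty := by
  constructor
  · rintro (⟨τ', h, h'⟩ | h)
    · cases h'
    · injection h
  · rintro rfl
    exact Or.inr rfl

theorem mem_smul_horoball {γ : SL(2, ℤ)} {z : ExtendedUHP} {R : ℝ} :
    z ∈ (fun z => γ • z) '' horoball R ↔ γ⁻¹ • z ∈ horoball R := by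
  constructor
  · rintro ⟨w, hw, rfl⟩
    simpa using hw
  · exact fun h => ⟨_, h, by simp⟩

theorem continuous_point : Continuous point := by
  refine continuous_generateFrom_iff.2 ?_
  rintro _ (⟨U, hU, rfl⟩ | ⟨γ, R, hR, rfl⟩)
  · rwa [Set.preimage_image_eq _ point_injective]
  · have : point ⁻¹' ((fun z => γ • z) '' horoball R) = {τ | R < (γ⁻¹ • τ).im} := by
      ext τ
      rw [Set.mem_preimage, mem_smul_horoball, smul_point, point_mem_horoball]
      rfl
    rw [this]
    exact isOpen_lt continuous_const (UpperHalfPlane.continuous_im.comp (continuous_SL_smul _))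

theorem isOpenEmbedding_point : Topology.IsOpenEmbedding point :=
  .of_continuous_injective_isOpenMap continuous_point point_injective
    fun _ hU => isOpen_image_point hU

instance : ContinuousConstSMul SL(2, ℤ) ExtendedUHP where
  continuous_const_smul γ := by
    refine continuous_generateFrom_iff.2 ?_
    rintro _ (⟨U, hU, rfl⟩ | ⟨δ, R, hR, rfl⟩)
    · have : (fun z : ExtendedUHP => γ • z) ⁻¹' (point '' U) = point '' ((fun τ => γ • τ) ⁻¹' U) := by
        ext z
        constructor
        · rintro ⟨τ, hτ, h⟩
          exact ⟨γ⁻¹ • τ, by simpa using hτ, by rw [← smul_point, h, inv_smul_smul]⟩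
        · rintro ⟨τ, hτ, rfl⟩
          exact ⟨γ • τ, hτ, rfl⟩
      rw [this]
      exact isOpen_image_point (hU.preimage (continuous_SL_smul γ))
    · have : (fun z : ExtendedUHP => γ • z) ⁻¹' ((fun z => δ • z) '' horoball R) =
          (fun z => (γ⁻¹ * δ) • z) '' horoball R := by
        ext z
        rw [Set.mem_preimage, mem_smul_horoball, mem_smul_horoball, smul_smul]
        simp
      rw [this]
      exact isOpen_smul_horoball _ hR

theorem im_smul_eq_of_smul_infty {γ : SL(2, ℤ)}
    (h : γ • cusp OnePoint.infty = cusp OnePoint.infty) (τ : ℍ) : (γ • τ).im = τ.im := by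
  rw [smul_cusp] at h
  have h1 : Matrix.SpecialLinearGroup.mapGL ℚ γ • (OnePoint.infty : OnePoint ℚ) =
    OnePoint.infty := by injection h
  rw [OnePoint.smul_infty_eq_self_iff] at h1
  have h2 : γ 1 0 = 0 := by simpa using h1
  have h3 := det_eq_one γ
  rw [h2, mul_zero, sub_zero] at h3
  have h4 : γ 1 1 = 1 ∨ γ 1 1 = -1 := Int.isUnit_iff.1 (IsUnit.of_mul_eq_one_right _ h3)
  rw [ModularGroup.im_smul_eq_div_normSq, ModularGroup.denom_apply, h2]
  rcases h4 with h4 | h4 <;> simp [h4]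

/-- A translated horoball that contains `∞` comes from an element fixing `∞`, which preserves
imaginary parts. -/
theorem tendsto_point_cusp : Tendsto point atImInfty (𝓝 (cusp OnePoint.infty)) := by
  refine TopologicalSpace.tendsto_nhds_generateFrom_iff.2 ?_
  rintro _ (⟨U, hU, rfl⟩ | ⟨γ, R, hR, rfl⟩) hmem
  · obtain ⟨τ, -, h⟩ := hmem
    cases h
  · have h1 := mem_smul_horoball.1 hmem
    rw [smul_cusp, cusp_mem_horoball] at h1
    have h2 : γ⁻¹ • cusp OnePoint.infty = cusp OnePoint.infty := by rw [smul_cusp, h1]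
    filter_upwards [tendsto_im_atImInfty.eventually_gt_atTop R] with τ hτ
    rw [Set.mem_preimage, mem_smul_horoball, smul_point, point_mem_horoball,
      im_smul_eq_of_smul_infty h2]
    exact hτ

instance : T1Space ExtendedUHP := by
  refine t1Space_iff_exists_open.2 ?_
  intro p q hpq
  cases p with
  | point τ =>
    cases q with
    | point τ' =>
      refine ⟨_, isOpen_image_point (U := {τ'}ᶜ) isOpen_compl_singleton,
        ⟨τ, fun h => hpq (congrArg point h), rfl⟩, ?_⟩
      rintro ⟨w, hw, h⟩
      exact hw (point_injective h)
    | cusp s =>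
      refine ⟨_, isOpen_image_point isOpen_univ, ⟨τ, trivial, rfl⟩, ?_⟩
      rintro ⟨w, -, h⟩
      cases h
  | cusp s =>
    obtain ⟨γ, hγ⟩ := exists_smul_infty s
    rw [hγ] at hpq ⊢
    cases q with
    | point τ =>
      refine ⟨_, isOpen_smul_horoball γ (γ⁻¹ • τ).im_pos, ⟨_, Or.inr rfl, rfl⟩, ?_⟩
      rw [mem_smul_horoball, smul_point, point_mem_horoball]
      exact lt_irrefl _
    | cusp s' =>
      refine ⟨_, isOpen_smul_horoball γ one_pos, ⟨_, Or.inr rfl, rfl⟩, ?_⟩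
      rw [mem_smul_horoball, smul_cusp, cusp_mem_horoball]
      intro h
      apply hpq
      rw [← h, ← smul_cusp, smul_inv_smul]

/-- The punctured neighbourhoods of a point of the extended upper half-plane. -/
def punctured (p : ExtendedUHP) : Filter ℍ := comap point (𝓝[≠] p)

theorem punctured_point (τ : ℍ) : punctured (point τ) = 𝓝[≠] τ := by
  rw [punctured, nhdsWithin, comap_inf, comap_principal, nhdsWithin,
    ← isOpenEmbedding_point.isInducing.nhds_eq_comap]
  congr 2
  ext w
  simp [point_injective.eq_iff]

theorem punctured_infty : punctured (cusp OnePoint.infty) = atImInfty := by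
  apply le_antisymm
  · rw [atImInfty, ← tendsto_iff_comap, tendsto_atTop]
    intro b
    refine mem_comap.2 ⟨horoball (max b 1), ?_, ?_⟩
    · apply nhdsWithin_le_nhds
      have h := isOpen_smul_horoball 1 (R := max b 1) (by positivity)
      simp only [one_smul, Set.image_id'] at h
      exact h.mem_nhds (Or.inr rfl)
    · intro τ hτ
      have := point_mem_horoball.1 hτ
      exact (le_max_left b 1).trans this.le
  · rw [punctured, ← tendsto_iff_comap]
    refine tendsto_nhdsWithin_iff.2 ⟨tendsto_point_cusp, Eventually.of_forall fun τ h => ?_⟩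
    cases h

theorem punctured_smul (γ : SL(2, ℤ)) (p : ExtendedUHP) :
    punctured (γ • p) = map (fun τ => γ • τ) (punctured p) := by
  have h1 : map (fun τ : ℍ => γ • τ) = comap (fun τ : ℍ => γ⁻¹ • τ) := by
    funext l
    refine map_eq_comap_of_inverse ?_ ?_ <;> funext τ <;> simp
  rw [h1, punctured, punctured, comap_comap]
  have h2 : 𝓝[≠] (γ • p) = comap (fun z => γ⁻¹ • z) (𝓝[≠] p) := by
    rw [nhdsWithin, nhdsWithin, comap_inf, comap_principal]
    congr 1
    · have := (Homeomorph.smul γ⁻¹ : ExtendedUHP ≃ₜ ExtendedUHP).isInducing.nhds_eq_comap (γ • p)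
      rw [Homeomorph.smul_apply, inv_smul_smul] at this
      exact this
    · congr 1
      ext z
      simp [inv_smul_eq_iff]
  rw [h2, comap_comap]
  rfl

theorem hasChart_punctured {K : ℕ} (hK : 0 < K) (p : ExtendedUHP) : HasChart K (punctured p) := by
  cases p with
  | point τ => rw [punctured_point]; exact hasChart_nhdsNE K τ
  | cusp s =>
    obtain ⟨γ, hγ⟩ := exists_smul_infty s
    rw [hγ, punctured_smul, punctured_infty]
    exact hasChart_cusp hK γ

/-- Near `p` every point other than `p` has `p` outside a small neighbourhood, so a punctured
neighbourhood of `p` is also one of nearby points. This turns the existence of limits into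
continuity in `continuous_placeOf`. -/
theorem eventually_mem_punctured {p : ExtendedUHP} {S : Set ℍ} (hS : S ∈ punctured p) :
    ∀ᶠ p' in 𝓝 p, S ∈ punctured p' := by
  obtain ⟨t, ht, hts⟩ := mem_comap.1 hS
  have h1 := eventually_eventually_nhdsWithin.2 (show ∀ᶠ z in 𝓝[≠] p, z ∈ t from ht)
  rw [eventually_nhdsWithin_iff] at h1
  filter_upwards [h1] with q hq
  by_cases h : q = p
  · rwa [h]
  · have h2 := hq h
    rw [(isOpen_compl_singleton (x := p)).nhdsWithin_eq h] at h2
    exact mem_comap.2 ⟨t, nhdsWithin_le_nhds h2, hts⟩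

/-- An ultrafilter on this set either contains some truncated fundamental domain, which is compact,
or leaves all of them and then converges to the cusp. -/
theorem isCompact_fundamental :
    IsCompact (insert (cusp OnePoint.infty) (point '' ModularGroup.fd)) := by
  refine isCompact_iff_ultrafilter_le_nhds.2 fun f hf => ?_
  by_cases h : ∃ R, point '' (ModularGroup.truncatedFundamentalDomain R) ∈ f
  · obtain ⟨R, hR⟩ := h
    have hc := (ModularGroup.isCompact_truncatedFundamentalDomain R).image continuous_point
    obtain ⟨x, ⟨τ, hτ, rfl⟩, hx⟩ := isCompact_iff_ultrafilter_le_nhds.1 hc f (by simpa using hR)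
    exact ⟨_, Or.inr ⟨τ, hτ.1, rfl⟩, hx⟩
  · push Not at h
    refine ⟨_, Or.inl rfl, fun S hS => ?_⟩
    have h1 := tendsto_point_cusp hS
    rw [atImInfty, mem_map, mem_comap] at h1
    obtain ⟨t, ht, hts⟩ := h1
    obtain ⟨R, hR⟩ := mem_atTop_sets.1 ht
    have h2 := Ultrafilter.compl_mem_iff_notMem.2 (h R)
    have h3 : insert (cusp OnePoint.infty) (point '' ModularGroup.fd) ∈ f := by simpa using hf
    filter_upwards [h2, h3] with z hz hz'
    rcases hz' with rfl | ⟨τ, hτ, rfl⟩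
    · exact mem_of_mem_nhds hS
    · refine hts (hR _ ?_)
      by_contra hlt
      exact hz ⟨τ, ⟨hτ, (not_le.1 hlt).le⟩, rfl⟩

theorem exists_smul_mem_fundamental (z : ExtendedUHP) :
    ∃ γ : SL(2, ℤ), γ • z ∈ insert (cusp OnePoint.infty) (point '' ModularGroup.fd) := by
  cases z with
  | point τ =>
    obtain ⟨γ, hγ⟩ := ModularGroup.exists_smul_mem_fd τ
    exact ⟨γ, Or.inr ⟨_, hγ, rfl⟩⟩
  | cusp s =>
    obtain ⟨γ, hγ⟩ := exists_smul_infty s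
    exact ⟨γ⁻¹, Or.inl (by rw [hγ, inv_smul_smul])⟩

end ExtendedUHP

open ExtendedUHP

/-- One translate of the compact fundamental set for each of the finitely many cosets covers the
quotient. -/
theorem compactSpace_compactifiedQuotient (Γ : Subgroup SL(2, ℤ)) [Γ.FiniteIndex] :
    CompactSpace (CompactifiedQuotient Γ) := by
  refine ⟨?_⟩
  have hq : Continuous (Quotient.mk (MulAction.orbitRel Γ ExtendedUHP)) := continuous_quot_mk
  have : Finite (SL(2, ℤ) ⧸ Γ) := Subgroup.finite_quotient_of_finiteIndex
  have hU : (Set.univ : Set (CompactifiedQuotient Γ)) = ⋃ q : SL(2, ℤ) ⧸ Γ,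
      Quotient.mk (MulAction.orbitRel Γ ExtendedUHP) '' ((fun z => (Quotient.out q)⁻¹ • z) ''
        insert (cusp OnePoint.infty) (point '' ModularGroup.fd)) := by
    refine (Set.eq_univ_of_forall fun x => ?_).symm
    induction x using Quotient.inductionOn with
    | h z =>
      obtain ⟨γ, hγ⟩ := exists_smul_mem_fundamental z
      refine Set.mem_iUnion.2 ⟨(γ : SL(2, ℤ) ⧸ Γ), _, ⟨_, hγ, rfl⟩, ?_⟩
      obtain ⟨h, hh⟩ := QuotientGroup.mk_out_eq_mul Γ γ
      refine Quotient.sound ((MulAction.orbitRel_apply).2 ⟨h⁻¹, ?_⟩)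
      have e : (Quotient.out (γ : SL(2, ℤ) ⧸ Γ)) = γ * h := hh
      simp only [e]
      rw [Subgroup.smul_def, smul_smul]
      simp
  rw [hU]
  exact isCompact_iUnion fun q => (isCompact_fundamental.image (continuous_const_smul _)).image hq

/-! ### Norms from level `2K` to level `2`. -/

instance (n : ℕ) : (CongruenceSubgroup.Gamma n).Normal := CongruenceSubgroup.Gamma_normal n

/-- The quotient `Γ(2) / Γ(2K)`. -/
abbrev LevelQuotient (K : ℕ) : Type :=
  CongruenceSubgroup.Gamma 2 ⧸ (CongruenceSubgroup.Gamma (2 * K)).subgroupOf (CongruenceSubgroup.Gamma 2)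

theorem finite_levelQuotient {K : ℕ} (hK : 0 < K) : Finite (LevelQuotient K) := by
  have : NeZero (2 * K) := ⟨by omega⟩
  exact Subgroup.finite_quotient_of_finiteIndex

/-- The translate of `f` by an element of `Γ(2) / Γ(2K)`. -/
def translate {K : ℕ} (f : ℍ → ℂ) (q : LevelQuotient K) (τ : ℍ) : ℂ :=
  f ((Quotient.out q : CongruenceSubgroup.Gamma 2) • τ)

theorem translate_mk {K : ℕ} {f : ℍ → ℂ} (hf : f ∈ regularAlgebra K)
    (δ : CongruenceSubgroup.Gamma 2) (τ : ℍ) :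
    translate f (δ : LevelQuotient K) τ = f (δ • τ) := by
  obtain ⟨⟨γ, hγ⟩, h⟩ := QuotientGroup.mk_out_eq_mul
    ((CongruenceSubgroup.Gamma (2 * K)).subgroupOf (CongruenceSubgroup.Gamma 2)) δ
  unfold translate
  have e : (Quotient.out (δ : LevelQuotient K)) = δ * γ := h
  rw [e]
  have h1 := (CongruenceSubgroup.Gamma_normal (2 * K)).conj_mem _ hγ (δ : SL(2, ℤ))
  rw [← hf.2.1 _ h1 (δ • τ)]
  congr 1
  simp only [Subgroup.smul_def, smul_smul]
  congr 1
  simp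

theorem translate_mem {K : ℕ} {f : ℍ → ℂ} (hf : f ∈ regularAlgebra K) (q : LevelQuotient K) :
    translate f q ∈ regularAlgebra K :=
  regularAlgebra_comp hf (Quotient.out q : CongruenceSubgroup.Gamma 2).2

theorem translate_one {K : ℕ} {f : ℍ → ℂ} (hf : f ∈ regularAlgebra K) :
    translate f (1 : LevelQuotient K) = f := by
  funext τ
  have := translate_mk hf 1 τ
  simpa using this

theorem translate_smul {K : ℕ} {f : ℍ → ℂ} (hf : f ∈ regularAlgebra K) (q : LevelQuotient K)
    (δ : CongruenceSubgroup.Gamma 2) (τ : ℍ) :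
    translate f q (δ • τ) = translate f (q * (QuotientGroup.mk δ : LevelQuotient K)) τ := by
  induction q using QuotientGroup.induction_on with
  | H g =>
    rw [translate_mk hf, ← QuotientGroup.mk_mul, translate_mk hf, mul_smul]

theorem translate_ne_zero {K : ℕ} {f : ℍ → ℂ} (h : f ≠ 0) (q : LevelQuotient K) :
    translate f q ≠ 0 := by
  intro h0
  apply h
  funext τ
  have := congrFun h0 ((Quotient.out q : CongruenceSubgroup.Gamma 2)⁻¹ • τ)
  simpa [translate] using this

/-- The norm of the linear polynomial `a T - b` from level `2K` to level `2`. -/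
def normPoly {K : ℕ} [Fintype (LevelQuotient K)] (a b : ℍ → ℂ) (τ : ℍ) : Polynomial ℂ :=
  ∏ q : LevelQuotient K, (Polynomial.C (translate a q τ) * Polynomial.X -
    Polynomial.C (translate b q τ))

theorem normPoly_smul {K : ℕ} [Fintype (LevelQuotient K)] {a b : ℍ → ℂ} (ha : a ∈ regularAlgebra K)
    (hb : b ∈ regularAlgebra K) (δ : CongruenceSubgroup.Gamma 2) (τ : ℍ) :
    normPoly (K := K) a b (δ • τ) = normPoly (K := K) a b τ := by
  unfold normPoly
  simp_rw [translate_smul ha, translate_smul hb]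
  exact Equiv.prod_comp (Equiv.mulRight (δ : LevelQuotient K)) (fun q : LevelQuotient K =>
    (Polynomial.C (translate a q τ) * Polynomial.X - Polynomial.C (translate b q τ)))

theorem normPoly_coeff_mem {K : ℕ} [Fintype (LevelQuotient K)] {a b : ℍ → ℂ}
    (ha : a ∈ regularAlgebra K) (hb : b ∈ regularAlgebra K) (i : ℕ) :
    (fun τ => (normPoly (K := K) a b τ).coeff i) ∈ regularAlgebra K := by
  let R : Polynomial (regularAlgebra K) := ∏ q : LevelQuotient K,
    (Polynomial.C ⟨translate a q, translate_mem ha q⟩ * Polynomial.X -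
      Polynomial.C ⟨translate b q, translate_mem hb q⟩)
  have h : (fun τ => (normPoly (K := K) a b τ).coeff i) = (R.coeff i : ℍ → ℂ) := by
    funext τ
    let φ : regularAlgebra K →+* ℂ := (Pi.evalRingHom _ τ).comp (regularAlgebra K).val.toRingHom
    have h1 : normPoly (K := K) a b τ = R.map φ := by
      simp only [R, normPoly, Polynomial.map_prod, Polynomial.map_sub, Polynomial.map_mul,
        Polynomial.map_C, Polynomial.map_X]
      rfl
    rw [h1, Polynomial.coeff_map]
    rfl
  rw [h]
  exact (R.coeff i).2

/-- The coefficients are symmetric in the translates by `Γ(2)/Γ(2K)`, hence invariant under `Γ(2)`.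
-/
theorem exists_polynomial_normPoly {K : ℕ} [Fintype (LevelQuotient K)] {a b : ℍ → ℂ}
    (ha : a ∈ regularAlgebra K) (hb : b ∈ regularAlgebra K) :
    ∃ P : ℕ → Polynomial ℂ, ∀ i τ, (P i).eval (picardX τ) = (normPoly (K := K) a b τ).coeff i := by
  have h : ∀ i, ∃ P : Polynomial ℂ, ∀ τ, (normPoly (K := K) a b τ).coeff i = P.eval (picardX τ) :=
    fun i => exists_polynomial_of_invariant (normPoly_coeff_mem ha hb i)
      fun γ hγ τ => by
        have := normPoly_smul ha hb ⟨γ, hγ⟩ τ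
        rw [← this]; rfl
  choose P hP using h
  exact ⟨P, fun i τ => (hP i τ).symm⟩

theorem normPoly_natDegree_le {K : ℕ} [Fintype (LevelQuotient K)] (a b : ℍ → ℂ) (τ : ℍ) :
    (normPoly (K := K) a b τ).natDegree ≤ Fintype.card (LevelQuotient K) := by
  refine (Polynomial.natDegree_prod_le _ _).trans ?_
  refine (Finset.sum_le_card_nsmul _ _ 1 fun q _ => ?_).trans (by simp)
  refine (Polynomial.natDegree_sub_le _ _).trans (max_le ?_ (by simp))
  exact Polynomial.natDegree_C_mul_le _ _ |>.trans Polynomial.natDegree_X_le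

theorem normPoly_coeff_card {K : ℕ} [Fintype (LevelQuotient K)] (a b : ℍ → ℂ) (τ : ℍ) :
    (normPoly (K := K) a b τ).coeff (Fintype.card (LevelQuotient K)) =
      ∏ q : LevelQuotient K, translate a q τ := by
  have h := Polynomial.coeff_prod_of_natDegree_le (s := Finset.univ) (fun q : LevelQuotient K =>
    (Polynomial.C (translate a q τ) * Polynomial.X - Polynomial.C (translate b q τ))) 1
    (fun q _ => (Polynomial.natDegree_sub_le _ _).trans (max_le
      (Polynomial.natDegree_C_mul_le _ _ |>.trans Polynomial.natDegree_X_le) (by simp)))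
  rw [mul_one, Finset.card_univ] at h
  rw [normPoly, h]
  simp

/-- The factor of the trivial coset has the root `b/a`. The homogeneous form remains valid where `a`
vanishes. -/
theorem normPoly_homogeneous {K : ℕ} [Fintype (LevelQuotient K)] {a b : ℍ → ℂ}
    (ha : a ∈ regularAlgebra K) (hb : b ∈ regularAlgebra K) (τ : ℍ) :
    ∑ i ∈ Finset.range (Fintype.card (LevelQuotient K) + 1), (normPoly (K := K) a b τ).coeff i *
      (b τ ^ i * a τ ^ (Fintype.card (LevelQuotient K) - i)) = 0 := by
  set n := Fintype.card (LevelQuotient K)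
  by_cases h : a τ = 0
  · refine Finset.sum_eq_zero fun i hi => ?_
    rcases (Nat.lt_succ_iff.1 (Finset.mem_range.1 hi)).lt_or_eq with h1 | h1
    · rw [h, zero_pow (by omega)]; ring
    · rw [h1, normPoly_coeff_card, Finset.prod_eq_zero (Finset.mem_univ (1 : LevelQuotient K)),
        zero_mul]
      rw [translate_one ha, h]
  · have h1 : (normPoly (K := K) a b τ).eval (b τ / a τ) = 0 := by
      rw [normPoly, Polynomial.eval_prod]
      refine Finset.prod_eq_zero (Finset.mem_univ (1 : LevelQuotient K)) ?_
      rw [translate_one ha, translate_one hb]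
      simp only [Polynomial.eval_sub, Polynomial.eval_mul, Polynomial.eval_C, Polynomial.eval_X]
      field_simp
      ring
    rw [Polynomial.eval_eq_sum_range' (Nat.lt_succ_of_le (normPoly_natDegree_le a b τ))] at h1
    have h2 : ∀ i ∈ Finset.range (n + 1), (normPoly (K := K) a b τ).coeff i *
        (b τ ^ i * a τ ^ (n - i)) = a τ ^ n * ((normPoly (K := K) a b τ).coeff i *
        (b τ / a τ) ^ i) := by
      intro i hi
      have h3 : a τ ^ n = a τ ^ (n - i) * a τ ^ i := by
        rw [← pow_add, Nat.sub_add_cancel (Nat.lt_succ_iff.1 (Finset.mem_range.1 hi))]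
      rw [h3, div_pow]
      field_simp
    rw [Finset.sum_congr rfl h2, ← Finset.mul_sum, h1, mul_zero]

theorem tendsto_coeff_prod {α ι : Type*} {l : Filter α} (s : Finset ι) {r : ι → α → ℂ} {ρ : ι → ℂ}
    (h : ∀ q ∈ s, Tendsto (r q) l (𝓝 (ρ q))) (i : ℕ) :
    Tendsto (fun t => (∏ q ∈ s, (Polynomial.X - Polynomial.C (r q t))).coeff i) l
      (𝓝 ((∏ q ∈ s, (Polynomial.X - Polynomial.C (ρ q))).coeff i)) := by
  classical
  induction s using Finset.induction_on generalizing i with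
  | empty => simpa using tendsto_const_nhds
  | insert a s ha ih =>
    have ih := ih fun q hq => h q (Finset.mem_insert_of_mem hq)
    have h0 := h a (Finset.mem_insert_self a s)
    simp_rw [Finset.prod_insert ha, sub_mul, Polynomial.coeff_sub, Polynomial.coeff_C_mul]
    refine Tendsto.sub ?_ (h0.mul (ih i))
    cases i with
    | zero => simpa using tendsto_const_nhds
    | succ i => simp_rw [Polynomial.coeff_X_mul]; exact ih i

/-- Up to sign, these ratios are elementary symmetric functions of the translates of `b/a`. -/
theorem tendsto_normPoly_ratio {K : ℕ} [Fintype (LevelQuotient K)] {a b : ℍ → ℂ} {l : Filter ℍ}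
    (hl : ∀ q : LevelQuotient K, ∀ᶠ τ in l, translate a q τ ≠ 0)
    (h : ∀ q : LevelQuotient K, ∃ c, Tendsto (fun τ => translate b q τ / translate a q τ) l (𝓝 c))
    (i : ℕ) : ∃ c, Tendsto (fun τ => (normPoly (K := K) a b τ).coeff i /
      (normPoly (K := K) a b τ).coeff (Fintype.card (LevelQuotient K))) l (𝓝 c) := by
  choose ρ hρ using h
  refine ⟨_, (tendsto_coeff_prod Finset.univ (fun q _ => hρ q) i).congr' ?_⟩
  filter_upwards [eventually_all.2 hl] with τ hτ
  rw [normPoly_coeff_card]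
  have h1 : normPoly (K := K) a b τ = Polynomial.C (∏ q : LevelQuotient K, translate a q τ) *
      ∏ q : LevelQuotient K,
        (Polynomial.X - Polynomial.C (translate b q τ / translate a q τ)) := by
    rw [map_prod, ← Finset.prod_mul_distrib, normPoly]
    refine Finset.prod_congr rfl fun q _ => ?_
    rw [mul_sub, ← Polynomial.C_mul, mul_div_cancel₀ _ (hτ q)]
  rw [h1, Polynomial.coeff_C_mul, mul_div_cancel_left₀ _ (Finset.prod_ne_zero_iff.2 fun q _ => hτ q)]

/-! ### The equation of the curve. -/

/-- Substitution of `x(τ)` and `y(τ)` into polynomials in two variables. -/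
def substXY (y : ℍ → ℂ) : MvPolynomial (Fin 2) ℂ →ₐ[ℂ] (ℍ → ℂ) :=
  MvPolynomial.aeval ![picardX, y]

theorem substXY_apply (y : ℍ → ℂ) (p : MvPolynomial (Fin 2) ℂ) (τ : ℍ) :
    substXY y p τ = MvPolynomial.eval ![picardX τ, y τ] p := by
  have h : (Pi.evalAlgHom ℂ (fun _ : ℍ => ℂ) τ).comp (substXY y) =
      MvPolynomial.aeval ![picardX τ, y τ] := by
    refine MvPolynomial.algHom_ext fun i => ?_
    fin_cases i <;> simp [substXY]
  have := DFunLike.congr_fun h p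
  rw [← MvPolynomial.coe_aeval_eq_eval]
  exact this

theorem substXY_X_zero (y : ℍ → ℂ) : substXY y (MvPolynomial.X 0) = picardX := by
  simp [substXY]

theorem substXY_X_one (y : ℍ → ℂ) : substXY y (MvPolynomial.X 1) = y := by
  simp [substXY]

theorem substXY_mem {K : ℕ} {y : ℍ → ℂ} (hy : y ∈ regularAlgebra K)
    (p : MvPolynomial (Fin 2) ℂ) : substXY y p ∈ regularAlgebra K := by
  induction p using MvPolynomial.induction_on with
  | C c => rw [← MvPolynomial.algebraMap_eq, AlgHom.commutes]; exact Subalgebra.algebraMap_mem _ c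
  | add p q hp hq => rw [map_add]; exact add_mem hp hq
  | mul_X p i hp =>
    rw [map_mul]
    refine mul_mem hp ?_
    fin_cases i
    · exact (substXY_X_zero y).symm ▸ picardX_mem_regularAlgebra K
    · exact (substXY_X_one y).symm ▸ hy

theorem ker_substXY_isPrime {K : ℕ} {y : ℍ → ℂ} (hy : y ∈ regularAlgebra K) :
    (RingHom.ker (substXY y)).IsPrime := by
  refine ⟨fun h => ?_, fun {p q} h => ?_⟩
  · have : (1 : MvPolynomial (Fin 2) ℂ) ∈ RingHom.ker (substXY y) := by rw [h]; trivial
    rw [RingHom.mem_ker, map_one] at this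
    exact one_ne_zero (congrFun this UpperHalfPlane.I)
  · rw [RingHom.mem_ker, map_mul] at h
    exact regularAlgebra_mul_eq_zero (substXY_mem hy p) (substXY_mem hy q) h

theorem eval_aeval_X_zero (z : Fin 2 → ℂ) (P : Polynomial ℂ) :
    MvPolynomial.eval z (Polynomial.aeval (MvPolynomial.X 0) P) = P.eval (z 0) := by
  have h := Polynomial.aeval_algHom_apply (MvPolynomial.aeval z : MvPolynomial (Fin 2) ℂ →ₐ[ℂ] ℂ)
    (MvPolynomial.X 0) P
  rw [MvPolynomial.aeval_X, Polynomial.coe_aeval_eq_eval] at h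
  rw [h, ← MvPolynomial.coe_aeval_eq_eval]
  rfl

theorem substXY_polynomial (y : ℍ → ℂ) (P : Polynomial ℂ) (τ : ℍ) :
    substXY y (Polynomial.aeval (MvPolynomial.X 0) P) τ = P.eval (picardX τ) := by
  rw [substXY_apply, eval_aeval_X_zero]
  rfl

/-- The norm equation of `y` is monic in the second variable, hence a nonzero element of the prime
ideal of relations; a nonzero prime ideal of a factorial ring contains a prime element. -/
theorem exists_curve {K : ℕ} (hK : 0 < K) {y : ℍ → ℂ} (hy : y ∈ regularAlgebra K) :
    ∃ C : PlaneCurve, ∀ τ : ℍ, MvPolynomial.eval ![picardX τ, y τ] C.poly = 0 := by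
  have := finite_levelQuotient hK
  have := Fintype.ofFinite (LevelQuotient K)
  have hone : (1 : ℍ → ℂ) ∈ regularAlgebra K := one_mem _
  obtain ⟨P, hP⟩ := exists_polynomial_normPoly hone hy
  set n := Fintype.card (LevelQuotient K) with hn
  let F : MvPolynomial (Fin 2) ℂ := ∑ i ∈ Finset.range (n + 1),
    Polynomial.aeval (MvPolynomial.X 0) (P i) * MvPolynomial.X 1 ^ i
  have hF : F ∈ RingHom.ker (substXY y) := by
    rw [RingHom.mem_ker]
    funext τ
    simp only [F, map_sum, map_mul, map_pow, substXY_X_one, Finset.sum_apply, Pi.mul_apply,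
      substXY_polynomial, Pi.pow_apply, hP]
    have := normPoly_homogeneous hone hy τ
    simpa using this
  have hF0 : F ≠ 0 := by
    intro h0
    have key : ∀ t : ℂ, (normPoly (K := K) 1 y UpperHalfPlane.I).eval t = 0 := by
      intro t
      have h1 : MvPolynomial.eval ![picardX UpperHalfPlane.I, t] F = 0 := by rw [h0, map_zero]
      rw [Polynomial.eval_eq_sum_range' (Nat.lt_succ_of_le
        (normPoly_natDegree_le 1 y UpperHalfPlane.I)), ← h1]
      simp only [F, map_sum, map_mul, map_pow, MvPolynomial.eval_X, ← hP]
      refine Finset.sum_congr rfl fun i _ => ?_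
      congr 1
      rw [eval_aeval_X_zero]
      rfl
    have h2 : normPoly (K := K) 1 y UpperHalfPlane.I = 0 := Polynomial.funext (by simpa using key)
    have h3 := normPoly_coeff_card (K := K) 1 y UpperHalfPlane.I
    rw [h2, Polynomial.coeff_zero] at h3
    simp [translate] at h3
  have hp := ker_substXY_isPrime hy
  obtain ⟨f, hf, hfp⟩ := hp.exists_mem_prime_of_ne_bot (fun h => hF0 (by
    rw [h] at hF; simpa using hF))
  refine ⟨⟨f, hfp.irreducible⟩, fun τ => ?_⟩
  rw [← substXY_apply]
  exact congrFun ((RingHom.mem_ker).1 hf) τ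

/-- The polynomial relations between `x` and `y` are the multiples of the equation of the curve. -/
theorem ker_substXY_eq {K : ℕ} {y : ℍ → ℂ} (hy : y ∈ regularAlgebra K) (C : PlaneCurve)
    (hC : ∀ τ : ℍ, MvPolynomial.eval ![picardX τ, y τ] C.poly = 0) :
    RingHom.ker (substXY y) = Ideal.span {C.poly} := by
  have hP := ker_substXY_isPrime hy
  have hmem : C.poly ∈ RingHom.ker (substXY y) :=
    (RingHom.mem_ker).2 (funext fun τ => by rw [substXY_apply]; exact hC τ)
  have hle : Ideal.span {C.poly} ≤ RingHom.ker (substXY y) :=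
    (Ideal.span_singleton_le_iff_mem _).2 hmem
  have hprime : (Ideal.span {C.poly}).IsPrime :=
    (Ideal.span_singleton_prime C.irreducible.ne_zero).2 C.irreducible.prime
  by_contra hne
  have hlt : Ideal.span {C.poly} < RingHom.ker (substXY y) := lt_of_le_of_ne hle (Ne.symm hne)
  -- A strict inclusion would give a chain of four primes in a ring of dimension two unless the
  -- kernel is maximal. A maximal kernel is the ideal of a point, which would make `x` constant.
  have hmax : (RingHom.ker (substXY y)).IsMaximal := by
    by_contra hnm
    obtain ⟨m, hm, hlm⟩ := Ideal.exists_le_maximal _ hP.ne_top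
    have hlt2 : RingHom.ker (substXY y) < m := lt_of_le_of_ne hlm fun h => hnm (h ▸ hm)
    have hdim : ringKrullDim (MvPolynomial (Fin 2) ℂ) = 2 := by
      rw [MvPolynomial.ringKrullDim_of_isNoetherianRing, ringKrullDim_eq_zero_of_field]
      simp
    let s : LTSeries (PrimeSpectrum (MvPolynomial (Fin 2) ℂ)) :=
      { length := 3
        toFun := ![⟨⊥, Ideal.isPrime_bot⟩, ⟨_, hprime⟩, ⟨_, hP⟩, ⟨m, hm.isPrime⟩]
        step := by
          intro i
          fin_cases i
          · exact (bot_lt_iff_ne_bot (a := Ideal.span {C.poly})).2 fun h =>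
              C.irreducible.ne_zero (Ideal.span_singleton_eq_bot.1 h)
          · exact hlt
          · exact hlt2 }
    have := Order.LTSeries.length_le_krullDim s
    rw [← ringKrullDim, hdim] at this
    norm_num [s] at this
  obtain ⟨z, hz⟩ := (MvPolynomial.isMaximal_iff_eq_vanishingIdeal_singleton (K := ℂ)).1 hmax
  apply one_sub_picardX_not_const (z 0)
  have h1 : MvPolynomial.X 0 - MvPolynomial.C (z 0) ∈ RingHom.ker (substXY y) := by
    rw [hz, MvPolynomial.mem_vanishingIdeal_singleton_iff]
    simp
  intro τ
  have h2 := congrFun ((RingHom.mem_ker).1 h1) τ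
  rw [substXY_apply] at h2
  simpa [sub_eq_zero] using h2

/-! ### The function field and the valuation ring of a chart. -/

/-- An injective algebra homomorphism into the regular functions of level `2K`. -/
structure IsRegularModel (K : ℕ) {A : Type*} [CommRing A] [Algebra ℂ A] (ev : A →ₐ[ℂ] (ℍ → ℂ)) :
    Prop where
  pos : 0 < K
  injective : Function.Injective ev
  mem : ∀ a, ev a ∈ regularAlgebra K

section FunctionField

/-- The meromorphic function on the upper half-plane given by an element of the function field. -/
def fn {A : Type*} [CommRing A] [IsDomain A] [Algebra ℂ A] (ev : A →ₐ[ℂ] (ℍ → ℂ))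
    (k : FractionRing A) (τ : ℍ) : ℂ :=
  ev (IsLocalization.sec (nonZeroDivisors A) k).1 τ /
    ev (IsLocalization.sec (nonZeroDivisors A) k).2 τ

theorem exists_mul_eq {A : Type*} [CommRing A] [IsDomain A] (k : FractionRing A) :
    ∃ a b : A, b ≠ 0 ∧ k * algebraMap A (FractionRing A) b = algebraMap A (FractionRing A) a :=
  ⟨_, _, nonZeroDivisors.coe_ne_zero (IsLocalization.sec (nonZeroDivisors A) k).2,
    IsLocalization.sec_spec (nonZeroDivisors A) k⟩

theorem IsRegularModel.ev_ne_zero {K : ℕ} {A : Type*} [CommRing A] [Algebra ℂ A]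
    {ev : A →ₐ[ℂ] (ℍ → ℂ)} (h : IsRegularModel K ev) {a : A} (ha : a ≠ 0) : ev a ≠ 0 :=
  fun h0 => ha (h.injective (h0.trans (map_zero ev).symm))

theorem IsRegularModel.eventually_ne_zero {K : ℕ} {A : Type*} [CommRing A] [Algebra ℂ A]
    {ev : A →ₐ[ℂ] (ℍ → ℂ)} {l : Filter ℍ} (h : IsRegularModel K ev) (hl : HasChart K l) {a : A}
    (ha : a ≠ 0) : ∀ᶠ τ in l, ev a τ ≠ 0 :=
  hl.eventually_ne_zero (h.mem a) (h.ev_ne_zero ha)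

variable {K : ℕ} {A : Type*} [CommRing A] [IsDomain A] [Algebra ℂ A] {ev : A →ₐ[ℂ] (ℍ → ℂ)}
  {l : Filter ℍ}

/-- The function `fn` is formed with one chosen fraction and is unreliable at zeros of the
denominators; identities therefore hold only eventually along the filter of a chart. -/
theorem IsRegularModel.fn_eq (h : IsRegularModel K ev) (hl : HasChart K l) {k : FractionRing A}
    {a b : A} (hb : b ≠ 0)
    (hk : k * algebraMap A (FractionRing A) b = algebraMap A (FractionRing A) a) :
    ∀ᶠ τ in l, fn ev k τ = ev a τ / ev b τ := by
  have h1 := IsLocalization.sec_spec (nonZeroDivisors A) k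
  set s := IsLocalization.sec (nonZeroDivisors A) k with hs
  have hs0 : (s.2 : A) ≠ 0 := nonZeroDivisors.coe_ne_zero s.2
  have h2 : s.1 * b = a * s.2 := by
    apply IsFractionRing.injective A (FractionRing A)
    rw [map_mul, map_mul, ← h1, ← hk]
    ring
  filter_upwards [h.eventually_ne_zero hl hb, h.eventually_ne_zero hl hs0] with τ h3 h4
  have h5 := congrFun (congrArg ev h2) τ
  rw [map_mul, map_mul] at h5
  rw [fn, ← hs, div_eq_div_iff h4 h3]
  exact h5

theorem IsRegularModel.fn_algebraMap (h : IsRegularModel K ev) (hl : HasChart K l) (a : A) :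
    ∀ᶠ τ in l, fn ev (algebraMap A (FractionRing A) a) τ = ev a τ := by
  filter_upwards [h.fn_eq hl one_ne_zero (k := algebraMap A (FractionRing A) a) (a := a)
    (by simp)] with τ hτ
  rw [hτ, map_one, Pi.one_apply, div_one]

theorem IsRegularModel.fn_const (h : IsRegularModel K ev) (hl : HasChart K l) (c : ℂ) :
    ∀ᶠ τ in l, fn ev (algebraMap ℂ (FractionRing A) c) τ = c := by
  filter_upwards [h.fn_algebraMap hl (algebraMap ℂ A c)] with τ hτ
  rw [IsScalarTower.algebraMap_apply ℂ A (FractionRing A), hτ, AlgHom.commutes]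
  rfl

theorem IsRegularModel.fn_mul (h : IsRegularModel K ev) (hl : HasChart K l)
    (k k' : FractionRing A) : ∀ᶠ τ in l, fn ev (k * k') τ = fn ev k τ * fn ev k' τ := by
  obtain ⟨a, b, hb, hk⟩ := exists_mul_eq k
  obtain ⟨a', b', hb', hk'⟩ := exists_mul_eq k'
  filter_upwards [h.fn_eq hl hb hk, h.fn_eq hl hb' hk', h.fn_eq hl (mul_ne_zero hb hb')
    (k := k * k') (a := a * a') (by rw [map_mul, map_mul, ← hk, ← hk']; ring)] with τ h1 h2 h3
  rw [h1, h2, h3, map_mul, map_mul, Pi.mul_apply, Pi.mul_apply, div_mul_div_comm]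

theorem IsRegularModel.fn_add (h : IsRegularModel K ev) (hl : HasChart K l)
    (k k' : FractionRing A) : ∀ᶠ τ in l, fn ev (k + k') τ = fn ev k τ + fn ev k' τ := by
  obtain ⟨a, b, hb, hk⟩ := exists_mul_eq k
  obtain ⟨a', b', hb', hk'⟩ := exists_mul_eq k'
  filter_upwards [h.fn_eq hl hb hk, h.fn_eq hl hb' hk', h.eventually_ne_zero hl hb,
    h.eventually_ne_zero hl hb', h.fn_eq hl (mul_ne_zero hb hb')
    (k := k + k') (a := a * b' + b * a')
    (by rw [map_mul, map_add, map_mul, map_mul, ← hk, ← hk']; ring)] with τ h1 h2 h4 h5 h3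
  rw [h1, h2, h3, div_add_div _ _ h4 h5]
  simp [map_mul, map_add]

theorem IsRegularModel.fn_inv (h : IsRegularModel K ev) (hl : HasChart K l)
    (k : FractionRing A) : ∀ᶠ τ in l, fn ev k⁻¹ τ = (fn ev k τ)⁻¹ := by
  obtain ⟨a, b, hb, hk⟩ := exists_mul_eq k
  by_cases ha : a = 0
  · have hk0 : k = 0 := by
      rw [ha, map_zero, mul_eq_zero] at hk
      exact hk.resolve_right fun h0 => hb (by simpa using h0)
    filter_upwards [h.fn_const hl 0] with τ hτ
    rw [map_zero] at hτ
    rw [hk0, inv_zero, hτ, inv_zero]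
  · have hb' : algebraMap A (FractionRing A) b ≠ 0 := by simpa using hb
    have ha' : algebraMap A (FractionRing A) a ≠ 0 := by simpa using ha
    have hk' : k⁻¹ * algebraMap A (FractionRing A) a = algebraMap A (FractionRing A) b := by
      have : k ≠ 0 := fun h0 => ha' (by rw [← hk, h0, zero_mul])
      rw [← hk]
      field_simp
    filter_upwards [h.fn_eq hl hb hk, h.fn_eq hl ha hk'] with τ h1 h2
    rw [h1, h2, inv_div]

theorem IsRegularModel.fn_sub_const (h : IsRegularModel K ev) (hl : HasChart K l)
    (k : FractionRing A) (c : ℂ) :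
    ∀ᶠ τ in l, fn ev (k - algebraMap ℂ (FractionRing A) c) τ = fn ev k τ - c := by
  filter_upwards [h.fn_add hl k (algebraMap ℂ (FractionRing A) (-c)), h.fn_const hl (-c)]
    with τ h1 h2
  rw [map_neg, ← sub_eq_add_neg] at h1
  rw [h1, ← map_neg, h2, sub_eq_add_neg]

theorem IsRegularModel.fn_ne_zero (h : IsRegularModel K ev) (hl : HasChart K l)
    {k : FractionRing A} (hk : k ≠ 0) : ∀ᶠ τ in l, fn ev k τ ≠ 0 := by
  filter_upwards [h.fn_mul hl k k⁻¹, h.fn_const hl 1] with τ h1 h2 h0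
  rw [mul_inv_cancel₀ hk, h0, zero_mul] at h1
  rw [map_one, h1] at h2
  exact one_ne_zero h2.symm

theorem IsRegularModel.fn_pow (h : IsRegularModel K ev) (hl : HasChart K l)
    (k : FractionRing A) (n : ℕ) : ∀ᶠ τ in l, fn ev (k ^ n) τ = fn ev k τ ^ n := by
  induction n with
  | zero => filter_upwards [h.fn_const hl 1] with τ hτ; simpa using hτ
  | succ n ih =>
    filter_upwards [ih, h.fn_mul hl (k ^ n) k] with τ h1 h2
    rw [pow_succ, h2, h1, pow_succ]

theorem IsRegularModel.tendsto_or (h : IsRegularModel K ev) (hl : HasChart K l)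
    (k : FractionRing A) :
    (∃ c, Tendsto (fn ev k) l (𝓝 c)) ∨ Tendsto (fn ev k⁻¹) l (𝓝 0) := by
  obtain ⟨a, b, hb, hk⟩ := exists_mul_eq k
  rcases hl.tendsto_or (h.mem a) (h.mem b) with ⟨c, hc⟩ | hc
  · refine Or.inl ⟨c, hc.congr' ?_⟩
    filter_upwards [h.fn_eq hl hb hk] with τ hτ
    exact hτ.symm
  · refine Or.inr (hc.congr' ?_)
    filter_upwards [h.fn_eq hl hb hk, h.fn_inv hl k] with τ hτ h2
    rw [h2, hτ, inv_div]

/-- The valuation ring of all functions with a finite limit along the filter `l`. -/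
def placeRing (h : IsRegularModel K ev) (hl : HasChart K l) :
    ValuationSubring (FractionRing A) where
  carrier := {k | ∃ c, Tendsto (fn ev k) l (𝓝 c)}
  mul_mem' := by
    rintro a b ⟨c, hc⟩ ⟨d, hd⟩
    exact ⟨c * d, (hc.mul hd).congr' ((h.fn_mul hl a b).mono fun _ h => h.symm)⟩
  one_mem' := ⟨1, (tendsto_const_nhds (x := (1 : ℂ))).congr' (by
    filter_upwards [h.fn_const hl 1] with τ hτ; rw [map_one] at hτ; exact hτ.symm)⟩
  add_mem' := by
    rintro a b ⟨c, hc⟩ ⟨d, hd⟩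
    exact ⟨c + d, (hc.add hd).congr' ((h.fn_add hl a b).mono fun _ h => h.symm)⟩
  zero_mem' := ⟨0, (tendsto_const_nhds (x := (0 : ℂ))).congr' (by
    filter_upwards [h.fn_const hl 0] with τ hτ; rw [map_zero] at hτ; exact hτ.symm)⟩
  neg_mem' := by
    rintro a ⟨c, hc⟩
    refine ⟨(-1) * c, (hc.const_mul (-1)).congr' ?_⟩
    filter_upwards [h.fn_mul hl (algebraMap ℂ _ (-1)) a, h.fn_const hl (-1)] with τ h1 h2
    rw [h2, map_neg, map_one, neg_one_mul] at h1
    exact h1.symm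
  mem_or_inv_mem' := fun k => (h.tendsto_or hl k).imp_right fun h => ⟨0, h⟩

theorem mem_nonunits_placeRing (h : IsRegularModel K ev) (hl : HasChart K l)
    {k : FractionRing A} : k ∈ (placeRing h hl).nonunits ↔ Tendsto (fn ev k) l (𝓝 0) := by
  have := hl.neBot
  rw [ValuationSubring.mem_nonunits_iff_or]
  constructor
  · rintro (rfl | hk)
    · refine (tendsto_const_nhds (x := (0 : ℂ))).congr' ?_
      filter_upwards [h.fn_const hl 0] with τ hτ
      rw [map_zero] at hτ
      exact hτ.symm
    · rcases h.tendsto_or hl k with ⟨c, hc⟩ | hc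
      · by_cases h0 : c = 0
        · rwa [h0] at hc
        · exact absurd ⟨c⁻¹, (hc.inv₀ h0).congr' ((h.fn_inv hl k).mono fun _ h => h.symm)⟩ hk
      · exact absurd ⟨0, hc⟩ hk
  · intro hk
    by_contra! hc
    obtain ⟨h0, c, hc⟩ := hc
    have h1 : Tendsto (fun _ : ℍ => (1 : ℂ)) l (𝓝 (0 * c)) := by
      refine (hk.mul hc).congr' ?_
      filter_upwards [h.fn_mul hl k k⁻¹, h.fn_const hl 1] with τ h1 h2
      rw [← h1, mul_inv_cancel₀ h0, ← map_one (algebraMap ℂ (FractionRing A)), h2]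
    rw [zero_mul] at h1
    exact one_ne_zero (tendsto_nhds_unique tendsto_const_nhds h1)

theorem algebraMap_mem_placeRing (h : IsRegularModel K ev) (hl : HasChart K l) (c : ℂ) :
    algebraMap ℂ (FractionRing A) c ∈ placeRing h hl :=
  ⟨c, tendsto_const_nhds.congr' ((h.fn_const hl c).mono fun _ h => h.symm)⟩

/-- The valuation rings of charts are maximal. -/
theorem eq_placeRing_of_le (h : IsRegularModel K ev) (hl : HasChart K l)
    {W : ValuationSubring (FractionRing A)} (hW : W ≠ ⊤) (hle : placeRing h hl ≤ W) :
    W = placeRing h hl := by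
  refine le_antisymm (fun k hk => ?_) hle
  by_contra hkV
  apply hW
  rw [eq_top_iff]
  intro u _
  obtain ⟨g, f, hf, hkf⟩ := exists_mul_eq k
  obtain ⟨a, b, hb, hu⟩ := exists_mul_eq u
  -- An element `k` of `W` outside the valuation ring has a pole, so `u k⁻ⁿ` is finite for large
  -- `n`; then `u = (u k⁻ⁿ) kⁿ` lies in `W`, for every `u`.
  rcases hl.archimedean (h.mem f) (h.mem g) (h.mem a) (h.mem b) with ⟨c, hc⟩ | ⟨n, c, hc⟩
  · refine absurd ⟨c, hc.congr' ?_⟩ hkV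
    filter_upwards [h.fn_eq hl hf hkf] with τ hτ
    exact hτ.symm
  · have h0 : k ≠ 0 := fun h0 => hkV (h0 ▸ zero_mem _)
    have h1 : u * k⁻¹ ^ n ∈ placeRing h hl := by
      refine ⟨c, hc.congr' ?_⟩
      filter_upwards [h.fn_eq hl hf hkf, h.fn_eq hl hb hu, h.fn_mul hl u (k⁻¹ ^ n),
        h.fn_pow hl k⁻¹ n, h.fn_inv hl k] with τ h1 h2 h3 h4 h5
      rw [h3, h4, h5, h1, h2, inv_div]
    have h2 := mul_mem (hle h1) (pow_mem hk n)
    rwa [mul_assoc, ← mul_pow, inv_mul_cancel₀ h0, one_pow, mul_one] at h2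

theorem tendsto_value (h : IsRegularModel K ev) (hl : HasChart K l) {k : FractionRing A} {c : ℂ}
    (hc : k - algebraMap ℂ _ c ∈ (placeRing h hl).nonunits) : Tendsto (fn ev k) l (𝓝 c) := by
  have h1 := ((mem_nonunits_placeRing h hl).1 hc).add_const c
  rw [zero_add] at h1
  refine h1.congr' ?_
  filter_upwards [h.fn_sub_const hl k c] with τ hτ
  rw [hτ, sub_add_cancel]

theorem tendsto_value_infty (h : IsRegularModel K ev) (hl : HasChart K l) {k : FractionRing A}
    (hc : ¬ ∃ c : ℂ, k - algebraMap ℂ _ c ∈ (placeRing h hl).nonunits) :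
    Tendsto (fun τ => (fn ev k τ : OnePoint ℂ)) l (𝓝 OnePoint.infty) := by
  rcases h.tendsto_or hl k with ⟨c, hk⟩ | hk
  · refine absurd ⟨c, (mem_nonunits_placeRing h hl).2 ?_⟩ hc
    have := hk.sub_const c
    rw [sub_self] at this
    exact this.congr' ((h.fn_sub_const hl k c).mono fun _ h => h.symm)
  · have h0 : k ≠ 0 := by
      rintro rfl
      exact hc ⟨0, by simp⟩
    exact tendsto_coe_infty_of_inv (hk.congr' (h.fn_inv hl k)) (h.fn_ne_zero hl h0)

end FunctionField

end PicardUniformization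

end

/-! ### The homeomorphism onto the Riemann surface. -/

noncomputable section

namespace PicardUniformization

open Filter ExtendedUHP

/-! ### The map to the Riemann surface of the curve -/

/-- `x` and `y` separate the points of the compactified quotient by `G`, the automorphism group
of the pair. -/
structure SeparatingPair (K : ℕ) (G : Subgroup SL(2, ℤ)) (y : ℍ → ℂ) : Prop where
  pos : 0 < K
  mem : y ∈ regularAlgebra K
  mem_iff : ∀ γ, γ ∈ G ↔ γ ∈ CongruenceSubgroup.Gamma 2 ∧ ∀ τ, y (γ • τ) = y τ
  sep : ∀ τ τ', picardX τ = picardX τ' → y τ = y τ' → ∃ γ ∈ G, γ • τ' = τ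
  sep_cusp : ∀ δ ∈ CongruenceSubgroup.Gamma 2, ∀ δ' ∈ CongruenceSubgroup.Gamma 2,
    ∀ σ : SL(2, ℤ), (σ = 1 ∨ σ = ModularGroup.S ∨ σ = ModularGroup.T * ModularGroup.S) →
    (∀ p q : MvPolynomial (Fin 2) ℂ, substXY y q ≠ 0 → ∀ c : ℂ,
      Tendsto (fun τ => substXY y p ((δ * σ) • τ) / substXY y q ((δ * σ) • τ)) atImInfty (𝓝 c) →
      Tendsto (fun τ => substXY y p ((δ' * σ) • τ) / substXY y q ((δ' * σ) • τ)) atImInfty (𝓝 c)) →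
    ∃ γ ∈ G, γ • (δ' * σ) • cusp OnePoint.infty = (δ * σ) • cusp OnePoint.infty

/-- Evaluation of the coordinate ring on the upper half-plane. -/
def evalCurve (C : PlaneCurve) (y : ℍ → ℂ)
    (hC : ∀ τ : ℍ, MvPolynomial.eval ![picardX τ, y τ] C.poly = 0) :
    C.CoordRing →ₐ[ℂ] (ℍ → ℂ) :=
  Ideal.Quotient.liftₐ _ (substXY y) fun a ha => by
    have hle : Ideal.span {C.poly} ≤ RingHom.ker (substXY y) :=
      (Ideal.span_singleton_le_iff_mem _).2
        ((RingHom.mem_ker).2 (funext fun τ => by rw [substXY_apply]; exact hC τ))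
    exact (RingHom.mem_ker).1 (hle ha)

theorem evalCurve_mk (C : PlaneCurve) (y : ℍ → ℂ)
    (hC : ∀ τ : ℍ, MvPolynomial.eval ![picardX τ, y τ] C.poly = 0) (p : MvPolynomial (Fin 2) ℂ) :
    evalCurve C y hC (Ideal.Quotient.mk _ p) = substXY y p := rfl

theorem isRegularModel_evalCurve {K : ℕ} (hK : 0 < K) {C : PlaneCurve} {y : ℍ → ℂ}
    (hy : y ∈ regularAlgebra K)
    (hC : ∀ τ : ℍ, MvPolynomial.eval ![picardX τ, y τ] C.poly = 0) :
    IsRegularModel K (evalCurve C y hC) where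
  pos := hK
  injective := by
    rw [injective_iff_map_eq_zero]
    intro a ha
    obtain ⟨p, rfl⟩ := Ideal.Quotient.mk_surjective a
    rw [evalCurve_mk, ← RingHom.mem_ker, ker_substXY_eq hy C hC] at ha
    exact Ideal.Quotient.eq_zero_iff_mem.2 ha
  mem a := by
    obtain ⟨p, rfl⟩ := Ideal.Quotient.mk_surjective a
    exact substXY_mem hy p

theorem fn_coord_zero {K : ℕ} {C : PlaneCurve} {y : ℍ → ℂ}
    {hC : ∀ τ : ℍ, MvPolynomial.eval ![picardX τ, y τ] C.poly = 0}
    (hm : IsRegularModel K (evalCurve C y hC)) {l : Filter ℍ} (hl : HasChart K l) :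
    ∀ᶠ τ in l, fn (evalCurve C y hC) (C.coord 0) τ = picardX τ := by
  filter_upwards [hm.fn_algebraMap hl (Ideal.Quotient.mk _ (MvPolynomial.X 0))] with τ hτ
  rw [PlaneCurve.coord, hτ, evalCurve_mk, substXY_X_zero]

theorem fn_coord_one {K : ℕ} {C : PlaneCurve} {y : ℍ → ℂ}
    {hC : ∀ τ : ℍ, MvPolynomial.eval ![picardX τ, y τ] C.poly = 0}
    (hm : IsRegularModel K (evalCurve C y hC)) {l : Filter ℍ} (hl : HasChart K l) :
    ∀ᶠ τ in l, fn (evalCurve C y hC) (C.coord 1) τ = y τ := by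
  filter_upwards [hm.fn_algebraMap hl (Ideal.Quotient.mk _ (MvPolynomial.X 1))] with τ hτ
  rw [PlaneCurve.coord, hτ, evalCurve_mk, substXY_X_one]

theorem coord_zero_ne {C : PlaneCurve} {y : ℍ → ℂ}
    (hC : ∀ τ : ℍ, MvPolynomial.eval ![picardX τ, y τ] C.poly = 0) (c : ℂ) :
    C.coord 0 - algebraMap ℂ C.FunctionField c ≠ 0 := by
  intro h0
  rw [sub_eq_zero, PlaneCurve.coord, IsScalarTower.algebraMap_apply ℂ C.CoordRing C.FunctionField]
    at h0
  have h1 := congrArg (evalCurve C y hC) (IsFractionRing.injective C.CoordRing C.FunctionField h0)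
  rw [evalCurve_mk, substXY_X_zero, AlgHom.commutes] at h1
  exact one_sub_picardX_not_const c fun τ => congrFun h1 τ

theorem exists_cusp_form (s : OnePoint ℚ) : ∃ δ ∈ CongruenceSubgroup.Gamma 2, ∃ σ : SL(2, ℤ),
    (σ = 1 ∨ σ = ModularGroup.S ∨ σ = ModularGroup.T * ModularGroup.S) ∧
      cusp s = (δ * σ) • cusp OnePoint.infty := by
  obtain ⟨γ, hγ⟩ := exists_smul_infty s
  obtain ⟨δ, hδ, σ, hσ, h⟩ := exists_gamma_two_mul γ
  refine ⟨δ, hδ, σ, hσ, ?_⟩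
  rcases h with rfl | rfl
  · exact hγ
  · rw [hγ, mul_smul]
    congr 1
    rw [smul_cusp]
    congr 1
    have key : ∀ γ : SL(2, ℤ), γ 1 0 = 0 →
        (Matrix.SpecialLinearGroup.mapGL ℚ γ : GL (Fin 2) ℚ) 1 0 = 0 := fun γ h => by simp [h]
    rw [OnePoint.smul_infty_eq_self_iff]
    exact key _ rfl

/-- The value of `x` at the cusp `σ ∞`. -/
def IsCuspValue (σ : SL(2, ℤ)) (v : OnePoint ℂ) : Prop :=
  (σ = 1 ∧ v = ((1 : ℂ) : OnePoint ℂ)) ∨ (σ = ModularGroup.S ∧ v = ((0 : ℂ) : OnePoint ℂ)) ∨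
    (σ = ModularGroup.T * ModularGroup.S ∧ v = OnePoint.infty)

theorem tendsto_picardX_cusp {δ : SL(2, ℤ)} (hδ : δ ∈ CongruenceSubgroup.Gamma 2) {σ : SL(2, ℤ)}
    {v : OnePoint ℂ} (h : IsCuspValue σ v) :
    Tendsto (fun τ => (picardX τ : OnePoint ℂ)) (punctured ((δ * σ) • cusp OnePoint.infty))
      (𝓝 v) := by
  rw [punctured_smul, punctured_infty, tendsto_map'_iff]
  have h1 : ∀ τ : ℍ, picardX ((δ * σ) • τ) = picardX (σ • τ) := fun τ => by
    rw [mul_smul, (gamma_two_smul hδ).1]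
  show Tendsto (fun τ : ℍ => (picardX ((δ * σ) • τ) : OnePoint ℂ)) _ _
  simp_rw [h1]
  rcases h with ⟨rfl, rfl⟩ | ⟨rfl, rfl⟩ | ⟨rfl, rfl⟩
  · simp_rw [one_smul]; exact cuspLim_picardX_infty
  · exact cuspLim_picardX_S
  · simp_rw [mul_smul]; exact cuspLim_picardX_TS

theorem continuous_picardX : Continuous picardX := holo_picardX.continuous

theorem tendsto_picardX_point (τ : ℍ) : Tendsto (fun τ => (picardX τ : OnePoint ℂ))
    (punctured (point τ)) (𝓝 (picardX τ : OnePoint ℂ)) := by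
  rw [punctured_point]
  exact ((OnePoint.continuous_coe.comp continuous_picardX).tendsto τ).mono_left
    nhdsWithin_le_nhds

/-- At every point of the extended upper half-plane, `x` takes a value, which depends only on the
orbit under `Γ(2)`. -/
theorem exists_tendsto_picardX (p : ExtendedUHP) : ∃ v : OnePoint ℂ,
    ∀ δ ∈ CongruenceSubgroup.Gamma 2,
      Tendsto (fun τ => (picardX τ : OnePoint ℂ)) (punctured (δ • p)) (𝓝 v) := by
  cases p with
  | point τ =>
    refine ⟨(picardX τ : OnePoint ℂ), fun δ hδ => ?_⟩
    rw [smul_point, ← (gamma_two_smul hδ).1 τ]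
    exact tendsto_picardX_point _
  | cusp s =>
    obtain ⟨δ', hδ', σ, hσ, h⟩ := exists_cusp_form s
    have : ∃ v, IsCuspValue σ v := by
      rcases hσ with rfl | rfl | rfl
      · exact ⟨_, Or.inl ⟨rfl, rfl⟩⟩
      · exact ⟨_, Or.inr (Or.inl ⟨rfl, rfl⟩)⟩
      · exact ⟨_, Or.inr (Or.inr ⟨rfl, rfl⟩)⟩
    obtain ⟨v, hv⟩ := this
    refine ⟨v, fun δ hδ => ?_⟩
    rw [h, ← mul_smul, ← mul_assoc]
    exact tendsto_picardX_cusp (mul_mem hδ hδ') hv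

/-- On the extended upper half-plane `x` takes every value of the Riemann sphere. -/
theorem exists_point_of_value (v : OnePoint ℂ) : ∃ p : ExtendedUHP,
    ∀ δ ∈ CongruenceSubgroup.Gamma 2,
      Tendsto (fun τ => (picardX τ : OnePoint ℂ)) (punctured (δ • p)) (𝓝 v) := by
  have key : ∀ σ, IsCuspValue σ v → ∃ p : ExtendedUHP, ∀ δ ∈ CongruenceSubgroup.Gamma 2,
      Tendsto (fun τ => (picardX τ : OnePoint ℂ)) (punctured (δ • p)) (𝓝 v) := fun σ hσ =>
    ⟨σ • cusp OnePoint.infty, fun δ hδ => by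
      rw [← mul_smul]; exact tendsto_picardX_cusp hδ hσ⟩
  induction v using OnePoint.rec with
  | infty => exact key _ (Or.inr (Or.inr ⟨rfl, rfl⟩))
  | coe c =>
    by_cases h0 : c = 0
    · exact key _ (Or.inr (Or.inl ⟨rfl, by rw [h0]⟩))
    by_cases h1 : c = 1
    · exact key _ (Or.inl ⟨rfl, by rw [h1]⟩)
    obtain ⟨τ, rfl⟩ := exists_picardX_eq h0 h1
    refine ⟨point τ, fun δ hδ => ?_⟩
    rw [smul_point, ← (gamma_two_smul hδ).1 τ]
    exact tendsto_picardX_point _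

/-- The local parameter of the `x`-line: `x - c`, or `1 / x` at infinity. -/
def lineParam (C : PlaneCurve) (v : OnePoint ℂ) : C.FunctionField :=
  Option.elim (show Option ℂ from v) (C.coord 0)⁻¹
    fun c => C.coord 0 - algebraMap ℂ C.FunctionField c

theorem lineParam_coe (C : PlaneCurve) (c : ℂ) :
    lineParam C (c : OnePoint ℂ) = C.coord 0 - algebraMap ℂ C.FunctionField c := rfl

theorem lineParam_infty (C : PlaneCurve) : lineParam C OnePoint.infty = (C.coord 0)⁻¹ := rfl

theorem lineParam_ne_zero {C : PlaneCurve} {y : ℍ → ℂ}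
    (hC : ∀ τ : ℍ, MvPolynomial.eval ![picardX τ, y τ] C.poly = 0) (v : OnePoint ℂ) : lineParam C v ≠ 0 := by
  induction v using OnePoint.rec with
  | infty =>
    rw [lineParam_infty]
    have := coord_zero_ne hC 0
    rw [map_zero, sub_zero] at this
    exact inv_ne_zero this
  | coe c => exact coord_zero_ne hC c

theorem tendsto_inv_of_tendsto_infty {α : Type*} {l : Filter α} {g : α → ℂ}
    (h : Tendsto (fun t => (g t : OnePoint ℂ)) l (𝓝 OnePoint.infty)) :
    Tendsto (fun t => (g t)⁻¹) l (𝓝 0) := by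
  have h1 : Tendsto g l (comap ((↑) : ℂ → OnePoint ℂ) (𝓝 OnePoint.infty)) := tendsto_comap_iff.2 h
  rw [OnePoint.comap_coe_nhds_infty, Filter.coclosedCompact_eq_cocompact,
    ← Metric.cobounded_eq_cocompact] at h1
  exact tendsto_inv₀_cobounded.comp h1

theorem lineParam_mem_nonunits {K : ℕ} {C : PlaneCurve} {y : ℍ → ℂ}
    {hC : ∀ τ : ℍ, MvPolynomial.eval ![picardX τ, y τ] C.poly = 0}
    (hm : IsRegularModel K (evalCurve C y hC)) {l : Filter ℍ} (hl : HasChart K l)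
    {v : OnePoint ℂ} (hv : Tendsto (fun τ => (picardX τ : OnePoint ℂ)) l (𝓝 v)) :
    lineParam C v ∈ (placeRing hm hl).nonunits := by
  rw [mem_nonunits_placeRing]
  induction v using OnePoint.rec with
  | infty =>
    refine (tendsto_inv_of_tendsto_infty hv).congr' ?_
    filter_upwards [hm.fn_inv hl (C.coord 0), fn_coord_zero hm hl] with τ h1 h2
    rw [lineParam_infty, h1, h2]
  | coe c =>
    have h1 : Tendsto picardX l (𝓝 c) :=
      OnePoint.isOpenEmbedding_coe.isEmbedding.tendsto_nhds_iff.2 hv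
    have h2 := h1.sub_const c
    rw [sub_self] at h2
    refine h2.congr' ?_
    filter_upwards [hm.fn_sub_const hl (C.coord 0) c, fn_coord_zero hm hl] with τ h1 h2
    rw [lineParam_coe, h1, h2]

/-- The local parameter of the `x`-line below the point is a nonzero element without inverse in the
ring. -/
theorem placeRing_ne_top {K : ℕ} {C : PlaneCurve} {y : ℍ → ℂ}
    {hC : ∀ τ : ℍ, MvPolynomial.eval ![picardX τ, y τ] C.poly = 0}
    (hm : IsRegularModel K (evalCurve C y hC)) (p : ExtendedUHP) :
    placeRing hm (hasChart_punctured hm.pos p) ≠ ⊤ := by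
  intro h
  obtain ⟨v, hv⟩ := exists_tendsto_picardX p
  have h1 := hv 1 (one_mem _)
  rw [one_smul] at h1
  have h2 := lineParam_mem_nonunits hm (hasChart_punctured hm.pos p) h1
  rw [h, ValuationSubring.mem_nonunits_iff_or] at h2
  rcases h2 with h2 | h2
  · exact lineParam_ne_zero hC v h2
  · exact h2 trivial

/-- The place of the function field at a point of the extended upper half-plane. -/
def placeOf {K : ℕ} {C : PlaneCurve} {y : ℍ → ℂ}
    {hC : ∀ τ : ℍ, MvPolynomial.eval ![picardX τ, y τ] C.poly = 0}
    (hm : IsRegularModel K (evalCurve C y hC)) (p : ExtendedUHP) : C.RiemannSurface :=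
  ⟨placeRing hm (hasChart_punctured hm.pos p), algebraMap_mem_placeRing hm _,
    placeRing_ne_top hm p⟩

theorem tendsto_value_placeOf {K : ℕ} {C : PlaneCurve} {y : ℍ → ℂ}
    {hC : ∀ τ : ℍ, MvPolynomial.eval ![picardX τ, y τ] C.poly = 0}
    (hm : IsRegularModel K (evalCurve C y hC)) (p : ExtendedUHP) (k : C.FunctionField) :
    Tendsto (fun τ => (fn (evalCurve C y hC) k τ : OnePoint ℂ)) (punctured p)
      (𝓝 (C.value k (placeOf hm p))) := by
  unfold PlaneCurve.value
  split_ifs with h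
  · exact (OnePoint.continuous_coe.tendsto _).comp
      (tendsto_value hm (hasChart_punctured hm.pos p) h.choose_spec)
  · exact tendsto_value_infty hm (hasChart_punctured hm.pos p) h

theorem value_placeOf_eq {K : ℕ} {C : PlaneCurve} {y : ℍ → ℂ}
    {hC : ∀ τ : ℍ, MvPolynomial.eval ![picardX τ, y τ] C.poly = 0}
    (hm : IsRegularModel K (evalCurve C y hC)) (p : ExtendedUHP) (k : C.FunctionField)
    {g : ℍ → ℂ} (hg : ∀ᶠ τ in punctured p, fn (evalCurve C y hC) k τ = g τ) {v : OnePoint ℂ}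
    (h : Tendsto (fun τ => (g τ : OnePoint ℂ)) (punctured p) (𝓝 v)) :
    C.value k (placeOf hm p) = v := by
  have := (hasChart_punctured hm.pos p).neBot
  refine tendsto_nhds_unique (tendsto_value_placeOf hm p k) (h.congr' ?_)
  filter_upwards [hg] with τ hτ
  rw [hτ]

theorem value_coord_zero {K : ℕ} {C : PlaneCurve} {y : ℍ → ℂ}
    {hC : ∀ τ : ℍ, MvPolynomial.eval ![picardX τ, y τ] C.poly = 0}
    (hm : IsRegularModel K (evalCurve C y hC)) (τ : ℍ) :
    C.value (C.coord 0) (placeOf hm (point τ)) = (picardX τ : OnePoint ℂ) :=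
  value_placeOf_eq hm _ _ (fn_coord_zero hm (hasChart_punctured hm.pos _)) (tendsto_picardX_point τ)

theorem value_coord_one {K : ℕ} {C : PlaneCurve} {y : ℍ → ℂ}
    {hC : ∀ τ : ℍ, MvPolynomial.eval ![picardX τ, y τ] C.poly = 0}
    (hm : IsRegularModel K (evalCurve C y hC)) (hy : y ∈ regularAlgebra K) (τ : ℍ) :
    C.value (C.coord 1) (placeOf hm (point τ)) = (y τ : OnePoint ℂ) := by
  refine value_placeOf_eq hm _ _ (fn_coord_one hm (hasChart_punctured hm.pos _)) ?_
  rw [punctured_point]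
  exact ((OnePoint.continuous_coe.comp hy.1.continuous).tendsto τ).mono_left nhdsWithin_le_nhds

/-- The target carries the initial topology, so only the values of functions matter. The sphere is
regular: if a function stays in a closed neighbourhood near `p`, so do its limits at the points near
`p`. -/
theorem continuous_placeOf {K : ℕ} {C : PlaneCurve} {y : ℍ → ℂ}
    {hC : ∀ τ : ℍ, MvPolynomial.eval ![picardX τ, y τ] C.poly = 0}
    (hm : IsRegularModel K (evalCurve C y hC)) : Continuous (placeOf hm) := by
  refine continuous_iInf_rng.2 fun k => continuous_induced_rng.2 ?_
  refine continuous_iff_continuousAt.2 fun p => ?_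
  refine (closed_nhds_basis _).tendsto_right_iff.2 fun S hS => ?_
  filter_upwards [eventually_mem_punctured (tendsto_value_placeOf hm p k hS.1)] with p' hp'
  have := (hasChart_punctured hm.pos p').neBot
  exact hS.2.mem_of_tendsto (tendsto_value_placeOf hm p' k) hp'

theorem placeOf_smul {K : ℕ} {C : PlaneCurve} {y : ℍ → ℂ}
    {hC : ∀ τ : ℍ, MvPolynomial.eval ![picardX τ, y τ] C.poly = 0}
    (hm : IsRegularModel K (evalCurve C y hC)) {γ : SL(2, ℤ)}
    (h2 : γ ∈ CongruenceSubgroup.Gamma 2) (h : ∀ τ, y (γ • τ) = y τ) (p : ExtendedUHP) :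
    placeOf hm (γ • p) = placeOf hm p := by
  have h3 : ∀ (a : C.CoordRing) (τ : ℍ), evalCurve C y hC a (γ • τ) = evalCurve C y hC a τ := by
    intro a τ
    obtain ⟨q, rfl⟩ := Ideal.Quotient.mk_surjective a
    rw [evalCurve_mk, substXY_apply, substXY_apply, h, (gamma_two_smul h2).1]
  refine Subtype.ext (SetLike.ext fun k => ?_)
  show (∃ c, Tendsto _ (punctured (γ • p)) _) ↔ ∃ c, Tendsto _ _ _
  simp only [punctured_smul, tendsto_map'_iff]
  have h4 : (fn (evalCurve C y hC) k ∘ fun τ : ℍ => γ • τ) = fn (evalCurve C y hC) k := by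
    funext τ
    simp only [Function.comp, fn, h3]
  rw [h4]

theorem eq_of_isCuspValue {σ σ' : SL(2, ℤ)} {v : OnePoint ℂ} (h : IsCuspValue σ v)
    (h' : IsCuspValue σ' v) : σ = σ' := by
  rcases h with ⟨rfl, rfl⟩ | ⟨rfl, rfl⟩ | ⟨rfl, rfl⟩ <;>
  rcases h' with ⟨rfl, h'⟩ | ⟨rfl, h'⟩ | ⟨rfl, h'⟩ <;> simp at h' ⊢

theorem ne_of_isCuspValue {σ : SL(2, ℤ)} {v : OnePoint ℂ} (h : IsCuspValue σ v) (τ : ℍ) :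
    (picardX τ : OnePoint ℂ) ≠ v := by
  rcases h with ⟨-, rfl⟩ | ⟨-, rfl⟩ | ⟨-, rfl⟩
  · rw [Ne, OnePoint.coe_eq_coe]
    exact fun h => one_sub_picardX_ne_zero τ (by rw [h, sub_self])
  · rw [Ne, OnePoint.coe_eq_coe]
    exact picardX_ne_zero τ
  · exact OnePoint.coe_ne_infty _

theorem exists_isCuspValue {σ : SL(2, ℤ)}
    (hσ : σ = 1 ∨ σ = ModularGroup.S ∨ σ = ModularGroup.T * ModularGroup.S) :
    ∃ v, IsCuspValue σ v := by
  rcases hσ with rfl | rfl | rfl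
  · exact ⟨_, Or.inl ⟨rfl, rfl⟩⟩
  · exact ⟨_, Or.inr (Or.inl ⟨rfl, rfl⟩)⟩
  · exact ⟨_, Or.inr (Or.inr ⟨rfl, rfl⟩)⟩

/-- The values of `x` tell interior points from cusps and distinguish the three classes of cusps.
Interior points are separated by `x` and `y`; for two cusps of one class, equal places give equal
limits of all quotients of polynomials in `x`, `y`. -/
theorem exists_smul_of_placeOf_eq {K : ℕ} {C : PlaneCurve} {G : Subgroup SL(2, ℤ)} {y : ℍ → ℂ}
    {hC : ∀ τ : ℍ, MvPolynomial.eval ![picardX τ, y τ] C.poly = 0}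
    (hm : IsRegularModel K (evalCurve C y hC)) (hs : SeparatingPair K G y) {p p' : ExtendedUHP}
    (h : placeOf hm p = placeOf hm p') : ∃ γ ∈ G, γ • p' = p := by
  have hval : ∀ {δ σ : SL(2, ℤ)} {v : OnePoint ℂ}, δ ∈ CongruenceSubgroup.Gamma 2 →
      IsCuspValue σ v →
      C.value (C.coord 0) (placeOf hm ((δ * σ) • cusp OnePoint.infty)) = v := fun hδ hσ =>
    value_placeOf_eq hm _ _ (fn_coord_zero hm (hasChart_punctured hm.pos _))
      (tendsto_picardX_cusp hδ hσ)
  cases p with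
  | point τ =>
    cases p' with
    | point τ' =>
      have h0 := congrArg (C.value (C.coord 0)) h
      have h1 := congrArg (C.value (C.coord 1)) h
      rw [value_coord_zero, value_coord_zero, OnePoint.coe_eq_coe] at h0
      rw [value_coord_one hm hs.mem, value_coord_one hm hs.mem, OnePoint.coe_eq_coe] at h1
      obtain ⟨γ, hγ, hγ'⟩ := hs.sep τ τ' h0 h1
      exact ⟨γ, hγ, by rw [smul_point, hγ']⟩
    | cusp s =>
      obtain ⟨δ, hδ, σ, hσ, hs⟩ := exists_cusp_form s
      obtain ⟨v, hv⟩ := exists_isCuspValue hσ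
      have h0 := congrArg (C.value (C.coord 0)) h
      rw [value_coord_zero, hs, hval hδ hv] at h0
      exact absurd h0 (ne_of_isCuspValue hv τ)
  | cusp s =>
    obtain ⟨δ, hδ, σ, hσ, hs1⟩ := exists_cusp_form s
    obtain ⟨v, hv⟩ := exists_isCuspValue hσ
    have h0 := congrArg (C.value (C.coord 0)) h
    cases p' with
    | point τ' =>
      rw [value_coord_zero, hs1, hval hδ hv] at h0
      exact absurd h0.symm (ne_of_isCuspValue hv τ')
    | cusp s' =>
      obtain ⟨δ', hδ', σ', hσ', hs2⟩ := exists_cusp_form s'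
      obtain ⟨v', hv'⟩ := exists_isCuspValue hσ'
      rw [hs1, hs2, hval hδ hv, hval hδ' hv'] at h0
      subst h0
      obtain rfl := eq_of_isCuspValue hv hv'
      rw [hs1, hs2]
      refine hs.sep_cusp δ hδ δ' hδ' σ hσ fun p q hq c hc => ?_
      rw [hs1, hs2] at h
      have hqC : Ideal.Quotient.mk (Ideal.span {C.poly}) q ≠ 0 := by
        intro h0
        apply hq
        rw [← evalCurve_mk C y hC, h0, map_zero]
      let k : C.FunctionField := algebraMap C.CoordRing C.FunctionField (Ideal.Quotient.mk _ p) /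
        algebraMap C.CoordRing C.FunctionField (Ideal.Quotient.mk _ q)
      have hk : k * algebraMap C.CoordRing C.FunctionField (Ideal.Quotient.mk _ q) =
          algebraMap C.CoordRing C.FunctionField (Ideal.Quotient.mk _ p) :=
        div_mul_cancel₀ _ (by simpa using hqC)
      have hfn : ∀ z : ExtendedUHP, ∀ᶠ τ in punctured z, fn (evalCurve C y hC) k τ =
          substXY y p τ / substXY y q τ := fun z =>
        hm.fn_eq (hasChart_punctured hm.pos z) hqC hk
      have h1 : C.value k (placeOf hm ((δ * σ) • cusp OnePoint.infty)) = (c : OnePoint ℂ) := by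
        refine value_placeOf_eq hm _ _ (hfn _) ?_
        rw [punctured_smul, punctured_infty, tendsto_map'_iff]
        exact (OnePoint.continuous_coe.tendsto c).comp hc
      have h2 := tendsto_value_placeOf hm ((δ' * σ) • cusp OnePoint.infty) k
      rw [← h, h1] at h2
      have h3 := h2.congr' ((hfn _).mono fun τ hτ => congrArg _ hτ)
      rw [punctured_smul, punctured_infty, tendsto_map'_iff] at h3
      exact OnePoint.isOpenEmbedding_coe.isEmbedding.tendsto_nhds_iff.2 h3

/-! ### Every place comes from a point -/

theorem mul_mem_nonunits {F : Type*} [Field F] {W : ValuationSubring F} {a b : F} (ha : a ∈ W)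
    (hb : b ∈ W.nonunits) : a * b ∈ W.nonunits := by
  rw [ValuationSubring.mem_nonunits_iff] at hb ⊢
  rw [← ValuationSubring.valuation_le_one_iff] at ha
  rw [map_mul]
  calc W.valuation a * W.valuation b ≤ 1 * W.valuation b := by gcongr
    _ < 1 := by rwa [one_mul]

theorem one_notMem_nonunits {F : Type*} [Field F] (W : ValuationSubring F) :
    (1 : F) ∉ W.nonunits := by
  rw [ValuationSubring.mem_nonunits_iff, map_one]
  exact lt_irrefl _

theorem pow_mem_nonunits {F : Type*} [Field F] {W : ValuationSubring F} {a : F}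
    (ha : a ∈ W.nonunits) {n : ℕ} (hn : n ≠ 0) : a ^ n ∈ W.nonunits := by
  obtain ⟨m, rfl⟩ := Nat.exists_eq_succ_of_ne_zero hn
  rw [pow_succ]
  exact mul_mem_nonunits (pow_mem (ValuationSubring.nonunits_subset ha) m) ha

/-- Valuation rings are integrally closed: if `k` is not in `W`, then `k⁻¹` is in the maximal ideal,
and division of the relation by `kⁿ` puts `1` there too. -/
theorem mem_of_monic_relation {F : Type*} [Field F] {W : ValuationSubring F} {n : ℕ} {r : ℕ → F}
    {k : F} (hr : ∀ i, r i ∈ W) (hn : r n = 1)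
    (h : ∑ i ∈ Finset.range (n + 1), r i * k ^ i = 0) : k ∈ W := by
  by_contra hk
  have hk0 : k ≠ 0 := fun h0 => hk (h0 ▸ zero_mem _)
  have hinv : k⁻¹ ∈ W.nonunits := by
    rw [ValuationSubring.inv_mem_nonunits_iff]
    exact Or.inr hk
  apply one_notMem_nonunits W
  rw [Finset.sum_range_succ, hn, one_mul] at h
  have h1 : (1 : F) = -∑ i ∈ Finset.range n, r i * k⁻¹ ^ (n - i) := by
    have h2 : k ^ n * k⁻¹ ^ n = 1 := by rw [← mul_pow, mul_inv_cancel₀ hk0, one_pow]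
    rw [← h2, eq_neg_of_add_eq_zero_right h, neg_mul, Finset.sum_mul]
    congr 1
    refine Finset.sum_congr rfl fun i hi => ?_
    have h3 : n = i + (n - i) := by have := Finset.mem_range.1 hi; omega
    have h4 : k ^ i * k⁻¹ ^ i = 1 := by rw [← mul_pow, mul_inv_cancel₀ hk0, one_pow]
    calc r i * k ^ i * k⁻¹ ^ n = r i * k ^ i * k⁻¹ ^ (i + (n - i)) := by rw [← h3]
      _ = r i * k⁻¹ ^ (n - i) * (k ^ i * k⁻¹ ^ i) := by rw [pow_add]; ring
      _ = _ := by rw [h4, mul_one]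
  rw [h1]
  refine neg_mem (sum_mem fun i hi => mul_mem_nonunits (hr i) (pow_mem_nonunits hinv ?_))
  have := Finset.mem_range.1 hi
  omega

/-- If `t` lies in the maximal ideal, polynomials in `t` with nonzero constant term are units. -/
theorem isUnit_aeval {F : Type*} [Field F] [Algebra ℂ F] {W : ValuationSubring F}
    (hW : ∀ c, algebraMap ℂ F c ∈ W) {t : F} (ht : t ∈ W.nonunits) {S : Polynomial ℂ}
    (hS : S.coeff 0 ≠ 0) : Polynomial.aeval t S ∈ W ∧ (Polynomial.aeval t S)⁻¹ ∈ W ∧ Polynomial.aeval t S ≠ 0 := by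
  have hmem : ∀ R : Polynomial ℂ, Polynomial.aeval t R ∈ W := by
    intro R
    rw [Polynomial.aeval_eq_sum_range]
    refine sum_mem fun i _ => ?_
    rw [Algebra.smul_def]
    exact mul_mem (hW _) (pow_mem (ValuationSubring.nonunits_subset ht) _)
  suffices h1 : Polynomial.aeval t S ∉ W.nonunits by
    rw [ValuationSubring.mem_nonunits_iff_or, not_or, not_not] at h1
    exact ⟨hmem S, h1.2, h1.1⟩
  intro h1
  rw [← Polynomial.divX_mul_X_add S, map_add, map_mul, Polynomial.aeval_X, Polynomial.aeval_C] at h1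
  have h2 := sub_mem h1 (mul_mem_nonunits (hmem S.divX) ht)
  rw [add_sub_cancel_left] at h2
  have h3 := mul_mem_nonunits (hW (S.coeff 0)⁻¹) h2
  rw [← map_mul, inv_mul_cancel₀ hS, map_one] at h3
  exact one_notMem_nonunits W h3

/-- The exponent is the order of `R` at `v`: the multiplicity of the root at a finite point, and
minus the degree at infinity, where `S` is the reversed polynomial. -/
theorem exists_lineParam_factor (C : PlaneCurve) (v : OnePoint ℂ) (ht : lineParam C v ≠ 0)
    {R : Polynomial ℂ} (hR : R ≠ 0) : ∃ (m : ℤ) (S : Polynomial ℂ), S.coeff 0 ≠ 0 ∧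
      Polynomial.aeval (C.coord 0) R = lineParam C v ^ m * Polynomial.aeval (lineParam C v) S := by
  induction v using OnePoint.rec with
  | infty =>
    refine ⟨-R.natDegree, R.reverse, ?_, ?_⟩
    · rwa [Polynomial.coeff_zero_reverse, Ne, Polynomial.leadingCoeff_eq_zero]
    · rw [lineParam_infty] at ht ⊢
      have h0 : C.coord 0 ≠ 0 := fun h => ht (by rw [h, inv_zero])
      have := invertibleOfNonzero h0
      have h1 := Polynomial.eval₂_reverse_mul_pow (algebraMap ℂ C.FunctionField) (C.coord 0) R
      rw [invOf_eq_inv] at h1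
      rw [Polynomial.aeval_def, Polynomial.aeval_def, ← h1, zpow_neg, inv_zpow, inv_inv,
        zpow_natCast, mul_comm]
  | coe c =>
    rw [lineParam_coe] at ht ⊢
    have hR' : R.comp (Polynomial.X + Polynomial.C c) ≠ 0 := by
      intro h0
      apply hR
      have := congrArg (fun Q : Polynomial ℂ => Q.comp (Polynomial.X - Polynomial.C c)) h0
      simpa [Polynomial.comp_assoc] using this
    obtain ⟨S, hS, hd⟩ := Polynomial.exists_eq_pow_rootMultiplicity_mul_and_not_dvd _ hR' 0
    rw [Polynomial.C_0, sub_zero] at hS hd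
    refine ⟨(Polynomial.rootMultiplicity 0 (R.comp (Polynomial.X + Polynomial.C c)) : ℕ), S,
      fun h0 => hd (Polynomial.X_dvd_iff.2 h0), ?_⟩
    · have h1 := congrArg (Polynomial.aeval (C.coord 0 - algebraMap ℂ C.FunctionField c)) hS
      rw [Polynomial.aeval_comp] at h1
      simp only [map_add, Polynomial.aeval_X, Polynomial.aeval_C, sub_add_cancel, map_mul,
        map_pow] at h1
      rw [h1, zpow_natCast]

/-- At every place above `v`, a rational function of `x` is a power of the local parameter times a
unit; whether it is regular depends on `v` only. -/
theorem places_agree (C : PlaneCurve) (v : OnePoint ℂ) (ht : lineParam C v ≠ 0)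
    {V W : ValuationSubring C.FunctionField} (hV : ∀ c, algebraMap ℂ C.FunctionField c ∈ V)
    (hW : ∀ c, algebraMap ℂ C.FunctionField c ∈ W) (htV : lineParam C v ∈ V.nonunits)
    (htW : lineParam C v ∈ W.nonunits) {P Q : Polynomial ℂ} (hQ : Q ≠ 0)
    (h : Polynomial.aeval (C.coord 0) P / Polynomial.aeval (C.coord 0) Q ∈ V) :
    Polynomial.aeval (C.coord 0) P / Polynomial.aeval (C.coord 0) Q ∈ W := by
  by_cases hP : P = 0
  · rw [hP, map_zero, zero_div]; exact zero_mem _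
  obtain ⟨m, S, hS, hm⟩ := exists_lineParam_factor C v ht hP
  obtain ⟨n, R, hR, hn⟩ := exists_lineParam_factor C v ht hQ
  obtain ⟨hS1, hS2, hS0⟩ := isUnit_aeval hV htV hS
  obtain ⟨hR1, hR2, hR0⟩ := isUnit_aeval hV htV hR
  have e : Polynomial.aeval (C.coord 0) P / Polynomial.aeval (C.coord 0) Q =
      lineParam C v ^ (m - n) * (Polynomial.aeval (lineParam C v) S *
        (Polynomial.aeval (lineParam C v) R)⁻¹) := by
    rw [hm, hn, zpow_sub₀ ht]
    field_simp
  rw [e] at h ⊢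
  rcases le_or_gt 0 (m - n) with h0 | h0
  · obtain ⟨j, hj⟩ := Int.eq_ofNat_of_zero_le h0
    rw [hj, zpow_natCast]
    exact mul_mem (pow_mem (ValuationSubring.nonunits_subset htW) j)
      (mul_mem (isUnit_aeval hW htW hS).1 (isUnit_aeval hW htW hR).2.1)
  · exfalso
    obtain ⟨j, hj⟩ := Int.eq_ofNat_of_zero_le (by omega : 0 ≤ -(m - n))
    have hj0 : j ≠ 0 := by rintro rfl; omega
    have h1 := mul_mem_nonunits (mul_mem h (mul_mem hS2
      hR1)) (pow_mem_nonunits htV hj0)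
    rw [← zpow_natCast, ← hj, zpow_neg] at h1
    apply one_notMem_nonunits V
    convert h1 using 1
    field_simp

theorem evalCurve_polynomial {C : PlaneCurve} {y : ℍ → ℂ}
    (hC : ∀ τ : ℍ, MvPolynomial.eval ![picardX τ, y τ] C.poly = 0) (P : Polynomial ℂ) (τ : ℍ) :
    evalCurve C y hC (Polynomial.aeval (Ideal.Quotient.mk _ (MvPolynomial.X 0)) P) τ =
      P.eval (picardX τ) := by
  rw [← substXY_polynomial y P, ← evalCurve_mk C y hC]
  exact congrFun (congrArg (evalCurve C y hC)
    (Polynomial.aeval_algHom_apply (Ideal.Quotient.mkₐ ℂ (Ideal.span {C.poly}))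
      (MvPolynomial.X 0) P)) τ

theorem algebraMap_polynomial (C : PlaneCurve) (P : Polynomial ℂ) :
    algebraMap C.CoordRing C.FunctionField
      (Polynomial.aeval (Ideal.Quotient.mk _ (MvPolynomial.X 0)) P) =
      Polynomial.aeval (C.coord 0) P :=
  (Polynomial.aeval_algebraMap_apply C.FunctionField _ P).symm

/-- Every function satisfies a monic equation over the field of rational functions of `x`, whose
coefficients are regular where all translates of the function are. -/
theorem exists_monic_relation {K : ℕ} {C : PlaneCurve} {y : ℍ → ℂ}
    {hC : ∀ τ : ℍ, MvPolynomial.eval ![picardX τ, y τ] C.poly = 0}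
    (hm : IsRegularModel K (evalCurve C y hC)) (k : C.FunctionField) :
    ∃ (n : ℕ) (P : ℕ → Polynomial ℂ), Polynomial.aeval (C.coord 0) (P n) ≠ 0 ∧
      ∑ i ∈ Finset.range (n + 1), Polynomial.aeval (C.coord 0) (P i) /
        Polynomial.aeval (C.coord 0) (P n) * k ^ i = 0 ∧
      ∀ p : ExtendedUHP, (∀ q : LevelQuotient K,
        k ∈ (placeOf hm ((Quotient.out q : CongruenceSubgroup.Gamma 2) • p)).1) →
        ∀ i, Polynomial.aeval (C.coord 0) (P i) / Polynomial.aeval (C.coord 0) (P n) ∈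
          (placeOf hm p).1 := by
  have := finite_levelQuotient hm.pos
  have := Fintype.ofFinite (LevelQuotient K)
  obtain ⟨b, a, ha, hk⟩ := exists_mul_eq k
  obtain ⟨P, hP⟩ := exists_polynomial_normPoly (hm.mem a) (hm.mem b)
  set n := Fintype.card (LevelQuotient K) with hn
  let u : ℕ → C.CoordRing := fun i => Polynomial.aeval (Ideal.Quotient.mk _ (MvPolynomial.X 0)) (P i)
  have hu : ∀ i τ, evalCurve C y hC (u i) τ = (normPoly (K := K) (evalCurve C y hC a)
      (evalCurve C y hC b) τ).coeff i := fun i τ => by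
    rw [← hP, evalCurve_polynomial]
  have hne : ∀ q : LevelQuotient K, ∀ {l : Filter ℍ}, HasChart K l →
      ∀ᶠ τ in l, translate (evalCurve C y hC a) q τ ≠ 0 := fun q l hl =>
    hl.eventually_ne_zero (translate_mem (hm.mem a) q) (translate_ne_zero (hm.ev_ne_zero ha) q)
  have hun : u n ≠ 0 := by
    intro h0
    have hch := hasChart_nhdsNE K UpperHalfPlane.I
    have := hch.neBot
    obtain ⟨τ, hτ⟩ := (eventually_all.2 fun q => hne q hch).exists
    have h1 := hu n τ
    rw [h0, map_zero, hn, normPoly_coeff_card] at h1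
    exact Finset.prod_ne_zero_iff.2 (fun q _ => hτ q) h1.symm
  have huF : ∀ i, algebraMap C.CoordRing C.FunctionField (u i) = Polynomial.aeval (C.coord 0) (P i) :=
    fun i => algebraMap_polynomial C (P i)
  have hPn : Polynomial.aeval (C.coord 0) (P n) ≠ 0 := by
    rw [← huF]
    simpa using hun
  have ha' : algebraMap C.CoordRing C.FunctionField a ≠ 0 := by simpa using ha
  refine ⟨n, P, hPn, ?_, fun p hp i => ?_⟩
  · have h1 : ∑ i ∈ Finset.range (n + 1), u i * (b ^ i * a ^ (n - i)) = 0 := by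
      apply hm.injective
      funext τ
      rw [map_sum, map_zero, Finset.sum_apply]
      refine Eq.trans (Finset.sum_congr rfl fun i _ => ?_)
        (normPoly_homogeneous (hm.mem a) (hm.mem b) τ)
      rw [← hu]
      simp only [map_mul, map_pow, Pi.mul_apply, Pi.pow_apply]
      rfl
    have h2 := congrArg (algebraMap C.CoordRing C.FunctionField) h1
    rw [map_sum, map_zero] at h2
    have h3 : ∑ i ∈ Finset.range (n + 1), algebraMap C.CoordRing C.FunctionField
        (u i * (b ^ i * a ^ (n - i))) = (algebraMap C.CoordRing C.FunctionField a ^ n *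
        algebraMap C.CoordRing C.FunctionField (u n)) *
        ∑ i ∈ Finset.range (n + 1), Polynomial.aeval (C.coord 0) (P i) /
        Polynomial.aeval (C.coord 0) (P n) * k ^ i := by
      rw [Finset.mul_sum]
      refine Finset.sum_congr rfl fun i hi => ?_
      have hun' : algebraMap C.CoordRing C.FunctionField (u n) ≠ 0 := by simpa using hun
      have h4 : n = (n - i) + i := by have := Finset.mem_range.1 hi; omega
      have h5 : algebraMap C.CoordRing C.FunctionField a ^ n =
          algebraMap C.CoordRing C.FunctionField a ^ (n - i) *
            algebraMap C.CoordRing C.FunctionField a ^ i := by rw [← pow_add, ← h4]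
      have h6 : algebraMap C.CoordRing C.FunctionField b =
          k * algebraMap C.CoordRing C.FunctionField a := hk.symm
      rw [map_mul, map_mul, map_pow, map_pow, h6, ← huF, ← huF, h5, mul_pow]
      field_simp
    rw [h3] at h2
    refine (mul_eq_zero.1 h2).resolve_left (mul_ne_zero (pow_ne_zero _ ha') ?_)
    simpa using hun
  -- The coefficients of the monic equation are symmetric functions of the translates of `k`, all of
  -- which have finite limits at `p` by hypothesis.
  · have hch := hasChart_punctured hm.pos p
    have hlim : ∀ q : LevelQuotient K, ∃ c, Tendsto (fun τ =>
        translate (evalCurve C y hC b) q τ / translate (evalCurve C y hC a) q τ)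
        (punctured p) (𝓝 c) := fun q => by
      obtain ⟨c, hc⟩ := hp q
      refine ⟨c, ?_⟩
      have h1 := hc.congr' (hm.fn_eq (hasChart_punctured hm.pos _) ha hk)
      have h2 := punctured_smul ((Quotient.out q : CongruenceSubgroup.Gamma 2) : SL(2, ℤ)) p
      rw [show (Quotient.out q : CongruenceSubgroup.Gamma 2) • p =
        ((Quotient.out q : CongruenceSubgroup.Gamma 2) : SL(2, ℤ)) • p from rfl, h2,
        tendsto_map'_iff] at h1
      exact h1
    obtain ⟨c, hc⟩ := tendsto_normPoly_ratio (fun q => hne q hch) hlim i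
    refine ⟨c, hc.congr' ?_⟩
    have hdiv : Polynomial.aeval (C.coord 0) (P i) / Polynomial.aeval (C.coord 0) (P n) *
        algebraMap C.CoordRing C.FunctionField (u n) =
        algebraMap C.CoordRing C.FunctionField (u i) := by
      rw [huF, huF]
      exact div_mul_cancel₀ _ hPn
    filter_upwards [hm.fn_eq hch hun hdiv] with τ hτ
    rw [hτ, hu, hu]

/-- Otherwise `x` and all `(x - c)⁻¹` lie in the valuation ring, hence all of `ℂ(x)` since
polynomials split. The whole function field is integral over `ℂ(x)`, so the ring would not be
proper. -/
theorem exists_lineParam_mem_nonunits {K : ℕ} {C : PlaneCurve} {y : ℍ → ℂ}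
    {hC : ∀ τ : ℍ, MvPolynomial.eval ![picardX τ, y τ] C.poly = 0}
    (hm : IsRegularModel K (evalCurve C y hC)) (w : C.RiemannSurface) :
    ∃ v, lineParam C v ∈ w.1.nonunits := by
  by_contra! hne
  have hx : C.coord 0 ∈ w.1 := by
    have := hne OnePoint.infty
    rw [lineParam_infty, ValuationSubring.inv_mem_nonunits_iff, not_or, not_not] at this
    exact this.2
  have hlin : ∀ c : ℂ, (C.coord 0 - algebraMap ℂ C.FunctionField c)⁻¹ ∈ w.1 := fun c => by
    have := hne (c : OnePoint ℂ)
    rw [lineParam_coe, ValuationSubring.mem_nonunits_iff_or, not_or, not_not] at this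
    exact this.2
  have hpoly : ∀ P : Polynomial ℂ, Polynomial.aeval (C.coord 0) P ∈ w.1 := fun P => by
    rw [Polynomial.aeval_eq_sum_range]
    refine sum_mem fun i _ => ?_
    rw [Algebra.smul_def]
    exact mul_mem (w.2.1 _) (pow_mem hx _)
  have hinv : ∀ P : Polynomial ℂ, (Polynomial.aeval (C.coord 0) P)⁻¹ ∈ w.1 := fun P => by
    rw [(IsAlgClosed.splits P).eq_prod_roots, map_mul, Polynomial.aeval_C, mul_inv, ← map_inv₀]
    refine mul_mem (w.2.1 _) ?_
    generalize P.roots = s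
    induction s using Multiset.induction_on with
    | empty => simp
    | cons a s ih =>
      rw [Multiset.map_cons, Multiset.prod_cons, map_mul, mul_inv, map_sub, Polynomial.aeval_X,
        Polynomial.aeval_C]
      exact mul_mem (hlin a) ih
  apply w.2.2
  rw [eq_top_iff]
  intro k _
  obtain ⟨n, P, hPn, hrel, -⟩ := exists_monic_relation hm k
  refine mem_of_monic_relation (fun i => ?_) ?_ hrel
  · rw [div_eq_mul_inv]
    exact mul_mem (hpoly _) (hinv _)
  · exact div_self hPn

/-- The maximal ideal of a place, as a complex vector space. -/
def nonunitsSubspace {C : PlaneCurve} (w : C.RiemannSurface) : Submodule ℂ C.FunctionField where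
  carrier := w.1.nonunits
  add_mem' := fun ha hb => add_mem ha hb
  zero_mem' := zero_mem _
  smul_mem' := fun c a ha => by
    rw [Algebra.smul_def]
    exact mul_mem_nonunits (w.2.1 c) ha

/-- Let `w` lie above `v`, and consider the finitely many translates of a point above `v`. If `h` in
the maximal ideal of `w` were in none of their maximal ideals, `h⁻¹` would be regular at all of
them; the coefficients of its monic equation are then regular above `v`, so `h⁻¹` would lie in the
ring of `w`. -/
theorem placeOf_surjective {K : ℕ} {C : PlaneCurve} {y : ℍ → ℂ}
    {hC : ∀ τ : ℍ, MvPolynomial.eval ![picardX τ, y τ] C.poly = 0}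
    (hm : IsRegularModel K (evalCurve C y hC)) : Function.Surjective (placeOf hm) := by
  intro w
  obtain ⟨v, hv⟩ := exists_lineParam_mem_nonunits hm w
  obtain ⟨p, hp⟩ := exists_point_of_value v
  have htp : ∀ δ ∈ CongruenceSubgroup.Gamma 2,
      lineParam C v ∈ (placeOf hm (δ • p)).1.nonunits := fun δ hδ =>
    lineParam_mem_nonunits hm (hasChart_punctured hm.pos _) (hp δ hδ)
  have htp1 := htp 1 (one_mem _)
  rw [one_smul] at htp1
  have := finite_levelQuotient hm.pos
  let V : LevelQuotient K → C.RiemannSurface := fun q =>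
    placeOf hm ((Quotient.out q : CongruenceSubgroup.Gamma 2) • p)
  suffices h : ∃ q, nonunitsSubspace w ≤ nonunitsSubspace (V q) by
    obtain ⟨q, hq⟩ := h
    refine ⟨_, Subtype.ext (eq_placeRing_of_le hm
      (hasChart_punctured hm.pos ((Quotient.out q : CongruenceSubgroup.Gamma 2) • p)) w.2.2
      (ValuationSubring.nonunits_le_nonunits.1 hq)).symm⟩
  -- A complex vector space is not a finite union of proper subspaces, so one of the maximal ideals
  -- contains that of `w`; maximality of valuation rings of charts then gives equality.
  suffices h : ⋃ q, (((nonunitsSubspace (V q)).comap (nonunitsSubspace w).subtype :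
      Submodule ℂ (nonunitsSubspace w)) : Set (nonunitsSubspace w)) = Set.univ by
    obtain ⟨q, hq⟩ := Subspace.exists_eq_top_of_iUnion_eq_univ h
    exact ⟨q, Submodule.comap_subtype_eq_top.1 hq⟩
  rw [Set.eq_univ_iff_forall]
  rintro ⟨h, hw⟩
  by_contra hcon
  rw [Set.mem_iUnion] at hcon
  have hcon : ∀ q, h ∉ (V q).1.nonunits := fun q hq => hcon ⟨q, hq⟩
  have hV : ∀ q, h⁻¹ ∈ (V q).1 := fun q => by
    have := hcon q
    rw [ValuationSubring.mem_nonunits_iff_or, not_or, not_not] at this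
    exact this.2
  have h0 : h ≠ 0 := by
    rintro rfl
    exact hcon 1 (zero_mem _)
  obtain ⟨n, P, hPn, hrel, hreg⟩ := exists_monic_relation hm h⁻¹
  have h1 : h⁻¹ ∈ w.1 := by
    refine mem_of_monic_relation (fun i => ?_) ?_ hrel
    · exact places_agree C v (lineParam_ne_zero hC v) (placeOf hm p).2.1 w.2.1 htp1 hv
        (fun h => hPn (by rw [h, map_zero])) (hreg p hV i)
    · exact div_self hPn
  have h2 : h ∈ w.1.nonunits := hw
  rw [ValuationSubring.mem_nonunits_iff_or] at h2
  rcases h2 with h2 | h2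
  · exact h0 h2
  · exact h2 h1

theorem value_placeOf_ne_infty_iff {K : ℕ} {C : PlaneCurve} {y : ℍ → ℂ}
    {hC : ∀ τ : ℍ, MvPolynomial.eval ![picardX τ, y τ] C.poly = 0}
    (hm : IsRegularModel K (evalCurve C y hC)) (p : ExtendedUHP) (k : C.FunctionField) :
    C.value k (placeOf hm p) ≠ OnePoint.infty ↔ k ∈ (placeOf hm p).1 := by
  have hl := hasChart_punctured hm.pos p
  have := hl.neBot
  constructor
  · intro h
    obtain ⟨c, hc⟩ := OnePoint.ne_infty_iff_exists.1 h
    have h1 := tendsto_value_placeOf hm p k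
    rw [← hc] at h1
    exact ⟨c, OnePoint.isOpenEmbedding_coe.isEmbedding.tendsto_nhds_iff.2 h1⟩
  · rintro ⟨c, hc⟩ h
    have h1 := tendsto_value_placeOf hm p k
    rw [h] at h1
    exact OnePoint.coe_ne_infty c (tendsto_nhds_unique ((OnePoint.continuous_coe.tendsto c).comp hc) h1)

/-- Distinct places differ on some `k`, which then has the value `∞` at exactly one of them. -/
theorem t2Space_riemannSurface {K : ℕ} {C : PlaneCurve} {y : ℍ → ℂ}
    {hC : ∀ τ : ℍ, MvPolynomial.eval ![picardX τ, y τ] C.poly = 0}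
    (hm : IsRegularModel K (evalCurve C y hC)) : T2Space C.RiemannSurface := by
  refine ⟨fun v w hvw => ?_⟩
  obtain ⟨p, rfl⟩ := placeOf_surjective hm v
  obtain ⟨p', rfl⟩ := placeOf_surjective hm w
  have hk : ∃ k, ¬ (k ∈ (placeOf hm p).1 ↔ k ∈ (placeOf hm p').1) := by
    by_contra! h
    exact hvw (Subtype.ext (SetLike.ext h))
  obtain ⟨k, hk⟩ := hk
  have hcont : Continuous (C.value k) :=
    continuous_iInf_dom (i := k) continuous_induced_dom
  refine separated_by_continuous hcont fun h => hk ?_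
  rw [← value_placeOf_ne_infty_iff, ← value_placeOf_ne_infty_iff, h]

/-- A continuous bijection from a compact space to a Hausdorff space is a homeomorphism. -/
theorem SeparatingPair.uniformizes {K : ℕ} {G : Subgroup SL(2, ℤ)} {y : ℍ → ℂ}
    (hs : SeparatingPair K G y) {C : PlaneCurve}
    (hC : ∀ τ : ℍ, MvPolynomial.eval ![picardX τ, y τ] C.poly = 0) :
    Uniformizes G picardX y C := by
  have hm := isRegularModel_evalCurve hs.pos hs.mem hC
  have hfin : G.FiniteIndex := by
    have : NeZero (2 * K) := ⟨by have := hs.pos; omega⟩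
    refine Subgroup.finiteIndex_of_le (H := CongruenceSubgroup.Gamma (2 * K)) fun γ hγ => ?_
    exact (hs.mem_iff γ).2 ⟨gamma_le_gamma_two K hγ, hs.mem.2.1 γ hγ⟩
  have hc := compactSpace_compactifiedQuotient G
  have ht := t2Space_riemannSurface hm
  have hlift : ∀ p p' : ExtendedUHP, (MulAction.orbitRel G ExtendedUHP) p p' →
      placeOf hm p = placeOf hm p' := by
    rintro p p' ⟨γ, rfl⟩
    have := (hs.mem_iff γ).1 γ.2
    exact placeOf_smul hm this.1 this.2 p'
  let φ : CompactifiedQuotient G → C.RiemannSurface := Quotient.lift (placeOf hm) hlift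
  have hφ : Continuous φ := (continuous_placeOf hm).quotient_lift hlift
  have hbij : Function.Bijective φ := by
    constructor
    · intro a b
      induction a using Quotient.inductionOn with
      | h p =>
        induction b using Quotient.inductionOn with
        | h p' =>
          intro h
          obtain ⟨γ, hγ, h'⟩ := exists_smul_of_placeOf_eq hm hs h
          exact Quotient.sound ⟨⟨γ, hγ⟩, h'⟩
    · intro w
      obtain ⟨p, hp⟩ := placeOf_surjective hm w
      exact ⟨Quotient.mk _ p, hp⟩
  refine ⟨Continuous.homeoOfEquivCompactToT2 (f := Equiv.ofBijective φ hbij) hφ, fun τ => ?_⟩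
  exact ⟨value_coord_zero hm τ, value_coord_one hm hs.mem τ⟩

/-! ### The uniformization of Picard's curves -/

theorem rowMul_T_zpow (w : ℤ × ℤ) (n : ℤ) : rowMul w (ModularGroup.T ^ n) = (w.1, w.2 + n * w.1) := by
  simp only [rowMul, ModularGroup.coe_T_zpow]
  simp
  ring

theorem T_zpow_smul_infty (n : ℤ) :
    (ModularGroup.T ^ n) • cusp OnePoint.infty = cusp OnePoint.infty := by
  rw [smul_cusp]
  congr 1
  have key : ∀ γ : SL(2, ℤ), γ 1 0 = 0 →
      (Matrix.SpecialLinearGroup.mapGL ℚ γ : GL (Fin 2) ℚ) 1 0 = 0 := fun γ h => by simp [h]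
  rw [OnePoint.smul_infty_eq_self_iff]
  refine key _ ?_
  rw [ModularGroup.coe_T_zpow]
  rfl

theorem T_zpow_two_mul_mem (k : ℤ) : ModularGroup.T ^ (2 * k) ∈ CongruenceSubgroup.Gamma 2 := by
  rw [mem_gamma_two_iff, ModularGroup.coe_T_zpow]
  simp

/-- The shear by `2k` is the action of `T^(2k)`, which fixes `∞` and stays in `Γ(2)` under
conjugation by `σ`. The element `δσT^(2k)(δ'σ)⁻¹` joins the cusps and fixes `v` up to sign modulo
`2K`. -/
theorem exists_smul_of_shear {K : ℕ} (hK : 0 < K) {v : ℤ × ℤ} (hv : IsNonDeg K v)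
    {δ δ' σ : SL(2, ℤ)} (hδ : δ ∈ CongruenceSubgroup.Gamma 2)
    (hδ' : δ' ∈ CongruenceSubgroup.Gamma 2)
    (h : ∃ k : ℤ,
      RowDvd (2 * (K : ℤ)) (rowMul v (δ' * σ) - ((rowMul v (δ * σ)).1,
        (rowMul v (δ * σ)).2 + 2 * k * (rowMul v (δ * σ)).1)) ∨
      RowDvd (2 * (K : ℤ)) (rowMul v (δ' * σ) + ((rowMul v (δ * σ)).1,
        (rowMul v (δ * σ)).2 + 2 * k * (rowMul v (δ * σ)).1))) :
    ∃ γ ∈ autGroup (pY K v),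
      γ • (δ' * σ) • cusp OnePoint.infty = (δ * σ) • cusp OnePoint.infty := by
  obtain ⟨k, h⟩ := h
  rw [← rowMul_T_zpow] at h
  have hN : (K : ℤ) ≠ 0 := by exact_mod_cast hK.ne'
  refine ⟨δ * σ * ModularGroup.T ^ (2 * k) * (δ' * σ)⁻¹, ?_, ?_⟩
  · rw [mem_autGroup_pY_iff hN hv]
    constructor
    · have h1 := (CongruenceSubgroup.Gamma_normal 2).conj_mem _ (T_zpow_two_mul_mem k) σ
      have h2 := mul_mem (mul_mem hδ h1) (inv_mem hδ')
      convert h2 using 1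
      group
    · have hv' : v = rowMul (rowMul v (δ' * σ)) (δ' * σ)⁻¹ := by
        rw [← rowMul_mul, mul_inv_cancel, rowMul_one]
      rcases h with h | h
      · left
        have h1 := (h.mul (δ' * σ)⁻¹).neg
        rw [sub_eq_add_neg, rowMul_add, rowMul_neg_left, ← hv', ← rowMul_mul, ← rowMul_mul] at h1
        rw [mul_assoc (δ * σ)]
        convert h1 using 1
        abel
      · right
        have h1 := h.mul (δ' * σ)⁻¹
        rw [rowMul_add, ← hv', ← rowMul_mul, ← rowMul_mul] at h1
        rw [mul_assoc (δ * σ)]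
        convert h1 using 1
        abel
  · rw [← mul_smul, inv_mul_cancel_right, mul_smul, T_zpow_smul_infty]

theorem substXY_ne_zero_of_forall {y : ℍ → ℂ} {q : MvPolynomial (Fin 2) ℂ}
    (h : ∀ τ, substXY y q τ ≠ 0) : substXY y q ≠ 0 :=
  fun h0 => h UpperHalfPlane.I (by rw [h0]; rfl)

theorem separatingPair_pY {K : ℕ} (hK : 0 < K) {v : ℤ × ℤ} (hv : IsNonDeg K v) :
    SeparatingPair K (autGroup (pY K v)) (pY K v) := by
  have hN : (K : ℤ) ≠ 0 := by exact_mod_cast hK.ne'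
  have hpos : (0 : ℤ) < K := by exact_mod_cast hK
  refine ⟨hK, pY_mem_regularAlgebra hK hv, fun γ => ?_, fun τ τ' hx hy => ?_,
    fun δ hδ δ' hδ' σ hσ H => ?_⟩
  · exact ⟨fun h => ⟨((mem_autGroup_pY_iff hN hv γ).1 h).1, h⟩, fun h => h.2⟩
  · obtain ⟨γ, hγ, rfl⟩ := exists_gamma_two_of_picardX_eq hx
    refine ⟨γ, (mem_autGroup_pY_iff hN hv γ).2 ⟨hγ, ?_⟩, rfl⟩
    rw [(gamma_two_smul hγ).2 hN v hv.1] at hy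
    exact (pY_eq_iff hN hv.1 (hv.rowMul hγ).1 τ').1 hy
  · apply exists_smul_of_shear hK hv hδ hδ'
    have hx : ∀ {ε : SL(2, ℤ)}, ε ∈ CongruenceSubgroup.Gamma 2 → ∀ τ, picardX ((ε * σ) • τ) =
        picardX (σ • τ) := fun hε τ => by rw [mul_smul, (gamma_two_smul hε).1]
    have hy : ∀ {ε : SL(2, ℤ)}, ε ∈ CongruenceSubgroup.Gamma 2 → ∀ τ, pY K v ((ε * σ) • τ) =
        pY K (rowMul v ε) (σ • τ) := fun hε τ => by
      rw [mul_smul, (gamma_two_smul hε).2 hN v hv.1]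
    have hTS : ∀ τ : ℍ, (ModularGroup.T * ModularGroup.S) • τ =
        ModularGroup.T • ModularGroup.S • τ := fun τ => mul_smul _ _ τ
    have h1 := fun γ => mt (rowDvd_mul_iff γ).1 hv.1
    -- For each class of cusps, polynomials in `x` and `y` are chosen whose quotient, pulled back to
    -- `∞`, becomes `(1 - y)^e/(1 - x)^m` with the transformed row.
    rcases hσ with rfl | rfl | rfl
    · refine exists_shear_of_limits hpos (h1 _) ?_ (h1 _) ?_ fun e m c hc => ?_
      · rw [mul_one]; exact (hv.rowMul hδ).2.1
      · rw [mul_one]; exact (hv.rowMul hδ').2.1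
      · have e1 : ∀ τ, substXY (pY K v) ((1 - MvPolynomial.X 1) ^ e) τ = (1 - pY K v τ) ^ e :=
          fun τ => by simp [substXY_X_one]
        have e2 : ∀ τ, substXY (pY K v) ((1 - MvPolynomial.X 0) ^ m) τ = (1 - picardX τ) ^ m :=
          fun τ => by simp [substXY_X_zero]
        have h2 := H ((1 - MvPolynomial.X 1) ^ e) ((1 - MvPolynomial.X 0) ^ m)
          (substXY_ne_zero_of_forall fun τ => by
            rw [e2]; exact pow_ne_zero _ (one_sub_picardX_ne_zero τ)) c
        simp only [e1, e2, hx hδ, hx hδ', hy hδ, hy hδ', one_smul] at h2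
        rw [mul_one] at hc ⊢
        exact h2 hc
    · refine exists_shear_of_limits hpos (h1 _) ?_ (h1 _) ?_ fun e m c hc => ?_
      · rw [rowMul_mul]; exact (hv.rowMul hδ).rowMul_S.2.1
      · rw [rowMul_mul]; exact (hv.rowMul hδ').rowMul_S.2.1
      · have e1 : ∀ τ, substXY (pY K v) (MvPolynomial.X 1 ^ e) τ = pY K v τ ^ e :=
          fun τ => by simp [substXY_X_one]
        have e2 : ∀ τ, substXY (pY K v) (MvPolynomial.X 0 ^ m) τ = picardX τ ^ m :=
          fun τ => by simp [substXY_X_zero]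
        have h2 := H (MvPolynomial.X 1 ^ e) (MvPolynomial.X 0 ^ m)
          (substXY_ne_zero_of_forall fun τ => by
            rw [e2]; exact pow_ne_zero _ (picardX_ne_zero τ)) c
        simp only [e1, e2, hx hδ, hx hδ', hy hδ, hy hδ', picardX_S_smul,
          pY_S_smul hN (h1 δ), pY_S_smul hN (h1 δ'), ← rowMul_mul] at h2
        exact h2 hc
    · refine exists_shear_of_limits hpos (h1 _) ?_ (h1 _) ?_ fun e m c hc => ?_
      · rw [rowMul_mul]; exact (hv.rowMul hδ).rowMul_TS.1
      · rw [rowMul_mul]; exact (hv.rowMul hδ').rowMul_TS.1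
      · have e1 : ∀ τ, substXY (pY K v) (MvPolynomial.X 1 ^ e * MvPolynomial.X 0 ^ m) τ =
            pY K v τ ^ e * picardX τ ^ m := fun τ => by simp [substXY_X_one, substXY_X_zero]
        have e2 : ∀ τ, substXY (pY K v) (MvPolynomial.X 0 ^ e) τ = picardX τ ^ e :=
          fun τ => by simp [substXY_X_zero]
        have h2 := H (MvPolynomial.X 1 ^ e * MvPolynomial.X 0 ^ m) (MvPolynomial.X 0 ^ e)
          (substXY_ne_zero_of_forall fun τ => by
            rw [e2]; exact pow_ne_zero _ (picardX_ne_zero τ)) c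
        simp only [e1, e2, hx hδ, hx hδ', hy hδ, hy hδ', hTS, picardX_TS_smul,
          pY_TS_smul hN (h1 δ), pY_TS_smul hN (h1 δ'), ← rowMul_mul] at h2
        have e3 : ∀ (a : ℂ) (τ : ℍ), (a / (1 - picardX τ)) ^ e * (1 - picardX τ)⁻¹ ^ m /
            (1 - picardX τ)⁻¹ ^ e = a ^ e / (1 - picardX τ) ^ m := fun a τ => by
          have := one_sub_picardX_ne_zero τ
          rw [div_pow, inv_pow, inv_pow]
          field_simp
        simp only [e3] at h2
        exact h2 hc

end PicardUniformization

end

/-! ### Explicit stabilizers, conjugacy and genus. -/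

noncomputable section

namespace PicardUniformization

open ExtendedUHP

/-! ### The groups in explicit form -/

/-- `γ ∈ Γ(2)` fixes the row vector `w` up to sign, modulo `2K`. -/
def StabMod (K : ℤ) (w : ℤ × ℤ) (γ : SL(2, ℤ)) : Prop :=
  γ ∈ CongruenceSubgroup.Gamma 2 ∧ ∃ ε : ℤ, (ε = 1 ∨ ε = -1) ∧
    2 * K ∣ w.1 * γ 0 0 + w.2 * γ 1 0 - ε * w.1 ∧ 2 * K ∣ w.1 * γ 0 1 + w.2 * γ 1 1 - ε * w.2

theorem mem_autGroup_picardY_iff {ν μ N : ℤ} (hN : N ≠ 0) (h : ¬ IsDegenerate ν μ N)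
    (γ : SL(2, ℤ)) : γ ∈ autGroup (picardY ν μ N) ↔ StabMod N (ν, μ) γ := by
  refine (mem_autGroup_pY_iff hN (not_isDegenerate_iff.1 h) γ).trans (and_congr_right fun _ => ?_)
  simp only [RowDvd, rowMul, Prod.fst_sub, Prod.snd_sub, Prod.fst_add, Prod.snd_add]
  constructor
  · rintro (h | h)
    · exact ⟨1, Or.inl rfl, by simpa using h⟩
    · exact ⟨-1, Or.inr rfl, by simpa using h⟩
  · rintro ⟨ε, rfl | rfl, h⟩
    · exact Or.inl (by simpa using h)
    · exact Or.inr (by simpa using h)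

theorem exists_halves {γ : SL(2, ℤ)} (h : γ ∈ CongruenceSubgroup.Gamma 2) {ε : ℤ}
    (hε : ε = 1 ∨ ε = -1) : ∃ a b c d : ℤ, γ 0 0 = 2 * a + ε ∧ γ 0 1 = 2 * b ∧ γ 1 0 = 2 * c ∧
      γ 1 1 = 2 * d + ε := by
  obtain ⟨⟨a, ha⟩, ⟨b, hb⟩, ⟨c, hc⟩, ⟨d, hd⟩⟩ := (mem_gamma_two_iff γ).1 h
  rcases hε with rfl | rfl
  · exact ⟨a, b, c, d, by linarith, hb, hc, by linarith⟩
  · exact ⟨a + 1, b, c, d + 1, by linarith, hb, hc, by linarith⟩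

/-- On `Γ(2)` the matrix `γ - ε` is twice an integral matrix, so the conditions modulo `2K` are
conditions modulo `K` on its half. They depend on `w` modulo `K` only, up to a unit. -/
theorem stabMod_congr {K u : ℤ} {w w' : ℤ × ℤ} (hu : IsCoprime u K) (h1 : K ∣ w.1 - u * w'.1)
    (h2 : K ∣ w.2 - u * w'.2) (γ : SL(2, ℤ)) : StabMod K w γ ↔ StabMod K w' γ := by
  refine and_congr_right fun hγ => exists_congr fun ε => and_congr_right fun hε => ?_
  obtain ⟨a, b, c, d, ha, hb, hc, hd⟩ := exists_halves hγ hε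
  have key : ∀ s t : ℤ, (K ∣ w.1 * s + w.2 * t ↔ K ∣ w'.1 * s + w'.2 * t) := by
    intro s t
    have e : w.1 * s + w.2 * t = (w.1 - u * w'.1) * s + (w.2 - u * w'.2) * t +
        u * (w'.1 * s + w'.2 * t) := by ring
    rw [e, dvd_add_right (dvd_add (h1.mul_right s) (h2.mul_right t))]
    exact ⟨fun h => hu.symm.dvd_of_dvd_mul_left h, fun h => h.mul_left u⟩
  have e1 : ∀ z : ℤ × ℤ, z.1 * γ 0 0 + z.2 * γ 1 0 - ε * z.1 = 2 * (z.1 * a + z.2 * c) := by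
    intro z; rw [ha, hc]; ring
  have e2 : ∀ z : ℤ × ℤ, z.1 * γ 0 1 + z.2 * γ 1 1 - ε * z.2 = 2 * (z.1 * b + z.2 * d) := by
    intro z; rw [hb, hd]; ring
  rw [e1, e2, e1, e2, mul_dvd_mul_iff_left two_ne_zero, mul_dvd_mul_iff_left two_ne_zero,
    mul_dvd_mul_iff_left two_ne_zero, mul_dvd_mul_iff_left two_ne_zero, key, key]

theorem stabMod_rowMul (K : ℤ) (w : ℤ × ℤ) (σ γ : SL(2, ℤ)) :
    StabMod K (rowMul w σ) γ ↔ StabMod K w (σ * γ * σ⁻¹) := by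
  refine and_congr ⟨fun h => (CongruenceSubgroup.Gamma_normal 2).conj_mem _ h σ, fun h => ?_⟩
    (exists_congr fun ε => and_congr_right fun hε => ?_)
  · have := (CongruenceSubgroup.Gamma_normal 2).conj_mem _ h σ⁻¹
    convert this using 1
    group
  · have e : ∀ (z : ℤ × ℤ) (δ : SL(2, ℤ)), (2 * K ∣ z.1 * δ 0 0 + z.2 * δ 1 0 - ε * z.1 ∧
        2 * K ∣ z.1 * δ 0 1 + z.2 * δ 1 1 - ε * z.2) ↔
        RowDvd (2 * K) (rowMul z δ + (-(ε * z.1), -(ε * z.2))) := by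
      intro z δ
      simp only [RowDvd, rowMul, Prod.fst_add, Prod.snd_add, sub_eq_add_neg]
    have e3 : rowMul (-(ε * w.1), -(ε * w.2)) σ =
        (-(ε * (rowMul w σ).1), -(ε * (rowMul w σ).2)) := by
      simp only [rowMul, Prod.mk.injEq]
      constructor <;> ring
    rw [e, e, ← rowDvd_mul_iff σ (v := rowMul w (σ * γ * σ⁻¹) + _), rowMul_add, ← rowMul_mul,
      ← rowMul_mul, inv_mul_cancel_right, e3]

/-- The quadratic relation in `picardMatrices` is the determinant condition divided by `2K`.
Conversely, fixing `(0, 1)` up to sign prescribes the lower row modulo `2K`, and the determinant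
then prescribes the upper left entry. -/
theorem representedIn_picardMatrices_iff {K : ℤ} (hK : K ≠ 0) (γ : SL(2, ℤ)) :
    RepresentedIn (picardMatrices K) γ ↔ StabMod K (0, 1) γ := by
  have hpos : ∀ δ : SL(2, ℤ), ((δ : Matrix (Fin 2) (Fin 2) ℤ) ∈ picardMatrices K ↔
      2 ∣ δ 0 1 ∧ 2 * K ∣ δ 0 0 - 1 ∧ 2 * K ∣ δ 1 0 ∧ 2 * K ∣ δ 1 1 - 1) := by
    intro δ
    constructor
    · rintro ⟨n, m, p, q, -, h⟩
      rw [h]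
      refine ⟨⟨m, by simp⟩, ⟨n, by simp⟩, ⟨p, by simp⟩, ⟨q, by simp⟩⟩
    · rintro ⟨⟨m, hm⟩, ⟨n, hn⟩, ⟨p, hp⟩, ⟨q, hq⟩⟩
      refine ⟨n, m, p, q, ?_, ?_⟩
      · have hd := det_eq_one δ
        rw [show δ 0 0 = 2 * K * n + 1 by linarith, hm, hp,
          show δ 1 1 = 2 * K * q + 1 by linarith] at hd
        have : 2 * K * (2 * m * p - 2 * K * q * n - (q + n)) = 0 := by linarith
        have := (mul_eq_zero.1 this).resolve_left (mul_ne_zero two_ne_zero hK)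
        linarith
      · ext i j
        fin_cases i <;> fin_cases j
        · show δ 0 0 = 2 * K * n + 1; linarith
        · exact hm
        · exact hp
        · show δ 1 1 = 2 * K * q + 1; linarith
  have hneg : (-(γ : Matrix (Fin 2) (Fin 2) ℤ) ∈ picardMatrices K ↔
      2 ∣ γ 0 1 ∧ 2 * K ∣ γ 0 0 + 1 ∧ 2 * K ∣ γ 1 0 ∧ 2 * K ∣ γ 1 1 + 1) := by
    rw [← Matrix.SpecialLinearGroup.coe_neg, hpos (-γ)]
    simp only [Matrix.SpecialLinearGroup.coe_neg, Matrix.neg_apply, dvd_neg]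
    rw [← neg_add', dvd_neg, ← neg_add', dvd_neg]
  have h2K : (2 : ℤ) ∣ 2 * K := Dvd.intro _ rfl
  have hdet := det_eq_one γ
  unfold RepresentedIn
  rw [hpos γ, hneg]
  unfold StabMod
  rw [mem_gamma_two_iff]
  simp only [zero_mul, one_mul, zero_add, mul_zero, sub_zero, mul_one]
  constructor
  · rintro (⟨h1, h2, h3, h4⟩ | ⟨h1, h2, h3, h4⟩)
    · exact ⟨⟨h2K.trans h2, h1, h2K.trans h3, h2K.trans h4⟩, 1, Or.inl rfl, h3, h4⟩
    · refine ⟨⟨?_, h1, h2K.trans h3, ?_⟩, -1, Or.inr rfl, h3, by simpa using h4⟩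
      · have := h2K.trans h2; omega
      · have := h2K.trans h4; omega
  · rintro ⟨⟨h1, h2, h3, h4⟩, ε, hε, h5, h6⟩
    have h7 : 2 * K ∣ γ 0 0 - ε := by
      have e : γ 0 0 - ε = ε * ((γ 0 0 * γ 1 1 - γ 0 1 * γ 1 0 - 1) - γ 0 0 * (γ 1 1 - ε) +
          γ 0 1 * γ 1 0) + (1 - ε * ε) * γ 0 0 := by ring
      rw [e, hdet]
      rcases hε with rfl | rfl
      · refine dvd_add (Dvd.dvd.mul_left (dvd_add ?_ (h5.mul_left _)) _) (by simp)
        simpa using h6.mul_left (γ 0 0)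
      · refine dvd_add (Dvd.dvd.mul_left (dvd_add ?_ (h5.mul_left _)) _) (by simp)
        simpa using h6.mul_left (γ 0 0)
    rcases hε with rfl | rfl
    · exact Or.inl ⟨h2, h7, h5, h6⟩
    · exact Or.inr ⟨h2, by simpa using h7, h5, by simpa using h6⟩

theorem representedIn_transpose_iff {K : ℤ} (hK : K ≠ 0) (γ : SL(2, ℤ)) :
    RepresentedIn (Matrix.transpose '' picardMatrices K) γ ↔ StabMod K (1, 0) γ := by
  have h1 : RepresentedIn (Matrix.transpose '' picardMatrices K) γ ↔
      RepresentedIn (picardMatrices K) γ.transpose := by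
    unfold RepresentedIn
    have key : ∀ A : Matrix (Fin 2) (Fin 2) ℤ, A ∈ Matrix.transpose '' picardMatrices K ↔
        A.transpose ∈ picardMatrices K := fun A =>
      ⟨fun ⟨B, hB, h⟩ => by rw [← h, Matrix.transpose_transpose]; exact hB,
        fun h => ⟨_, h, Matrix.transpose_transpose A⟩⟩
    rw [key, key, Matrix.transpose_neg, Matrix.SpecialLinearGroup.coe_transpose]
  have h00 : γ.transpose 0 0 = γ 0 0 := rfl
  have h01 : γ.transpose 0 1 = γ 1 0 := rfl
  have h10 : γ.transpose 1 0 = γ 0 1 := rfl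
  have h11 : γ.transpose 1 1 = γ 1 1 := rfl
  have hdet := det_eq_one γ
  rw [h1, representedIn_picardMatrices_iff hK]
  unfold StabMod
  rw [mem_gamma_two_iff, mem_gamma_two_iff]
  simp only [h00, h01, h10, h11, zero_mul, one_mul, zero_add, add_zero, mul_zero, sub_zero, mul_one]
  refine and_congr ⟨fun h => ⟨h.1, h.2.2.1, h.2.1, h.2.2.2⟩, fun h => ⟨h.1, h.2.2.1, h.2.1, h.2.2.2⟩⟩
    (exists_congr fun ε => and_congr_right fun hε => ?_)
  have e1 : γ 0 0 - ε = ε * (- γ 0 0 * (γ 1 1 - ε) + γ 1 0 * γ 0 1) + (1 - ε * ε) * γ 0 0 := by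
    linear_combination ε * hdet
  have e2 : γ 1 1 - ε = ε * (- γ 1 1 * (γ 0 0 - ε) + γ 1 0 * γ 0 1) + (1 - ε * ε) * γ 1 1 := by
    linear_combination ε * hdet
  have hε2 : 1 - ε * ε = 0 := by rcases hε with rfl | rfl <;> rfl
  rw [hε2, zero_mul, add_zero] at e1 e2
  constructor
  · rintro ⟨h1, h2⟩
    exact ⟨by rw [e1]; exact Dvd.dvd.mul_left (dvd_add (h2.mul_left _) (h1.mul_left _)) _, h1⟩
  · rintro ⟨h1, h2⟩
    exact ⟨h2, by rw [e2]; exact Dvd.dvd.mul_left (dvd_add (h1.mul_left _) (h2.mul_left _)) _⟩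

/-- Add `tK` to `b`, where `t` is the product of the primes dividing `a` but not `b`. A prime of `a`
dividing `b` divides neither `t` nor `K`; any other prime of `a` divides `tK` but not `b`. If `a =
0`, use `K` in its place. -/
theorem exists_coprime_lift {a b K : ℤ} (hK : K ≠ 0)
    (h : ∀ p : ℕ, p.Prime → (p : ℤ) ∣ a → (p : ℤ) ∣ b → ¬ (p : ℤ) ∣ K) :
    ∃ a' b' : ℤ, K ∣ a - a' ∧ K ∣ b - b' ∧ IsCoprime a' b' := by
  wlog ha : a ≠ 0 generalizing a
  · obtain ⟨a', b', h1, h2, h3⟩ := this (a := K) (fun p hp h1 h2 => by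
      rw [not_not.1 ha] at h
      exact h p hp (dvd_zero _) h2) hK
    refine ⟨a', b', ?_, h2, h3⟩
    rw [not_not.1 ha, zero_sub]
    have := dvd_sub (dvd_refl K) h1
    rw [sub_sub_cancel] at this
    exact this.neg_right
  let s : Finset ℕ := a.natAbs.primeFactors.filter fun p => ¬ (p : ℤ) ∣ b
  let t : ℕ := ∏ p ∈ s, p
  refine ⟨a, b + t * K, by simp, ⟨-t, by ring⟩, ?_⟩
  rw [Int.isCoprime_iff_gcd_eq_one]
  refine Nat.coprime_of_dvd fun p hp h1 h2 => ?_
  have h1' := Int.natCast_dvd.2 h1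
  have h2' := Int.natCast_dvd.2 h2
  by_cases hb : (p : ℤ) ∣ b
  · have h3 : (p : ℤ) ∣ t * K := (dvd_add_right hb).1 h2'
    rcases (Nat.prime_iff_prime_int.1 hp).dvd_or_dvd h3 with h4 | h4
    · have h5 : p ∣ t := by exact_mod_cast h4
      obtain ⟨q, hq, hpq⟩ := (hp.prime.dvd_finsetProd_iff _).1 h5
      rw [Finset.mem_filter] at hq
      rw [(Nat.prime_dvd_prime_iff_eq hp (Nat.prime_of_mem_primeFactors hq.1)).1 hpq] at hb
      exact hq.2 hb
    · exact h p hp h1' hb h4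
  · have h3 : p ∣ t := Finset.dvd_prod_of_mem _ (Finset.mem_filter.2
      ⟨Nat.mem_primeFactors.2 ⟨hp, h1, by simpa using ha⟩, hb⟩)
    have h4 : (p : ℤ) ∣ t := by exact_mod_cast h3
    exact hb ((dvd_add_left (h4.mul_right K)).1 h2')

theorem exists_rowMul_eq {a b : ℤ} (h : IsCoprime a b) : ∃ σ : SL(2, ℤ), rowMul (0, 1) σ = (a, b) := by
  obtain ⟨u, v, huv⟩ := h
  refine ⟨⟨!![v, -u; a, b], by rw [Matrix.det_fin_two_of]; linarith⟩, ?_⟩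
  simp [rowMul]

/-- Division by the common factor `g`. The hypothesis `hMK` is the passage from the order `M` of the
torsion point to the reduced level: since `γ - ε` is even, an odd `M` is as good as `2M`. -/
theorem stabMod_mul {g M w₁ w₂ : ℤ} {K : ℤ} (N : ℤ) (hg : g ≠ 0) (hN : 2 * N = g * M ∨ 2 * N = -(g * M))
    (hMK : ∀ s : ℤ, M ∣ 2 * s ↔ 2 * K ∣ 2 * s) (γ : SL(2, ℤ)) :
    StabMod N (g * w₁, g * w₂) γ ↔ StabMod K (w₁, w₂) γ := by
  refine and_congr_right fun hγ => exists_congr fun ε => and_congr_right fun hε => ?_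
  obtain ⟨a, b, c, d, ha, hb, hc, hd⟩ := exists_halves hγ hε
  have key : ∀ s : ℤ, 2 * N ∣ g * (2 * s) ↔ 2 * K ∣ 2 * s := by
    intro s
    rw [← hMK]
    rcases hN with h | h
    · rw [h, mul_dvd_mul_iff_left hg]
    · rw [h, neg_dvd, mul_dvd_mul_iff_left hg]
  have e1 : ∀ u v : ℤ, u * γ 0 0 + v * γ 1 0 - ε * u = 2 * (u * a + v * c) := by
    intro u v; rw [ha, hc]; ring
  have e2 : ∀ u v : ℤ, u * γ 0 1 + v * γ 1 1 - ε * v = 2 * (u * b + v * d) := by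
    intro u v; rw [hb, hd]; ring
  have e3 : ∀ s t : ℤ, 2 * (g * w₁ * s + g * w₂ * t) = g * (2 * (w₁ * s + w₂ * t)) := by
    intro s t; ring
  simp only [e1, e2, e3, key]

/-- The row `w` is `(ν, μ)` divided by `g = gcd(ν, μ, 2N)`, so no prime divides both its entries and
`M = 2|N|/g`. -/
theorem exists_reduced {ν μ N : ℤ} (hN : N ≠ 0) :
    1 ≤ reducedLevel ν μ N ∧ reducedLevel ν μ N ≤ N.natAbs ∧ ∃ w : ℤ × ℤ,
      (∀ γ, StabMod N (ν, μ) γ ↔ StabMod (reducedLevel ν μ N) w γ) ∧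
      (∀ p : ℕ, p.Prime → (p : ℤ) ∣ w.1 → (p : ℤ) ∣ w.2 → ¬ (p : ℤ) ∣ reducedLevel ν μ N) ∧
      (2 * N ∣ ν → (reducedLevel ν μ N : ℤ) ∣ w.1) ∧ (2 * N ∣ μ → (reducedLevel ν μ N : ℤ) ∣ w.2) := by
  set D := (2 * N).natAbs with hD
  have hDN : D = 2 * N.natAbs := by rw [hD, Int.natAbs_mul]; rfl
  have hDpos : 0 < D := by rw [hDN]; have := Int.natAbs_pos.2 hN; omega
  set g := Nat.gcd (Int.gcd ν μ) D with hg
  have hgpos : 0 < g := Nat.gcd_pos_of_pos_right _ hDpos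
  obtain ⟨M, hM⟩ : g ∣ D := Nat.gcd_dvd_right _ _
  have hgν : (g : ℤ) ∣ ν := (Int.natCast_dvd_natCast.2 (Nat.gcd_dvd_left _ _)).trans (Int.gcd_dvd_left ..)
  have hgμ : (g : ℤ) ∣ μ := (Int.natCast_dvd_natCast.2 (Nat.gcd_dvd_left _ _)).trans (Int.gcd_dvd_right ..)
  obtain ⟨w₁, hw₁⟩ := hgν
  obtain ⟨w₂, hw₂⟩ := hgμ
  have hMdiv : D / g = M := by rw [hM, Nat.mul_div_cancel_left _ hgpos]
  have hMpos : 0 < M := Nat.pos_of_ne_zero fun h => by rw [h, mul_zero] at hM; omega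
  have hgZ : (g : ℤ) ≠ 0 := by exact_mod_cast hgpos.ne'
  have hND : 2 * N = g * M ∨ 2 * N = -(g * M) := by
    have : (D : ℤ) = g * M := by exact_mod_cast hM
    rw [← this, hD]
    exact Int.natAbs_eq _
  have hcop : ∀ p : ℕ, p.Prime → (p : ℤ) ∣ w₁ → (p : ℤ) ∣ w₂ → ¬ p ∣ M := by
    intro p hp h1 h2 h3
    have h4 : g * p ∣ g := by
      rw [hg]
      refine Nat.dvd_gcd ?_ ?_
      · rw [← hg]
        refine Int.dvd_gcd ?_ ?_
        · rw [hw₁]; push_cast; exact mul_dvd_mul_left _ h1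
        · rw [hw₂]; push_cast; exact mul_dvd_mul_left _ h2
      · rw [← hg, hM]; exact mul_dvd_mul_left _ h3
    have h5 := Nat.le_of_dvd hgpos h4
    have := hp.two_le
    nlinarith
  have hdvd : ∀ z w : ℤ, z = g * w → 2 * N ∣ z → (M : ℤ) ∣ w := by
    intro z w hz h
    rw [hz] at h
    rcases hND with h' | h'
    · rwa [h', mul_dvd_mul_iff_left hgZ] at h
    · rwa [h', neg_dvd, mul_dvd_mul_iff_left hgZ] at h
  have hred : reducedLevel ν μ N = if Even M then M / 2 else M := by
    unfold reducedLevel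
    rw [← hD, ← hg, hMdiv]
  generalize reducedLevel ν μ N = K at hred ⊢
  have hKM : K ∣ M := by
    rw [hred]
    split_ifs with he
    · exact Nat.div_dvd_of_dvd he.two_dvd
    · exact dvd_rfl
  have hKMZ : (K : ℤ) ∣ M := Int.natCast_dvd_natCast.2 hKM
  refine ⟨Nat.pos_of_ne_zero fun h => ?_, ?_, (w₁, w₂), fun γ => ?_, fun p hp h1 h2 h3 => ?_,
    fun h => ?_, fun h => ?_⟩
  · rw [h, zero_dvd_iff] at hKM; omega
  · have hle : M ≤ g * M := Nat.le_mul_of_pos_left _ hgpos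
    rw [hred]
    split_ifs with he
    · omega
    -- An odd divisor of `2N` divides `N`.
    · have h1 : M ∣ 2 * N.natAbs := by rw [← hDN, hM]; exact dvd_mul_left _ _
      have h2 : Nat.Coprime M 2 := (Nat.not_even_iff_odd.1 he).coprime_two_right
      exact Nat.le_of_dvd (Int.natAbs_pos.2 hN) (h2.dvd_of_dvd_mul_left h1)
  · rw [hw₁, hw₂]
    refine stabMod_mul N hgZ hND (fun s => ?_) γ
    rw [hred]
    split_ifs with he
    · obtain ⟨m, hm⟩ := he.two_dvd
      rw [hm, Nat.mul_div_cancel_left _ two_pos]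
      push_cast
      rfl
    · rw [mul_dvd_mul_iff_left two_ne_zero]
      have h2 : IsCoprime (M : ℤ) 2 := by
        exact_mod_cast Nat.isCoprime_iff_coprime.2 (Nat.not_even_iff_odd.1 he).coprime_two_right
      exact ⟨fun h => h2.dvd_of_dvd_mul_left h, fun h => h.mul_left _⟩
  · refine hcop p hp h1 h2 ?_
    exact (Int.natCast_dvd_natCast.1 h3).trans hKM
  · exact hKMZ.trans (hdvd _ _ hw₁ h)
  · exact hKMZ.trans (hdvd _ _ hw₂ h)

theorem isCoprime_of_forall_prime {a K : ℤ} (h : ∀ p : ℕ, p.Prime → (p : ℤ) ∣ a → ¬ (p : ℤ) ∣ K) :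
    IsCoprime a K := by
  rw [Int.isCoprime_iff_gcd_eq_one]
  exact Nat.coprime_of_dvd fun p hp h1 h2 => h p hp (Int.natCast_dvd.2 h1) (Int.natCast_dvd.2 h2)

/-- The explicit form of the stabilizers, up to conjugation. -/
theorem stabMod_explicit {ν μ N : ℤ} (hN : N ≠ 0) :
    (∃ σ : SL(2, ℤ), ∀ γ, StabMod N (ν, μ) γ ↔
      RepresentedIn (picardMatrices (reducedLevel ν μ N)) (σ * γ * σ⁻¹)) ∧
    (2 * N ∣ ν → ∀ γ, StabMod N (ν, μ) γ ↔ RepresentedIn (picardMatrices (reducedLevel ν μ N)) γ) ∧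
    (2 * N ∣ μ → ∀ γ, StabMod N (ν, μ) γ ↔
      RepresentedIn (Matrix.transpose '' picardMatrices (reducedLevel ν μ N)) γ) := by
  obtain ⟨h1, h2, w, hw, hcop, hν, hμ⟩ := exists_reduced (ν := ν) (μ := μ) hN
  set K := reducedLevel ν μ N
  have hK : (K : ℤ) ≠ 0 := by exact_mod_cast (by omega : K ≠ 0)
  refine ⟨?_, fun h γ => ?_, fun h γ => ?_⟩
  -- Modulo `K` the row is primitive, hence of the form `(0, 1)σ`, and the stabilizers are conjugate
  -- by `σ`.
  · obtain ⟨a, b, ha, hb, hab⟩ := exists_coprime_lift hK hcop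
    obtain ⟨σ, hσ⟩ := exists_rowMul_eq hab
    refine ⟨σ, fun γ => ?_⟩
    rw [hw, representedIn_picardMatrices_iff hK, ← stabMod_rowMul, hσ]
    exact stabMod_congr isCoprime_one_left (by simpa using ha) (by simpa using hb) γ
  -- Now `w` is congruent to `w.2 · (0, 1)` modulo `K`, and `w.2` is a unit modulo `K`; no
  -- conjugation is needed.
  · rw [hw, representedIn_picardMatrices_iff hK]
    refine stabMod_congr (u := w.2) (isCoprime_of_forall_prime fun p hp h1 h2 =>
      hcop p hp (h2.trans (hν h)) h1 h2) (by simpa using hν h) (by simp) γ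
  · rw [hw, representedIn_transpose_iff hK]
    refine stabMod_congr (u := w.1) (isCoprime_of_forall_prime fun p hp h1 h2 =>
      hcop p hp h1 (h2.trans (hμ h)) h2) (by simp) (by simpa using hμ h) γ

/-! ### Picard's curves: existence, uniformization and genus -/

/-- This covers reduced level `1`, where `y` is constant and the quotient by `Γ(2)` is the `x`-line.
-/
theorem separatingPair_const (c : ℂ) :
    SeparatingPair 1 (CongruenceSubgroup.Gamma 2) (fun _ => c) := by
  refine ⟨one_pos, Subalgebra.algebraMap_mem _ c, fun γ => by simp, fun τ τ' hx _ => ?_,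
    fun δ hδ δ' hδ' σ _ _ => ?_⟩
  · obtain ⟨γ, hγ, h⟩ := exists_gamma_two_of_picardX_eq hx
    exact ⟨γ, hγ, h⟩
  · exact ⟨δ * δ'⁻¹, mul_mem hδ (inv_mem hδ'), by rw [← mul_smul]; congr 1; group⟩

theorem picardY_natAbs (ν μ N : ℤ) : picardY ν μ N.natAbs = picardY ν μ N := by
  funext τ
  rcases Int.natAbs_eq N with h | h
  · rw [← h]
  · have h1 := pY_neg_level (-N) (ν, μ) τ
    rw [neg_neg] at h1
    rw [show ((N.natAbs : ℕ) : ℤ) = -N by omega]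
    exact h1.symm

theorem separatingPair_picardY {ν μ N : ℤ} (hN : N ≠ 0) (h : ¬ IsDegenerate ν μ N) :
    SeparatingPair N.natAbs (autGroup (picardY ν μ N)) (picardY ν μ N) := by
  have h1 : IsNonDeg (N.natAbs : ℤ) (ν, μ) := by
    have h2 := not_isDegenerate_iff.1 h
    rw [← not_isDegenerate_iff] at h2 ⊢
    unfold IsDegenerate at h2 ⊢
    have e1 : ∀ z : ℤ, (N.natAbs : ℤ) ∣ z ↔ N ∣ z := fun z => Int.natAbs_dvd
    have e2 : ∀ z : ℤ, 2 * (N.natAbs : ℤ) ∣ z ↔ 2 * N ∣ z := fun z => by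
      rw [← Int.natAbs_dvd (a := 2 * N), Int.natAbs_mul]
      push_cast
      rfl
    rwa [e1, e1, e2, e2]
  have h2 := separatingPair_pY (Int.natAbs_pos.2 hN) h1
  have h3 : pY (N.natAbs : ℤ) (ν, μ) = picardY ν μ N := picardY_natAbs ν μ N
  rwa [h3] at h2

theorem SeparatingPair.exists_curve {K : ℕ} {G : Subgroup SL(2, ℤ)} {y : ℍ → ℂ}
    (hs : SeparatingPair K G y) :
    ∃ C : PlaneCurve, ∀ τ : ℍ, MvPolynomial.eval ![picardX τ, y τ] C.poly = 0 :=
  PicardUniformization.exists_curve hs.pos hs.mem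

/-- Picard's functions with parameters `(0, 1, K)` are uniformized by `G^(K)`. -/
theorem exists_separatingPair_picardMatrices {K : ℕ} (hK : 1 ≤ K) :
    ∃ (n : ℕ) (G : Subgroup SL(2, ℤ)), SeparatingPair n G (picardY 0 1 K) ∧
      ∀ γ, γ ∈ G ↔ RepresentedIn (picardMatrices K) γ := by
  have hK0 : (K : ℤ) ≠ 0 := by exact_mod_cast (by omega : K ≠ 0)
  rcases hK.eq_or_lt with rfl | hK
  · obtain ⟨c, hc⟩ := picardY_of_isDegenerate (ν := 0) (μ := 1) (N := (1 : ℕ)) (by norm_num)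
      (Or.inl ⟨dvd_zero _, by simp⟩)
    refine ⟨1, CongruenceSubgroup.Gamma 2, ?_, fun γ => ?_⟩
    · rw [show picardY 0 1 (1 : ℕ) = fun _ => c from funext hc]
      exact separatingPair_const c
    · rw [representedIn_picardMatrices_iff hK0]
      unfold StabMod
      refine ⟨fun h => ⟨h, 1, Or.inl rfl, ?_⟩, fun h => h.1⟩
      have := (mem_gamma_two_iff γ).1 h
      simpa using this.2.2
  · have hd : ¬ IsDegenerate 0 1 (K : ℤ) := by
      rintro (⟨-, h⟩ | ⟨h, -⟩)
      · have := Int.le_of_dvd one_pos h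
        omega
      · have := Int.le_of_dvd one_pos h
        omega
    exact ⟨_, _, separatingPair_picardY hK0 hd, fun γ => by
      rw [mem_autGroup_picardY_iff hK0 hd, representedIn_picardMatrices_iff hK0]⟩

theorem topologicalGenus_congr {X Y : Type} [TopologicalSpace X] [TopologicalSpace Y] (e : X ≃ₜ Y) :
    topologicalGenus X = topologicalGenus Y := by
  unfold topologicalGenus
  congr 1
  exact LinearEquiv.finrank_eq ((((AlgebraicTopology.singularHomologyFunctor (ModuleCat.{0} ℚ) 1).obj
    (ModuleCat.of ℚ ℚ)).mapIso (TopCat.isoOfHomeo e)).toLinearEquiv)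

/-- Conjugate groups have homeomorphic quotients. -/
def quotientHomeo {G H : Subgroup SL(2, ℤ)} (σ : SL(2, ℤ)) (h : ∀ γ, γ ∈ G ↔ σ * γ * σ⁻¹ ∈ H) :
    CompactifiedQuotient G ≃ₜ CompactifiedQuotient H where
  toEquiv := Quotient.congr (Homeomorph.smul σ : ExtendedUHP ≃ₜ ExtendedUHP).toEquiv (by
    intro a b
    constructor
    · rintro ⟨⟨γ, hγ⟩, rfl⟩
      refine ⟨⟨_, (h γ).1 hγ⟩, ?_⟩
      show (σ * γ * σ⁻¹) • σ • b = σ • γ • b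
      rw [mul_smul, mul_smul, inv_smul_smul]
    · rintro ⟨⟨γ, hγ⟩, hab⟩
      have hab : γ • σ • b = σ • a := hab
      refine ⟨⟨σ⁻¹ * γ * σ, (h _).2 (by convert hγ using 1; group)⟩, ?_⟩
      show (σ⁻¹ * γ * σ) • b = a
      rw [mul_smul, mul_smul, hab, inv_smul_smul])
  continuous_toFun := by
    refine isQuotientMap_quotient_mk'.continuous_iff.2 ?_
    exact continuous_quotient_mk'.comp (continuous_const_smul σ)
  continuous_invFun := by
    refine isQuotientMap_quotient_mk'.continuous_iff.2 ?_
    exact continuous_quotient_mk'.comp (continuous_const_smul σ⁻¹)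

theorem isCongruenceSubgroup_autGroup {ν μ N : ℤ} (hN : N ≠ 0) (h : ¬ IsDegenerate ν μ N) :
    CongruenceSubgroup.IsCongruenceSubgroup (autGroup (picardY ν μ N)) := by
  have hs := separatingPair_picardY hN h
  refine ⟨2 * N.natAbs, by have := Int.natAbs_pos.2 hN; omega, fun γ hγ => ?_⟩
  exact fun τ => hs.mem.2.1 γ hγ τ

theorem autGroup_picardY_eq {ν μ N : ℤ} (hN : N ≠ 0) (h : ¬ IsDegenerate ν μ N) :
    autGroup (picardY ν μ N) = picardGroup ν μ N := by
  unfold picardGroup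
  rw [autGroup_picardX, right_eq_inf]
  exact fun γ hγ => ((mem_autGroup_picardY_iff hN h γ).1 hγ).1

/-- The curve is uniformized by a group with the matrices of level `𝐍`, to which `Aut y` is
conjugate; conjugate groups have homeomorphic quotients. -/
theorem genus_eq {ν μ N : ℤ} (hN : N ≠ 0) (h : ¬ IsDegenerate ν μ N) {C : PlaneCurve}
    (hC : IsPicardCurve 0 1 (reducedLevel ν μ N) C) :
    topologicalGenus (CompactifiedQuotient (autGroup (picardY ν μ N))) =
      topologicalGenus C.RiemannSurface := by
  obtain ⟨n, G, hs, hG⟩ := exists_separatingPair_picardMatrices (exists_reduced (ν := ν) (μ := μ) hN).1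
  obtain ⟨Φ, -⟩ := hs.uniformizes hC
  obtain ⟨σ, hσ⟩ := (stabMod_explicit (ν := ν) (μ := μ) hN).1
  rw [← topologicalGenus_congr Φ]
  refine topologicalGenus_congr (quotientHomeo σ fun γ => ?_)
  rw [mem_autGroup_picardY_iff hN h, hσ, hG]

end PicardUniformization

end

/-! ### Free bases and their computation. -/

noncomputable section

namespace PicardUniformization

/-! ### Free bases of subgroups of free groups -/

section Schreier

variable {ι : Type*} {H : Subgroup (FreeGroup ι)}

theorem smul_mk_coset (x y : FreeGroup ι) :
    x • (y : FreeGroup ι ⧸ H) = ((x * y : FreeGroup ι) : FreeGroup ι ⧸ H) := rfl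

theorem smul_one_coset {x : FreeGroup ι} (hx : x ∈ H) :
    x • ((1 : FreeGroup ι) : FreeGroup ι ⧸ H) = ((1 : FreeGroup ι) : FreeGroup ι ⧸ H) := by
  rw [smul_mk_coset, mul_one]
  exact QuotientGroup.eq.2 (by simpa using hx)

/-- The Schreier generators that are not trivial, for a set of coset representatives. -/
abbrev SchreierIndex (rp : FreeGroup ι ⧸ H → FreeGroup ι) : Type _ :=
  {p : (FreeGroup ι ⧸ H) × ι // (rp (FreeGroup.of p.2 • p.1))⁻¹ * (FreeGroup.of p.2 * rp p.1) ≠ 1}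

/-- The Schreier generator with a given index. -/
def schreierGen (rp : FreeGroup ι ⧸ H → FreeGroup ι) (e : SchreierIndex rp) : FreeGroup ι :=
  (rp (FreeGroup.of e.1.2 • e.1.1))⁻¹ * (FreeGroup.of e.1.2 * rp e.1.1)

open Classical in
/-- The formal letter attached to an edge of the coset graph. -/
def edgeLetter (rp : FreeGroup ι ⧸ H → FreeGroup ι) (q : FreeGroup ι ⧸ H) (g : ι) :
    FreeGroup (SchreierIndex rp) :=
  if h : (rp (FreeGroup.of g • q))⁻¹ * (FreeGroup.of g * rp q) ≠ 1 then
    FreeGroup.of ⟨(q, g), h⟩ else 1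

/-- The action of a generator on the covering of the coset graph. -/
def edgePerm (rp : FreeGroup ι ⧸ H → FreeGroup ι) (g : ι) :
    Equiv.Perm ((FreeGroup ι ⧸ H) × FreeGroup (SchreierIndex rp)) where
  toFun p := (FreeGroup.of g • p.1, edgeLetter rp p.1 g * p.2)
  invFun p := ((FreeGroup.of g)⁻¹ • p.1, (edgeLetter rp ((FreeGroup.of g)⁻¹ • p.1) g)⁻¹ * p.2)
  left_inv p := by simp
  right_inv p := by simp

/-- The action of the free group on the covering of the coset graph. -/
def edgeAction (rp : FreeGroup ι ⧸ H → FreeGroup ι) :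
    FreeGroup ι →* Equiv.Perm ((FreeGroup ι ⧸ H) × FreeGroup (SchreierIndex rp)) :=
  FreeGroup.lift (edgePerm rp)

theorem edgeAction_apply (rp : FreeGroup ι ⧸ H → FreeGroup ι) (x : FreeGroup ι) :
    ∀ p : (FreeGroup ι ⧸ H) × FreeGroup (SchreierIndex rp),
      edgeAction rp x p = (x • p.1, (edgeAction rp x (p.1, 1)).2 * p.2) := by
  induction x using FreeGroup.induction_on with
  | C1 => intro p; simp
  | of g => intro p; simp [edgeAction, edgePerm]
  | inv_of g _ =>
    intro p
    have h : ∀ p, edgeAction rp (FreeGroup.of g)⁻¹ p = (edgePerm rp g).symm p := fun p => by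
      rw [map_inv, edgeAction, FreeGroup.lift_apply_of]
      rfl
    rw [h, h]
    simp [edgePerm]
  | mul x y hx hy =>
    intro p
    rw [map_mul, Equiv.Perm.mul_apply, Equiv.Perm.mul_apply, hy p, hx, hy (p.1, 1),
      hx (y • p.1, _ * 1)]
    simp [mul_smul, mul_assoc]

/-- The second component of the orbit of the base point. -/
def edgeCocycle (rp : FreeGroup ι ⧸ H → FreeGroup ι) (x : FreeGroup ι) :
    FreeGroup (SchreierIndex rp) := (edgeAction rp x ((1 : FreeGroup ι), 1)).2

/-- Elements of `H` fix the base coset, so on `H` the cocycle is a homomorphism; it will invert the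
map given by the Schreier generators. -/
theorem edgeCocycle_mul (rp : FreeGroup ι ⧸ H → FreeGroup ι) (x : FreeGroup ι) {h : FreeGroup ι}
    (hh : h ∈ H) : edgeCocycle rp (x * h) = edgeCocycle rp x * edgeCocycle rp h := by
  have h1 := smul_one_coset hh
  unfold edgeCocycle
  rw [map_mul, Equiv.Perm.mul_apply, edgeAction_apply rp h, edgeAction_apply rp x, h1, mul_one]

theorem edgeCocycle_of_mul (rp : FreeGroup ι ⧸ H → FreeGroup ι) (g : ι) (x : FreeGroup ι) :
    edgeCocycle rp (FreeGroup.of g * x) =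
      edgeLetter rp (x : FreeGroup ι ⧸ H) g * edgeCocycle rp x := by
  unfold edgeCocycle
  rw [map_mul, Equiv.Perm.mul_apply, edgeAction_apply rp x]
  simp [edgeAction, edgePerm]

theorem schreierGen_mem (rp : FreeGroup ι ⧸ H → FreeGroup ι)
    (hrp : ∀ q, ((rp q : FreeGroup ι) : FreeGroup ι ⧸ H) = q) (q : FreeGroup ι ⧸ H)
    (x : FreeGroup ι) : (rp (x • q))⁻¹ * (x * rp q) ∈ H := by
  rw [← QuotientGroup.eq, hrp]
  conv_lhs => rw [← hrp q]
  rfl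

/-- Schreier generators along a tree of coset representatives form a free basis. -/
theorem schreier_free_basis (rp : FreeGroup ι ⧸ H → FreeGroup ι)
    (hrp : ∀ q, ((rp q : FreeGroup ι) : FreeGroup ι ⧸ H) = q)
    (h1 : rp (1 : FreeGroup ι) = 1) (len : FreeGroup ι ⧸ H → ℕ)
    (htree : ∀ q : FreeGroup ι ⧸ H, q ≠ (1 : FreeGroup ι) → ∃ (q' : FreeGroup ι ⧸ H) (g : ι),
      len q' < len q ∧ (rp q = FreeGroup.of g * rp q' ∨ rp q = (FreeGroup.of g)⁻¹ * rp q')) :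
    Function.Injective (FreeGroup.lift (schreierGen rp)) ∧
      (FreeGroup.lift (schreierGen rp)).range = H := by
  -- Tree edges carry the trivial letter, and every representative is reached along the tree.
  have hcoc : ∀ q, edgeCocycle rp (rp q) = 1 := by
    intro q
    induction hn : len q using Nat.strong_induction_on generalizing q with
    | _ n ih =>
      by_cases hq : q = (1 : FreeGroup ι)
      · rw [hq, h1]; simp [edgeCocycle]
      obtain ⟨q', g, hlt, h⟩ := htree q hq
      have h0 := ih _ (hn ▸ hlt) q' rfl
      rcases h with h | h
      · rw [h, edgeCocycle_of_mul, h0, mul_one, hrp, edgeLetter, dif_neg]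
        rw [not_not, ← h]
        have : FreeGroup.of g • q' = q := by
          rw [← hrp q, h, ← smul_mk_coset, hrp]
        rw [this, inv_mul_cancel]
      · have h2 : rp q' = FreeGroup.of g * rp q := by rw [h, mul_inv_cancel_left]
        rw [h2, edgeCocycle_of_mul, hrp, edgeLetter, dif_neg, one_mul] at h0
        · exact h0
        · rw [not_not, ← h2]
          have : FreeGroup.of g • q = q' := by
            rw [← hrp q', h2, ← smul_mk_coset, hrp]
          rw [this, inv_mul_cancel]
  have hmem : ∀ e, schreierGen rp e ∈ H := fun e => schreierGen_mem rp hrp _ _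
  -- Each Schreier generator crosses exactly one edge outside the tree, so the cocycle returns its
  -- letter. This is the left inverse that proves injectivity.
  have hgen : ∀ e, edgeCocycle rp (schreierGen rp e) = FreeGroup.of e := by
    intro e
    have h2 := edgeCocycle_mul rp (rp (FreeGroup.of e.1.2 • e.1.1)) (hmem e)
    rw [hcoc, one_mul, schreierGen, mul_inv_cancel_left, edgeCocycle_of_mul, hcoc, mul_one,
      hrp, edgeLetter, dif_pos e.2] at h2
    exact h2.symm
  have hle : (FreeGroup.lift (schreierGen rp)).range ≤ H := by
    refine FreeGroup.range_lift_le ?_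
    rintro _ ⟨e, rfl⟩
    exact hmem e
  constructor
  · have key : ∀ z, edgeCocycle rp (FreeGroup.lift (schreierGen rp) z) = z := by
      let c : H →* FreeGroup (SchreierIndex rp) :=
        { toFun := fun h => edgeCocycle rp h
          map_one' := by simp [edgeCocycle]
          map_mul' := fun a b => edgeCocycle_mul rp a b.2 }
      let f : FreeGroup (SchreierIndex rp) →* H :=
        FreeGroup.lift fun e => ⟨schreierGen rp e, hmem e⟩
      have hf : ∀ z, (f z : FreeGroup ι) = FreeGroup.lift (schreierGen rp) z := by
        have : H.subtype.comp f = FreeGroup.lift (schreierGen rp) := by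
          ext e
          simp [f]
        exact fun z => DFunLike.congr_fun this z
      have hcf : c.comp f = MonoidHom.id _ := by
        ext e
        simp only [MonoidHom.comp_apply, f, FreeGroup.lift_apply_of, MonoidHom.id_apply]
        exact hgen e
      intro z
      rw [← hf]
      exact DFunLike.congr_fun hcf z
    exact Function.LeftInverse.injective key
  · refine le_antisymm hle ?_
    -- The path of `x` through the coset graph telescopes into Schreier generators and their
    -- inverses; for `x ∈ H` it starts and ends at the base coset.
    have key : ∀ (x : FreeGroup ι) (q : FreeGroup ι ⧸ H), (rp (x • q))⁻¹ * (x * rp q) ∈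
        (FreeGroup.lift (schreierGen rp)).range := by
      have hof : ∀ (g : ι) (q : FreeGroup ι ⧸ H),
          (rp (FreeGroup.of g • q))⁻¹ * (FreeGroup.of g * rp q) ∈
            (FreeGroup.lift (schreierGen rp)).range := by
        intro g q
        by_cases h : (rp (FreeGroup.of g • q))⁻¹ * (FreeGroup.of g * rp q) = 1
        · rw [h]; exact one_mem _
        · exact ⟨FreeGroup.of ⟨(q, g), h⟩, by rw [FreeGroup.lift_apply_of]; rfl⟩
      intro x
      induction x using FreeGroup.induction_on with
      | C1 => intro q; simp
      | of g => exact hof g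
      | inv_of g _ =>
        intro q
        have := inv_mem (hof g ((FreeGroup.of g)⁻¹ • q))
        rw [smul_inv_smul] at this
        convert this using 1
        rw [mul_inv_rev, mul_inv_rev, inv_inv, mul_assoc]
      | mul x y hx hy =>
        intro q
        have := mul_mem (hx (y • q)) (hy q)
        rw [← mul_smul] at this
        convert this using 1
        group
    intro x hx
    have h2 := key x (1 : FreeGroup ι)
    rw [smul_one_coset hx, h1] at h2
    simpa using h2

end Schreier

/-! ### The image of `Γ(2)` in the modular group is free -/

theorem re_S_smul_mul (τ : ℍ) :
    (ModularGroup.S • τ).re * (τ.re ^ 2 + τ.im ^ 2) = -τ.re := by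
  have h : τ.re ^ 2 + τ.im ^ 2 ≠ 0 := by have := τ.im_pos; positivity
  rw [UpperHalfPlane.modular_S_smul, ← UpperHalfPlane.coe_re, UpperHalfPlane.coe_mk,
    Complex.inv_re, Complex.normSq_apply, Complex.neg_re, Complex.neg_im, UpperHalfPlane.coe_re,
    UpperHalfPlane.coe_im]
  rw [show -τ.re * -τ.re + -τ.im * -τ.im = τ.re ^ 2 + τ.im ^ 2 by ring]
  field_simp

theorem S_smul_S_smul (τ : ℍ) : ModularGroup.S • ModularGroup.S • τ = τ := by
  rw [← mul_smul, S_mul_S]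
  have := ModularGroup.SL_neg_smul 1 τ
  rw [this, one_smul]

theorem re_genA_smul (τ : ℍ) : (genA • τ).re = τ.re + 2 := by
  rw [genA_eq, mul_smul, ModularGroup.re_T_smul, ModularGroup.re_T_smul]
  ring

theorem re_genA_inv_smul (τ : ℍ) : (genA⁻¹ • τ).re = τ.re - 2 := by
  have := re_genA_smul (genA⁻¹ • τ)
  rw [smul_inv_smul] at this
  linarith

theorem re_S_genB_smul (τ : ℍ) : (ModularGroup.S • genB • τ).re = (ModularGroup.S • τ).re - 2 := by
  rw [genB_eq, mul_smul, mul_smul, S_smul_S_smul, SL_inv_smul_eq, re_genA_inv_smul]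

theorem re_S_genB_inv_smul (τ : ℍ) :
    (ModularGroup.S • genB⁻¹ • τ).re = (ModularGroup.S • τ).re + 2 := by
  have := re_S_genB_smul (genB⁻¹ • τ)
  rw [smul_inv_smul] at this
  linarith

/-- The homomorphism from the free group of rank two onto the Sanov subgroup. -/
def sanovHom : FreeGroup (Fin 2) →* SL(2, ℤ) := FreeGroup.lift ![genA, genB]

open scoped Pointwise in
-- Ping-pong on the upper half-plane: `genA` shifts `Re τ` by `2` and `genB` shifts `s τ = Re
-- (-1/τ)` by `-2`. The four half-planes and half-discs are disjoint because `s τ · |τ|² = -Re τ`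
-- and `Im τ > 0`.
theorem sanovHom_injective : Function.Injective sanovHom := by
  obtain ⟨s, hs⟩ : ∃ s : ℍ → ℝ, ∀ τ, (ModularGroup.S • τ).re = s τ := ⟨_, fun _ => rfl⟩
  have hS : ∀ τ : ℍ, s τ * (τ.re ^ 2 + τ.im ^ 2) = -τ.re := fun τ => hs τ ▸ re_S_smul_mul τ
  have hpos : ∀ τ : ℍ, 0 < τ.im ^ 2 := fun τ => by have := τ.im_pos; positivity
  have hB : ∀ τ : ℍ, s (genB • τ) = s τ - 2 := fun τ => by
    rw [← hs, ← hs, re_S_genB_smul]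
  have hB' : ∀ τ : ℍ, s (genB⁻¹ • τ) = s τ + 2 := fun τ => by
    rw [← hs, ← hs, re_S_genB_inv_smul]
  refine FreeGroup.injective_lift_of_ping_pong (α := ℍ) ![genA, genB]
    ![{τ | 1 ≤ τ.re}, {τ | s τ < -1}] ![{τ | τ.re < -1}, {τ | 1 ≤ s τ}] ?_ ?_ ?_ ?_ ?_ ?_
  · refine Fin.forall_fin_two.2 ⟨⟨genA • UpperHalfPlane.I, ?_⟩, ⟨genB • UpperHalfPlane.I, ?_⟩⟩
    · change (1 : ℝ) ≤ (genA • UpperHalfPlane.I).re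
      rw [re_genA_smul]
      norm_num
    · change s (genB • UpperHalfPlane.I) < -1
      have h := hS UpperHalfPlane.I
      rw [hB]
      norm_num at h ⊢
      linarith
  · intro i j hij
    rw [Function.onFun, Set.disjoint_left]
    intro τ h1 h2
    have := hS τ
    have := hpos τ
    fin_cases i <;> fin_cases j <;> simp at h1 h2 hij <;> nlinarith
  · intro i j hij
    rw [Function.onFun, Set.disjoint_left]
    intro τ h1 h2
    have := hS τ
    have := hpos τ
    fin_cases i <;> fin_cases j <;> simp at h1 h2 hij <;> nlinarith
  · intro i j
    rw [Set.disjoint_left]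
    intro τ h1 h2
    have := hS τ
    have := hpos τ
    fin_cases i <;> fin_cases j <;> simp at h1 h2 <;> nlinarith
  · refine Fin.forall_fin_two.2 ⟨?_, ?_⟩ <;> rw [Set.smul_set_subset_iff] <;> intro τ h
    · replace h : ¬ τ.re < -1 := h
      change 1 ≤ (genA • τ).re
      rw [re_genA_smul]
      linarith
    · replace h : ¬ 1 ≤ s τ := h
      change s (genB • τ) < -1
      rw [hB]
      linarith
  · refine Fin.forall_fin_two.2 ⟨?_, ?_⟩ <;> rw [Set.smul_set_subset_iff] <;> intro τ h
    · replace h : ¬ 1 ≤ τ.re := h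
      change (genA⁻¹ • τ).re < -1
      rw [re_genA_inv_smul]
      linarith
    · replace h : ¬ s τ < -1 := h
      change 1 ≤ s (genB⁻¹ • τ)
      rw [hB']
      linarith

theorem mk_neg (γ : SL(2, ℤ)) : QuotientGroup.mk' (Subgroup.center SL(2, ℤ)) (-γ) =
    QuotientGroup.mk' (Subgroup.center SL(2, ℤ)) γ := by
  refine QuotientGroup.eq.2 ?_
  have : (-γ)⁻¹ * γ = -1 := by
    ext i j
    simp [Matrix.SpecialLinearGroup.coe_neg]
  rw [this]
  exact Matrix.SpecialLinearGroup.mem_center_iff.2 ⟨-1, by simp, by simp⟩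

/-- The homomorphism from the free group of rank two to the modular group. -/
def sanovPSL : FreeGroup (Fin 2) →* Matrix.ProjectiveSpecialLinearGroup (Fin 2) ℤ :=
  (QuotientGroup.mk' (Subgroup.center SL(2, ℤ))).comp sanovHom

/-- A word in the kernel is sent to a scalar matrix of square `1`, so its square is trivial, and
free groups have no torsion. -/
theorem sanovPSL_injective : Function.Injective sanovPSL := by
  rw [injective_iff_map_eq_one]
  intro w hw
  have h1 : sanovHom w ∈ Subgroup.center SL(2, ℤ) := (QuotientGroup.eq_one_iff _).1 hw
  obtain ⟨r, hr, h⟩ := Matrix.SpecialLinearGroup.mem_center_iff.1 h1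
  have h2 : sanovHom (w ^ 2) = 1 := by
    rw [map_pow]
    ext i j
    rw [Fintype.card_fin] at hr
    rw [Matrix.SpecialLinearGroup.coe_pow, ← h, ← map_pow, hr]
    simp
  have h3 : w ^ 2 = 1 := sanovHom_injective (h2.trans (map_one _).symm)
  simpa using h3

theorem range_sanovHom : sanovHom.range = sanov := by
  rw [sanovHom, FreeGroup.range_lift_eq_closure, sanov]
  congr 1
  simp [Set.pair_comm]

/-- `Γ(2)` is generated by the Sanov group and `-1`, and the sign is lost in `PSL₂(ℤ)`. -/
theorem map_sanovPSL_comap {G : Subgroup SL(2, ℤ)} (hG : G ≤ CongruenceSubgroup.Gamma 2)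
    (hneg : ∀ γ ∈ G, -γ ∈ G) : (G.comap sanovHom).map sanovPSL = inPSL G := by
  unfold inPSL sanovPSL
  rw [← Subgroup.map_map]
  refine le_antisymm (Subgroup.map_mono (Subgroup.map_comap_le _ _)) ?_
  rintro _ ⟨γ, hγ, rfl⟩
  have key : ∀ δ ∈ G, δ ∈ sanov → δ ∈ (G.comap sanovHom).map sanovHom := by
    intro δ hδ h
    rw [← range_sanovHom] at h
    obtain ⟨w, rfl⟩ := h
    exact ⟨w, hδ, rfl⟩
  rcases mem_sanov_or_neg (hG hγ) with h | h
  · exact ⟨γ, key γ hγ h, rfl⟩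
  · exact ⟨-γ, key _ (hneg γ hγ) h, mk_neg γ⟩

theorem isFreeGroup_of_isFreeBasis {H : Type*} [Group H] {L : List H} {G : Subgroup H}
    (h : IsFreeBasis L G) : IsFreeGroup G := by
  obtain ⟨h1, rfl⟩ := h
  exact IsFreeGroup.ofMulEquiv (MonoidHom.ofInjective h1)

/-- Reindexing a free basis by a list. -/
theorem isFreeBasis_map {E J G : Type*} [Group G] {f : E → G}
    (hf : Function.Injective (FreeGroup.lift f)) {L : List J} (hL : L.Nodup) (F : J → G) (s : E → J)
    (hs : Function.Injective s) (hmem : ∀ j, j ∈ L ↔ j ∈ Set.range s) (hF : ∀ e, F (s e) = f e) :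
    IsFreeBasis (L.map F) (FreeGroup.lift f).range := by
  classical
  have hlen : (L.map F).length = L.length := List.length_map ..
  let e₁ : Fin (L.map F).length ≃ {j // j ∈ L} := (finCongr hlen).trans (hL.getEquiv L)
  let e₂ : E ≃ {j // j ∈ L} := Equiv.ofBijective (fun e => ⟨s e, (hmem _).2 ⟨e, rfl⟩⟩)
    ⟨fun a b h => hs (congrArg Subtype.val h), fun j => by
      obtain ⟨e, he⟩ := (hmem j).1 j.2
      exact ⟨e, Subtype.ext he⟩⟩
  let e : Fin (L.map F).length ≃ E := e₁.trans e₂.symm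
  have hget : (fun i : Fin (L.map F).length => (L.map F).get i) = f ∘ e := by
    funext i
    rw [Function.comp, ← hF]
    have : s (e i) = (e₁ i).1 := congrArg Subtype.val (e₂.apply_symm_apply (e₁ i))
    rw [this]
    simp [e₁]
  have hlift : FreeGroup.lift (fun i : Fin (L.map F).length => (L.map F).get i) =
      (FreeGroup.lift f).comp (FreeGroup.freeGroupCongr e).toMonoidHom := by
    rw [hget]
    ext i
    simp
  unfold IsFreeBasis
  rw [hlift]
  refine ⟨hf.comp (FreeGroup.freeGroupCongr e).injective, ?_⟩
  rw [MonoidHom.range_comp, MonoidHom.range_eq_top_of_surjective (FreeGroup.freeGroupCongr e).toMonoidHom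
      (FreeGroup.freeGroupCongr e).surjective,
    MonoidHom.range_eq_map]

/-! ### An enumeration of the free group and minimal coset representatives -/

/-- The generators of the free group and their inverses. -/
def wordLetter (i : ℕ) : FreeGroup (Fin 2) :=
  if i = 0 then FreeGroup.of 0 else if i = 1 then (FreeGroup.of 0)⁻¹ else
    if i = 2 then FreeGroup.of 1 else (FreeGroup.of 1)⁻¹

/-- An enumeration of the elements of the free group of rank two. -/
def word : ℕ → FreeGroup (Fin 2)
  | 0 => 1
  | n + 1 => wordLetter (n % 4) * word (n / 4)
decreasing_by omega

theorem word_zero : word 0 = 1 := by rw [word]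

theorem word_succ (n : ℕ) : word (n + 1) = wordLetter (n % 4) * word (n / 4) := by rw [word]

theorem word_letter {i : ℕ} (hi : i < 4) (k : ℕ) :
    word (4 * k + i + 1) = wordLetter i * word k := by
  rw [word_succ, show (4 * k + i) % 4 = i by omega, show (4 * k + i) / 4 = k by omega]

theorem word_generator (g : Fin 2) (k : ℕ) :
    word (4 * k + 2 * (g : ℕ) + 1) = FreeGroup.of g * word k := by
  rw [word_letter (by omega)]
  fin_cases g <;> simp [wordLetter]

theorem word_surjective : Function.Surjective word := by
  suffices h : ∀ x n, ∃ m, word m = x * word n by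
    intro x
    obtain ⟨m, hm⟩ := h x 0
    exact ⟨m, by rw [hm, word_zero, mul_one]⟩
  intro x
  induction x using FreeGroup.induction_on with
  | C1 => exact fun n => ⟨n, (one_mul _).symm⟩
  | of g => exact fun n => ⟨_, word_generator g n⟩
  | inv_of g _ =>
    refine fun n => ⟨4 * n + (2 * (g : ℕ) + 1) + 1, ?_⟩
    rw [word_letter (by omega)]
    fin_cases g <;> simp [wordLetter]
  | mul x y hx hy =>
    intro n
    obtain ⟨m, hm⟩ := hy n
    obtain ⟨k, hk⟩ := hx m
    exact ⟨k, by rw [hk, hm, mul_assoc]⟩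

section Cosets

variable {H : Subgroup (FreeGroup (Fin 2))}

theorem exists_word_coset (q : FreeGroup (Fin 2) ⧸ H) :
    ∃ n, ((word n : FreeGroup (Fin 2)) : FreeGroup (Fin 2) ⧸ H) = q := by
  obtain ⟨x, rfl⟩ := QuotientGroup.mk_surjective q
  obtain ⟨n, rfl⟩ := word_surjective x
  exact ⟨n, rfl⟩

open Classical in
/-- The position of the first word in a coset. -/
def cosetIdx (q : FreeGroup (Fin 2) ⧸ H) : ℕ := Nat.find (exists_word_coset q)

theorem word_cosetIdx (q : FreeGroup (Fin 2) ⧸ H) :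
    ((word (cosetIdx q) : FreeGroup (Fin 2)) : FreeGroup (Fin 2) ⧸ H) = q := by
  classical
  exact Nat.find_spec (exists_word_coset q)

theorem cosetIdx_le {n : ℕ} {q : FreeGroup (Fin 2) ⧸ H}
    (h : ((word n : FreeGroup (Fin 2)) : FreeGroup (Fin 2) ⧸ H) = q) : cosetIdx q ≤ n := by
  classical
  exact Nat.find_min' (exists_word_coset q) h

theorem cosetIdx_word_cosetIdx (q : FreeGroup (Fin 2) ⧸ H) :
    cosetIdx ((word (cosetIdx q) : FreeGroup (Fin 2)) : FreeGroup (Fin 2) ⧸ H) = cosetIdx q := by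
  rw [word_cosetIdx]

/-- Initial segments of minimal representatives are minimal. -/
theorem cosetIdx_word_of_succ {n : ℕ}
    (h : cosetIdx ((word (n + 1) : FreeGroup (Fin 2)) : FreeGroup (Fin 2) ⧸ H) = n + 1) :
    cosetIdx ((word (n / 4) : FreeGroup (Fin 2)) : FreeGroup (Fin 2) ⧸ H) = n / 4 := by
  refine le_antisymm (cosetIdx_le rfl) ?_
  set m := cosetIdx ((word (n / 4) : FreeGroup (Fin 2)) : FreeGroup (Fin 2) ⧸ H) with hm
  have h1 : ((word m : FreeGroup (Fin 2)) : FreeGroup (Fin 2) ⧸ H) = (word (n / 4)) :=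
    word_cosetIdx _
  -- Replacing the tail `n / 4` by the first word of its coset gives a word of the same coset with
  -- number `4m + n % 4 + 1`.
  have h2 : cosetIdx ((word (n + 1) : FreeGroup (Fin 2)) : FreeGroup (Fin 2) ⧸ H) ≤
      4 * m + n % 4 + 1 := by
    refine cosetIdx_le ?_
    rw [word_letter (Nat.mod_lt _ (by norm_num)), word_succ, ← smul_mk_coset, h1, smul_mk_coset]
  omega

variable (H) in
theorem cosetIdx_one : cosetIdx ((1 : FreeGroup (Fin 2)) : FreeGroup (Fin 2) ⧸ H) = 0 :=
  Nat.le_zero.1 (cosetIdx_le (by rw [word_zero]))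

variable (H) in
/-- The minimal representatives form a Schreier transversal. -/
theorem schreier_free_basis_word :
    Function.Injective (FreeGroup.lift
      (schreierGen (fun q : FreeGroup (Fin 2) ⧸ H => word (cosetIdx q)))) ∧
    (FreeGroup.lift
      (schreierGen (fun q : FreeGroup (Fin 2) ⧸ H => word (cosetIdx q)))).range = H := by
  refine schreier_free_basis _ word_cosetIdx (by rw [cosetIdx_one, word_zero]) cosetIdx ?_
  intro q hq
  obtain ⟨n, hn⟩ : ∃ n, cosetIdx q = n + 1 := by
    refine Nat.exists_eq_succ_of_ne_zero fun h => hq ?_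
    rw [← word_cosetIdx q, h, word_zero]
  have h1 := cosetIdx_word_cosetIdx q
  rw [hn] at h1
  have h2 := cosetIdx_word_of_succ h1
  have h3 : n % 4 < 4 := Nat.mod_lt _ (by norm_num)
  have h4 : ∃ g : Fin 2, wordLetter (n % 4) = FreeGroup.of g ∨
      wordLetter (n % 4) = (FreeGroup.of g)⁻¹ := by
    unfold wordLetter
    split_ifs
    exacts [⟨0, .inl rfl⟩, ⟨0, .inr rfl⟩, ⟨1, .inl rfl⟩, ⟨1, .inr rfl⟩]
  obtain ⟨g, hg⟩ := h4
  refine ⟨(word (n / 4) : FreeGroup (Fin 2)), g, by rw [h2, hn]; omega, ?_⟩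
  rw [hn, h2, word_succ]
  exact hg.imp (fun h => by rw [h]) (fun h => by rw [h])

/-- The number of an edge of the coset graph. -/
def edgeNumber (e : SchreierIndex (fun q : FreeGroup (Fin 2) ⧸ H => word (cosetIdx q))) : ℕ :=
  4 * cosetIdx e.1.1 + 2 * (e.1.2 : ℕ) + 1

theorem edgeNumber_injective : Function.Injective (edgeNumber (H := H)) := by
  rintro ⟨⟨q, g⟩, _⟩ ⟨⟨q', g'⟩, _⟩ h
  simp only [edgeNumber] at h
  have h1 : cosetIdx q = cosetIdx q' := by omega
  have h2 : g = g' := by omega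
  have h3 : q = q' := by rw [← word_cosetIdx q, h1, word_cosetIdx]
  subst h2 h3
  rfl

/-- The number of an edge is the number of the word obtained by prefixing the generator to the
representative, so edges are tested through words. -/
theorem of_smul_eq_word (q : FreeGroup (Fin 2) ⧸ H) (g : Fin 2) :
    FreeGroup.of g • q = (word (4 * cosetIdx q + 2 * (g : ℕ) + 1) : FreeGroup (Fin 2)) := by
  rw [word_generator, ← smul_mk_coset, word_cosetIdx]

theorem schreierGen_eq_word
    (e : SchreierIndex (fun q : FreeGroup (Fin 2) ⧸ H => word (cosetIdx q))) :
    schreierGen _ e = (word (cosetIdx ((word (edgeNumber e) : FreeGroup (Fin 2)) :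
      FreeGroup (Fin 2) ⧸ H)))⁻¹ * word (edgeNumber e) := by
  rw [schreierGen, of_smul_eq_word, edgeNumber, word_generator]

theorem mem_range_edgeNumber (j : ℕ) : j ∈ Set.range (edgeNumber (H := H)) ↔ j % 2 = 1 ∧
    cosetIdx ((word ((j - 1) / 4) : FreeGroup (Fin 2)) : FreeGroup (Fin 2) ⧸ H) = (j - 1) / 4 ∧
    word (cosetIdx ((word j : FreeGroup (Fin 2)) : FreeGroup (Fin 2) ⧸ H)) ≠ word j := by
  constructor
  · rintro ⟨e, rfl⟩
    have h1 : (edgeNumber e - 1) / 4 = cosetIdx e.1.1 := by unfold edgeNumber; omega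
    refine ⟨by unfold edgeNumber; omega, by rw [h1, word_cosetIdx], fun h => e.2 ?_⟩
    have := schreierGen_eq_word e
    rw [h, inv_mul_cancel] at this
    exact this
  · rintro ⟨h1, h2, h3⟩
    set k := (j - 1) / 4 with hk
    have hj : j = 4 * k + 2 * ((⟨(j - 1) % 4 / 2, by omega⟩ : Fin 2) : ℕ) + 1 := by
      simp only
      omega
    refine ⟨⟨((word k : FreeGroup (Fin 2)), ⟨(j - 1) % 4 / 2, by omega⟩), fun h => h3 ?_⟩, ?_⟩
    · rw [of_smul_eq_word, ← word_generator, h2, ← hj, inv_mul_eq_one] at h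
      exact h
    · unfold edgeNumber
      simp only [h2]
      omega

/-- A bound for the minimal representatives. -/
theorem lt_of_cosetIdx_eq {α : Type*} [Fintype α] (f : ℕ → α)
    (hf : ∀ m n, f m = f n → (word m : FreeGroup (Fin 2) ⧸ H) = (word n : FreeGroup (Fin 2)))
    {n : ℕ} (hn : cosetIdx ((word n : FreeGroup (Fin 2)) : FreeGroup (Fin 2) ⧸ H) = n) :
    n < 2 * 4 ^ Fintype.card α := by
  classical
  -- The tails of a minimal word are minimal and lie in distinct cosets, so the length of the chain
  -- of tails is bounded by the size of `α`, while each further tail at most multiplies `n + 2` by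
  -- `4`.
  suffices h : ∃ s : Finset ℕ, (∀ k ∈ s, k ≤ n ∧
      cosetIdx ((word k : FreeGroup (Fin 2)) : FreeGroup (Fin 2) ⧸ H) = k) ∧
      n + 2 ≤ 2 * 4 ^ s.card by
    obtain ⟨s, hs, h⟩ := h
    have h1 : s.card ≤ Fintype.card α := by
      refine Finset.card_le_card_of_injOn f (fun _ _ => Finset.mem_univ _) ?_
      intro a ha b hb hab
      rw [← (hs a ha).2, hf a b hab, (hs b hb).2]
    have := Nat.pow_le_pow_right (show 0 < 4 by norm_num) h1
    omega
  induction n using Nat.strong_induction_on with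
  | _ n ih =>
    rcases n with - | n
    · exact ⟨{0}, by simpa using hn, by norm_num⟩
    · obtain ⟨s, hs, h⟩ := ih (n / 4) (by omega) (cosetIdx_word_of_succ hn)
      have h1 : n + 1 ∉ s := fun hmem => by
        have := (hs _ hmem).1
        omega
      refine ⟨insert (n + 1) s, ?_, ?_⟩
      · intro k hk
        rcases Finset.mem_insert.1 hk with rfl | hk
        · exact ⟨le_rfl, hn⟩
        · exact ⟨by have := (hs k hk).1; omega, (hs k hk).2⟩
      · rw [Finset.card_insert_of_notMem h1, pow_succ]
        omega

end Cosets

/-! ### Primitive recursive functions on the integers -/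

theorem encode_int_of_nonneg (n : ℕ) : Encodable.encode (n : ℤ) = 2 * n := rfl

theorem encode_int_neg_succ (n : ℕ) : Encodable.encode (Int.negSucc n) = 2 * n + 1 := rfl

/-- Integer arithmetic is reduced to natural numbers through the codes `2n` and `2n + 1` of
nonnegative and negative integers. -/
theorem primrec_toNat : Primrec Int.toNat := by
  have h : Primrec fun z : ℤ => if Encodable.encode z % 2 = 0 then Encodable.encode z / 2 else 0 :=
    Primrec.ite (Primrec.eq.comp (Primrec.nat_mod.comp Primrec.encode (Primrec.const 2))
      (Primrec.const 0)) (Primrec.nat_div.comp Primrec.encode (Primrec.const 2)) (Primrec.const 0)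
  refine h.of_eq fun z => ?_
  rcases z with n | n
  · rw [Int.ofNat_eq_natCast, encode_int_of_nonneg, if_pos (by omega)]
    simp
  · rw [encode_int_neg_succ, if_neg (by omega)]
    rfl

theorem primrec_toNat_neg : Primrec fun z : ℤ => (-z).toNat := by
  have h : Primrec fun z : ℤ =>
      if Encodable.encode z % 2 = 0 then 0 else Encodable.encode z / 2 + 1 :=
    Primrec.ite (Primrec.eq.comp (Primrec.nat_mod.comp Primrec.encode (Primrec.const 2))
      (Primrec.const 0)) (Primrec.const 0)
      (Primrec.succ.comp (Primrec.nat_div.comp Primrec.encode (Primrec.const 2)))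
  refine h.of_eq fun z => ?_
  rcases z with n | n
  · rw [Int.ofNat_eq_natCast, encode_int_of_nonneg, if_pos (by omega)]
    simp
  · rw [encode_int_neg_succ, if_neg (by omega), Int.neg_negSucc, Int.toNat_natCast]
    omega

theorem primrec_natCast_sub : Primrec₂ fun a b : ℕ => (a : ℤ) - b := by
  rw [← Primrec₂.encode_iff]
  have h : Primrec₂ fun a b : ℕ => if b ≤ a then 2 * (a - b) else 2 * (b - a) - 1 :=
    Primrec.ite (Primrec.nat_le.comp Primrec.snd Primrec.fst)
      (Primrec.nat_mul.comp (Primrec.const 2) Primrec.nat_sub)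
      (Primrec.nat_sub.comp (Primrec.nat_mul.comp (Primrec.const 2)
        (Primrec.nat_sub.comp Primrec.snd Primrec.fst)) (Primrec.const 1))
  refine h.of_eq fun a b => ?_
  split_ifs with hab
  · rw [← Nat.cast_sub hab, encode_int_of_nonneg]
  · rw [show (a : ℤ) - b = Int.negSucc (b - a - 1) by omega, encode_int_neg_succ]
    omega

theorem primrec_int_add : Primrec₂ fun a b : ℤ => a + b := by
  have h : Primrec₂ fun a b : ℤ =>
      ((a.toNat + b.toNat : ℕ) : ℤ) - (((-a).toNat + (-b).toNat : ℕ) : ℤ) :=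
    primrec_natCast_sub.comp
      (Primrec.nat_add.comp (primrec_toNat.comp Primrec.fst) (primrec_toNat.comp Primrec.snd))
      (Primrec.nat_add.comp (primrec_toNat_neg.comp Primrec.fst)
        (primrec_toNat_neg.comp Primrec.snd))
  exact h.of_eq fun a b => by omega

theorem primrec_int_neg : Primrec fun a : ℤ => -a := by
  have h : Primrec fun a : ℤ => (((-a).toNat : ℕ) : ℤ) - ((a.toNat : ℕ) : ℤ) :=
    primrec_natCast_sub.comp primrec_toNat_neg primrec_toNat
  exact h.of_eq fun a => by omega

theorem primrec_int_sub : Primrec₂ fun a b : ℤ => a - b :=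
  primrec_int_add.comp Primrec.fst (primrec_int_neg.comp Primrec.snd)

theorem primrec_int_mul : Primrec₂ fun a b : ℤ => a * b := by
  have hp := primrec_toNat
  have hn := primrec_toNat_neg
  have h : Primrec₂ fun a b : ℤ =>
      ((a.toNat * b.toNat + (-a).toNat * (-b).toNat : ℕ) : ℤ) -
        ((a.toNat * (-b).toNat + (-a).toNat * b.toNat : ℕ) : ℤ) :=
    primrec_natCast_sub.comp
      (Primrec.nat_add.comp (Primrec.nat_mul.comp (hp.comp Primrec.fst) (hp.comp Primrec.snd))
        (Primrec.nat_mul.comp (hn.comp Primrec.fst) (hn.comp Primrec.snd)))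
      (Primrec.nat_add.comp (Primrec.nat_mul.comp (hp.comp Primrec.fst) (hn.comp Primrec.snd))
        (Primrec.nat_mul.comp (hn.comp Primrec.fst) (hp.comp Primrec.snd)))
  refine h.of_eq fun a b => ?_
  have ha : a = (a.toNat : ℤ) - ((-a).toNat : ℤ) := by omega
  have hb : b = (b.toNat : ℤ) - ((-b).toNat : ℤ) := by omega
  conv_rhs => rw [ha, hb]
  push_cast
  ring

theorem primrec_natAbs : Primrec Int.natAbs := by
  have h : Primrec fun a : ℤ => a.toNat + (-a).toNat :=
    Primrec.nat_add.comp primrec_toNat primrec_toNat_neg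
  exact h.of_eq fun a => by omega

theorem primrec_int_dvd : PrimrecRel fun a b : ℤ => a ∣ b := by
  have h : PrimrecRel fun a b : ℤ => b.natAbs % a.natAbs = 0 :=
    Primrec.eq.comp (Primrec.nat_mod.comp (primrec_natAbs.comp Primrec.snd)
      (primrec_natAbs.comp Primrec.fst)) (Primrec.const 0)
  exact h.of_eq fun a b => by rw [← Nat.dvd_iff_mod_eq_zero, Int.natAbs_dvd_natAbs]

theorem primrec_nat_pow : Primrec₂ fun a b : ℕ => a ^ b := by
  have h : Primrec₂ fun a b : ℕ => Nat.rec (motive := fun _ => ℕ) 1 (fun _ y => y * a) b :=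
    Primrec.nat_rec (Primrec.const 1) (g := fun a p => p.2 * a)
      (Primrec.nat_mul.comp (Primrec.snd.comp Primrec.snd) Primrec.fst)
  refine h.of_eq fun a b => ?_
  induction b with
  | zero => rfl
  | succ b ih => exact (congrArg (· * a) ih).trans (pow_succ a b).symm

/-! ### Computations with integral matrices -/

/-- The product of matrices given by their entries. -/
def quadMul (x y : ℤ × ℤ × ℤ × ℤ) : ℤ × ℤ × ℤ × ℤ :=
  (x.1 * y.1 + x.2.1 * y.2.2.1, x.1 * y.2.1 + x.2.1 * y.2.2.2,
    x.2.2.1 * y.1 + x.2.2.2 * y.2.2.1, x.2.2.1 * y.2.1 + x.2.2.2 * y.2.2.2)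

/-- The adjugate of a matrix given by its entries. -/
def quadInv (x : ℤ × ℤ × ℤ × ℤ) : ℤ × ℤ × ℤ × ℤ := (x.2.2.2, -x.2.1, -x.2.2.1, x.1)

theorem entries_mul (γ δ : SL(2, ℤ)) : entries (γ * δ) = quadMul (entries γ) (entries δ) := by
  simp only [entries, quadMul, SL_mul_apply]

theorem entries_inv (γ : SL(2, ℤ)) : entries γ⁻¹ = quadInv (entries γ) := by
  simp only [entries, quadInv, SL_inv_apply]

theorem entries_injective : Function.Injective entries := by
  intro γ δ h
  simp only [entries, Prod.mk.injEq] at h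
  exact SL_ext h.1 h.2.1 h.2.2.1 h.2.2.2

theorem primrec_quadMul : Primrec₂ quadMul := by
  have h1 : Primrec fun p : (ℤ × ℤ × ℤ × ℤ) × (ℤ × ℤ × ℤ × ℤ) => p.1.1 :=
    Primrec.fst.comp Primrec.fst
  have h2 : Primrec fun p : (ℤ × ℤ × ℤ × ℤ) × (ℤ × ℤ × ℤ × ℤ) => p.1.2.1 :=
    Primrec.fst.comp (Primrec.snd.comp Primrec.fst)
  have h3 : Primrec fun p : (ℤ × ℤ × ℤ × ℤ) × (ℤ × ℤ × ℤ × ℤ) => p.1.2.2.1 :=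
    Primrec.fst.comp (Primrec.snd.comp (Primrec.snd.comp Primrec.fst))
  have h4 : Primrec fun p : (ℤ × ℤ × ℤ × ℤ) × (ℤ × ℤ × ℤ × ℤ) => p.1.2.2.2 :=
    Primrec.snd.comp (Primrec.snd.comp (Primrec.snd.comp Primrec.fst))
  have k1 : Primrec fun p : (ℤ × ℤ × ℤ × ℤ) × (ℤ × ℤ × ℤ × ℤ) => p.2.1 :=
    Primrec.fst.comp Primrec.snd
  have k2 : Primrec fun p : (ℤ × ℤ × ℤ × ℤ) × (ℤ × ℤ × ℤ × ℤ) => p.2.2.1 :=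
    Primrec.fst.comp (Primrec.snd.comp Primrec.snd)
  have k3 : Primrec fun p : (ℤ × ℤ × ℤ × ℤ) × (ℤ × ℤ × ℤ × ℤ) => p.2.2.2.1 :=
    Primrec.fst.comp (Primrec.snd.comp (Primrec.snd.comp Primrec.snd))
  have k4 : Primrec fun p : (ℤ × ℤ × ℤ × ℤ) × (ℤ × ℤ × ℤ × ℤ) => p.2.2.2.2 :=
    Primrec.snd.comp (Primrec.snd.comp (Primrec.snd.comp Primrec.snd))
  have key : ∀ {f g f' g' : (ℤ × ℤ × ℤ × ℤ) × (ℤ × ℤ × ℤ × ℤ) → ℤ}, Primrec f → Primrec g →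
      Primrec f' → Primrec g' → Primrec fun p => f p * g p + f' p * g' p :=
    fun hf hg hf' hg' => primrec_int_add.comp (primrec_int_mul.comp hf hg)
      (primrec_int_mul.comp hf' hg')
  exact (key h1 k1 h2 k3).pair ((key h1 k2 h2 k4).pair ((key h3 k1 h4 k3).pair (key h3 k2 h4 k4)))

theorem primrec_quadInv : Primrec quadInv :=
  (Primrec.snd.comp (Primrec.snd.comp Primrec.snd)).pair
    ((primrec_int_neg.comp (Primrec.fst.comp Primrec.snd)).pair
      ((primrec_int_neg.comp (Primrec.fst.comp (Primrec.snd.comp Primrec.snd))).pair Primrec.fst))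

/-- The entries of the images of the generators and of their inverses. -/
def quadLetter (i : ℕ) : ℤ × ℤ × ℤ × ℤ :=
  if i = 0 then (1, 2, 0, 1) else if i = 1 then (1, -2, 0, 1) else
    if i = 2 then (1, 0, 2, 1) else (1, 0, -2, 1)

/-- The entries of the images of the words. -/
def quadWord : ℕ → ℤ × ℤ × ℤ × ℤ
  | 0 => (1, 0, 0, 1)
  | n + 1 => quadMul (quadLetter (n % 4)) (quadWord (n / 4))
decreasing_by omega

theorem entries_sanovHom_wordLetter (i : ℕ) :
    entries (sanovHom (wordLetter i)) = quadLetter i := by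
  unfold wordLetter quadLetter
  split_ifs <;>
    simp [sanovHom, entries, SL_inv_apply, genA_apply, genB_apply]

theorem entries_sanovHom_word (n : ℕ) : entries (sanovHom (word n)) = quadWord n := by
  induction n using Nat.strong_induction_on with
  | _ n ih =>
    rcases n with - | n
    · rw [word_zero, quadWord, map_one]
      rfl
    · rw [word_succ, quadWord, map_mul, entries_mul, entries_sanovHom_wordLetter,
        ih _ (by omega)]

theorem primrec_quadLetter : Primrec quadLetter := by
  have h : ∀ k : ℕ, PrimrecPred fun i : ℕ => i = k :=
    fun k => Primrec.eq.comp Primrec.id (Primrec.const k)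
  exact Primrec.ite (h 0) (Primrec.const _) (Primrec.ite (h 1) (Primrec.const _)
    (Primrec.ite (h 2) (Primrec.const _) (Primrec.const _)))

/-- Course-of-values recursion: the argument is the length of the list of earlier values, and the
value needed stands at position `(length - 1) / 4`. -/
theorem primrec_quadWord : Primrec quadWord := by
  have hpred : Primrec fun p : Unit × List (ℤ × ℤ × ℤ × ℤ) => p.2.length - 1 :=
    Primrec.nat_sub.comp (Primrec.list_length.comp Primrec.snd) (Primrec.const 1)
  have hg : Primrec₂ fun (_ : Unit) (l : List (ℤ × ℤ × ℤ × ℤ)) =>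
      if l.length = 0 then some (1, 0, 0, 1) else
        (l[(l.length - 1) / 4]?).map (quadMul (quadLetter ((l.length - 1) % 4))) :=
    Primrec.ite (Primrec.eq.comp (Primrec.list_length.comp Primrec.snd) (Primrec.const 0))
      (Primrec.const _)
      (Primrec.option_map (Primrec.list_getElem?.comp Primrec.snd
          (Primrec.nat_div.comp hpred (Primrec.const 4)))
        (primrec_quadMul.comp (primrec_quadLetter.comp
          (Primrec.nat_mod.comp (hpred.comp Primrec.fst) (Primrec.const 4))) Primrec.snd))
  have h := Primrec.nat_strong_rec (fun _ : Unit => quadWord) hg fun _ n => by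
    rcases n with - | n
    · rw [quadWord]
      rfl
    · have h1 : n / 4 < n + 1 := by omega
      rw [List.length_map, List.length_range, if_neg (by omega), Nat.add_sub_cancel, quadWord,
        List.getElem?_map, List.getElem?_range h1]
      rfl
  exact h.comp (Primrec.const ()) Primrec.id

/-! ### Computation of free generators -/

/-- The matrix with entries `x` fixes the row `(ν, μ)` up to sign modulo `2 N`, where
`p = (ν, μ, N)`. -/
def StabQuad (p : ℤ × ℤ × ℤ) (x : ℤ × ℤ × ℤ × ℤ) : Prop :=
  (2 * p.2.2 ∣ p.1 * x.1 + p.2.1 * x.2.2.1 - p.1 ∧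
    2 * p.2.2 ∣ p.1 * x.2.1 + p.2.1 * x.2.2.2 - p.2.1) ∨
  (2 * p.2.2 ∣ p.1 * x.1 + p.2.1 * x.2.2.1 + p.1 ∧
    2 * p.2.2 ∣ p.1 * x.2.1 + p.2.1 * x.2.2.2 + p.2.1)

instance : DecidableRel StabQuad := fun _ _ => inferInstanceAs (Decidable (_ ∨ _))

theorem stabMod_iff_stabQuad {ν μ N : ℤ} {γ : SL(2, ℤ)} (hγ : γ ∈ CongruenceSubgroup.Gamma 2) :
    StabMod N (ν, μ) γ ↔ StabQuad (ν, μ, N) (entries γ) := by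
  constructor
  · rintro ⟨-, ε, rfl | rfl, h1, h2⟩
    · exact .inl ⟨by simpa [entries] using h1, by simpa [entries] using h2⟩
    · exact .inr ⟨by simpa [entries] using h1, by simpa [entries] using h2⟩
  · rintro (⟨h1, h2⟩ | ⟨h1, h2⟩)
    · exact ⟨hγ, 1, .inl rfl, by simpa [entries] using h1, by simpa [entries] using h2⟩
    · exact ⟨hγ, -1, .inr rfl, by simpa [entries] using h1, by simpa [entries] using h2⟩

/-- The position of the first word that is equivalent to the word with a given position. -/
def firstWord (p : ℤ × ℤ × ℤ) (n : ℕ) : ℕ :=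
  (List.range (n + 1)).findIdx fun m =>
    decide (StabQuad p (quadMul (quadInv (quadWord m)) (quadWord n)))

/-- The number `j` belongs to an edge of the coset graph outside of the maximal tree. -/
def IsEdgeNumber (p : ℤ × ℤ × ℤ) (j : ℕ) : Prop :=
  j % 2 = 1 ∧ firstWord p ((j - 1) / 4) = (j - 1) / 4 ∧ quadWord (firstWord p j) ≠ quadWord j

instance : DecidableRel IsEdgeNumber := fun _ _ => inferInstanceAs (Decidable (_ ∧ _))

/-- The entries of the generator belonging to an edge. -/
def edgeQuad (p : ℤ × ℤ × ℤ) (j : ℕ) : ℤ × ℤ × ℤ × ℤ :=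
  quadMul (quadInv (quadWord (firstWord p j))) (quadWord j)

/-- A bound for the numbers of the edges. -/
def edgeBound (p : ℤ × ℤ × ℤ) : ℕ :=
  4 * (2 * 4 ^ (2 * p.2.2.natAbs * (2 * p.2.2.natAbs)))

/-- The list of the free generators. -/
def freeGenerators (p : ℤ × ℤ × ℤ) : List (ℤ × ℤ × ℤ × ℤ) :=
  (List.range (edgeBound p)).filterMap fun j => if IsEdgeNumber p j then some (edgeQuad p j) else none

theorem primrec_stabQuad : PrimrecRel StabQuad := by
  have h1 : Primrec fun p : (ℤ × ℤ × ℤ) × (ℤ × ℤ × ℤ × ℤ) => p.1.1 := Primrec.fst.comp Primrec.fst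
  have h2 : Primrec fun p : (ℤ × ℤ × ℤ) × (ℤ × ℤ × ℤ × ℤ) => p.1.2.1 :=
    Primrec.fst.comp (Primrec.snd.comp Primrec.fst)
  have h3 : Primrec fun p : (ℤ × ℤ × ℤ) × (ℤ × ℤ × ℤ × ℤ) => 2 * p.1.2.2 :=
    primrec_int_mul.comp (Primrec.const 2) (Primrec.snd.comp (Primrec.snd.comp Primrec.fst))
  have k1 : Primrec fun p : (ℤ × ℤ × ℤ) × (ℤ × ℤ × ℤ × ℤ) => p.2.1 := Primrec.fst.comp Primrec.snd
  have k2 : Primrec fun p : (ℤ × ℤ × ℤ) × (ℤ × ℤ × ℤ × ℤ) => p.2.2.1 :=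
    Primrec.fst.comp (Primrec.snd.comp Primrec.snd)
  have k3 : Primrec fun p : (ℤ × ℤ × ℤ) × (ℤ × ℤ × ℤ × ℤ) => p.2.2.2.1 :=
    Primrec.fst.comp (Primrec.snd.comp (Primrec.snd.comp Primrec.snd))
  have k4 : Primrec fun p : (ℤ × ℤ × ℤ) × (ℤ × ℤ × ℤ × ℤ) => p.2.2.2.2 :=
    Primrec.snd.comp (Primrec.snd.comp (Primrec.snd.comp Primrec.snd))
  have s1 := primrec_int_add.comp (primrec_int_mul.comp h1 k1) (primrec_int_mul.comp h2 k3)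
  have s2 := primrec_int_add.comp (primrec_int_mul.comp h1 k2) (primrec_int_mul.comp h2 k4)
  exact ((primrec_int_dvd.comp h3 (primrec_int_sub.comp s1 h1)).and
      (primrec_int_dvd.comp h3 (primrec_int_sub.comp s2 h2))).or
    ((primrec_int_dvd.comp h3 (primrec_int_add.comp s1 h1)).and
      (primrec_int_dvd.comp h3 (primrec_int_add.comp s2 h2)))

theorem primrec_firstWord : Primrec₂ firstWord := by
  refine Primrec.list_findIdx (f := fun a : (ℤ × ℤ × ℤ) × ℕ => List.range (a.2 + 1))
    (Primrec.list_range.comp (Primrec.succ.comp Primrec.snd)) ?_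
  exact PrimrecPred.decide (primrec_stabQuad.comp (Primrec.fst.comp Primrec.fst)
    (primrec_quadMul.comp (primrec_quadInv.comp (primrec_quadWord.comp Primrec.snd))
      (primrec_quadWord.comp (Primrec.snd.comp Primrec.fst))))

theorem primrec_isEdgeNumber : PrimrecRel IsEdgeNumber := by
  have h : Primrec fun a : (ℤ × ℤ × ℤ) × ℕ => (a.2 - 1) / 4 :=
    Primrec.nat_div.comp (Primrec.nat_sub.comp Primrec.snd (Primrec.const 1)) (Primrec.const 4)
  exact (Primrec.eq.comp (Primrec.nat_mod.comp Primrec.snd (Primrec.const 2))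
      (Primrec.const 1)).and ((Primrec.eq.comp (primrec_firstWord.comp Primrec.fst h) h).and
    (Primrec.eq.comp (primrec_quadWord.comp primrec_firstWord)
      (primrec_quadWord.comp Primrec.snd)).not)

theorem primrec_edgeQuad : Primrec₂ edgeQuad :=
  primrec_quadMul.comp (primrec_quadInv.comp (primrec_quadWord.comp primrec_firstWord))
    (primrec_quadWord.comp Primrec.snd)

theorem primrec_edgeBound : Primrec edgeBound := by
  have h : Primrec fun p : ℤ × ℤ × ℤ => 2 * p.2.2.natAbs :=
    Primrec.nat_mul.comp (Primrec.const 2) (primrec_natAbs.comp (Primrec.snd.comp Primrec.snd))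
  exact Primrec.nat_mul.comp (Primrec.const 4) (Primrec.nat_mul.comp (Primrec.const 2)
    (primrec_nat_pow.comp (Primrec.const 4) (Primrec.nat_mul.comp h h)))

theorem primrec_freeGenerators : Primrec freeGenerators :=
  Primrec.listFilterMap (Primrec.list_range.comp primrec_edgeBound)
    (Primrec.ite primrec_isEdgeNumber (Primrec.option_some.comp primrec_edgeQuad)
      (Primrec.const none))

section Correctness

variable {p : ℤ × ℤ × ℤ} {H : Subgroup (FreeGroup (Fin 2))}

theorem word_coset_eq_iff (hH : ∀ w, w ∈ H ↔ StabQuad p (entries (sanovHom w))) (m n : ℕ) :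
    ((word m : FreeGroup (Fin 2)) : FreeGroup (Fin 2) ⧸ H) = (word n : FreeGroup (Fin 2)) ↔
      StabQuad p (quadMul (quadInv (quadWord m)) (quadWord n)) := by
  rw [QuotientGroup.eq, hH, map_mul, map_inv, entries_mul, entries_inv, entries_sanovHom_word,
    entries_sanovHom_word]

theorem firstWord_eq_cosetIdx (hH : ∀ w, w ∈ H ↔ StabQuad p (entries (sanovHom w))) (n : ℕ) :
    firstWord p n = cosetIdx ((word n : FreeGroup (Fin 2)) : FreeGroup (Fin 2) ⧸ H) := by
  have hle : cosetIdx ((word n : FreeGroup (Fin 2)) : FreeGroup (Fin 2) ⧸ H) ≤ n := cosetIdx_le rfl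
  unfold firstWord
  rw [List.findIdx_eq (by rw [List.length_range]; omega)]
  refine ⟨?_, fun j hj => ?_⟩
  · rw [List.getElem_range, decide_eq_true_eq, ← word_coset_eq_iff hH, word_cosetIdx]
  · rw [List.getElem_range, decide_eq_false_iff_not, ← word_coset_eq_iff hH]
    exact fun h => absurd (cosetIdx_le h) (by omega)

/-- Words are compared through their matrices, which is faithful because `sanovHom` is injective. -/
theorem isEdgeNumber_iff (hH : ∀ w, w ∈ H ↔ StabQuad p (entries (sanovHom w))) (j : ℕ) :
    IsEdgeNumber p j ↔ j ∈ Set.range (edgeNumber (H := H)) := by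
  rw [mem_range_edgeNumber, IsEdgeNumber, firstWord_eq_cosetIdx hH, firstWord_eq_cosetIdx hH,
    ← entries_sanovHom_word, ← entries_sanovHom_word, entries_injective.ne_iff,
    sanovHom_injective.ne_iff]

/-- There are at most `(2|N|)²` cosets, one for each row modulo `2N`; `lt_of_cosetIdx_eq` bounds the
first words by `2 · 4^((2|N|)²)`, and the factor `4` passes from words to edges. -/
theorem cosetIdx_lt (hp : p.2.2 ≠ 0) (hH : ∀ w, w ∈ H ↔ StabQuad p (entries (sanovHom w))) {n : ℕ}
    (hn : cosetIdx ((word n : FreeGroup (Fin 2)) : FreeGroup (Fin 2) ⧸ H) = n) :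
    4 * n + 3 < edgeBound p := by
  obtain ⟨ν, μ, N⟩ := p
  have : NeZero (2 * N.natAbs) := ⟨by simpa using hp⟩
  -- The row `(ν, μ)γ⁻¹` modulo `2N`, with `γ` the matrix of the word, determines the coset:
  -- equality for two words means that `γₖ⁻¹γₘ` fixes `(ν, μ)`.
  have h := lt_of_cosetIdx_eq (fun k =>
    (((ν * (quadInv (quadWord k)).1 + μ * (quadInv (quadWord k)).2.2.1 : ℤ) : ZMod (2 * N.natAbs)),
      ((ν * (quadInv (quadWord k)).2.1 + μ * (quadInv (quadWord k)).2.2.2 : ℤ) :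
        ZMod (2 * N.natAbs)))) ?_ hn
  · rw [Fintype.card_prod, ZMod.card] at h
    unfold edgeBound
    simp only
    omega
  · intro k m hkm
    rw [word_coset_eq_iff hH]
    have hdet : (quadWord m).1 * (quadWord m).2.2.2 - (quadWord m).2.1 * (quadWord m).2.2.1 = 1 := by
      rw [← entries_sanovHom_word]
      exact det_eq_one _
    have hN : ((2 * N.natAbs : ℕ) : ℤ) ∣ 2 * N ∧ 2 * N ∣ ((2 * N.natAbs : ℕ) : ℤ) := by
      constructor <;> push_cast <;> exact mul_dvd_mul_left 2 (by simp)
    have h1 := hN.2.trans ((ZMod.intCast_eq_intCast_iff_dvd_sub _ _ _).1 (congrArg Prod.fst hkm))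
    have h2 := hN.2.trans ((ZMod.intCast_eq_intCast_iff_dvd_sub _ _ _).1 (congrArg Prod.snd hkm))
    obtain ⟨s, hs⟩ := h1
    obtain ⟨t, ht⟩ := h2
    generalize quadWord k = x at *
    generalize quadWord m = y at *
    obtain ⟨x1, x2, x3, x4⟩ := x
    obtain ⟨y1, y2, y3, y4⟩ := y
    simp only [quadInv] at hs ht hdet
    refine .inl ⟨⟨-(s * y1 + t * y3), ?_⟩, ⟨-(s * y2 + t * y4), ?_⟩⟩
    · simp only [quadMul, quadInv]
      linear_combination (-y1) * hs - y3 * ht + ν * hdet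
    · simp only [quadMul, quadInv]
      linear_combination (-y2) * hs - y4 * ht + μ * hdet

end Correctness

theorem neg_mem_gamma_two {γ : SL(2, ℤ)} (h : γ ∈ CongruenceSubgroup.Gamma 2) :
    -γ ∈ CongruenceSubgroup.Gamma 2 := by
  rw [← neg_one_mul γ]
  exact mul_mem neg_one_mem_gamma_two h

/-- The computed list of generators is a free basis. -/
theorem exists_isFreeBasis {ν μ N : ℤ} (hN : N ≠ 0) {G : Subgroup SL(2, ℤ)}
    (hG : ∀ γ, γ ∈ G ↔ StabMod N (ν, μ) γ) :
    ∃ L : List SL(2, ℤ), L.map entries = freeGenerators (ν, μ, N) ∧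
      IsFreeBasis (L.map (QuotientGroup.mk' (Subgroup.center SL(2, ℤ)))) (inPSL G) := by
  have hsub : G ≤ CongruenceSubgroup.Gamma 2 := fun γ h => ((hG γ).1 h).1
  have hneg : ∀ γ ∈ G, -γ ∈ G := by
    intro γ h
    obtain ⟨h0, ε, hε, h1, h2⟩ := (hG γ).1 h
    have hentry : ∀ i j, (-γ) i j = -γ i j := fun _ _ => by
      rw [Matrix.SpecialLinearGroup.coe_neg, Matrix.neg_apply]
    refine (hG _).2 ⟨neg_mem_gamma_two h0, -ε, by omega, ?_, ?_⟩
    · refine (dvd_neg.2 h1).trans (dvd_of_eq ?_)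
      rw [hentry, hentry]
      ring
    · refine (dvd_neg.2 h2).trans (dvd_of_eq ?_)
      rw [hentry, hentry]
      ring
  have hH : ∀ w, w ∈ G.comap sanovHom ↔ StabQuad (ν, μ, N) (entries (sanovHom w)) := by
    intro w
    rw [Subgroup.mem_comap, hG, stabMod_iff_stabQuad]
    exact sanov_le (range_sanovHom ▸ ⟨w, rfl⟩)
  refine ⟨((List.range (edgeBound (ν, μ, N))).filter (IsEdgeNumber (ν, μ, N) ·)).map fun j =>
    sanovHom ((word (firstWord (ν, μ, N) j))⁻¹ * word j), ?_, ?_⟩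
  · rw [List.map_map, freeGenerators, ← List.filterMap_eq_map, List.filterMap_filter]
    congr 1
    funext j
    by_cases h : IsEdgeNumber (ν, μ, N) j
    · simp [h, edgeQuad, entries_mul, entries_inv, entries_sanovHom_word]
    · simp [h]
  · rw [List.map_map]
    have h := schreier_free_basis_word (G.comap sanovHom)
    have hlift : FreeGroup.lift (sanovPSL ∘ schreierGen
        (fun q : FreeGroup (Fin 2) ⧸ G.comap sanovHom => word (cosetIdx q))) =
        sanovPSL.comp (FreeGroup.lift (schreierGen
          (fun q : FreeGroup (Fin 2) ⧸ G.comap sanovHom => word (cosetIdx q)))) := by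
      ext e
      simp
    rw [← map_sanovPSL_comap hsub hneg, ← h.2, MonoidHom.map_range, ← hlift]
    refine isFreeBasis_map ?_ (List.nodup_range.filter _) _ edgeNumber edgeNumber_injective ?_ ?_
    · rw [hlift]
      exact sanovPSL_injective.comp h.1
    · intro j
      rw [List.mem_filter, decide_eq_true_eq, isEdgeNumber_iff hH, List.mem_range,
        and_iff_right_of_imp]
      rintro ⟨e, rfl⟩
      have := cosetIdx_lt (p := (ν, μ, N)) hN hH (cosetIdx_word_cosetIdx e.1.1)
      have := e.1.2.2
      unfold edgeNumber
      omega
    · intro e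
      rw [Function.comp, Function.comp, schreierGen_eq_word, firstWord_eq_cosetIdx hH]
      rfl

end PicardUniformization

end

open PicardUniformization in
theorem theorem7 :
    (∀ ν μ N : ℤ, N ≠ 0 → (¬ ∃ c : ℂ, ∀ τ : ℍ, picardY ν μ N τ = c) →
      -- the automorphism group is the group that uniformizes Picard's curve
      autGroup (picardY ν μ N) = picardGroup ν μ N ∧
      (∃ C : PlaneCurve, IsPicardCurve ν μ N C) ∧
      (∀ C : PlaneCurve, IsPicardCurve ν μ N C →
        Uniformizes (autGroup (picardY ν μ N)) picardX (picardY ν μ N) C) ∧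
      -- it is a free congruence subgroup of `Γ(2)`
      autGroup (picardY ν μ N) ≤ CongruenceSubgroup.Gamma 2 ∧
      CongruenceSubgroup.IsCongruenceSubgroup (autGroup (picardY ν μ N)) ∧
      IsFreeGroup (inPSL (autGroup (picardY ν μ N))) ∧
      -- its explicit form
      (∀ γ : SL(2, ℤ), γ ∈ autGroup (picardY ν μ N) ↔
        γ ∈ CongruenceSubgroup.Gamma 2 ∧ ∃ ε : ℤ, (ε = 1 ∨ ε = -1) ∧
          2 * N ∣ ν * γ 0 0 + μ * γ 1 0 - ε * ν ∧ 2 * N ∣ ν * γ 0 1 + μ * γ 1 1 - ε * μ) ∧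
      1 ≤ reducedLevel ν μ N ∧ reducedLevel ν μ N ≤ N.natAbs ∧
      (∃ σ : SL(2, ℤ), ∀ γ : SL(2, ℤ), γ ∈ autGroup (picardY ν μ N) ↔
        RepresentedIn (picardMatrices (reducedLevel ν μ N)) (σ * γ * σ⁻¹)) ∧
      (2 * N ∣ ν → ∀ γ : SL(2, ℤ), γ ∈ autGroup (picardY ν μ N) ↔
        RepresentedIn (picardMatrices (reducedLevel ν μ N)) γ) ∧
      (2 * N ∣ μ → ∀ γ : SL(2, ℤ), γ ∈ autGroup (picardY ν μ N) ↔
        RepresentedIn (Matrix.transpose '' picardMatrices (reducedLevel ν μ N)) γ) ∧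
      -- its genus is that of Picard's curve with parameters `(0, 1, 𝐍)`
      (∃ C : PlaneCurve, IsPicardCurve 0 1 (reducedLevel ν μ N) C) ∧
      (∀ C : PlaneCurve, IsPicardCurve 0 1 (reducedLevel ν μ N) C →
        topologicalGenus (CompactifiedQuotient (autGroup (picardY ν μ N))) =
          topologicalGenus C.RiemannSurface)) ∧
    -- its rank and free generators are computable from `(ν, μ, N)`
    (∃ (rank : ℤ × ℤ × ℤ → ℕ) (gens : ℤ × ℤ × ℤ → List (ℤ × ℤ × ℤ × ℤ)),
      Computable rank ∧ Computable gens ∧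
      ∀ ν μ N : ℤ, N ≠ 0 → (¬ ∃ c : ℂ, ∀ τ : ℍ, picardY ν μ N τ = c) →
        ∃ L : List SL(2, ℤ), L.map entries = gens (ν, μ, N) ∧ L.length = rank (ν, μ, N) ∧
          IsFreeBasis (L.map (QuotientGroup.mk' (Subgroup.center SL(2, ℤ))))
            (inPSL (autGroup (picardY ν μ N)))) := by
  refine ⟨fun ν μ N hN h => ?_, fun p => (freeGenerators p).length, freeGenerators,
    (Primrec.list_length.comp primrec_freeGenerators).to_comp, primrec_freeGenerators.to_comp,
    fun ν μ N hN h => ?_⟩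
  -- Nonconstancy enters only here, through the fact that degenerate parameters give constant
  -- functions.
  · have hd : ¬ IsDegenerate ν μ N := fun hd => h (picardY_of_isDegenerate hN hd)
    have hs := separatingPair_picardY hN hd
    have hmem := mem_autGroup_picardY_iff hN hd
    obtain ⟨L, -, hL⟩ := exists_isFreeBasis hN hmem
    obtain ⟨hr1, hr2, -⟩ := exists_reduced (ν := ν) (μ := μ) hN
    obtain ⟨⟨σ, hσ⟩, hν, hμ⟩ := stabMod_explicit (ν := ν) (μ := μ) hN
    obtain ⟨n, G, hK, -⟩ := exists_separatingPair_picardMatrices hr1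
    exact ⟨autGroup_picardY_eq hN hd, hs.exists_curve, fun C hC => hs.uniformizes hC,
      fun γ hγ => ((hmem γ).1 hγ).1, isCongruenceSubgroup_autGroup hN hd,
      isFreeGroup_of_isFreeBasis hL, hmem, hr1, hr2, ⟨σ, fun γ => (hmem γ).trans (hσ γ)⟩,
      fun h γ => (hmem γ).trans (hν h γ), fun h γ => (hmem γ).trans (hμ h γ), hK.exists_curve,
      fun C hC => genus_eq hN hd hC⟩
  · have hd : ¬ IsDegenerate ν μ N := fun hd => h (picardY_of_isDegenerate hN hd)
    obtain ⟨L, hL, hfree⟩ := exists_isFreeBasis hN (mem_autGroup_picardY_iff hN hd)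
    exact ⟨L, hL, (List.length_map ..).symm.trans (congrArg List.length hL), hfree⟩
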